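/- **Setting.** A unit is $(X,T,Y(0),Y(1),R)$ with law $\mathbb P$: covariates $X$ (with values in $\mathbb R^d$, or any standard Borel space), treatment $T\in\{0,1\}$, potential outcomes $Y(0),Y(1)\in\mathbb R$, labelling indicator $R\in\{0,1\}$; $Y=Y(T)$. For i.i.d. units $i=1,\dots,N$ one observes $W_i=(X_i,T_i,R_i,R_iY_i)$; $N_l$ and $N_u=N-N_l$ are the numbers of labelled ($R_i=1$) and unlabelled ($R_i=0$) units. Let $\delta^*=\mathbb E[Y(1)]-\mathbb E[Y(0)]$, $e^*(x)=\mathbb P(T=1\mid X=x)$, $r^*(t,x)=\mathbb P(R=1\mid T=t,X=x)$, $\mu^*(t,x)=\mathbb E[Y\mid T=t,R=1,X=x]$. **Assumptions on $\mathbb P$.** (a) $Y(t)\perp T\mid X$ for $t=0,1$. (b) For some $\epsilon\in(0,1/2)$, almost surely $\epsilon\le e^*(X)\le 1-\epsilon$ and $\epsilon\le r^*(t,X)\le 1$, $t=0,1$. (c) For some $C>0$, $q>2$: $\operatorname{Var}(Y\mid X,T)\le C$ a.s. and $\|Y(t)\|_q\le C$, $t=0,1$. (d) Labels are missing completely at random: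 $R$ is independent of $(X,T,Y(0),Y(1))$. **Estimators.** For a fixed $K$, the units are split into $K$ folds, $k(i)$ being the fold of unit $i$; the split depends only on $(R_1,\dots,R_N)$ and on randomness independent of the data, and among the labelled and among the unlabelled units each fold has $N_l/K+O_p(\sqrt N)$, respectively $N_u/K+O_p(\sqrt N)$, units (e.g. equal folds, or folds drawn independently and uniformly). For each fold $k$, nuisance estimators $\hat e_k$, $\hat\mu_k$ are computed from the data outside fold $k$ (possibly with independent extra randomness). Put $$\hat\Delta=\frac1{N_l}\sum_{i:R_i=1}\Big[\frac{T_i}{\hat e_{k(i)}(X_i)}\big(Y_i-\hat\mu_{k(i)}(1,X_i)\big)-\frac{1-T_i}{1-\hat e_{k(i)}(X_i)}\big(Y_i-\hat\mu_{k(i)}(0,X_i)\big)\Big],$$ $$\hat\delta_{\rm our}=\frac1N\sum_{i=1}^N\big[\hat\mu_{k(i)}(1,X_i)-\hat\mu_{k(i)}(0,X_i)\big]+\hat\Delta,\qquad \hat\delta_{\rm ZB}=\frac1{N_u}\sum_{i:R_i=0}\big[\hat\mu_{k(i)}(1,X_i)-\hat\mu_{k(i)}(0,X_i)\big]+\hat\Delta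 .$$ Assume that $\hat e_k(X)\in[\epsilon,1-\epsilon]$ almost surely, and that for every $k$, with $\|\cdot\|$ the $L_2(\mathbb P)$ norm over a fresh unit (the estimators held fixed), $\|\hat e_k-e^*\|=O_p(\rho_{N,e})$ and $\|\hat\mu_k-\mu^*\|=O_p(\rho_{N,\mu})$, where $\rho_{N,e}=o(1)$, $\rho_{N,\mu}=o(1)$ and $\rho_{N,\mu}\rho_{N,e}=o(N^{-1/2})$. **Claim.** Write $D=\mu^*(1,X)-\mu^*(0,X)-\delta^*$ and $H=\frac{T-e^*(X)}{e^*(X)(1-e^*(X))}(Y-\mu^*(T,X))$. Then $D$ and $H$ are square integrable, $\mathbb P(R=1)>0$, and as $N\to\infty$ $$\sqrt N(\hat\delta_{\rm our}-\delta^*)\xrightarrow{d}\mathcal N(0,V_{\rm our}),\qquad V_{\rm our}=\mathbb E[D^2]+\frac1{\mathbb P(R=1)}\mathbb E[H^2].$$ $V_{\rm our}$ is the semiparametric efficiency lower bound for $\delta^*$ when $(X,T,R,RY)$ is observed, that is, $V_{\rm our}=\mathbb E[\psi^2]$ for the efficient influence function $\psi$ (the element of the closed linear span in $L_2$ of the scores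 of all regular one-dimensional submodels that represents the derivative of the average treatment effect along each of them; a submodel is regular if the law of the observed data is differentiable in quadratic mean and the constants in (b), (c) can be chosen the same along the submodel), both in the model given by (a)-(d) and in the larger model in which (d) is relaxed to $R\perp Y(t)\mid(X,T=t)$, $t=0,1$. If moreover $\mathbb P(R=1)<1$, then $$\sqrt N(\hat\delta_{\rm ZB}-\delta^*)\xrightarrow{d}\mathcal N(0,V_{\rm ZB}),\qquad V_{\rm ZB}=\frac1{1-\mathbb P(R=1)}\mathbb E[D^2]+\frac1{\mathbb P(R=1)}\mathbb E[H^2],$$ $$V_{\rm ZB}-V_{\rm our}=\frac{\mathbb P(R=1)}{1-\mathbb P(R=1)}\,\mathbb E\big[(\mu^*(1,X)-\mu^*(0,X)-\delta^*)^2\big],$$ and this difference is strictly positive if and only if $\mu^*(1,X)-\mu^*(0,X)$ is not almost surely equal to $\delta^*$. -/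

import Mathlib

open MeasureTheory ProbabilityTheory Filter Topology
open scoped ENNReal NNReal

namespace SemiSupervisedATE

noncomputable section

/-! ### Units: potential outcomes and observed data -/

/-- The full description `(X, T, Y(0), Y(1), R)` of a unit: covariates, treatment indicator, the two
potential outcomes, labelling indicator. -/
abbrev Pop (𝓧 : Type*) := 𝓧 × Bool × ℝ × ℝ × Bool

/-- The observed data `(X, T, R, R * Y)` of a unit; the last entry is the outcome if the unit is
labelled, and the placeholder `0` (missing value) if it is not. -/
abbrev Obs (𝓧 : Type*) := 𝓧 × Bool × Bool × ℝ

variable {𝓧 : Type*}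

/-- covariates -/
def Pop.X (z : Pop 𝓧) : 𝓧 := z.1

/-- treatment indicator (`true` means treated) -/
def Pop.T (z : Pop 𝓧) : Bool := z.2.1

/-- potential outcome `Y(t)` -/
def Pop.Ypot (t : Bool) (z : Pop 𝓧) : ℝ := if t then z.2.2.2.1 else z.2.2.1

/-- labelling indicator (`true` means that the outcome is observed) -/
def Pop.R (z : Pop 𝓧) : Bool := z.2.2.2.2

/-- realized outcome `Y = Y(T)` -/
def Pop.Y (z : Pop 𝓧) : ℝ := z.Ypot z.T

/-- what is observed of a unit -/
def Pop.obs (z : Pop 𝓧) : Obs 𝓧 := (z.X, z.T, z.R, if z.R then z.Y else 0)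

/-- covariates of an observation -/
def Obs.X (o : Obs 𝓧) : 𝓧 := o.1

/-- treatment indicator of an observation -/
def Obs.T (o : Obs 𝓧) : Bool := o.2.1

/-- labelling indicator of an observation -/
def Obs.R (o : Obs 𝓧) : Bool := o.2.2.1

/-- outcome of a labelled observation -/
def Obs.Y (o : Obs 𝓧) : ℝ := o.2.2.2

/-- a binary indicator as a real number -/
def ind (b : Bool) : ℝ := if b then 1 else 0

section Population

variable [MeasurableSpace 𝓧]

theorem measurable_X : Measurable (Pop.X : Pop 𝓧 → 𝓧) := measurable_fst

theorem measurable_TX : Measurable (fun z : Pop 𝓧 => (z.T, z.X)) := by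
  unfold Pop.T Pop.X
  fun_prop

/-! ### Population quantities -/

/-- average treatment effect `δ* = E[Y(1)] - E[Y(0)]` -/
def ate (P : Measure (Pop 𝓧)) : ℝ := (∫ z, z.Ypot true ∂P) - ∫ z, z.Ypot false ∂P

/-- treatment propensity score `e*(x) = P(T = 1 | X = x)` -/
def eStar (P : Measure (Pop 𝓧)) [IsFiniteMeasure P] (x : 𝓧) : ℝ :=
  (condDistrib Pop.T Pop.X P x).real {true}

/-- labelling propensity score `r*(t, x) = P(R = 1 | T = t, X = x)` -/
def rStar (P : Measure (Pop 𝓧)) [IsFiniteMeasure P] (t : Bool) (x : 𝓧) : ℝ :=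
  (condDistrib Pop.R (fun z => (z.T, z.X)) P (t, x)).real {true}

/-- outcome regression `μ*(t, x) = E[Y | T = t, R = 1, X = x]` -/
def muStar (P : Measure (Pop 𝓧)) [IsFiniteMeasure P] (t : Bool) (x : 𝓧) : ℝ :=
  ∫ y, y ∂(condDistrib Pop.Y (fun z => (z.T, z.R, z.X)) P (t, true, x))

/-- `P(R = 1)` -/
def labelProb (P : Measure (Pop 𝓧)) : ℝ := P.real {z | z.R = true}

/-- `μ*(1, X) - μ*(0, X) - δ*` -/
def effectDev (P : Measure (Pop 𝓧)) [IsFiniteMeasure P] (z : Pop 𝓧) : ℝ :=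
  muStar P true z.X - muStar P false z.X - ate P

/-- `(T - e*(X)) / (e*(X) (1 - e*(X))) * (Y - μ*(T, X))` -/
def weightedResid (P : Measure (Pop 𝓧)) [IsFiniteMeasure P] (z : Pop 𝓧) : ℝ :=
  (ind z.T - eStar P z.X) / (eStar P z.X * (1 - eStar P z.X)) * (z.Y - muStar P z.T z.X)

/-- asymptotic variance of the surrogate-free estimator -/
def varOur (P : Measure (Pop 𝓧)) [IsFiniteMeasure P] : ℝ :=
  (∫ z, effectDev P z ^ 2 ∂P) + 1 / labelProb P * ∫ z, weightedResid P z ^ 2 ∂P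

/-- asymptotic variance of the Zhang-Bradic estimator -/
def varZB (P : Measure (Pop 𝓧)) [IsFiniteMeasure P] : ℝ :=
  1 / (1 - labelProb P) * (∫ z, effectDev P z ^ 2 ∂P)
    + 1 / labelProb P * ∫ z, weightedResid P z ^ 2 ∂P

/-! ### Assumptions on the population -/

variable [StandardBorelSpace 𝓧]

/-- Unconfoundedness, strict overlap with constant `ε`, and the moment condition with
constants `q`, `C`. -/
structure Basic (ε q C : ℝ) (P : Measure (Pop 𝓧)) [IsFiniteMeasure P] : Prop where
  unconfounded : ∀ t : Bool, Pop.Ypot t ⟂ᵢ[Pop.X, measurable_X; P] Pop.T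
  overlap_treatment : ∀ᵐ z ∂P, ε ≤ eStar P z.X ∧ eStar P z.X ≤ 1 - ε
  overlap_label : ∀ t : Bool, ∀ᵐ z ∂P, ε ≤ rStar P t z.X ∧ rStar P t z.X ≤ 1
  condVar_le : ∀ᵐ z ∂P,
    condVar (MeasurableSpace.comap (fun z : Pop 𝓧 => (z.T, z.X)) inferInstance) Pop.Y P z ≤ C
  moment : ∀ t : Bool, eLpNorm (Pop.Ypot t) (ENNReal.ofReal q) P ≤ ENNReal.ofReal C

/-- Labels missing completely at random: `R` is independent of all other variables. -/
def MCAR (P : Measure (Pop 𝓧)) : Prop :=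
  IndepFun Pop.R (fun z : Pop 𝓧 => (z.X, z.T, z.Ypot false, z.Ypot true)) P

/-- Labels missing at random: `R` and `Y` are independent given `(T, X)`, i.e. `R` and `Y(t)` are
independent given `(X, T = t)`, for `t = 0, 1`. -/
def MAR (P : Measure (Pop 𝓧)) [IsFiniteMeasure P] : Prop :=
  Pop.R ⟂ᵢ[fun z : Pop 𝓧 => (z.T, z.X), measurable_TX; P] Pop.Y

/-! ### Semiparametric efficiency bound -/

end Population

/-- The one-dimensional submodel `t ↦ Q t` is differentiable in quadratic mean at `t = 0`, with
score `g`; the densities are taken with respect to the dominating measure `Q t + Q 0`. -/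
def HasScore {α : Type*} [MeasurableSpace α] (Q : ℝ → Measure α) (g : α → ℝ) : Prop :=
  Tendsto (fun t : ℝ => ∫⁻ w, ENNReal.ofReal
      (((√((Q t).rnDeriv (Q t + Q 0) w).toReal - √((Q 0).rnDeriv (Q t + Q 0) w).toReal) / t
        - 1 / 2 * g w * √((Q 0).rnDeriv (Q t + Q 0) w).toReal) ^ 2) ∂(Q t + Q 0))
    (𝓝[≠] 0) (𝓝 0)

section Efficiency

variable [MeasurableSpace 𝓧] [StandardBorelSpace 𝓧]

/-- A model: a class of population laws, given through the constants `ε, q, C` of the overlap and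
moment conditions; the model itself is the union over the admissible constants. -/
abbrev Model (𝓧 : Type*) [MeasurableSpace 𝓧] := ℝ → ℝ → ℝ → Set (ProbabilityMeasure (Pop 𝓧))

/-- population laws with labels missing completely at random -/
def modelMCAR (𝓧 : Type*) [MeasurableSpace 𝓧] [StandardBorelSpace 𝓧] : Model 𝓧 :=
  fun ε q C => {Q | Basic ε q C (Q : Measure (Pop 𝓧)) ∧ MCAR (Q : Measure (Pop 𝓧))}

/-- population laws with labels missing at random -/
def modelMAR (𝓧 : Type*) [MeasurableSpace 𝓧] [StandardBorelSpace 𝓧] : Model 𝓧 :=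
  fun ε q C => {Q | Basic ε q C (Q : Measure (Pop 𝓧)) ∧ MAR (Q : Measure (Pop 𝓧))}

/-- law of the observed data under a population law -/
def obsLaw (P : ProbabilityMeasure (Pop 𝓧)) : Measure (Obs 𝓧) :=
  (P : Measure (Pop 𝓧)).map Pop.obs

/-- `Q` is a regular one-dimensional submodel of `𝓜` through `P` whose score (for the observed
data) is `g`: near `t = 0` it stays in the model, with overlap and moment constants that do not
depend on `t`, and the laws of the observed data are differentiable in quadratic mean. -/
structure IsSubmodel (𝓜 : Model 𝓧) (P : ProbabilityMeasure (Pop 𝓧))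
    (Q : ℝ → ProbabilityMeasure (Pop 𝓧)) (g : Lp ℝ 2 (obsLaw P)) : Prop where
  through : Q 0 = P
  mem : ∃ ε q C : ℝ, 0 < ε ∧ ε < 1 / 2 ∧ 2 < q ∧ 0 < C ∧ ∀ᶠ t in 𝓝 (0 : ℝ), Q t ∈ 𝓜 ε q C
  score : HasScore (fun t => obsLaw (Q t)) g

/-- tangent set: all scores of regular one-dimensional submodels -/
def tangentSet (𝓜 : Model 𝓧) (P : ProbabilityMeasure (Pop 𝓧)) : Set (Lp ℝ 2 (obsLaw P)) :=
  {g | ∃ Q, IsSubmodel 𝓜 P Q g}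

/-- `ψ` is the efficient influence function of the average treatment effect at `P`, when the data
`(X, T, R, R * Y)` are observed, under the model `𝓜`: it represents the derivative of the average
treatment effect along every regular submodel, and lies in the closed linear span of the scores. -/
structure IsEfficientInfluence (𝓜 : Model 𝓧) (P : ProbabilityMeasure (Pop 𝓧))
    (ψ : Lp ℝ 2 (obsLaw P)) : Prop where
  gradient : ∀ (Q : ℝ → ProbabilityMeasure (Pop 𝓧)) (g : Lp ℝ 2 (obsLaw P)), IsSubmodel 𝓜 P Q g →
    HasDerivAt (fun t => ate (Q t : Measure (Pop 𝓧))) (inner ℝ ψ g) 0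
  mem_tangent : ψ ∈ (Submodule.span ℝ (tangentSet 𝓜 P)).topologicalClosure

/-- `V` is the efficiency lower bound: `V = E[ψ²]` for the efficient influence function `ψ`. -/
def IsEfficiencyBound (𝓜 : Model 𝓧) (P : ProbabilityMeasure (Pop 𝓧)) (V : ℝ) : Prop :=
  ∃ ψ : Lp ℝ 2 (obsLaw P), IsEfficientInfluence 𝓜 P ψ ∧ V = ∫ w, ψ w ^ 2 ∂(obsLaw P)

end Efficiency

/-! ### Estimators -/

section Estimators

variable {N K : ℕ}

/-- number of labelled observations -/
def numLabelled (w : Fin N → Obs 𝓧) : ℕ := (Finset.univ.filter fun i => (w i).R = true).card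

/-- number of unlabelled observations -/
def numUnlabelled (w : Fin N → Obs 𝓧) : ℕ := (Finset.univ.filter fun i => (w i).R = false).card

/-- the labelled-data correction term
`T / e(X) * (Y - m(1, X)) - (1 - T) / (1 - e(X)) * (Y - m(0, X))` -/
def correction (e : 𝓧 → ℝ) (m : Bool × 𝓧 → ℝ) (o : Obs 𝓧) : ℝ :=
  ind o.T / e o.X * (o.Y - m (true, o.X))
    - (1 - ind o.T) / (1 - e o.X) * (o.Y - m (false, o.X))

/-- the average over labelled data of the correction, each unit with the nuisance estimates
`e (κ i)`, `m (κ i)` of its fold `κ i` -/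
def avgCorrection (κ : Fin N → Fin K) (e : Fin K → 𝓧 → ℝ) (m : Fin K → Bool × 𝓧 → ℝ)
    (w : Fin N → Obs 𝓧) : ℝ :=
  1 / (numLabelled w : ℝ) *
    ∑ i ∈ Finset.univ.filter (fun i => (w i).R = true), correction (e (κ i)) (m (κ i)) (w i)

/-- the surrogate-free estimator: outcomes are imputed on the whole sample -/
def deltaOur (κ : Fin N → Fin K) (e : Fin K → 𝓧 → ℝ) (m : Fin K → Bool × 𝓧 → ℝ)
    (w : Fin N → Obs 𝓧) : ℝ :=
  1 / (N : ℝ) * ∑ i, (m (κ i) (true, (w i).X) - m (κ i) (false, (w i).X))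
    + avgCorrection κ e m w

/-- the Zhang-Bradic estimator: outcomes are imputed on the unlabelled data only -/
def deltaZB (κ : Fin N → Fin K) (e : Fin K → 𝓧 → ℝ) (m : Fin K → Bool × 𝓧 → ℝ)
    (w : Fin N → Obs 𝓧) : ℝ :=
  1 / (numUnlabelled w : ℝ) *
      ∑ i ∈ Finset.univ.filter (fun i => (w i).R = false),
        (m (κ i) (true, (w i).X) - m (κ i) (false, (w i).X))
    + avgCorrection κ e m w

end Estimators

/-! ### Cross-fitting -/

/-- `ξ N = O_p(a N)` for nonnegative random variables `ξ N` -/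
def IsBigOp {Ω : Type*} [MeasurableSpace Ω] (Pr : Measure Ω) (ξ : ℕ → Ω → ℝ≥0∞) (a : ℕ → ℝ) :
    Prop :=
  ∀ η : ℝ, 0 < η → ∃ M : ℝ, ∀ᶠ N in atTop,
    Pr {ω | ENNReal.ofReal (M * a N) < ξ N ω} ≤ ENNReal.ofReal η

/-- A rule that splits the sample into folds: for each sample size `N`, the folds are chosen from
the labelling indicators and a random seed. -/
abbrev FoldRule (𝓤 : Type*) (K : ℕ) := ∀ N : ℕ, 𝓤 → (Fin N → Bool) → Fin N → Fin K

/-- A learning algorithm: from a seed, the fold assignment and the data it builds, for each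
fold, a function on `β`. -/
abbrev Learner (𝓤 𝓧 β : Type*) (K : ℕ) :=
  ∀ N : ℕ, Fin K → 𝓤 → (Fin N → Fin K) → (Fin N → Obs 𝓧) → β → ℝ

/-- The function built for fold `k` is computed from the data outside fold `k` only, and
measurably so. -/
structure IsCrossFit {𝓤 β : Type*} {K : ℕ} [MeasurableSpace 𝓧] [MeasurableSpace 𝓤]
    [MeasurableSpace β] (A : Learner 𝓤 𝓧 β K) : Prop where
  measurable : ∀ (N : ℕ) (k : Fin K) (κ : Fin N → Fin K),
    Measurable fun p : 𝓤 × (Fin N → Obs 𝓧) × β => A N k p.1 κ p.2.1 p.2.2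
  out_of_fold : ∀ (N : ℕ) (k : Fin K) (u : 𝓤) (κ : Fin N → Fin K) (w w' : Fin N → Obs 𝓧),
    (∀ i, κ i ≠ k → w i = w' i) → A N k u κ w = A N k u κ w'

section Sampling

variable {Ω 𝓤 : Type*} {K : ℕ}

/-- the first `N` observations -/
def sample (Z : ℕ → Ω → Pop 𝓧) (N : ℕ) (ω : Ω) : Fin N → Obs 𝓧 := fun i => (Z i ω).obs

/-- the fold assignment of the first `N` observations -/
def folds (F : FoldRule 𝓤 K) (Z : ℕ → Ω → Pop 𝓧) (U : Ω → 𝓤) (N : ℕ) (ω : Ω) : Fin N → Fin K :=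
  F N (U ω) fun i => (Z i ω).R

/-- the cross-fitted nuisance estimate for fold `k` -/
def fitted {β : Type*} (A : Learner 𝓤 𝓧 β K) (F : FoldRule 𝓤 K) (Z : ℕ → Ω → Pop 𝓧) (U : Ω → 𝓤)
    (N : ℕ) (ω : Ω) (k : Fin K) : β → ℝ :=
  A N k (U ω) (folds F Z U N ω) (sample Z N ω)

/-- number of units in fold `k` with labelling indicator `r` -/
def foldCount (F : FoldRule 𝓤 K) (Z : ℕ → Ω → Pop 𝓧) (U : Ω → 𝓤) (r : Bool) (k : Fin K) (N : ℕ)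
    (ω : Ω) : ℕ :=
  (Finset.univ.filter fun i : Fin N => (Z i ω).R = r ∧ folds F Z U N ω i = k).card

/-- number of units among the first `N` with labelling indicator `r` -/
def labelCount (Z : ℕ → Ω → Pop 𝓧) (r : Bool) (N : ℕ) (ω : Ω) : ℕ :=
  (Finset.univ.filter fun i : Fin N => (Z i ω).R = r).card

/-- The labelled and the unlabelled units are both split into `K` folds of approximately equal
size, up to an error `O_p(√N)`. -/
def IsBalanced [MeasurableSpace Ω] (Pr : Measure Ω) (F : FoldRule 𝓤 K) (Z : ℕ → Ω → Pop 𝓧)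
    (U : Ω → 𝓤) : Prop :=
  ∀ (r : Bool) (k : Fin K), IsBigOp Pr
    (fun N ω => ENNReal.ofReal |(foldCount F Z U r k N ω : ℝ) - (labelCount Z r N ω : ℝ) / K|)
    (fun N => √(N : ℝ))

end Sampling

end

end SemiSupervisedATE

open SemiSupervisedATE

set_option linter.unusedSectionVars false

/-! Efficiency. Let `a` be the inverse of P(T = s, R = 1 | X). The candidate `influence` is the
difference over the two arms of μ*(s, X) + 1{T = s, R = 1} a(X) (Y - μ*(s, X)), centred at the
average treatment effect. For any law Q of the larger model, any bounded weight a and any square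
integrable regression m, `integral_augmented_sub` says that the mean of the augmented variable
misses E_Q[Y(s)] by exactly E_Q[(1 - 1{T = s, R = 1} a(X)) (m(X) - μ_Q(s, X))]. Take a from P and
for m a truncation of μ_P. Along a path Q_t the mean of the augmented variable is differentiable,
because the path is differentiable in quadratic mean. The product term is negligible to first order:
the factor with the weight has conditional mean zero given X under P, so under Q_t it is orthogonal
to functions of X up to O(t) (`abs_integral_mul_comp_le`), while μ of Q_t is close to m in L²(Q_t),
up to the truncation error (`regression_dist_le`); the moment of order q > 2 makes that error small
uniformly along the path. Hence `influence` is a gradient in the model with labels missing at random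
(`hasDerivAt_mean_Ypot`, `hasDerivAt_ate`).

It is also an L² limit of scores of submodels with labels missing completely at random
(`influenceLp_mem`). These perturb the law of X and the laws of Y(s) given X by bounded amounts. A
path needs full population laws, and `recouple` supplies them by making the potential outcomes
conditionally independent given X, a change that the observed data cannot detect. A gradient of the
larger model that lies in the tangent space of the smaller one is efficient in both
(`isEfficiencyBound`).

Normality. Both estimators are instances of `weightedEstimator β`, where β is 1 or the indicator of
the unlabelled units. The scaled error is a normalized i.i.d. sum of `linearized` plus an explicit
`remainder` (`estimation_error_eq`). The remainder is negligible for four reasons. Label frequencies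
converge. Labels are independent of everything else, so given seed, labels and the data outside a
fold, the errors inside the fold form a centred independent sum of small variance
(`measure_pi_crossfit_le`, `negligibleP_foldSum`). The bias of the imputation and the bias of the
correction cancel up to the product of the two nuisance errors (`abs_integral_errors_le`). Finally,
balanced folds give these two biases equal weights up to O_p(N^(-1/2)). The central limit theorem
treats the linear part; its variance splits into the terms in D and H because E[D H] = 0 and R is
independent of both. For β = 1 the linear part is the efficient influence function itself
(`influence_obs_ae_eq`). -/

namespace SemiSupervisedATE

noncomputable section

/-! ### Conditional independence as disintegration -/

section CondIndep

variable {Ω γ β β' : Type*} [MeasurableSpace Ω] [StandardBorelSpace Ω] [MeasurableSpace γ]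
  [MeasurableSpace β] [StandardBorelSpace β] [Nonempty β]
  [MeasurableSpace β'] [StandardBorelSpace β'] [Nonempty β']
  {μ : Measure Ω} [IsFiniteMeasure μ] {k : Ω → γ} {g : Ω → β} {f : Ω → β'}

theorem map_eq_compProd_of_condIndepFun (hk : Measurable k) (hg : Measurable g) (hf : Measurable f)
    (h : g ⟂ᵢ[k, hk; μ] f) :
    μ.map (fun ω => ((k ω, g ω), f ω))
      = μ.map (fun ω => (k ω, g ω)) ⊗ₘ (condDistrib f k μ).prodMkRight β := by
  rw [← condDistrib_ae_eq_iff_measure_eq_compProd _ hf.aemeasurable]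
  exact (condIndepFun_iff_condDistrib_prod_ae_eq_prodMkRight hf hg hk).1 h

theorem map_prodMk_eq_compProd {κ : Kernel γ β'} [IsFiniteKernel κ] (hk : Measurable k)
    (hg : Measurable g) (hf : Measurable f)
    (h : μ.map (fun ω => ((k ω, g ω), f ω)) = μ.map (fun ω => (k ω, g ω)) ⊗ₘ κ.prodMkRight β) :
    μ.map (fun ω => (k ω, f ω)) = μ.map k ⊗ₘ κ := by
  have h1 : μ.map (fun ω => (k ω, f ω))
      = (μ.map (fun ω => ((k ω, g ω), f ω))).map (Prod.map Prod.fst id) := by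
    rw [Measure.map_map (by fun_prop) (by fun_prop)]; rfl
  have h2 : μ.map k = (μ.map (fun ω => (k ω, g ω))).map Prod.fst := by
    rw [Measure.map_map (by fun_prop) (by fun_prop)]; rfl
  rw [h1, h, h2]
  ext s hs
  rw [Measure.map_apply (by fun_prop) hs, Measure.compProd_apply (hs.preimage (by fun_prop)),
    Measure.compProd_apply hs, lintegral_map (Kernel.measurable_kernel_prodMk_left hs) (by fun_prop)]
  rfl

/-- Disintegrations are unique: `κ` is a version of the conditional law of `f` given `(k, g)` and,
after `g` is forgotten, of the one given `k`, so the two agree. As `κ` is arbitrary, constructed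
laws can be checked without computing their conditional distributions. -/
theorem condIndepFun_of_map_eq_compProd {κ : Kernel γ β'} [IsFiniteKernel κ] (hk : Measurable k)
    (hg : Measurable g) (hf : Measurable f)
    (h : μ.map (fun ω => ((k ω, g ω), f ω)) = μ.map (fun ω => (k ω, g ω)) ⊗ₘ κ.prodMkRight β) :
    g ⟂ᵢ[k, hk; μ] f := by
  rw [condIndepFun_iff_condDistrib_prod_ae_eq_prodMkRight hf hg hk]
  have h1 := condDistrib_ae_eq_of_measure_eq_compProd (fun ω => (k ω, g ω)) hf.aemeasurable h
  have h2 := condDistrib_ae_eq_of_measure_eq_compProd k hf.aemeasurable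
    (map_prodMk_eq_compProd hk hg hf h)
  have h3 : ∀ᵐ p ∂(μ.map fun ω => (k ω, g ω)), condDistrib f k μ p.1 = κ p.1 := by
    have : μ.map k = (μ.map (fun ω => (k ω, g ω))).map Prod.fst := by
      rw [Measure.map_map (by fun_prop) (by fun_prop)]; rfl
    rw [this] at h2
    exact ae_of_ae_map (by fun_prop) h2
  filter_upwards [h1, h3] with p hp hp'
  rw [hp, Kernel.prodMkRight_apply, Kernel.prodMkRight_apply, hp']

/-- Tonelli on the disintegration: given `k`, the event `f ∈ B` ignores `g`, so its conditional
probability may replace its indicator. With the treatment or the label as `f`, this is inverse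
probability weighting; values in `ℝ≥0∞` dispense with integrability. -/
theorem setLIntegral_of_condIndepFun (hk : Measurable k) (hg : Measurable g) (hf : Measurable f)
    (h : g ⟂ᵢ[k, hk; μ] f) {B : Set β'} (hB : MeasurableSet B) {φ : γ × β → ℝ≥0∞}
    (hφ : Measurable φ) :
    ∫⁻ ω in f ⁻¹' B, φ (k ω, g ω) ∂μ
      = ∫⁻ ω, condDistrib f k μ (k ω) B * φ (k ω, g ω) ∂μ := by
  have hm : Measurable fun p : (γ × β) × β' => (Prod.snd ⁻¹' B).indicator (fun p => φ p.1) p :=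
    (hφ.comp measurable_fst).indicator (measurable_snd hB)
  have e1 : ∫⁻ ω in f ⁻¹' B, φ (k ω, g ω) ∂μ
      = ∫⁻ p, (Prod.snd ⁻¹' B).indicator (fun p => φ p.1) p
          ∂(μ.map fun ω => ((k ω, g ω), f ω)) := by
    rw [lintegral_map hm (by fun_prop), ← lintegral_indicator (hf hB)]
    rfl
  rw [e1, map_eq_compProd_of_condIndepFun hk hg hf h, Measure.lintegral_compProd hm,
    lintegral_map hm.lintegral_kernel_prod_right' (by fun_prop)]
  refine lintegral_congr fun ω => ?_
  have : ∀ b, (Prod.snd ⁻¹' B).indicator (fun p : (γ × β) × β' => φ p.1) ((k ω, g ω), b)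
      = B.indicator (fun _ => φ (k ω, g ω)) b := fun b => rfl
  simp_rw [this]
  rw [lintegral_indicator hB, setLIntegral_const, Kernel.prodMkRight_apply, mul_comm]

theorem condDistrib_ae_eq_const_of_indepFun [IsProbabilityMeasure μ] (hk : Measurable k)
    (hf : Measurable f)
    (h : IndepFun k f μ) : condDistrib f k μ =ᵐ[μ.map k] Kernel.const γ (μ.map f) := by
  refine condDistrib_ae_eq_of_measure_eq_compProd k hf.aemeasurable ?_
  rw [Measure.compProd_const]
  exact (indepFun_iff_map_prod_eq_prod_map_map hk.aemeasurable hf.aemeasurable).1 h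

theorem condIndepFun_of_indepFun_prodMk [IsProbabilityMeasure μ] (hk : Measurable k)
    (hg : Measurable g) (hf : Measurable f)
    (h : IndepFun (fun ω => (k ω, g ω)) f μ) : g ⟂ᵢ[k, hk; μ] f := by
  refine condIndepFun_of_map_eq_compProd (κ := Kernel.const γ (μ.map f)) hk hg hf ?_
  have : (Kernel.const γ (μ.map f)).prodMkRight β = Kernel.const (γ × β) (μ.map f) := by
    ext; rfl
  rw [this, Measure.compProd_const]
  exact (indepFun_iff_map_prod_eq_prod_map_map (by fun_prop) hf.aemeasurable).1 h

end CondIndep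

/-! ### Inverse probability weighting by treatment and label -/

section Identification

variable {𝓧 : Type*} [MeasurableSpace 𝓧]

@[fun_prop] theorem measurable_popX : Measurable (Pop.X : Pop 𝓧 → 𝓧) := measurable_fst

@[fun_prop] theorem measurable_popT : Measurable (Pop.T : Pop 𝓧 → Bool) := by
  unfold Pop.T; fun_prop

@[fun_prop] theorem measurable_popR : Measurable (Pop.R : Pop 𝓧 → Bool) := by
  unfold Pop.R; fun_prop

@[fun_prop] theorem measurable_Ypot (s : Bool) : Measurable (Pop.Ypot s : Pop 𝓧 → ℝ) := by
  unfold Pop.Ypot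
  split_ifs <;> fun_prop

@[fun_prop] theorem measurable_popY : Measurable (Pop.Y : Pop 𝓧 → ℝ) := by
  unfold Pop.Y Pop.Ypot
  exact Measurable.ite (measurable_popT (measurableSet_singleton true)) (by fun_prop) (by fun_prop)

@[fun_prop] theorem measurable_obs : Measurable (Pop.obs : Pop 𝓧 → Obs 𝓧) := by
  unfold Pop.obs
  have : Measurable fun z : Pop 𝓧 => if z.R = true then z.Y else 0 :=
    Measurable.ite (measurable_popR (measurableSet_singleton true)) (by fun_prop) (by fun_prop)
  fun_prop

@[fun_prop] theorem measurable_obsX : Measurable (Obs.X : Obs 𝓧 → 𝓧) := measurable_fst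

@[fun_prop] theorem measurable_obsT : Measurable (Obs.T : Obs 𝓧 → Bool) := by
  unfold Obs.T; fun_prop

@[fun_prop] theorem measurable_obsR : Measurable (Obs.R : Obs 𝓧 → Bool) := by
  unfold Obs.R; fun_prop

@[fun_prop] theorem measurable_obsY : Measurable (Obs.Y : Obs 𝓧 → ℝ) := by
  unfold Obs.Y; fun_prop

/-- the units with treatment `s` -/
def treated (s : Bool) : Set (Pop 𝓧) := Pop.T ⁻¹' {s}

/-- the labelled units with treatment `s` -/
def arm (s : Bool) : Set (Pop 𝓧) := treated s ∩ Pop.R ⁻¹' {true}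

theorem measurableSet_treated (s : Bool) : MeasurableSet (treated s : Set (Pop 𝓧)) :=
  measurable_popT (measurableSet_singleton s)

theorem measurableSet_arm (s : Bool) : MeasurableSet (arm s : Set (Pop 𝓧)) :=
  (measurableSet_treated s).inter (measurable_popR (measurableSet_singleton true))

theorem Y_eq_of_treated {s : Bool} {z : Pop 𝓧} (h : z ∈ treated s) : z.Y = z.Ypot s := by
  have : z.T = s := h
  rw [Pop.Y, this]

/-- `P(T = s | X = x)` -/
def propensity (Q : Measure (Pop 𝓧)) [IsFiniteMeasure Q] (s : Bool) (x : 𝓧) : ℝ :=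
  (condDistrib Pop.T Pop.X Q x).real {s}

theorem propensity_false (Q : Measure (Pop 𝓧)) [IsFiniteMeasure Q] (x : 𝓧) :
    propensity Q false x = 1 - eStar Q x := by
  have h : ({false} : Set Bool) = {true}ᶜ := by ext b; cases b <;> simp
  rw [propensity, h, probReal_compl_eq_one_sub (measurableSet_singleton _)]
  rfl

@[fun_prop] theorem measurable_propensity (Q : Measure (Pop 𝓧)) [IsFiniteMeasure Q] (s : Bool) :
    Measurable (propensity Q s) :=
  (Kernel.measurable_coe _ (measurableSet_singleton s)).ennreal_toReal

@[fun_prop] theorem measurable_eStar (Q : Measure (Pop 𝓧)) [IsFiniteMeasure Q] :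
    Measurable (eStar Q) := measurable_propensity Q true

@[fun_prop] theorem measurable_rStar (Q : Measure (Pop 𝓧)) [IsFiniteMeasure Q] (s : Bool) :
    Measurable (rStar Q s) :=
  ((Kernel.measurable_coe _ (measurableSet_singleton true)).comp
    (measurable_const.prodMk measurable_id)).ennreal_toReal

theorem measurable_muStar_uncurry (Q : Measure (Pop 𝓧)) [IsFiniteMeasure Q] :
    Measurable fun p : Bool × 𝓧 => muStar Q p.1 p.2 := by
  have h : StronglyMeasurable fun c : Bool × Bool × 𝓧 =>
      ∫ y, y ∂(condDistrib Pop.Y (fun z : Pop 𝓧 => (z.T, z.R, z.X)) Q c) :=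
    (measurable_snd (α := Bool × Bool × 𝓧) (β := ℝ)).stronglyMeasurable.integral_kernel_prod_right'
  exact h.measurable.comp (by fun_prop : Measurable fun p : Bool × 𝓧 => (p.1, true, p.2))

@[fun_prop] theorem measurable_muStar (Q : Measure (Pop 𝓧)) [IsFiniteMeasure Q] (s : Bool) :
    Measurable (muStar Q s) :=
  (measurable_muStar_uncurry Q).comp (measurable_const.prodMk measurable_id)

/-- `P(T = s, R = 1 | X = x)` -/
def armProb (Q : Measure (Pop 𝓧)) [IsFiniteMeasure Q] (s : Bool) (x : 𝓧) : ℝ :=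
  propensity Q s x * rStar Q s x

@[fun_prop] theorem measurable_armProb (Q : Measure (Pop 𝓧)) [IsFiniteMeasure Q] (s : Bool) :
    Measurable (armProb Q s) := by unfold armProb; fun_prop

theorem propensity_nonneg (Q : Measure (Pop 𝓧)) [IsFiniteMeasure Q] (s : Bool) (x : 𝓧) :
    0 ≤ propensity Q s x := measureReal_nonneg

theorem propensity_le_one (Q : Measure (Pop 𝓧)) [IsFiniteMeasure Q] (s : Bool) (x : 𝓧) :
    propensity Q s x ≤ 1 := measureReal_le_one

theorem rStar_nonneg (Q : Measure (Pop 𝓧)) [IsFiniteMeasure Q] (s : Bool) (x : 𝓧) :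
    0 ≤ rStar Q s x := measureReal_nonneg

theorem rStar_le_one (Q : Measure (Pop 𝓧)) [IsFiniteMeasure Q] (s : Bool) (x : 𝓧) :
    rStar Q s x ≤ 1 := measureReal_le_one

theorem armProb_nonneg (Q : Measure (Pop 𝓧)) [IsFiniteMeasure Q] (s : Bool) (x : 𝓧) :
    0 ≤ armProb Q s x := mul_nonneg (propensity_nonneg Q s x) (rStar_nonneg Q s x)

theorem armProb_le_one (Q : Measure (Pop 𝓧)) [IsFiniteMeasure Q] (s : Bool) (x : 𝓧) :
    armProb Q s x ≤ 1 :=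
  mul_le_one₀ (propensity_le_one Q s x) (rStar_nonneg Q s x) (rStar_le_one Q s x)

variable [StandardBorelSpace 𝓧] {ε q C : ℝ} {Q : Measure (Pop 𝓧)} [IsFiniteMeasure Q]

theorem setLIntegral_treated (h : ∀ t : Bool, Pop.Ypot t ⟂ᵢ[Pop.X, measurable_X; Q] Pop.T)
    (s : Bool) {φ : 𝓧 × ℝ → ℝ≥0∞} (hφ : Measurable φ) :
    ∫⁻ z in treated s, φ (z.X, z.Ypot s) ∂Q
      = ∫⁻ z, ENNReal.ofReal (propensity Q s z.X) * φ (z.X, z.Ypot s) ∂Q := by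
  rw [treated, setLIntegral_of_condIndepFun measurable_X (measurable_Ypot s) measurable_popT (h s)
    (measurableSet_singleton s) hφ]
  simp [propensity, Measure.real]

theorem setLIntegral_labelled (h : MAR Q) {φ : (Bool × 𝓧) × ℝ → ℝ≥0∞}
    (hφ : Measurable φ) :
    ∫⁻ z in Pop.R ⁻¹' {true}, φ ((z.T, z.X), z.Y) ∂Q
      = ∫⁻ z, ENNReal.ofReal (rStar Q z.T z.X) * φ ((z.T, z.X), z.Y) ∂Q := by
  rw [setLIntegral_of_condIndepFun measurable_TX measurable_popY measurable_popR h.symm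
    (measurableSet_singleton true) hφ]
  simp [rStar, Measure.real]

/-- Weighting twice: the label is integrated out given `(T, X)` with weight `rStar`, and the
treatment given `X` with weight `propensity`. -/
theorem setLIntegral_arm (h : ∀ t : Bool, Pop.Ypot t ⟂ᵢ[Pop.X, measurable_X; Q] Pop.T)
    (h' : MAR Q) (s : Bool) {φ : 𝓧 × ℝ → ℝ≥0∞} (hφ : Measurable φ) :
    ∫⁻ z in arm s, φ (z.X, z.Ypot s) ∂Q
      = ∫⁻ z, ENNReal.ofReal (armProb Q s z.X) * φ (z.X, z.Ypot s) ∂Q := by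
  have hm : Measurable fun p : (Bool × 𝓧) × ℝ =>
      ((fun p : (Bool × 𝓧) × ℝ => p.1.1) ⁻¹' {s}).indicator (fun p => φ (p.1.2, p.2)) p :=
    (hφ.comp (by fun_prop : Measurable fun p : (Bool × 𝓧) × ℝ => (p.1.2, p.2))).indicator
      ((by fun_prop : Measurable fun p : (Bool × 𝓧) × ℝ => p.1.1) (measurableSet_singleton s))
  have e1 := setLIntegral_labelled h' hm
  have e2 := setLIntegral_treated h s
    (φ := fun p => ENNReal.ofReal (rStar Q s p.1) * φ p) (by fun_prop)
  have e3 : ∀ z : Pop 𝓧, ((fun p : (Bool × 𝓧) × ℝ => p.1.1) ⁻¹' {s}).indicator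
      (fun p => φ (p.1.2, p.2)) ((z.T, z.X), z.Y)
      = (treated s).indicator (fun z => φ (z.X, z.Ypot s)) z := by
    intro z
    by_cases hz : z.T = s
    · have hz' : z ∈ treated s := hz
      rw [Set.indicator_of_mem (by simpa using hz), Set.indicator_of_mem hz', Y_eq_of_treated hz']
    · have hz' : z ∉ treated s := hz
      rw [Set.indicator_of_notMem (by simpa using hz), Set.indicator_of_notMem hz']
  simp_rw [e3] at e1
  have e4 : ∫⁻ z in arm s, φ (z.X, z.Ypot s) ∂Q
      = ∫⁻ z in Pop.R ⁻¹' {true}, (treated s).indicator (fun z => φ (z.X, z.Ypot s)) z ∂Q := by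
    rw [lintegral_indicator (measurableSet_treated s), Measure.restrict_restrict
      (measurableSet_treated s)]
    rfl
  rw [e4, e1]
  have e5 : ∫⁻ z, ENNReal.ofReal (rStar Q z.T z.X)
        * (treated s).indicator (fun z => φ (z.X, z.Ypot s)) z ∂Q
      = ∫⁻ z in treated s, ENNReal.ofReal (rStar Q s z.X) * φ (z.X, z.Ypot s) ∂Q := by
    rw [← lintegral_indicator (measurableSet_treated s)]
    refine lintegral_congr fun z => ?_
    by_cases hz : z ∈ treated s
    · rw [Set.indicator_of_mem hz, Set.indicator_of_mem hz, show z.T = s from hz]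
    · rw [Set.indicator_of_notMem hz, Set.indicator_of_notMem hz, mul_zero]
  rw [e5, e2]
  refine lintegral_congr fun z => ?_
  rw [armProb, ENNReal.ofReal_mul (propensity_nonneg Q s _), mul_assoc]

end Identification

/-! ### From nonnegative to real integrands -/

section Weighted

variable {Ω E : Type*} [MeasurableSpace Ω] [MeasurableSpace E] {Q : Measure Ω} {A : Set Ω}
  {V : Ω → E} {w : E → ℝ}

theorem map_restrict_eq_withDensity (hV : Measurable V) (hw : Measurable w)
    (h : ∀ φ : E → ℝ≥0∞, Measurable φ →
      ∫⁻ z in A, φ (V z) ∂Q = ∫⁻ z, ENNReal.ofReal (w (V z)) * φ (V z) ∂Q) :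
    (Q.restrict A).map V = (Q.map V).withDensity fun v => ENNReal.ofReal (w v) := by
  refine Measure.ext_of_lintegral _ fun φ hφ => ?_
  rw [lintegral_map hφ hV, h φ hφ, lintegral_withDensity_eq_lintegral_mul _ (by fun_prop) hφ,
    lintegral_map (by fun_prop) hV]
  rfl

/-- Nonnegative test functions determine a measure, so `h` amounts to an identity of measures and
passes to Bochner integrals without any integrability of `f`. -/
theorem setIntegral_eq_integral_weight (hV : Measurable V) (hw : Measurable w)
    (hw0 : ∀ v, 0 ≤ w v)
    (h : ∀ φ : E → ℝ≥0∞, Measurable φ →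
      ∫⁻ z in A, φ (V z) ∂Q = ∫⁻ z, ENNReal.ofReal (w (V z)) * φ (V z) ∂Q)
    {f : E → ℝ} (hf : Measurable f) :
    ∫ z in A, f (V z) ∂Q = ∫ z, w (V z) * f (V z) ∂Q := by
  have e1 : ∫ z in A, f (V z) ∂Q = ∫ v, f v ∂((Q.restrict A).map V) :=
    (integral_map hV.aemeasurable hf.aestronglyMeasurable).symm
  rw [e1, map_restrict_eq_withDensity hV hw h,
    integral_withDensity_eq_integral_toReal_smul (by fun_prop) (by simp),
    integral_map hV.aemeasurable
      (by fun_prop : Measurable fun v => (ENNReal.ofReal (w v)).toReal • f v).aestronglyMeasurable]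
  refine integral_congr_ae (ae_of_all _ fun z => ?_)
  simp [hw0]

end Weighted

/-! ### The outcome regression as a projection -/

section Identification

variable {𝓧 : Type*} [MeasurableSpace 𝓧] [StandardBorelSpace 𝓧] {ε q C : ℝ}
  {Q : Measure (Pop 𝓧)} [IsProbabilityMeasure Q]

theorem setIntegral_treated (h : Basic ε q C Q) (s : Bool) {f : 𝓧 × ℝ → ℝ} (hf : Measurable f) :
    ∫ z in treated s, f (z.X, z.Ypot s) ∂Q = ∫ z, propensity Q s z.X * f (z.X, z.Ypot s) ∂Q :=
  setIntegral_eq_integral_weight (V := fun z : Pop 𝓧 => (z.X, z.Ypot s))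
    (w := fun v => propensity Q s v.1) (by fun_prop) (by fun_prop)
    (fun v => propensity_nonneg Q s v.1)
    (fun _ hφ => setLIntegral_treated h.unconfounded s hφ) hf

theorem setIntegral_arm (h : Basic ε q C Q) (h' : MAR Q) (s : Bool) {f : 𝓧 × ℝ → ℝ}
    (hf : Measurable f) :
    ∫ z in arm s, f (z.X, z.Ypot s) ∂Q = ∫ z, armProb Q s z.X * f (z.X, z.Ypot s) ∂Q :=
  setIntegral_eq_integral_weight (V := fun z : Pop 𝓧 => (z.X, z.Ypot s))
    (w := fun v => armProb Q s v.1) (by fun_prop) (by fun_prop)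
    (fun v => armProb_nonneg Q s v.1)
    (fun _ hφ => setLIntegral_arm h.unconfounded h' s hφ) hf

theorem Basic.le_propensity (h : Basic ε q C Q) (s : Bool) :
    ∀ᵐ z ∂Q, ε ≤ propensity Q s z.X := by
  filter_upwards [h.overlap_treatment] with z hz
  cases s
  · rw [propensity_false]; linarith [hz.2]
  · exact hz.1

theorem Basic.le_armProb (h : Basic ε q C Q) (hε : 0 < ε) (s : Bool) :
    ∀ᵐ z ∂Q, ε ^ 2 ≤ armProb Q s z.X := by
  filter_upwards [h.le_propensity s, h.overlap_label s] with z h1 h2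
  rw [armProb, sq]
  exact mul_le_mul h1 h2.1 hε.le (hε.le.trans h1)

theorem Basic.eLpNorm_two_le (h : Basic ε q C Q) (hq : 2 < q) (s : Bool) :
    eLpNorm (Pop.Ypot s) 2 Q ≤ ENNReal.ofReal C := by
  refine le_trans (eLpNorm_le_eLpNorm_of_exponent_le ?_ (by fun_prop)) (h.moment s)
  rw [show (2 : ℝ≥0∞) = ENNReal.ofReal 2 by simp]
  exact ENNReal.ofReal_le_ofReal hq.le

theorem Basic.memLp_Ypot (h : Basic ε q C Q) (hq : 2 < q) (s : Bool) :
    MemLp (Pop.Ypot s) 2 Q :=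
  ⟨by fun_prop, (h.eLpNorm_two_le hq s).trans_lt ENNReal.ofReal_lt_top⟩

theorem Basic.memLp_Y (h : Basic ε q C Q) (hq : 2 < q) : MemLp Pop.Y 2 Q := by
  refine ((h.memLp_Ypot hq true).norm.add (h.memLp_Ypot hq false).norm).mono (by fun_prop)
    (ae_of_all _ fun z => ?_)
  have e : ‖((fun z : Pop 𝓧 => ‖z.Ypot true‖) + fun z : Pop 𝓧 => ‖z.Ypot false‖) z‖
      = |z.Ypot true| + |z.Ypot false| :=
    Real.norm_of_nonneg (add_nonneg (abs_nonneg _) (abs_nonneg _))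
  rw [e, Real.norm_eq_abs, Pop.Y]
  cases z.T
  · linarith [abs_nonneg (z.Ypot true)]
  · linarith [abs_nonneg (z.Ypot false)]

/-- By overlap each arm contains at least the fraction `ε ^ 2` of the units at almost every `X`, so
bounds proved on one arm extend to the population. -/
theorem lintegral_le_arm (h : Basic ε q C Q) (h' : MAR Q) (hε : 0 < ε) (s : Bool)
    {φ : 𝓧 → ℝ≥0∞} (hφ : Measurable φ) :
    ENNReal.ofReal (ε ^ 2) * ∫⁻ z, φ z.X ∂Q ≤ ∫⁻ z in arm s, φ z.X ∂Q := by
  have e := setLIntegral_arm h.unconfounded h' s (φ := fun p => φ p.1) (by fun_prop)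
  simp only at e
  rw [e, ← lintegral_const_mul _ (by fun_prop)]
  refine lintegral_mono_ae ?_
  filter_upwards [h.le_armProb hε s] with z hz
  gcongr

theorem lintegral_le_treated (h : Basic ε q C Q) (s : Bool)
    {φ : 𝓧 → ℝ≥0∞} (hφ : Measurable φ) :
    ENNReal.ofReal ε * ∫⁻ z, φ z.X ∂Q ≤ ∫⁻ z in treated s, φ z.X ∂Q := by
  have e := setLIntegral_treated h.unconfounded s (φ := fun p => φ p.1) (by fun_prop)
  simp only at e
  rw [e, ← lintegral_const_mul _ (by fun_prop)]
  refine lintegral_mono_ae ?_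
  filter_upwards [h.le_propensity s] with z hz
  gcongr

/-- covariates, treatment and label as a random element -/
def labelledDesign (z : Pop 𝓧) : Bool × Bool × 𝓧 := (z.T, z.R, z.X)

theorem measurable_labelledDesign : Measurable (labelledDesign : Pop 𝓧 → _) := by
  unfold labelledDesign; fun_prop

theorem condExp_eq_muStar_on_arm (h : Basic ε q C Q) (hq : 2 < q) (s : Bool) :
    ∀ᵐ z ∂Q, z ∈ arm s →
      (Q[Pop.Y | MeasurableSpace.comap labelledDesign inferInstance]) z = muStar Q s z.X := by
  have := condExp_ae_eq_integral_condDistrib' (μ := Q) measurable_labelledDesign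
    ((h.memLp_Y hq).integrable (by norm_num))
  filter_upwards [this] with z hz hz'
  rw [hz, muStar]
  have h1 : z.T = s := hz'.1
  have h2 : z.R = true := hz'.2
  have h3 : labelledDesign z = (s, true, z.X) := by rw [labelledDesign, h1, h2]
  rw [h3]
  rfl

theorem lintegral_sq_lt_top_of_memLp {Ω : Type*} [MeasurableSpace Ω] {μ : Measure Ω} {f : Ω → ℝ}
    (hf : MemLp f 2 μ) : ∫⁻ z, ‖f z‖ₑ ^ 2 ∂μ < ∞ := by
  have := (eLpNorm_lt_top_iff_lintegral_rpow_enorm_lt_top (by norm_num : (2 : ℝ≥0∞) ≠ 0)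
    (by norm_num)).1 hf.2
  simpa using this

theorem memLp_two_of_lintegral_sq_lt_top {Ω : Type*} [MeasurableSpace Ω] {μ : Measure Ω}
    {f : Ω → ℝ} (hf : AEStronglyMeasurable f μ) (h : ∫⁻ z, ‖f z‖ₑ ^ 2 ∂μ < ∞) : MemLp f 2 μ := by
  refine ⟨hf, ?_⟩
  rw [eLpNorm_lt_top_iff_lintegral_rpow_enorm_lt_top (by norm_num : (2 : ℝ≥0∞) ≠ 0)
    (by norm_num)]
  simpa using h

/-- On the arm `muStar` is a conditional expectation of `Y`, hence square integrable by contraction.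
Off the arm it is an extrapolation, which is controlled through overlap. -/
theorem memLp_muStar (h : Basic ε q C Q) (h' : MAR Q) (hε : 0 < ε) (hq : 2 < q) (s : Bool) :
    MemLp (fun z => muStar Q s z.X) 2 Q := by
  refine memLp_two_of_lintegral_sq_lt_top (by fun_prop : Measurable _).aestronglyMeasurable ?_
  have h1 := lintegral_le_arm h h' hε s (φ := fun x => ‖muStar Q s x‖ₑ ^ 2) (by fun_prop)
  have h2 : ∫⁻ z in arm s, ‖muStar Q s z.X‖ₑ ^ 2 ∂Q < ∞ := by
    refine lt_of_le_of_lt ?_ (lintegral_sq_lt_top_of_memLp (MemLp.condExp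
      (m := MeasurableSpace.comap labelledDesign inferInstance) (by norm_num) (h.memLp_Y hq)))
    refine le_trans (le_of_eq ?_) (setLIntegral_le_lintegral (arm s) _)
    refine setLIntegral_congr_fun_ae (measurableSet_arm s) ?_
    filter_upwards [condExp_eq_muStar_on_arm h hq s] with z hz hz'
    rw [hz hz']
  by_contra hc
  rw [not_lt, top_le_iff] at hc
  rw [hc, ENNReal.mul_top (by simpa using hε.ne')] at h1
  exact absurd h2 (not_lt.2 h1)

/-- The indicator of the arm times `f` is measurable for `(T, R, X)`, and on the arm `muStar` is the
conditional mean of `Y` given these variables, so the residual is orthogonal to the test function.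
-/
theorem setIntegral_arm_resid_mul (h : Basic ε q C Q) (hq : 2 < q)
    (s : Bool) {f : 𝓧 → ℝ} (hf : Measurable f) (hf2 : MemLp (fun z => f z.X) 2 Q) :
    ∫ z in arm s, (z.Ypot s - muStar Q s z.X) * f z.X ∂Q = 0 := by
  have hmle := (measurable_labelledDesign (𝓧 := 𝓧)).comap_le
  set m : MeasurableSpace (Pop 𝓧) := MeasurableSpace.comap labelledDesign inferInstance with hm
  set k : Pop 𝓧 → ℝ := (arm s).indicator fun z => f z.X with hk
  have hk2 : MemLp k 2 Q := hf2.indicator (measurableSet_arm s)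
  have hkm : StronglyMeasurable[m] k := by
    have : k = (fun p : Bool × Bool × 𝓧 => ({p | p.1 = s ∧ p.2.1 = true}).indicator
        (fun p => f p.2.2) p) ∘ labelledDesign := by
      rfl
    rw [this]
    refine StronglyMeasurable.comp_measurable (Measurable.stronglyMeasurable ?_)
      (comap_measurable _)
    refine (by fun_prop : Measurable fun p : Bool × Bool × 𝓧 => f p.2.2).indicator ?_
    exact (measurableSet_eq_fun (by fun_prop) (by fun_prop)).inter
      (measurableSet_eq_fun (by fun_prop) (by fun_prop))
  have hY := h.memLp_Y hq
  have hYc : MemLp (Q[Pop.Y | m]) 2 Q := MemLp.condExp (by norm_num) hY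
  have hd : MemLp (fun z => z.Y - (Q[Pop.Y | m]) z) 2 Q := hY.sub hYc
  have e1 : ∫ z in arm s, (z.Ypot s - muStar Q s z.X) * f z.X ∂Q
      = ∫ z, (z.Y - (Q[Pop.Y | m]) z) * k z ∂Q := by
    rw [← integral_indicator (measurableSet_arm s)]
    refine integral_congr_ae ?_
    filter_upwards [condExp_eq_muStar_on_arm h hq s] with z hz
    by_cases hz' : z ∈ arm s
    · rw [Set.indicator_of_mem hz', hz hz', Y_eq_of_treated hz'.1, hk, Set.indicator_of_mem hz']
    · rw [Set.indicator_of_notMem hz', hk, Set.indicator_of_notMem hz', mul_zero]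
  rw [e1, ← integral_condExp hmle]
  have e2 := condExp_mul_of_stronglyMeasurable_right hkm (hd.integrable_mul hk2)
    (hd.integrable (by norm_num))
  have e3 : Q[fun z => z.Y - (Q[Pop.Y | m]) z | m] =ᵐ[Q] 0 := by
    have := condExp_sub (hY.integrable (by norm_num)) (hYc.integrable (by norm_num)) m
    refine this.trans ?_
    rw [condExp_of_stronglyMeasurable hmle stronglyMeasurable_condExp integrable_condExp]
    exact ae_of_all _ fun z => sub_self _
  rw [show (0 : ℝ) = ∫ z, (0 : ℝ) ∂Q by simp]
  refine integral_congr_ae ?_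
  filter_upwards [e2, e3] with z h2 h3
  refine h2.trans ?_
  simp [h3]

/-- Identification: the test function is divided by `armProb`, which is bounded below, and the
weighting formula then turns an integral over the arm into one over all units. So the regression
fitted on the labelled arm is the regression of the potential outcome on `X`. -/
theorem integral_resid_mul (h : Basic ε q C Q) (h' : MAR Q) (hε : 0 < ε) (hq : 2 < q)
    (s : Bool) {f : 𝓧 → ℝ} (hf : Measurable f) (hf2 : MemLp (fun z => f z.X) 2 Q) :
    ∫ z, (z.Ypot s - muStar Q s z.X) * f z.X ∂Q = 0 := by
  have hb : MemLp (fun z : Pop 𝓧 => f z.X / armProb Q s z.X) 2 Q := by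
    refine (hf2.const_mul (ε ^ 2)⁻¹).mono (by fun_prop : Measurable _).aestronglyMeasurable ?_
    filter_upwards [h.le_armProb hε s] with z hz
    have : 0 < ε ^ 2 := by positivity
    rw [norm_div, norm_mul, norm_inv, Real.norm_of_nonneg this.le,
      Real.norm_of_nonneg (this.le.trans hz), div_eq_inv_mul]
    gcongr
  have e1 := setIntegral_arm_resid_mul h hq s (f := fun x => f x / armProb Q s x) (by fun_prop) hb
  have e2 := setIntegral_arm h h' s
    (f := fun p => (p.2 - muStar Q s p.1) * (f p.1 / armProb Q s p.1)) (by fun_prop)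
  simp only at e2
  rw [e1] at e2
  rw [e2]
  refine integral_congr_ae ?_
  filter_upwards [h.le_armProb hε s] with z hz
  have : 0 < armProb Q s z.X := lt_of_lt_of_le (by positivity) hz
  field_simp

theorem setIntegral_treated_resid_mul (h : Basic ε q C Q) (h' : MAR Q) (hε : 0 < ε) (hq : 2 < q)
    (s : Bool) {f : 𝓧 → ℝ} (hf : Measurable f) (hf2 : MemLp (fun z => f z.X) 2 Q) :
    ∫ z in treated s, (z.Ypot s - muStar Q s z.X) * f z.X ∂Q = 0 := by
  have e2 := setIntegral_treated h s
    (f := fun p => (p.2 - muStar Q s p.1) * f p.1) (by fun_prop)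
  simp only at e2
  rw [e2]
  have hb : MemLp (fun z : Pop 𝓧 => propensity Q s z.X * f z.X) 2 Q := by
    refine hf2.mono (by fun_prop : Measurable _).aestronglyMeasurable (ae_of_all _ fun z => ?_)
    rw [norm_mul, Real.norm_of_nonneg (propensity_nonneg Q s _)]
    exact mul_le_of_le_one_left (norm_nonneg _) (propensity_le_one Q s _)
  rw [← integral_resid_mul h h' hε hq s (f := fun x => propensity Q s x * f x) (by fun_prop) hb]
  refine integral_congr_ae (ae_of_all _ fun z => ?_)
  simp only
  ring

end Identification

/-! ### Constant labelling probability and the conditional variance bound -/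

section Identification

variable {𝓧 : Type*} [MeasurableSpace 𝓧] [StandardBorelSpace 𝓧] {ε q C : ℝ}
  {Q : Measure (Pop 𝓧)} [IsProbabilityMeasure Q]

/-- covariates, treatment and potential outcomes -/
def core (z : Pop 𝓧) : 𝓧 × Bool × ℝ × ℝ := (z.X, z.T, z.Ypot false, z.Ypot true)

@[fun_prop] theorem measurable_core : Measurable (core : Pop 𝓧 → _) := by
  unfold core; fun_prop

theorem MCAR.mar (h : MCAR Q) : MAR Q := by
  refine CondIndepFun.symm (condIndepFun_of_indepFun_prodMk measurable_TX measurable_popY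
    measurable_popR ?_)
  have h1 : IndepFun (core : Pop 𝓧 → _) Pop.R Q := IndepFun.symm h
  have h2 : (fun z : Pop 𝓧 => ((z.T, z.X), z.Y))
      = (fun v : 𝓧 × Bool × ℝ × ℝ => ((v.2.1, v.1), if v.2.1 = true then v.2.2.2 else v.2.2.1))
        ∘ core := by
    ext z
    · rfl
    · rfl
    · simp only [Function.comp, core, Pop.Y]
      by_cases hT : z.T = true
      · simp [hT]
      · rw [Bool.not_eq_true] at hT
        simp [hT]
  rw [h2]
  refine h1.comp (φ := fun v : 𝓧 × Bool × ℝ × ℝ =>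
    ((v.2.1, v.1), if v.2.1 = true then v.2.2.2 else v.2.2.1)) (ψ := id) ?_ measurable_id
  refine Measurable.prodMk (by fun_prop) (Measurable.ite ?_ (by fun_prop) (by fun_prop))
  exact measurableSet_eq_fun (by fun_prop) (by fun_prop)

/-- Conditional independence from a constant is automatic, so weighting functions of `X` alone needs
no unconfoundedness. -/
theorem setLIntegral_treated_X (Q : Measure (Pop 𝓧)) [IsProbabilityMeasure Q] (s : Bool)
    {φ : 𝓧 → ℝ≥0∞} (hφ : Measurable φ) :
    ∫⁻ z in treated s, φ z.X ∂Q = ∫⁻ z, ENNReal.ofReal (propensity Q s z.X) * φ z.X ∂Q := by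
  have := setLIntegral_of_condIndepFun (μ := Q) (g := fun _ : Pop 𝓧 => ()) measurable_X
    measurable_const measurable_popT (condIndepFun_const_left _ _)
    (measurableSet_singleton s) (φ := fun p => φ p.1) (by fun_prop)
  simpa [treated, propensity, Measure.real] using this

/-- The covariates in arm `s` have density at least `ε` with respect to the covariates of all units,
so null sets of the former are null for the latter. -/
theorem ae_of_ae_treated (hε : 0 < ε) (s : Bool) (h : ∀ᵐ z ∂Q, ε ≤ propensity Q s z.X)
    {p : 𝓧 → Prop} (hp : MeasurableSet {x | p x}) (h2 : ∀ᵐ z ∂Q, z ∈ treated s → p z.X) :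
    ∀ᵐ z ∂Q, p z.X := by
  have e := setLIntegral_treated_X Q s (φ := ({x | p x}ᶜ).indicator 1)
    (measurable_one.indicator hp.compl)
  have e1 : ∫⁻ z in treated s, ({x | p x}ᶜ).indicator 1 z.X ∂Q = 0 := by
    refine (lintegral_eq_zero_iff ((measurable_one.indicator hp.compl).comp measurable_X)).2 ?_
    rw [Filter.EventuallyEq, ae_restrict_iff' (measurableSet_treated s)]
    filter_upwards [h2] with z hz hz'
    simpa using hz hz'
  rw [e1] at e
  have e2 := (lintegral_eq_zero_iff (by
    have := (measurable_one.indicator hp.compl : Measurable (({x | p x}ᶜ).indicator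
      (1 : 𝓧 → ℝ≥0∞)))
    fun_prop)).1 e.symm
  filter_upwards [e2, h] with z h3 h4
  by_contra hc
  have : ({x | p x}ᶜ).indicator (1 : 𝓧 → ℝ≥0∞) z.X = 1 := Set.indicator_of_mem hc _
  simp only [this, Pi.zero_apply, mul_one, ENNReal.ofReal_eq_zero] at h3
  linarith

/-- The conditional law determines `rStar Q s` only at units with `T = s`; overlap carries the
identity over to almost every `X`. -/
theorem MCAR.rStar_ae_eq (hM : MCAR Q) (hε : 0 < ε) (s : Bool)
    (h : ∀ᵐ z ∂Q, ε ≤ propensity Q s z.X) : ∀ᵐ z ∂Q, rStar Q s z.X = labelProb Q := by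
  refine ae_of_ae_treated hε s h (p := fun x => rStar Q s x = labelProb Q)
    (measurableSet_eq_fun (by fun_prop) (by fun_prop)) ?_
  have h1 : IndepFun (fun z : Pop 𝓧 => (z.T, z.X)) Pop.R Q :=
    (IndepFun.symm hM).comp (φ := fun v : 𝓧 × Bool × ℝ × ℝ => (v.2.1, v.1)) (ψ := id)
      (by fun_prop) measurable_id
  have h2 := ae_of_ae_map (measurable_TX (𝓧 := 𝓧)).aemeasurable
    (condDistrib_ae_eq_const_of_indepFun measurable_TX measurable_popR h1)
  filter_upwards [h2] with z hz hz'
  have hz'' : z.T = s := hz'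
  rw [rStar, ← hz'', hz, labelProb, Kernel.const_apply, map_measureReal_apply measurable_popR
    (measurableSet_singleton true)]
  rfl

theorem Basic.rStar_ae_eq (h : Basic ε q C Q) (hM : MCAR Q) (hε : 0 < ε) (s : Bool) :
    ∀ᵐ z ∂Q, rStar Q s z.X = labelProb Q :=
  hM.rStar_ae_eq hε s (h.le_propensity s)

theorem Basic.le_labelProb (h : Basic ε q C Q) (hM : MCAR Q) (hε : 0 < ε) :
    ε ≤ labelProb Q := by
  obtain ⟨z, h1, h2⟩ := ((h.rStar_ae_eq hM hε true).and (h.overlap_label true)).exists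
  rw [← h1]
  exact h2.1

theorem Basic.armProb_ae_eq (h : Basic ε q C Q) (hM : MCAR Q) (hε : 0 < ε) (s : Bool) :
    ∀ᵐ z ∂Q, armProb Q s z.X = propensity Q s z.X * labelProb Q := by
  filter_upwards [h.rStar_ae_eq hM hε s] with z hz
  rw [armProb, hz]

/-- treatment and covariates as a random element -/
def design (z : Pop 𝓧) : Bool × 𝓧 := (z.T, z.X)

theorem measurable_design : Measurable (design : Pop 𝓧 → _) := measurable_TX

theorem measurable_muStar_TX (Q : Measure (Pop 𝓧)) [IsFiniteMeasure Q] :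
    Measurable fun z : Pop 𝓧 => muStar Q z.T z.X :=
  (measurable_muStar_uncurry Q).comp measurable_TX

theorem memLp_muStar_TX (h : Basic ε q C Q) (h' : MAR Q) (hε : 0 < ε) (hq : 2 < q) :
    MemLp (fun z => muStar Q z.T z.X) 2 Q := by
  refine ((memLp_muStar h h' hε hq true).norm.add (memLp_muStar h h' hε hq false).norm).mono
    (measurable_muStar_TX Q).aestronglyMeasurable (ae_of_all _ fun z => ?_)
  have e : ‖((fun z : Pop 𝓧 => ‖muStar Q true z.X‖) + fun z : Pop 𝓧 => ‖muStar Q false z.X‖) z‖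
      = |muStar Q true z.X| + |muStar Q false z.X| :=
    Real.norm_of_nonneg (add_nonneg (abs_nonneg _) (abs_nonneg _))
  rw [e, Real.norm_eq_abs]
  cases z.T
  · linarith [abs_nonneg (muStar Q true z.X)]
  · linarith [abs_nonneg (muStar Q false z.X)]

theorem treated_compl (s : Bool) : (treated s : Set (Pop 𝓧))ᶜ = treated (!s) := by
  ext z
  simp only [treated, Set.mem_compl_iff, Set.mem_preimage, Set.mem_singleton_iff]
  cases z.T <;> cases s <;> simp

theorem integral_eq_add_treated {f : Pop 𝓧 → ℝ} (hf : Integrable f Q) :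
    ∫ z, f z ∂Q = ∫ z in treated true, f z ∂Q + ∫ z in treated false, f z ∂Q := by
  rw [← integral_add_compl (measurableSet_treated true) hf, treated_compl]
  rfl

/-- `muStar` conditions on `R = 1`, whereas the variance assumption conditions on `(T, X)` alone.
Since the two regressions agree, that assumption bounds the squared residual. -/
theorem condExp_design_eq_muStar (h : Basic ε q C Q) (h' : MAR Q) (hε : 0 < ε) (hq : 2 < q) :
    Q[Pop.Y | MeasurableSpace.comap design inferInstance] =ᵐ[Q]
      fun z => muStar Q z.T z.X := by
  have hY := h.memLp_Y hq
  have hmu := memLp_muStar_TX h h' hε hq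
  symm
  refine ae_eq_condExp_of_forall_setIntegral_eq measurable_design.comap_le
    (hY.integrable (by norm_num)) (fun S _ _ => (hmu.integrable (by norm_num)).integrableOn) ?_
    ((measurable_muStar_uncurry Q).stronglyMeasurable.comp_measurable
      (comap_measurable design)).aestronglyMeasurable
  rintro S ⟨B, hB, rfl⟩ -
  have hS := measurable_design hB
  have hi : Integrable (fun z => (design ⁻¹' B).indicator
      (fun z : Pop 𝓧 => z.Y - muStar Q z.T z.X) z) Q :=
    ((hY.integrable (by norm_num)).sub (hmu.integrable (by norm_num))).indicator hS
  have key : ∫ z in design ⁻¹' B, (z.Y - muStar Q z.T z.X) ∂Q = 0 := by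
    rw [← integral_indicator hS, integral_eq_add_treated hi]
    have : ∀ s : Bool, ∫ z in treated s, (design ⁻¹' B).indicator
        (fun z : Pop 𝓧 => z.Y - muStar Q z.T z.X) z ∂Q = 0 := by
      intro s
      have hm : MeasurableSet {x : 𝓧 | (s, x) ∈ B} := hB.preimage (by fun_prop)
      rw [← setIntegral_treated_resid_mul h h' hε hq s
        (f := ({x : 𝓧 | (s, x) ∈ B}).indicator 1) (measurable_one.indicator hm) ?_]
      · refine setIntegral_congr_fun (measurableSet_treated s) fun z hz => ?_
        have hz' : z.T = s := hz
        by_cases hzB : z ∈ design ⁻¹' B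
        · have : z.X ∈ {x : 𝓧 | (s, x) ∈ B} := by rw [← hz']; exact hzB
          simp only [Set.indicator_of_mem hzB, Set.indicator_of_mem this]
          rw [Y_eq_of_treated hz, hz']; simp
        · have : z.X ∉ {x : 𝓧 | (s, x) ∈ B} := by rw [← hz']; exact hzB
          simp only [Set.indicator_of_notMem hzB, Set.indicator_of_notMem this]
          simp
      · refine MemLp.of_bound ((measurable_one.indicator hm).comp
          measurable_X).aestronglyMeasurable 1 (ae_of_all _ fun z => ?_)
        refine (norm_indicator_le_norm_self _ _).trans ?_
        simp
    rw [this, this, add_zero]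
  rw [integral_sub (hY.integrable (by norm_num)).integrableOn
    (hmu.integrable (by norm_num)).integrableOn, sub_eq_zero] at key
  exact key.symm

/-- On sets `{X ∈ B, T = s}` the variance bound is an inequality between two measures on the
covariate space, and so it extends to every weight `φ`. -/
theorem lintegral_sq_resid_le (h : Basic ε q C Q) (h' : MAR Q) (hε : 0 < ε) (hq : 2 < q)
    (s : Bool) {φ : 𝓧 → ℝ≥0∞} (hφ : Measurable φ) :
    ∫⁻ z in treated s, ‖z.Ypot s - muStar Q s z.X‖ₑ ^ 2 * φ z.X ∂Q
      ≤ ENNReal.ofReal C * ∫⁻ z in treated s, φ z.X ∂Q := by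
  have hY := h.memLp_Y hq
  have hmu := memLp_muStar_TX h h' hε hq
  have hmX : Measurable (Pop.X : Pop 𝓧 → 𝓧) := measurable_X
  have hw : Measurable fun z : Pop 𝓧 => ‖z.Ypot s - muStar Q s z.X‖ₑ ^ 2 := by fun_prop
  have hle : ((Q.restrict (treated s)).withDensity
        fun z => ‖z.Ypot s - muStar Q s z.X‖ₑ ^ 2).map Pop.X
      ≤ ENNReal.ofReal C • (Q.restrict (treated s)).map Pop.X := by
    refine Measure.le_iff.2 fun B hB => ?_
    rw [Measure.map_apply hmX hB, withDensity_apply _ (hmX hB), Measure.smul_apply,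
      Measure.map_apply hmX hB, smul_eq_mul, Measure.restrict_restrict (hmX hB),
      Measure.restrict_apply (hmX hB)]
    set S : Set (Pop 𝓧) := Pop.X ⁻¹' B ∩ treated s with hS
    have hSm : MeasurableSet S := (hmX hB).inter (measurableSet_treated s)
    have hd : MemLp (fun z => z.Y - muStar Q z.T z.X) 2 Q := hY.sub hmu
    have e1 : ∫⁻ z in S, ‖z.Ypot s - muStar Q s z.X‖ₑ ^ 2 ∂Q
        = ENNReal.ofReal (∫ z in S, (z.Y - muStar Q z.T z.X) ^ 2 ∂Q) := by
      rw [ofReal_integral_eq_lintegral_ofReal hd.integrable_sq.integrableOn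
        (ae_of_all _ fun z => sq_nonneg _)]
      refine setLIntegral_congr_fun hSm fun z hz => ?_
      have hz' : z.T = s := hz.2
      rw [Y_eq_of_treated hz.2, hz', ← sq_abs, ENNReal.ofReal_pow (abs_nonneg _),
        ← Real.norm_eq_abs, ofReal_norm]
    have e2 : ∫ z in S, (z.Y - muStar Q z.T z.X) ^ 2 ∂Q ≤ C * Q.real S := by
      have hSd : MeasurableSet[MeasurableSpace.comap design inferInstance] S :=
        ⟨Prod.snd ⁻¹' B ∩ Prod.fst ⁻¹' {s}, (measurable_snd hB).inter
          (measurable_fst (measurableSet_singleton s)), rfl⟩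
      have hce := condExp_design_eq_muStar h h' hε hq
      have e3 : Q[fun z => (z.Y - muStar Q z.T z.X) ^ 2 |
            MeasurableSpace.comap design inferInstance] =ᵐ[Q]
          condVar (MeasurableSpace.comap design inferInstance) Pop.Y Q := by
        refine condExp_congr_ae ?_
        filter_upwards [hce] with z hz
        simp [hz]
      rw [← setIntegral_condExp measurable_design.comap_le hd.integrable_sq hSd]
      calc ∫ z in S, (Q[fun z => (z.Y - muStar Q z.T z.X) ^ 2 |
            MeasurableSpace.comap design inferInstance]) z ∂Q
          ≤ ∫ z in S, C ∂Q := by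
            refine setIntegral_mono_ae integrable_condExp.integrableOn
              (integrable_const C).integrableOn ?_
            filter_upwards [e3, h.condVar_le] with z h1 h2
            rw [h1]; exact h2
        _ = C * Q.real S := by simp [mul_comm]
    rw [e1]
    refine (ENNReal.ofReal_le_ofReal e2).trans ?_
    rw [mul_comm C, ENNReal.ofReal_mul measureReal_nonneg, mul_comm]
    simp [Measure.real]
  have := lintegral_mono' hle (le_refl φ)
  rw [lintegral_map hφ hmX, lintegral_smul_measure, lintegral_map hφ hmX,
    show ∫⁻ a : Pop 𝓧, φ a.X ∂(Q.restrict (treated s)).withDensity _ = _ from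
      lintegral_withDensity_eq_lintegral_mul _ hw (hφ.comp hmX)] at this
  exact this

end Identification

/-! ### `L²` norms and truncation -/

section L2

variable {α : Type*} [MeasurableSpace α] {μ : Measure α} {f g : α → ℝ}

/-- the `L²` norm as a real number -/
def l2norm (μ : Measure α) (f : α → ℝ) : ℝ := √(∫ x, f x ^ 2 ∂μ)

theorem l2norm_nonneg (μ : Measure α) (f : α → ℝ) : 0 ≤ l2norm μ f := Real.sqrt_nonneg _

theorem sq_l2norm (μ : Measure α) (f : α → ℝ) : l2norm μ f ^ 2 = ∫ x, f x ^ 2 ∂μ :=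
  Real.sq_sqrt (integral_nonneg fun _ => sq_nonneg _)

theorem l2norm_eq_toReal (hf : MemLp f 2 μ) : l2norm μ f = (eLpNorm f 2 μ).toReal := by
  rw [hf.eLpNorm_eq_integral_rpow_norm (by norm_num) (by norm_num), ENNReal.toReal_ofReal
    (by positivity), l2norm, Real.sqrt_eq_rpow]
  simp

theorem ofReal_l2norm (hf : MemLp f 2 μ) : ENNReal.ofReal (l2norm μ f) = eLpNorm f 2 μ := by
  rw [l2norm_eq_toReal hf, ENNReal.ofReal_toReal hf.2.ne]

theorem l2norm_congr (h : ∀ᵐ x ∂μ, f x = g x) : l2norm μ f = l2norm μ g := by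
  unfold l2norm
  congr 1
  refine integral_congr_ae ?_
  filter_upwards [h] with x hx
  rw [hx]

theorem l2norm_mono (hg : MemLp g 2 μ) (h : ∀ᵐ x ∂μ, |f x| ≤ |g x|) :
    l2norm μ f ≤ l2norm μ g := by
  unfold l2norm
  refine Real.sqrt_le_sqrt (integral_mono_of_nonneg (ae_of_all _ fun x => sq_nonneg _)
    hg.integrable_sq ?_)
  filter_upwards [h] with x hx
  exact sq_le_sq.2 hx

theorem l2norm_const_mul (c : ℝ) : l2norm μ (fun x => c * f x) = |c| * l2norm μ f := by
  unfold l2norm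
  simp_rw [mul_pow]
  rw [integral_const_mul, Real.sqrt_mul (sq_nonneg c), Real.sqrt_sq_eq_abs]

theorem l2norm_add_le (hf : MemLp f 2 μ) (hg : MemLp g 2 μ) :
    l2norm μ (fun x => f x + g x) ≤ l2norm μ f + l2norm μ g := by
  rw [l2norm_eq_toReal hf, l2norm_eq_toReal hg, l2norm_eq_toReal (f := fun x => f x + g x) (hf.add hg),
    ← ENNReal.toReal_add hf.2.ne hg.2.ne]
  exact ENNReal.toReal_mono (ENNReal.add_ne_top.2 ⟨hf.2.ne, hg.2.ne⟩)
    (eLpNorm_add_le hf.1 hg.1 (by norm_num))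

theorem l2norm_sub_le (hf : MemLp f 2 μ) (hg : MemLp g 2 μ) :
    l2norm μ (fun x => f x - g x) ≤ l2norm μ f + l2norm μ g := by
  have := l2norm_add_le hf (hg.const_mul (-1))
  rw [l2norm_const_mul, abs_neg, abs_one, one_mul] at this
  simpa [sub_eq_add_neg] using this

theorem abs_integral_mul_le (hf : MemLp f 2 μ) (hg : MemLp g 2 μ) :
    |∫ x, f x * g x ∂μ| ≤ l2norm μ f * l2norm μ g := by
  have h1 := integral_mul_le_Lp_mul_Lq_of_nonneg (μ := μ) (p := 2) (q := 2)
    (Real.HolderConjugate.two_two) (f := fun x => |f x|) (g := fun x => |g x|)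
    (ae_of_all _ fun x => abs_nonneg _) (ae_of_all _ fun x => abs_nonneg _)
    (by simpa using hf.norm) (by simpa using hg.norm)
  calc |∫ x, f x * g x ∂μ| ≤ ∫ x, |f x * g x| ∂μ := abs_integral_le_integral_abs
    _ = ∫ x, |f x| * |g x| ∂μ := by simp_rw [abs_mul]
    _ ≤ _ := by
      refine h1.trans (le_of_eq ?_)
      simp [l2norm, Real.sqrt_eq_rpow]

theorem abs_integral_le_l2norm [IsProbabilityMeasure μ] (hf : MemLp f 2 μ) :
    |∫ x, f x ∂μ| ≤ l2norm μ f := by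
  have := abs_integral_mul_le hf (memLp_const (1 : ℝ))
  simpa [l2norm] using this

/-- truncation to `[-M, M]` -/
def clip (M y : ℝ) : ℝ := max (-M) (min M y)

theorem measurable_clip (M : ℝ) : Measurable (clip M) := by unfold clip; fun_prop

@[fun_prop] theorem measurable_clip_comp {M : ℝ} {f : α → ℝ} (hf : Measurable f) :
    Measurable fun x => clip M (f x) := (measurable_clip M).comp hf

theorem abs_clip_le {M : ℝ} (hM : 0 ≤ M) (y : ℝ) : |clip M y| ≤ M := by
  unfold clip
  rw [abs_le]
  exact ⟨le_max_left _ _, max_le (by linarith) (min_le_left _ _)⟩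

theorem clip_eq_self {M y : ℝ} (h : |y| ≤ M) : clip M y = y := by
  rw [abs_le] at h
  rw [clip, min_eq_right h.2, max_eq_right h.1]

theorem abs_clip_le_abs {M : ℝ} (hM : 0 ≤ M) (y : ℝ) : |clip M y| ≤ |y| := by
  by_cases h : |y| ≤ M
  · rw [clip_eq_self h]
  · exact (abs_clip_le hM y).trans (not_le.1 h).le

theorem abs_sub_clip_le {M : ℝ} (hM : 0 ≤ M) (y : ℝ) : |y - clip M y| ≤ |y| := by
  by_cases h : |y| ≤ M
  · rw [clip_eq_self h]; simp
  · rw [not_le, lt_abs] at h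
    unfold clip
    rcases h with h | h
    · rw [min_eq_left h.le, max_eq_right (by linarith), abs_of_nonneg (by linarith),
        abs_of_nonneg (by linarith)]
      linarith
    · rw [min_eq_right (by linarith), max_eq_left (by linarith), abs_of_nonpos (by linarith),
        abs_of_nonpos (by linarith)]
      linarith

theorem tendsto_l2norm_sub_clip (hf : MemLp f 2 μ) :
    Tendsto (fun M : ℕ => l2norm μ fun x => f x - clip M (f x)) atTop (𝓝 0) := by
  have h : Tendsto (fun M : ℕ => ∫ x, (f x - clip M (f x)) ^ 2 ∂μ) atTop
      (𝓝 (∫ _, (0 : ℝ) ∂μ)) := by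
    refine tendsto_integral_of_dominated_convergence (fun x => f x ^ 2) (fun M => ?_)
      hf.integrable_sq (fun M => ae_of_all _ fun x => ?_) (ae_of_all _ fun x => ?_)
    · exact (hf.1.sub ((measurable_clip M).comp_aemeasurable
        hf.1.aemeasurable).aestronglyMeasurable).pow 2
    · rw [Real.norm_of_nonneg (sq_nonneg _)]
      exact sq_le_sq.2 (abs_sub_clip_le (Nat.cast_nonneg _) _)
    · obtain ⟨n, hn⟩ := exists_nat_ge |f x|
      refine tendsto_const_nhds.congr' ?_
      filter_upwards [eventually_ge_atTop n] with M hM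
      rw [clip_eq_self (hn.trans (by exact_mod_cast hM)), sub_self]
      norm_num
  have := h.sqrt
  simpa [l2norm] using this

theorem memLp_clip (hf : MemLp f 2 μ) {M : ℝ} (hM : 0 ≤ M) :
    MemLp (fun x => clip M (f x)) 2 μ :=
  hf.mono ((measurable_clip M).comp_aemeasurable hf.1.aemeasurable).aestronglyMeasurable
    (ae_of_all _ fun x => by simpa using abs_clip_le_abs hM (f x))

end L2

/-! ### Hellinger distance -/

section Hellinger

variable {α : Type*} [MeasurableSpace α] {μ₁ μ₀ : Measure α} [IsProbabilityMeasure μ₁]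
  [IsProbabilityMeasure μ₀] {f g : α → ℝ}

/-- square root of the density of `μ` with respect to `ν` -/
def rootDensity (μ ν : Measure α) (w : α) : ℝ := √(μ.rnDeriv ν w).toReal

@[fun_prop] theorem measurable_rootDensity (μ ν : Measure α) : Measurable (rootDensity μ ν) :=
  (Measure.measurable_rnDeriv μ ν).ennreal_toReal.sqrt

theorem sq_rootDensity (μ ν : Measure α) (w : α) :
    rootDensity μ ν w ^ 2 = (μ.rnDeriv ν w).toReal := Real.sq_sqrt ENNReal.toReal_nonneg

section

variable {μ ν : Measure α} [IsFiniteMeasure μ] [IsFiniteMeasure ν]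

theorem integral_sq_rootDensity_mul (h : μ ≪ ν) (f : α → ℝ) :
    ∫ w, rootDensity μ ν w ^ 2 * f w ∂ν = ∫ w, f w ∂μ := by
  simp_rw [sq_rootDensity]
  exact integral_rnDeriv_smul h

theorem l2norm_rootDensity_mul (h : μ ≪ ν) (f : α → ℝ) :
    l2norm ν (fun w => rootDensity μ ν w * f w) = l2norm μ f := by
  unfold l2norm
  rw [← integral_sq_rootDensity_mul h]
  simp_rw [mul_pow]

theorem memLp_rootDensity_mul (h : μ ≪ ν) (hf : Measurable f) (hf2 : MemLp f 2 μ) :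
    MemLp (fun w => rootDensity μ ν w * f w) 2 ν := by
  rw [memLp_two_iff_integrable_sq (by fun_prop : Measurable _).aestronglyMeasurable]
  have := (integrable_rnDeriv_smul_iff (f := fun w => f w ^ 2) h).2 hf2.integrable_sq
  refine this.congr (ae_of_all _ fun w => ?_)
  simp only [smul_eq_mul]
  rw [mul_pow, sq_rootDensity]

end

/-- Hellinger distance -/
def hellinger (μ₁ μ₀ : Measure α) : ℝ :=
  l2norm (μ₁ + μ₀) fun w => rootDensity μ₁ (μ₁ + μ₀) w - rootDensity μ₀ (μ₁ + μ₀) w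

theorem ac_left (μ₁ μ₀ : Measure α) : μ₁ ≪ μ₁ + μ₀ :=
  Measure.absolutelyContinuous_of_le (Measure.le_add_right le_rfl)

theorem ac_right (μ₁ μ₀ : Measure α) : μ₀ ≪ μ₁ + μ₀ :=
  Measure.absolutelyContinuous_of_le (Measure.le_add_left le_rfl)

theorem memLp_rootDensity_left (μ₁ μ₀ : Measure α) [IsProbabilityMeasure μ₁]
    [IsProbabilityMeasure μ₀] : MemLp (rootDensity μ₁ (μ₁ + μ₀)) 2 (μ₁ + μ₀) := by
  simpa using memLp_rootDensity_mul (f := fun _ => 1) (ac_left μ₁ μ₀) (by fun_prop)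
    (memLp_const (1 : ℝ))

theorem memLp_rootDensity_right (μ₁ μ₀ : Measure α) [IsProbabilityMeasure μ₁]
    [IsProbabilityMeasure μ₀] : MemLp (rootDensity μ₀ (μ₁ + μ₀)) 2 (μ₁ + μ₀) := by
  simpa using memLp_rootDensity_mul (f := fun _ => 1) (ac_right μ₁ μ₀) (by fun_prop)
    (memLp_const (1 : ℝ))

/-- With `a` and `b` the root densities, `a ^ 2 - b ^ 2 = (a - b) * (a + b)`. The first factor
carries the Hellinger distance; the second, times `f`, needs only second moments of `f`. -/
theorem integral_sub_integral_eq (hf : Measurable f) (h1 : MemLp f 2 μ₁) (h0 : MemLp f 2 μ₀) :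
    ∫ w, f w ∂μ₁ - ∫ w, f w ∂μ₀
      = ∫ w, (rootDensity μ₁ (μ₁ + μ₀) w - rootDensity μ₀ (μ₁ + μ₀) w)
          * (rootDensity μ₁ (μ₁ + μ₀) w * f w + rootDensity μ₀ (μ₁ + μ₀) w * f w) ∂(μ₁ + μ₀) := by
  have i1 := (memLp_rootDensity_mul (ac_left μ₁ μ₀) hf h1).integrable_mul
    (memLp_rootDensity_left μ₁ μ₀)
  have i0 := (memLp_rootDensity_mul (ac_right μ₁ μ₀) hf h0).integrable_mul
    (memLp_rootDensity_right μ₁ μ₀)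
  rw [← integral_sq_rootDensity_mul (ac_left μ₁ μ₀) f,
    ← integral_sq_rootDensity_mul (ac_right μ₁ μ₀) f, ← integral_sub]
  · refine integral_congr_ae (ae_of_all _ fun w => ?_)
    simp only
    ring
  · refine i1.congr (ae_of_all _ fun w => ?_)
    simp only [Pi.mul_apply]
    ring
  · refine i0.congr (ae_of_all _ fun w => ?_)
    simp only [Pi.mul_apply]
    ring

theorem abs_integral_sub_le (hf : Measurable f) (h1 : MemLp f 2 μ₁) (h0 : MemLp f 2 μ₀) :
    |∫ w, f w ∂μ₁ - ∫ w, f w ∂μ₀| ≤ hellinger μ₁ μ₀ * (l2norm μ₁ f + l2norm μ₀ f) := by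
  rw [integral_sub_integral_eq hf h1 h0]
  have m1 := memLp_rootDensity_mul (ac_left μ₁ μ₀) hf h1
  have m0 := memLp_rootDensity_mul (ac_right μ₁ μ₀) hf h0
  refine (abs_integral_mul_le ((memLp_rootDensity_left μ₁ μ₀).sub (memLp_rootDensity_right μ₁ μ₀))
    (m1.add m0)).trans ?_
  refine mul_le_mul_of_nonneg_left ?_ (l2norm_nonneg _ _)
  refine (l2norm_add_le m1 m0).trans (le_of_eq ?_)
  rw [l2norm_rootDensity_mul (ac_left μ₁ μ₀), l2norm_rootDensity_mul (ac_right μ₁ μ₀)]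

theorem l2norm_indicator_one {μ : Measure α} {B : Set α} (hB : MeasurableSet B) :
    l2norm μ (B.indicator 1) = √(μ.real B) := by
  unfold l2norm
  have : (fun x => (B.indicator 1 x : ℝ) ^ 2) = B.indicator 1 := by
    ext x
    by_cases hx : x ∈ B <;> simp [hx]
  rw [this, integral_indicator_one hB]

/-- Let `x` and `y` be the roots of the masses of `B` under `μ₁` and `μ₀`, and `H` the Hellinger
distance. From `y ^ 2 - x ^ 2 ≤ H * (x + y)` comes `y - x ≤ H`, and `2 * x ≤ y` turns this into `x ≤
H`. -/
theorem sqrt_measureReal_le_hellinger {B : Set α} (hB : MeasurableSet B)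
    (h : 4 * μ₁.real B ≤ μ₀.real B) : √(μ₁.real B) ≤ hellinger μ₁ μ₀ := by
  have hi : Measurable (B.indicator (1 : α → ℝ)) := measurable_one.indicator hB
  have hm : ∀ (μ : Measure α) [IsProbabilityMeasure μ], MemLp (B.indicator (1 : α → ℝ)) 2 μ :=
    fun μ _ => (memLp_const (1 : ℝ)).indicator hB
  have key := abs_integral_sub_le hi (hm μ₁) (hm μ₀)
  rw [integral_indicator_one hB, integral_indicator_one hB, l2norm_indicator_one hB,
    l2norm_indicator_one hB, abs_sub_comm] at key
  have key2 := (le_abs_self _).trans key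
  set x := √(μ₁.real B) with hx
  set y := √(μ₀.real B) with hy
  have hx2 : x ^ 2 = μ₁.real B := Real.sq_sqrt measureReal_nonneg
  have hy2 : y ^ 2 = μ₀.real B := Real.sq_sqrt measureReal_nonneg
  have hx0 : 0 ≤ x := Real.sqrt_nonneg _
  have hy0 : 0 ≤ y := Real.sqrt_nonneg _
  have hH : 0 ≤ hellinger μ₁ μ₀ := l2norm_nonneg _ _
  rw [← hx2, ← hy2] at key2 h
  have hxy : 2 * x ≤ y := by
    refine le_of_sq_le_sq ?_ hy0
    nlinarith
  by_contra hc
  rw [not_le] at hc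
  have : 0 < x := hH.trans_lt hc
  nlinarith

end Hellinger

/-! ### Differentiating means along a path -/

section Score

variable {α : Type*} [MeasurableSpace α] {Q : ℝ → Measure α} [∀ t, IsProbabilityMeasure (Q t)]
  {f g : α → ℝ}

/-- remainder of the expansion of the root density -/
def scoreRem (Q : ℝ → Measure α) (g : α → ℝ) (t : ℝ) (w : α) : ℝ :=
  (rootDensity (Q t) (Q t + Q 0) w - rootDensity (Q 0) (Q t + Q 0) w) / t
    - 1 / 2 * g w * rootDensity (Q 0) (Q t + Q 0) w

theorem memLp_scoreRem (hg : Measurable g) (hg2 : MemLp g 2 (Q 0)) (t : ℝ) :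
    MemLp (scoreRem Q g t) 2 (Q t + Q 0) := by
  have h1 := ((memLp_rootDensity_left (Q t) (Q 0)).sub
    (memLp_rootDensity_right (Q t) (Q 0))).const_mul t⁻¹
  have h2 := (memLp_rootDensity_mul (ac_right (Q t) (Q 0)) hg hg2).const_mul (1 / 2)
  refine (h1.sub h2).ae_eq (ae_of_all _ fun w => ?_)
  simp only [Pi.sub_apply, scoreRem]
  ring

theorem HasScore.tendsto_l2norm_scoreRem (h : HasScore Q g) (hg : Measurable g)
    (hg2 : MemLp g 2 (Q 0)) :
    Tendsto (fun t => l2norm (Q t + Q 0) (scoreRem Q g t)) (𝓝[≠] 0) (𝓝 0) := by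
  have h1 := (ENNReal.tendsto_toReal (by simp)).comp h
  have h2 := h1.sqrt
  simp only [ENNReal.toReal_zero, Real.sqrt_zero] at h2
  refine h2.congr fun t => ?_
  rw [l2norm, integral_eq_lintegral_of_nonneg_ae (ae_of_all _ fun _ => sq_nonneg _)
    (memLp_scoreRem hg hg2 t).integrable_sq.aestronglyMeasurable]
  rfl

theorem hellinger_le (hg : Measurable g) (hg2 : MemLp g 2 (Q 0)) {t : ℝ} (ht : t ≠ 0) :
    hellinger (Q t) (Q 0)
      ≤ |t| * (1 / 2 * l2norm (Q 0) g + l2norm (Q t + Q 0) (scoreRem Q g t)) := by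
  have h2 := (memLp_rootDensity_mul (ac_right (Q t) (Q 0)) hg hg2).const_mul (1 / 2)
  have e : hellinger (Q t) (Q 0) = l2norm (Q t + Q 0) fun w => t *
      (1 / 2 * (rootDensity (Q 0) (Q t + Q 0) w * g w) + scoreRem Q g t w) := by
    refine l2norm_congr (ae_of_all _ fun w => ?_)
    simp only [scoreRem]
    field_simp
    ring
  rw [e, l2norm_const_mul]
  gcongr
  refine (l2norm_add_le h2 (memLp_scoreRem hg hg2 t)).trans (le_of_eq ?_)
  rw [l2norm_const_mul, l2norm_rootDensity_mul (ac_right (Q t) (Q 0)),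
    abs_of_pos (by norm_num : (0 : ℝ) < 1 / 2)]

theorem HasScore.eventually_hellinger_le (h : HasScore Q g) (hg : Measurable g)
    (hg2 : MemLp g 2 (Q 0)) :
    ∀ᶠ t in 𝓝[≠] 0, hellinger (Q t) (Q 0) ≤ |t| * (1 / 2 * l2norm (Q 0) g + 1) := by
  filter_upwards [(h.tendsto_l2norm_scoreRem hg hg2).eventually_le_const one_pos,
    self_mem_nhdsWithin] with t h1 h2
  refine (hellinger_le hg hg2 h2).trans ?_
  gcongr

theorem HasScore.tendsto_hellinger (h : HasScore Q g) (hg : Measurable g)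
    (hg2 : MemLp g 2 (Q 0)) : Tendsto (fun t => hellinger (Q t) (Q 0)) (𝓝[≠] 0) (𝓝 0) := by
  have h1 : Tendsto (fun t : ℝ => |t| * (1 / 2 * l2norm (Q 0) g + 1)) (𝓝[≠] 0) (𝓝 0) := by
    have : Tendsto (fun t : ℝ => |t| * (1 / 2 * l2norm (Q 0) g + 1)) (𝓝 0)
        (𝓝 (|0| * (1 / 2 * l2norm (Q 0) g + 1))) := by
      apply Continuous.tendsto; fun_prop
    rw [abs_zero, zero_mul] at this
    exact this.mono_left nhdsWithin_le_nhds
  exact squeeze_zero' (Eventually.of_forall fun t => l2norm_nonneg _ _)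
    (h.eventually_hellinger_le hg hg2) h1

/-- With root densities `a`, `b` and remainder `r`, one has `a = b + t * (r + g * b / 2)`, and the
error becomes the integral of `r * (a + b) * f + g * b * f * (a - b) / 2`. As `g` is merely square
integrable, the second product is split at the level `L`: the tail of `g` is paired with norms of
`f`, the bounded part with the Hellinger distance. -/
theorem abs_difference_quotient_sub_le (hg : Measurable g) (hg2 : MemLp g 2 (Q 0))
    (hf : Measurable f) (h0 : MemLp f 2 (Q 0)) {t : ℝ} (ht : t ≠ 0) (h1 : MemLp f 2 (Q t))
    {L : ℝ} (hL : 0 ≤ L) :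
    |(∫ w, f w ∂(Q t) - ∫ w, f w ∂(Q 0)) / t - ∫ w, f w * g w ∂(Q 0)|
      ≤ (l2norm (Q 0) fun w => g w - clip L (g w)) * (l2norm (Q t) f + l2norm (Q 0) f)
        + L * l2norm (Q 0) f * hellinger (Q t) (Q 0)
        + l2norm (Q t + Q 0) (scoreRem Q g t) * (l2norm (Q t) f + l2norm (Q 0) f) := by
  set ν := Q t + Q 0 with hν
  set a := rootDensity (Q t) ν with ha
  set b := rootDensity (Q 0) ν with hb
  have ma : MemLp a 2 ν := memLp_rootDensity_left (Q t) (Q 0)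
  have mb : MemLp b 2 ν := memLp_rootDensity_right (Q t) (Q 0)
  have maf := memLp_rootDensity_mul (ac_left (Q t) (Q 0)) hf h1
  have mbf := memLp_rootDensity_mul (ac_right (Q t) (Q 0)) hf h0
  have mg' : MemLp (fun w => g w - clip L (g w)) 2 (Q 0) := hg2.sub (memLp_clip hg2 hL)
  have mbg := memLp_rootDensity_mul (ac_right (Q t) (Q 0)) hg hg2
  have mbg' := memLp_rootDensity_mul (ac_right (Q t) (Q 0)) (by fun_prop) mg'
  have mr := memLp_scoreRem hg hg2 t
  have naf := l2norm_rootDensity_mul (ac_left (Q t) (Q 0)) f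
  have nbf := l2norm_rootDensity_mul (ac_right (Q t) (Q 0)) f
  have nbg' := l2norm_rootDensity_mul (ac_right (Q t) (Q 0)) fun w => g w - clip L (g w)
  simp only [← hν, ← ha, ← hb] at maf mbf mbg mbg' naf nbf nbg' mr
  have mcl : MemLp (fun w => clip L (g w) * (b w * f w)) 2 ν := by
    refine (mbf.const_mul L).mono (by fun_prop : Measurable _).aestronglyMeasurable
      (ae_of_all _ fun w => ?_)
    rw [norm_mul, norm_mul L]
    refine mul_le_mul_of_nonneg_right ?_ (norm_nonneg _)
    exact (abs_clip_le hL _).trans (le_abs_self L)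
  have e : (∫ w, f w ∂(Q t) - ∫ w, f w ∂(Q 0)) / t - ∫ w, f w * g w ∂(Q 0)
      = (1 / 2 * ∫ w, (b w * (g w - clip L (g w))) * (a w * f w - b w * f w) ∂ν
        + 1 / 2 * ∫ w, (clip L (g w) * (b w * f w)) * (a w - b w) ∂ν)
        + ∫ w, scoreRem Q g t w * (a w * f w + b w * f w) ∂ν := by
    rw [integral_sub_integral_eq hf h1 h0, ← integral_sq_rootDensity_mul (ac_right (Q t) (Q 0)),
      ← integral_div, ← integral_const_mul, ← integral_const_mul, ← integral_sub,
      ← integral_add, ← integral_add]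
    · refine integral_congr_ae (ae_of_all _ fun w => ?_)
      simp only [scoreRem, ← hν, ← ha, ← hb]
      field_simp
      ring
    · exact ((mbg'.integrable_mul (maf.sub mbf)).const_mul _).add
        ((mcl.integrable_mul (ma.sub mb)).const_mul _)
    · exact mr.integrable_mul (maf.add mbf)
    · exact (mbg'.integrable_mul (maf.sub mbf)).const_mul _
    · exact (mcl.integrable_mul (ma.sub mb)).const_mul _
    · exact ((ma.sub mb).integrable_mul (maf.add mbf)).div_const t
    · refine (mbf.integrable_mul mbg).congr (ae_of_all _ fun w => ?_)
      simp only [Pi.mul_apply, ← hν, ← hb]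
      ring
  have b1 : |∫ w, (b w * (g w - clip L (g w))) * (a w * f w - b w * f w) ∂ν|
      ≤ (l2norm (Q 0) fun w => g w - clip L (g w)) * (l2norm (Q t) f + l2norm (Q 0) f) := by
    refine (abs_integral_mul_le mbg' (maf.sub mbf)).trans ?_
    rw [nbg', ← naf, ← nbf]
    exact mul_le_mul_of_nonneg_left (l2norm_sub_le maf mbf) (l2norm_nonneg _ _)
  have b2 : |∫ w, (clip L (g w) * (b w * f w)) * (a w - b w) ∂ν|
      ≤ L * l2norm (Q 0) f * hellinger (Q t) (Q 0) := by
    refine (abs_integral_mul_le mcl (ma.sub mb)).trans ?_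
    refine mul_le_mul_of_nonneg_right ?_ (l2norm_nonneg _ _)
    rw [← nbf, ← abs_of_nonneg hL, ← l2norm_const_mul, abs_of_nonneg hL]
    refine l2norm_mono (mbf.const_mul L) (ae_of_all _ fun w => ?_)
    rw [abs_mul, abs_mul L]
    refine mul_le_mul_of_nonneg_right ?_ (abs_nonneg _)
    exact (abs_clip_le hL _).trans (le_abs_self L)
  have b3 : |∫ w, scoreRem Q g t w * (a w * f w + b w * f w) ∂ν|
      ≤ l2norm ν (scoreRem Q g t) * (l2norm (Q t) f + l2norm (Q 0) f) := by
    refine (abs_integral_mul_le mr (maf.add mbf)).trans ?_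
    rw [← naf, ← nbf]
    exact mul_le_mul_of_nonneg_left (l2norm_add_le maf mbf) (l2norm_nonneg _ _)
  rw [e]
  refine (abs_add_le _ _).trans (add_le_add ((abs_add_le _ _).trans ?_) b3)
  rw [abs_mul, abs_mul, abs_of_pos (by norm_num : (0 : ℝ) < 1 / 2)]
  have := abs_nonneg (∫ w, (b w * (g w - clip L (g w))) * (a w * f w - b w * f w) ∂ν)
  have := abs_nonneg (∫ w, (clip L (g w) * (b w * f w)) * (a w - b w) ∂ν)
  linarith

/-- The level `L` is fixed before `t` tends to zero: `B` bounds the norms of `f` along the path, so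
the tail of `g` contributes little uniformly in `t`, and the other two terms vanish with `t`. -/
theorem HasScore.tendsto_difference_quotient (h : HasScore Q g) (hg : Measurable g)
    (hg2 : MemLp g 2 (Q 0)) (hf : Measurable f) (h0 : MemLp f 2 (Q 0)) {B : ℝ}
    (hB : ∀ᶠ t in 𝓝[≠] 0, MemLp f 2 (Q t) ∧ l2norm (Q t) f ≤ B) :
    Tendsto (fun t => (∫ w, f w ∂(Q t) - ∫ w, f w ∂(Q 0)) / t) (𝓝[≠] 0)
      (𝓝 (∫ w, f w * g w ∂(Q 0))) := by
  rw [Metric.tendsto_nhds]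
  intro η hη
  set F := |B| + l2norm (Q 0) f + 1 with hF
  have hF0 : 0 < F := by
    have := l2norm_nonneg (Q 0) f
    have := abs_nonneg B
    linarith
  obtain ⟨L, hL⟩ := ((tendsto_l2norm_sub_clip hg2).eventually_lt_const
    (by positivity : 0 < η / 3 / F)).exists
  have t1 : Tendsto (fun t => (L : ℝ) * l2norm (Q 0) f * hellinger (Q t) (Q 0)
      + l2norm (Q t + Q 0) (scoreRem Q g t) * F) (𝓝[≠] 0) (𝓝 0) := by
    have := ((h.tendsto_hellinger hg hg2).const_mul ((L : ℝ) * l2norm (Q 0) f)).add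
      ((h.tendsto_l2norm_scoreRem hg hg2).mul_const F)
    simpa using this
  filter_upwards [hB, t1.eventually_lt_const (by positivity : 0 < η / 3), self_mem_nhdsWithin]
    with t h1 h2 ht
  rw [Real.dist_eq]
  refine (abs_difference_quotient_sub_le hg hg2 hf h0 ht h1.1 (Nat.cast_nonneg L)).trans_lt ?_
  have hle : l2norm (Q t) f + l2norm (Q 0) f ≤ F := by
    have := le_abs_self B
    linarith [h1.2]
  have c1 : (l2norm (Q 0) fun w => g w - clip L (g w)) * (l2norm (Q t) f + l2norm (Q 0) f)
      ≤ η / 3 := by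
    calc _ ≤ η / 3 / F * F := mul_le_mul hL.le hle
            (add_nonneg (l2norm_nonneg _ _) (l2norm_nonneg _ _)) (by positivity)
      _ = η / 3 := by field_simp
  have c2 : l2norm (Q t + Q 0) (scoreRem Q g t) * (l2norm (Q t) f + l2norm (Q 0) f)
      ≤ l2norm (Q t + Q 0) (scoreRem Q g t) * F :=
    mul_le_mul_of_nonneg_left hle (l2norm_nonneg _ _)
  linarith

end Score

/-! ### Transferring orthogonality between nearby laws -/

section Comparison

variable {α 𝓧 : Type*} [MeasurableSpace α] [MeasurableSpace 𝓧] {μ₁ μ₀ : Measure α}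
  [IsProbabilityMeasure μ₁] [IsProbabilityMeasure μ₀] {π : α → 𝓧}

/-- A function of `π` in `L²(μ₁)` need not lie in `L²(μ₀)`. `G` is a Hahn set for the image of `μ₀`
against four times the image of `μ₁`: on it the density is at most 4, whence the factor `2`; off it
`4 * μ₁ ≤ μ₀`, and `sqrt_measureReal_le_hellinger` bounds the lost mass. -/
theorem exists_comparison_set (hπ : Measurable π) :
    ∃ G : Set 𝓧, MeasurableSet G ∧ √(μ₁.real (π ⁻¹' Gᶜ)) ≤ hellinger μ₁ μ₀ ∧
      ∀ f : 𝓧 → ℝ, Measurable f → MemLp (fun w => f (π w)) 2 μ₁ →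
        MemLp (fun w => G.indicator f (π w)) 2 μ₀ ∧
          l2norm μ₀ (fun w => G.indicator f (π w)) ≤ 2 * l2norm μ₁ fun w => f (π w) := by
  obtain ⟨G, hG⟩ := exists_isHahnDecomposition (μ₀.map π) ((4 : ℝ≥0) • μ₁.map π)
  refine ⟨G, hG.measurableSet, ?_, fun f hf hf2 => ?_⟩
  · refine sqrt_measureReal_le_hellinger (hπ hG.measurableSet.compl) ?_
    have h := Measure.le_iff'.1 hG.ge_on_compl Gᶜ
    rw [Measure.restrict_apply_self, Measure.restrict_apply_self, Measure.smul_apply,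
      Measure.map_apply hπ hG.measurableSet.compl, Measure.map_apply hπ hG.measurableSet.compl] at h
    have h' := ENNReal.toReal_mono (measure_ne_top _ _) h
    simpa [Measure.real, ENNReal.smul_def] using h'
  · have hle : (μ₀.map π).restrict G ≤ (4 : ℝ≥0) • μ₁.map π :=
      hG.le_on.trans Measure.restrict_le_self
    have hf1 : MemLp f 2 (μ₁.map π) :=
      (memLp_map_measure_iff hf.aestronglyMeasurable hπ.aemeasurable).2 hf2
    have hf0 : MemLp f 2 ((μ₀.map π).restrict G) :=
      (hf1.smul_measure (c := (4 : ℝ≥0∞)) (by norm_num)).mono_measure hle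
    have hi : MemLp (G.indicator f) 2 (μ₀.map π) :=
      (memLp_indicator_iff_restrict hG.measurableSet).2 hf0
    have e0 : l2norm μ₀ (fun w => G.indicator f (π w)) = l2norm ((μ₀.map π).restrict G) f := by
      unfold l2norm
      rw [← integral_map (f := fun x => (G.indicator f x) ^ 2) hπ.aemeasurable
        ((hf.indicator hG.measurableSet).pow_const 2).aestronglyMeasurable,
        ← integral_indicator hG.measurableSet]
      congr 2
      ext x
      by_cases hx : x ∈ G <;> simp [hx]
    have e1 : l2norm μ₁ (fun w => f (π w)) = l2norm (μ₁.map π) f := by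
      unfold l2norm
      rw [← integral_map (f := fun x => f x ^ 2) hπ.aemeasurable
        (hf.pow_const 2).aestronglyMeasurable]
    refine ⟨(memLp_map_measure_iff (hf.indicator hG.measurableSet).aestronglyMeasurable
      hπ.aemeasurable).1 hi, ?_⟩
    rw [e0, e1]
    have h4 : ∫ x, f x ^ 2 ∂((μ₀.map π).restrict G) ≤ 4 * ∫ x, f x ^ 2 ∂(μ₁.map π) := by
      have := integral_mono_measure hle (ae_of_all _ fun x => sq_nonneg (f x))
        ((hf1.smul_measure (c := (4 : ℝ≥0∞)) (by norm_num)).integrable_sq)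
      rw [integral_smul_nnreal_measure] at this
      simpa [NNReal.smul_def] using this
    calc l2norm ((μ₀.map π).restrict G) f ≤ √(4 * ∫ x, f x ^ 2 ∂(μ₁.map π)) :=
          Real.sqrt_le_sqrt h4
      _ = 2 * l2norm (μ₁.map π) f := by
          rw [Real.sqrt_mul (by norm_num), show (4 : ℝ) = 2 ^ 2 by norm_num,
            Real.sqrt_sq (by norm_num)]
          rfl

theorem integrable_mul_of_memLp {μ : Measure α} {f g : α → ℝ} (hf : MemLp f 2 μ)
    (hg : MemLp g 2 μ) : Integrable (fun x => f x * g x) μ := hf.integrable_mul hg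

theorem memLp_mul_of_bound {μ : Measure α} {v h : α → ℝ} {W : ℝ} (hv : Measurable v)
    (hW : ∀ w, |v w| ≤ W) (hh : MemLp h 2 μ) :
    MemLp (fun w => v w * h w) 2 μ ∧ l2norm μ (fun w => v w * h w) ≤ W * l2norm μ h := by
  have hp : ∀ w, |v w * h w| ≤ |W * h w| := fun w => by
    rw [abs_mul, abs_mul]
    exact mul_le_mul_of_nonneg_right ((hW w).trans (le_abs_self W)) (abs_nonneg _)
  refine ⟨(hh.const_mul W).mono (hv.aestronglyMeasurable.mul hh.1)
    (ae_of_all _ hp), ?_⟩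
  by_cases hα : Nonempty α
  · have hW0 : 0 ≤ W := (abs_nonneg _).trans (hW hα.some)
    refine (l2norm_mono (hh.const_mul W) (ae_of_all _ hp)).trans (le_of_eq ?_)
    rw [l2norm_const_mul, abs_of_nonneg hW0]
  · rw [not_nonempty_iff] at hα
    simp [l2norm, Measure.eq_zero_of_isEmpty μ]

/-- Near-orthogonality of `u` to functions of `π` is carried from `μ₀` to `μ₁`, at the price of the
Hellinger distance and of the error in replacing `u` by the bounded `v`. The estimate sees `f` only
through its norm under `μ₁`, so `f` may vary with `μ₁`. -/
theorem abs_integral_mul_comp_le (hπ : Measurable π) {u v : α → ℝ} {W κ : ℝ} (hv : Measurable v)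
    (hW : ∀ w, |v w| ≤ W) (hu1 : MemLp u 2 μ₁) (hu0 : MemLp u 2 μ₀) (hκ : 0 ≤ κ)
    (hκu : ∀ h : 𝓧 → ℝ, Measurable h → MemLp (fun w => h (π w)) 2 μ₀ →
      |∫ w, u w * h (π w) ∂μ₀| ≤ κ * l2norm μ₀ fun w => h (π w))
    {f : 𝓧 → ℝ} (hf : Measurable f) (hf2 : MemLp (fun w => f (π w)) 2 μ₁) :
    |∫ w, u w * f (π w) ∂μ₁|
      ≤ (l2norm μ₁ (fun w => u w - v w) + 2 * l2norm μ₀ (fun w => u w - v w)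
          + 4 * W * hellinger μ₁ μ₀ + 2 * κ) * l2norm μ₁ fun w => f (π w) := by
  obtain ⟨G, hG, hGc, hcomp⟩ := exists_comparison_set (μ₁ := μ₁) (μ₀ := μ₀) hπ
  obtain ⟨hg0, hg0le⟩ := hcomp f hf hf2
  have hW0 : 0 ≤ W := by
    obtain ⟨w⟩ : Nonempty α := μ₁.nonempty_of_neZero
    exact (abs_nonneg _).trans (hW w)
  have hH : 0 ≤ hellinger μ₁ μ₀ := l2norm_nonneg _ _
  set F := l2norm μ₁ fun w => f (π w) with hF
  have hF0 : 0 ≤ F := l2norm_nonneg _ _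
  have hfG : Measurable fun w => G.indicator f (π w) := (hf.indicator hG).comp hπ
  have hv1 : MemLp v 2 μ₁ := MemLp.of_bound hv.aestronglyMeasurable W (ae_of_all _ hW)
  have hv0 : MemLp v 2 μ₀ := MemLp.of_bound hv.aestronglyMeasurable W (ae_of_all _ hW)
  have hd1 : MemLp (fun w => u w - v w) 2 μ₁ := hu1.sub hv1
  have hd0 : MemLp (fun w => u w - v w) 2 μ₀ := hu0.sub hv0
  have hle : ∀ w, |G.indicator f (π w)| ≤ |f (π w)| := fun w => by
    simpa using norm_indicator_le_norm_self (s := G) f (π w)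
  have hg1 : MemLp (fun w => G.indicator f (π w)) 2 μ₁ :=
    hf2.mono hfG.aestronglyMeasurable (ae_of_all _ hle)
  have hg1le : l2norm μ₁ (fun w => G.indicator f (π w)) ≤ F := l2norm_mono hf2 (ae_of_all _ hle)
  have hc1 : MemLp ((π ⁻¹' Gᶜ).indicator (1 : α → ℝ)) 2 μ₁ :=
    (memLp_const (1 : ℝ)).indicator (hπ hG.compl)
  have hvg1 := memLp_mul_of_bound hv hW hg1
  have hvg0 := memLp_mul_of_bound hv hW hg0
  have hvf1 := memLp_mul_of_bound hv hW hf2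
  -- The terms are: the unbounded part of `u`, the bad set off `G`, the change of law for a bounded
  -- multiplier, the unbounded part again, and the orthogonality under `μ₀`. The coefficient `4 * W`
  -- in the claim is `W` from the second and `3 * W` from the third.
  have e : ∫ w, u w * f (π w) ∂μ₁
      = ∫ w, (u w - v w) * f (π w) ∂μ₁
        + ∫ w, (π ⁻¹' Gᶜ).indicator (1 : α → ℝ) w * (v w * f (π w)) ∂μ₁
        + (∫ w, v w * G.indicator f (π w) ∂μ₁ - ∫ w, v w * G.indicator f (π w) ∂μ₀)
        - ∫ w, (u w - v w) * G.indicator f (π w) ∂μ₀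
        + ∫ w, u w * G.indicator f (π w) ∂μ₀ := by
    have e0 : ∫ w, u w * G.indicator f (π w) ∂μ₀
        = ∫ w, (u w - v w) * G.indicator f (π w) ∂μ₀ + ∫ w, v w * G.indicator f (π w) ∂μ₀ := by
      rw [← integral_add (integrable_mul_of_memLp hd0 hg0) (integrable_mul_of_memLp hv0 hg0)]
      exact integral_congr_ae (ae_of_all _ fun w => by simp only; ring)
    have e1 : ∫ w, u w * f (π w) ∂μ₁
      = ∫ w, (u w - v w) * f (π w) ∂μ₁
        + ∫ w, (π ⁻¹' Gᶜ).indicator (1 : α → ℝ) w * (v w * f (π w)) ∂μ₁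
        + ∫ w, v w * G.indicator f (π w) ∂μ₁ := by
      have i1 := integrable_mul_of_memLp hd1 hf2
      have i2 := integrable_mul_of_memLp hc1 hvf1.1
      have i3 := integrable_mul_of_memLp hv1 hg1
      have i12 : Integrable (fun w => (u w - v w) * f (π w)
          + (π ⁻¹' Gᶜ).indicator (1 : α → ℝ) w * (v w * f (π w))) μ₁ := i1.add i2
      rw [← integral_add i1 i2, ← integral_add i12 i3]
      refine integral_congr_ae (ae_of_all _ fun w => ?_)
      by_cases hw : π w ∈ G
      · have : w ∉ π ⁻¹' Gᶜ := fun h => h hw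
        simp only [Set.indicator_of_mem hw, Set.indicator_of_notMem this]
        ring
      · have : w ∈ π ⁻¹' Gᶜ := hw
        simp only [Set.indicator_of_notMem hw, Set.indicator_of_mem this, Pi.one_apply]
        ring
    rw [e0, e1]
    ring
  have b1 := abs_integral_mul_le hd1 hf2
  have b2 : |∫ w, (π ⁻¹' Gᶜ).indicator (1 : α → ℝ) w * (v w * f (π w)) ∂μ₁|
      ≤ W * hellinger μ₁ μ₀ * F := by
    refine (abs_integral_mul_le hc1 hvf1.1).trans ?_
    rw [l2norm_indicator_one (hπ hG.compl)]
    calc _ ≤ hellinger μ₁ μ₀ * (W * F) :=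
          mul_le_mul hGc hvf1.2 (l2norm_nonneg _ _) hH
      _ = _ := by ring
  have b3 : |∫ w, v w * G.indicator f (π w) ∂μ₁ - ∫ w, v w * G.indicator f (π w) ∂μ₀|
      ≤ 3 * W * hellinger μ₁ μ₀ * F := by
    refine (abs_integral_sub_le (hv.mul hfG) hvg1.1 hvg0.1).trans ?_
    have : l2norm μ₁ (fun w => v w * G.indicator f (π w))
        + l2norm μ₀ (fun w => v w * G.indicator f (π w)) ≤ 3 * W * F := by
      have h1 := hvg1.2.trans (mul_le_mul_of_nonneg_left hg1le hW0)
      have h2 := hvg0.2.trans (mul_le_mul_of_nonneg_left hg0le hW0)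
      linarith
    calc _ ≤ hellinger μ₁ μ₀ * (3 * W * F) := mul_le_mul_of_nonneg_left this hH
      _ = _ := by ring
  have b4 : |∫ w, (u w - v w) * G.indicator f (π w) ∂μ₀|
      ≤ 2 * l2norm μ₀ (fun w => u w - v w) * F := by
    refine (abs_integral_mul_le hd0 hg0).trans ?_
    calc _ ≤ l2norm μ₀ (fun w => u w - v w) * (2 * F) :=
          mul_le_mul_of_nonneg_left hg0le (l2norm_nonneg _ _)
      _ = _ := by ring
  have b5 : |∫ w, u w * G.indicator f (π w) ∂μ₀| ≤ 2 * κ * F := by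
    refine (hκu _ (hf.indicator hG) hg0).trans ?_
    calc _ ≤ κ * (2 * F) := mul_le_mul_of_nonneg_left hg0le hκ
      _ = _ := by ring
  rw [e]
  refine (abs_add_le _ _).trans ?_
  refine (add_le_add_left ((abs_sub _ _).trans (add_le_add_left ((abs_add_le _ _).trans
    (add_le_add_left (abs_add_le _ _) _)) _)) _).trans ?_
  linarith

end Comparison

/-! ### Scores of linear tilts -/

section Tilt

variable {α : Type*} [MeasurableSpace α] {P : Measure α} [IsProbabilityMeasure P] {g : α → ℝ}

/-- With `y = √(1 + u)` the left side is `(y - 1) ^ 2 / 2`, while `u ^ 2 = (y - 1) ^ 2 * (y + 1) ^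
2` and `1 ≤ y + 1`. -/
theorem abs_sqrt_one_add_sub_le {u : ℝ} (hu : -1 ≤ u) : |√(1 + u) - 1 - u / 2| ≤ u ^ 2 / 2 := by
  have h0 : 0 ≤ √(1 + u) := Real.sqrt_nonneg _
  have h1 : √(1 + u) ^ 2 = 1 + u := Real.sq_sqrt (by linarith)
  set y := √(1 + u)
  have h2 : u = y ^ 2 - 1 := by linarith
  have h3 : y - 1 - u / 2 = -((y - 1) ^ 2 / 2) := by rw [h2]; ring
  rw [h3, abs_neg, abs_of_nonneg (by positivity), h2]
  have : y ^ 2 - 1 = (y - 1) * (y + 1) := by ring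
  rw [this, mul_pow]
  have : 1 ≤ (y + 1) ^ 2 := by nlinarith
  have := mul_le_mul_of_nonneg_left this (sq_nonneg (y - 1))
  linarith

/-- All densities are explicit: relative to `Q t + Q 0` they are `(1 + t * g) / (2 + t * g)` and `1
/ (2 + t * g)`. The second-order remainder of the square root is `O(t ^ 2)`, uniformly as `g` is
bounded, and remains `O(t)` after division by `t`. -/
theorem hasScore_of_tilt {Q : ℝ → Measure α} {g' : α → ℝ} (hg : Measurable g) {B : ℝ}
    (hB : ∀ w, |g w| ≤ B) (hg' : g' =ᵐ[P] g) (h0 : Q 0 = P) {b : ℝ} (hb : 0 < b)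
    (hQ : ∀ t, t ≠ 0 → |t| ≤ b →
      Q t = P.withDensity fun w => ENNReal.ofReal (1 + t * g w)) : HasScore Q g' := by
  have hB0 : 0 ≤ B := by
    obtain ⟨w⟩ : Nonempty α := P.nonempty_of_neZero
    exact (abs_nonneg _).trans (hB w)
  have key : ∀ t, t ≠ 0 → |t| ≤ b → |t| * (B + 1) ≤ 1 / 2 →
      ∫⁻ w, ENNReal.ofReal
        (((√((Q t).rnDeriv (Q t + Q 0) w).toReal - √((Q 0).rnDeriv (Q t + Q 0) w).toReal) / t
        - 1 / 2 * g' w * √((Q 0).rnDeriv (Q t + Q 0) w).toReal) ^ 2) ∂(Q t + Q 0)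
      ≤ ENNReal.ofReal ((|t| * B ^ 2 / 2) ^ 2) := by
    intro t ht htb htB
    have htg : ∀ w, |t * g w| ≤ 1 / 2 := fun w => by
      rw [abs_mul]
      refine le_trans (mul_le_mul_of_nonneg_left ((hB w).trans ?_) (abs_nonneg t)) htB
      linarith
    have hpos : ∀ w, 1 / 2 ≤ 1 + t * g w := fun w => by
      have := (abs_le.1 (htg w)).1; linarith
    set d : α → ℝ≥0∞ := fun w => ENNReal.ofReal (2 + t * g w) with hd
    have hdm : Measurable d := by fun_prop
    set ν := Q t + Q 0 with hν
    have hνd : ν = P.withDensity d := by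
      rw [hν, hQ t ht htb, h0]
      nth_rw 2 [← withDensity_one (μ := P)]
      rw [← withDensity_add_left (by fun_prop)]
      congr 1
      ext w
      simp only [Pi.add_apply, Pi.one_apply, hd]
      rw [← ENNReal.ofReal_one, ← ENNReal.ofReal_add (by linarith [hpos w]) zero_le_one]
      congr 1
      ring
    have hνfin : IsFiniteMeasure (P.withDensity d) := by
      refine isFiniteMeasure_withDensity ?_
      have : ∫⁻ w, d w ∂P ≤ ∫⁻ _, ENNReal.ofReal 3 ∂P := by
        refine lintegral_mono fun w => ENNReal.ofReal_le_ofReal ?_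
        have := (abs_le.1 (htg w)).2; linarith
      refine (this.trans_lt ?_).ne
      simp
    have hQt : Q t = ν.withDensity fun w => ENNReal.ofReal ((1 + t * g w) / (2 + t * g w)) := by
      rw [hνd, ← withDensity_mul _ hdm (by fun_prop), hQ t ht htb]
      congr 1
      ext w
      simp only [Pi.mul_apply, hd]
      have := hpos w
      rw [← ENNReal.ofReal_mul (by linarith)]
      congr 1
      have : 2 + t * g w ≠ 0 := by linarith
      field_simp
    have hQ0 : Q 0 = ν.withDensity fun w => ENNReal.ofReal (1 / (2 + t * g w)) := by
      rw [hνd, ← withDensity_mul _ hdm (by fun_prop), h0]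
      conv_lhs => rw [← withDensity_one (μ := P)]
      congr 1
      ext w
      simp only [Pi.mul_apply, Pi.one_apply, hd]
      have := hpos w
      rw [← ENNReal.ofReal_mul (by linarith), ← ENNReal.ofReal_one]
      congr 1
      have : 2 + t * g w ≠ 0 := by linarith
      field_simp
    have : IsFiniteMeasure ν := by rw [hνd]; exact hνfin
    have r1 : (Q t).rnDeriv ν =ᵐ[ν]
        fun w => ENNReal.ofReal ((1 + t * g w) / (2 + t * g w)) := by
      conv_lhs => rw [hQt]
      exact Measure.rnDeriv_withDensity ν (by fun_prop)
    have r0 : (Q 0).rnDeriv ν =ᵐ[ν] fun w => ENNReal.ofReal (1 / (2 + t * g w)) := by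
      conv_lhs => rw [hQ0]
      exact Measure.rnDeriv_withDensity ν (by fun_prop)
    have rg : g' =ᵐ[ν] g := by
      have : ν ≪ P := by rw [hνd]; exact withDensity_absolutelyContinuous _ _
      exact this.ae_eq hg'
    calc ∫⁻ w, ENNReal.ofReal
            (((√((Q t).rnDeriv ν w).toReal - √((Q 0).rnDeriv ν w).toReal) / t
              - 1 / 2 * g' w * √((Q 0).rnDeriv ν w).toReal) ^ 2) ∂ν
        ≤ ∫⁻ w, ENNReal.ofReal ((|t| * B ^ 2 / 2) ^ 2 * (1 / (2 + t * g w))) ∂ν := by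
          refine lintegral_mono_ae ?_
          filter_upwards [r1, r0, rg] with w h1 h2 h3
          have hw := hpos w
          rw [h1, h2, h3, ENNReal.toReal_ofReal (div_nonneg (by linarith) (by linarith)),
            ENNReal.toReal_ofReal (div_nonneg (by norm_num) (by linarith)),
            Real.sqrt_div (by linarith), Real.sqrt_div (by norm_num), Real.sqrt_one]
          refine ENNReal.ofReal_le_ofReal ?_
          have e : (√(1 + t * g w) / √(2 + t * g w) - 1 / √(2 + t * g w)) / t
              - 1 / 2 * g w * (1 / √(2 + t * g w))
              = ((√(1 + t * g w) - 1 - t * g w / 2) / t) * (1 / √(2 + t * g w)) := by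
            field_simp
          rw [e, mul_pow, div_pow 1, Real.sq_sqrt (by linarith), one_pow]
          refine mul_le_mul_of_nonneg_right ?_ (div_nonneg (by norm_num) (by linarith))
          refine sq_le_sq.2 ?_
          rw [abs_div, abs_of_nonneg (by positivity : 0 ≤ |t| * B ^ 2 / 2),
            div_le_iff₀ (abs_pos.2 ht)]
          refine (abs_sqrt_one_add_sub_le (by linarith)).trans ?_
          have : (g w) ^ 2 ≤ B ^ 2 := by
            rw [← sq_abs]; exact pow_le_pow_left₀ (abs_nonneg _) (hB w) 2
          rw [mul_pow, ← sq_abs t]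
          nlinarith [sq_nonneg |t|]
      -- The density `2 + t * g` of the dominating measure cancels the factor `1 / (2 + t * g)`.
      _ = ∫⁻ w, ENNReal.ofReal ((|t| * B ^ 2 / 2) ^ 2) ∂P := by
          rw [hνd, lintegral_withDensity_eq_lintegral_mul _ hdm (by fun_prop)]
          refine lintegral_congr fun w => ?_
          have hw := hpos w
          simp only [Pi.mul_apply, hd]
          rw [← ENNReal.ofReal_mul (by linarith)]
          congr 1
          have : 2 + t * g w ≠ 0 := by linarith
          field_simp
      _ = _ := by simp
  have hlim : Tendsto (fun t : ℝ => ENNReal.ofReal ((|t| * B ^ 2 / 2) ^ 2)) (𝓝[≠] 0) (𝓝 0) := by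
    have h : Continuous fun t : ℝ => ENNReal.ofReal ((|t| * B ^ 2 / 2) ^ 2) :=
      ENNReal.continuous_ofReal.comp (by fun_prop)
    have := h.tendsto 0
    simp only [abs_zero, zero_mul, zero_div, ne_eq, OfNat.ofNat_ne_zero, not_false_eq_true,
      zero_pow, ENNReal.ofReal_zero] at this
    exact this.mono_left nhdsWithin_le_nhds
  refine tendsto_of_tendsto_of_tendsto_of_le_of_le' tendsto_const_nhds hlim
    (Eventually.of_forall fun _ => bot_le) ?_
  have h1 : ∀ᶠ t : ℝ in 𝓝 0, |t| < b := by
    have : Tendsto (fun t : ℝ => |t|) (𝓝 0) (𝓝 |0|) := continuous_abs.tendsto 0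
    rw [abs_zero] at this
    exact this.eventually_lt_const hb
  have h2 : ∀ᶠ t : ℝ in 𝓝 0, |t| * (B + 1) < 1 / 2 := by
    have : Tendsto (fun t : ℝ => |t| * (B + 1)) (𝓝 0) (𝓝 (|0| * (B + 1))) := by
      apply Continuous.tendsto; fun_prop
    rw [abs_zero, zero_mul] at this
    exact this.eventually_lt_const (by norm_num)
  filter_upwards [nhdsWithin_le_nhds h1, nhdsWithin_le_nhds h2, self_mem_nhdsWithin] with t a c ht
  exact key t ht a.le c.le

end Tilt

/-! ### Uniform tails from the moment of order `q` -/

section Tail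

variable {α : Type*} [MeasurableSpace α] {μ : Measure α} {f : α → ℝ} {q C L : ℝ}

/-- Where truncation acts, `|y| > L`, and `|y| ^ 2 = |y| ^ (2 - q) * |y| ^ q` has a negative
exponent `2 - q`. This makes tails small uniformly along a submodel with fixed moment constants. -/
theorem sq_sub_clip_le (hq : 2 < q) (hL : 0 < L) (y : ℝ) :
    (y - clip L y) ^ 2 ≤ L ^ (2 - q) * |y| ^ q := by
  by_cases h : |y| ≤ L
  · rw [clip_eq_self h, sub_self, zero_pow two_ne_zero]
    positivity
  · rw [not_le] at h
    have hy : 0 < |y| := hL.trans h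
    calc (y - clip L y) ^ 2 ≤ |y| ^ 2 := by
          rw [← sq_abs]; exact pow_le_pow_left₀ (abs_nonneg _) (abs_sub_clip_le hL.le y) 2
      _ = |y| ^ (2 - q) * |y| ^ q := by
          rw [← Real.rpow_add hy, sub_add_cancel]; norm_cast
      _ ≤ L ^ (2 - q) * |y| ^ q := by
          refine mul_le_mul_of_nonneg_right ?_ (by positivity)
          exact Real.rpow_le_rpow_of_nonpos hL h.le (by linarith)

theorem l2norm_sub_clip_le (hq : 2 < q) (hC : 0 < C) (hL : 0 < L) (hf : Measurable f)
    (h : eLpNorm f (ENNReal.ofReal q) μ ≤ ENNReal.ofReal C) :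
    l2norm μ (fun x => f x - clip L (f x)) ≤ √(L ^ (2 - q) * C ^ q) := by
  have hq0 : 0 < q := by linarith
  have hm : MemLp f (ENNReal.ofReal q) μ :=
    ⟨hf.aestronglyMeasurable, h.trans_lt ENNReal.ofReal_lt_top⟩
  have hi : Integrable (fun x => |f x| ^ q) μ := by
    have := hm.integrable_norm_rpow (by simpa using hq0) (by simp)
    rwa [ENNReal.toReal_ofReal hq0.le] at this
  have hle : ∫ x, |f x| ^ q ∂μ ≤ C ^ q := by
    rw [hm.eLpNorm_eq_integral_rpow_norm (by simpa using hq0) (by simp),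
      ENNReal.toReal_ofReal hq0.le, ENNReal.ofReal_le_ofReal_iff hC.le] at h
    simp only [Real.norm_eq_abs] at h
    have h0 : 0 ≤ ∫ x, |f x| ^ q ∂μ := integral_nonneg fun x => by positivity
    have := Real.rpow_le_rpow (by positivity) h hq0.le
    rwa [← Real.rpow_mul h0, inv_mul_cancel₀ hq0.ne', Real.rpow_one] at this
  unfold l2norm
  refine Real.sqrt_le_sqrt ?_
  calc ∫ x, (f x - clip L (f x)) ^ 2 ∂μ ≤ ∫ x, L ^ (2 - q) * |f x| ^ q ∂μ :=
        integral_mono_of_nonneg (ae_of_all _ fun x => sq_nonneg _) (hi.const_mul _)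
          (ae_of_all _ fun x => sq_sub_clip_le hq hL (f x))
    _ = L ^ (2 - q) * ∫ x, |f x| ^ q ∂μ := integral_const_mul _ _
    _ ≤ L ^ (2 - q) * C ^ q := mul_le_mul_of_nonneg_left hle (by positivity)

theorem tendsto_tail (hq : 2 < q) (C : ℝ) :
    Tendsto (fun L : ℕ => √((L : ℝ) ^ (2 - q) * C ^ q)) atTop (𝓝 0) := by
  have h := ((tendsto_rpow_neg_atTop (by linarith : 0 < q - 2)).comp
    tendsto_natCast_atTop_atTop).mul_const (C ^ q)
  rw [zero_mul] at h
  have h2 := h.sqrt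
  rw [Real.sqrt_zero] at h2
  refine h2.congr fun L => ?_
  simp only [Function.comp, neg_sub]

theorem l2norm_map {β : Type*} [MeasurableSpace β] {φ : α → β} (hφ : Measurable φ) {f : β → ℝ}
    (hf : Measurable f) : l2norm (μ.map φ) f = l2norm μ fun x => f (φ x) := by
  unfold l2norm
  rw [integral_map hφ.aemeasurable (hf.pow_const 2).aestronglyMeasurable]

theorem memLp_map_iff {β : Type*} [MeasurableSpace β] {φ : α → β} (hφ : Measurable φ) {f : β → ℝ}
    (hf : Measurable f) : MemLp f 2 (μ.map φ) ↔ MemLp (fun x => f (φ x)) 2 μ :=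
  memLp_map_measure_iff hf.aestronglyMeasurable hφ.aemeasurable

end Tail

/-! ### Augmented inverse probability weighting -/

section Arm

variable {𝓧 : Type*} [MeasurableSpace 𝓧]

/-- indicator of the labelled observations with treatment `s` -/
def armInd (s : Bool) (o : Obs 𝓧) : ℝ := ({o | o.T = s} ∩ {o | o.R = true}).indicator 1 o

@[fun_prop] theorem measurable_armInd (s : Bool) : Measurable (armInd s : Obs 𝓧 → ℝ) :=
  measurable_one.indicator ((measurable_obsT (measurableSet_singleton s)).inter
    (measurable_obsR (measurableSet_singleton true)))

theorem armInd_nonneg (s : Bool) (o : Obs 𝓧) : 0 ≤ armInd s o :=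
  Set.indicator_nonneg (fun _ _ => zero_le_one) _

theorem armInd_le_one (s : Bool) (o : Obs 𝓧) : armInd s o ≤ 1 :=
  Set.indicator_le_self' (fun _ _ => zero_le_one) _

theorem abs_armInd_le_one (s : Bool) (o : Obs 𝓧) : |armInd s o| ≤ 1 := by
  rw [abs_of_nonneg (armInd_nonneg s o)]; exact armInd_le_one s o

theorem armInd_obs (s : Bool) (z : Pop 𝓧) : armInd s z.obs = (arm s).indicator 1 z := rfl

theorem obs_X (z : Pop 𝓧) : z.obs.X = z.X := rfl

theorem obs_Y_of_arm {s : Bool} {z : Pop 𝓧} (hz : z ∈ arm s) : z.obs.Y = z.Ypot s := by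
  have hR : z.R = true := hz.2
  rw [← Y_eq_of_treated hz.1]
  change (if z.R then z.Y else 0) = z.Y
  rw [if_pos hR]

theorem armInd_obs_mul (s : Bool) (z : Pop 𝓧) (F : ℝ → ℝ) :
    armInd s z.obs * F z.obs.Y = (arm s).indicator (fun z => F (z.Ypot s)) z := by
  rw [armInd_obs]
  by_cases hz : z ∈ arm s
  · rw [Set.indicator_of_mem hz, Set.indicator_of_mem hz, obs_Y_of_arm hz]; simp
  · rw [Set.indicator_of_notMem hz, Set.indicator_of_notMem hz, zero_mul]

theorem integral_armInd_mul (Q : Measure (Pop 𝓧)) (s : Bool) {F : 𝓧 → ℝ → ℝ}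
    (hF : Measurable fun p : 𝓧 × ℝ => F p.1 p.2) :
    ∫ o, armInd s o * F o.X o.Y ∂(Q.map Pop.obs) = ∫ z in arm s, F z.X (z.Ypot s) ∂Q := by
  have hm : Measurable fun o : Obs 𝓧 => F o.X o.Y :=
    hF.comp (measurable_obsX.prodMk measurable_obsY)
  have hm2 : Measurable fun o : Obs 𝓧 => armInd s o * F o.X o.Y := (measurable_armInd s).mul hm
  rw [integral_map measurable_obs.aemeasurable hm2.aestronglyMeasurable,
    ← integral_indicator (measurableSet_arm s)]
  refine integral_congr_ae (ae_of_all _ fun z => ?_)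
  exact armInd_obs_mul s z (F z.X)

/-- augmented inverse probability weighting for the mean outcome under treatment `s`, with weight
`a` and outcome regression `m` -/
def augmented (a m : 𝓧 → ℝ) (s : Bool) (o : Obs 𝓧) : ℝ :=
  m o.X + armInd s o * (a o.X * (o.Y - m o.X))

/-- centred inverse probability weight -/
def balance (a : 𝓧 → ℝ) (s : Bool) (o : Obs 𝓧) : ℝ := 1 - armInd s o * a o.X

@[fun_prop] theorem measurable_augmented {a m : 𝓧 → ℝ} (ha : Measurable a) (hm : Measurable m)
    (s : Bool) : Measurable (augmented a m s) := by unfold augmented; fun_prop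

@[fun_prop] theorem measurable_balance {a : 𝓧 → ℝ} (ha : Measurable a) (s : Bool) :
    Measurable (balance a s) := by unfold balance; fun_prop

theorem abs_balance_le {a : 𝓧 → ℝ} {A : ℝ} (ha : ∀ x, |a x| ≤ A) (s : Bool) (o : Obs 𝓧) :
    |balance a s o| ≤ 1 + A := by
  unfold balance
  refine (abs_sub _ _).trans ?_
  rw [abs_one, abs_mul]
  gcongr
  calc |armInd s o| * |a o.X| ≤ 1 * |a o.X| :=
        mul_le_mul_of_nonneg_right (abs_armInd_le_one s o) (abs_nonneg _)
    _ ≤ A := by rw [one_mul]; exact ha _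

theorem augmented_sub_augmented (a m m' : 𝓧 → ℝ) (s : Bool) (o : Obs 𝓧) :
    augmented a m s o - augmented a m' s o = balance a s o * (m o.X - m' o.X) := by
  unfold augmented balance
  ring

variable [StandardBorelSpace 𝓧] {ε q C : ℝ} {Q P : Measure (Pop 𝓧)} [IsProbabilityMeasure Q]
  [IsProbabilityMeasure P]

instance : IsProbabilityMeasure (Q.map Pop.obs) :=
  Measure.isProbabilityMeasure_map measurable_obs.aemeasurable

theorem memLp_armInd_mul {Y : Pop 𝓧 → ℝ} {s : Bool} {F : Obs 𝓧 → ℝ} (hF : Measurable F)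
    (hY : MemLp Y 2 Q) (h : ∀ z ∈ arm s, |F z.obs| ≤ |Y z|) :
    MemLp (fun o => armInd s o * F o) 2 (Q.map Pop.obs) ∧
      l2norm (Q.map Pop.obs) (fun o => armInd s o * F o) ≤ l2norm Q Y := by
  have hm : Measurable fun o => armInd s o * F o := (measurable_armInd s).mul hF
  have hp : ∀ z : Pop 𝓧, |armInd s z.obs * F z.obs| ≤ |Y z| := fun z => by
    rw [armInd_obs]
    by_cases hz : z ∈ arm s
    · rw [Set.indicator_of_mem hz, Pi.one_apply, one_mul]; exact h z hz
    · rw [Set.indicator_of_notMem hz, zero_mul, abs_zero]; exact abs_nonneg _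
  rw [memLp_map_iff measurable_obs hm, l2norm_map measurable_obs hm]
  exact ⟨hY.mono (hm.comp measurable_obs).aestronglyMeasurable (ae_of_all _ hp),
    l2norm_mono hY (ae_of_all _ hp)⟩

/-- Double robustness as an exact identity: on the arm the residual `Y - muStar` is orthogonal to
`a`, so only the product of the imbalance of `a` and the error of `m` is left. The weight need not
be the true one for `Q`, which allows it to be frozen along a path. -/
theorem integral_augmented_sub (h : Basic ε q C Q) (h' : MAR Q) (hε : 0 < ε) (hq : 2 < q)
    (s : Bool) {a m : 𝓧 → ℝ} (ha : Measurable a) (hm : Measurable m) {A : ℝ}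
    (hA : ∀ x, |a x| ≤ A) (hm2 : MemLp (fun z => m z.X) 2 Q) :
    ∫ o, augmented a m s o ∂(Q.map Pop.obs) - ∫ z, z.Ypot s ∂Q
      = ∫ o, balance a s o * (m o.X - muStar Q s o.X) ∂(Q.map Pop.obs) := by
  have hmu := memLp_muStar h h' hε hq s
  have hY := h.memLp_Ypot hq s
  have ha2 : MemLp (fun z : Pop 𝓧 => a z.X) 2 Q :=
    MemLp.of_bound (ha.comp measurable_X).aestronglyMeasurable A (ae_of_all _ fun z => hA _)
  have hmul : ∀ {f : Pop 𝓧 → ℝ}, MemLp f 2 Q → Integrable (fun z => a z.X * f z) Q :=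
    fun hf => integrable_mul_of_memLp ha2 hf
  have hmmu : MemLp (fun z => m z.X - muStar Q s z.X) 2 Q := hm2.sub hmu
  have e1 : ∫ o, augmented a m s o ∂(Q.map Pop.obs)
      = ∫ z, m z.X ∂Q + ∫ z in arm s, a z.X * (z.Ypot s - m z.X) ∂Q := by
    rw [← integral_armInd_mul Q s (F := fun x y => a x * (y - m x)) (by fun_prop),
      integral_map measurable_obs.aemeasurable (by fun_prop : Measurable _).aestronglyMeasurable,
      integral_map measurable_obs.aemeasurable (by fun_prop : Measurable _).aestronglyMeasurable,
      ← integral_add (hm2.integrable (by norm_num))]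
    · rfl
    · refine ((hmul (hY.sub hm2)).indicator (measurableSet_arm s)).congr (ae_of_all _ fun z => ?_)
      exact (armInd_obs_mul s z fun y => a z.X * (y - m z.X)).symm
  have e2 : ∫ o, balance a s o * (m o.X - muStar Q s o.X) ∂(Q.map Pop.obs)
      = ∫ z, (m z.X - muStar Q s z.X) ∂Q
        - ∫ z in arm s, a z.X * (m z.X - muStar Q s z.X) ∂Q := by
    rw [← integral_armInd_mul Q s (F := fun x _ => a x * (m x - muStar Q s x)) (by fun_prop),
      integral_map measurable_obs.aemeasurable (by fun_prop : Measurable _).aestronglyMeasurable,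
      integral_map measurable_obs.aemeasurable (by fun_prop : Measurable _).aestronglyMeasurable,
      ← integral_sub (hmmu.integrable (by norm_num))]
    · refine integral_congr_ae (ae_of_all _ fun z => ?_)
      simp only [balance, obs_X]
      ring
    · refine ((hmul hmmu).indicator (measurableSet_arm s)).congr (ae_of_all _ fun z => ?_)
      exact (armInd_obs_mul s z fun _ => a z.X * (m z.X - muStar Q s z.X)).symm
  have o1 := setIntegral_arm_resid_mul h hq s ha ha2
  have o2 := integral_resid_mul h h' hε hq s (f := fun _ => 1) measurable_const
    (memLp_const (1 : ℝ))
  simp only [mul_one] at o2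
  rw [integral_sub (hY.integrable (by norm_num)) (hmu.integrable (by norm_num))] at o2
  have e3 : ∫ z in arm s, a z.X * (z.Ypot s - m z.X) ∂Q
      = ∫ z in arm s, (z.Ypot s - muStar Q s z.X) * a z.X ∂Q
        - ∫ z in arm s, a z.X * (m z.X - muStar Q s z.X) ∂Q := by
    rw [← integral_sub]
    · exact integral_congr_ae (ae_of_all _ fun z => by simp only; ring)
    · exact (((hmul (hY.sub hmu)).congr (ae_of_all _ fun z => mul_comm _ _))).integrableOn
    · exact (hmul hmmu).integrableOn
  rw [e1, e2, e3, o1, integral_sub (hm2.integrable (by norm_num)) (hmu.integrable (by norm_num))]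
  linarith

/-- inverse of the (truncated) probability of being labelled with treatment `s` -/
def armWeight (ε : ℝ) (P : Measure (Pop 𝓧)) [IsFiniteMeasure P] (s : Bool) (x : 𝓧) : ℝ :=
  (labelProb P * max ε (propensity P s x))⁻¹

@[fun_prop] theorem measurable_armWeight (s : Bool) : Measurable (armWeight ε P s) := by
  unfold armWeight; fun_prop

/-- The truncation of the propensity at `ε` is inactive almost everywhere, but it makes this bound
hold at every point, as `memLp_mul_of_bound` and `Direction` require. -/
theorem abs_armWeight_le (h : Basic ε q C P) (hM : MCAR P) (hε : 0 < ε) (s : Bool) (x : 𝓧) :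
    |armWeight ε P s x| ≤ (ε ^ 2)⁻¹ := by
  have hp := h.le_labelProb hM hε
  have hp0 : 0 < labelProb P := hε.trans_le hp
  have hm : 0 < max ε (propensity P s x) := lt_max_of_lt_left hε
  rw [armWeight, abs_of_pos (inv_pos.2 (mul_pos hp0 hm))]
  refine inv_anti₀ (by positivity) ?_
  rw [sq]
  exact mul_le_mul hp (le_max_left _ _) hε.le hp0.le

theorem setIntegral_arm_weight (h : Basic ε q C P) (hM : MCAR P) (hε : 0 < ε) (s : Bool)
    {f : 𝓧 × ℝ → ℝ} (hf : Measurable f) :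
    ∫ z in arm s, armWeight ε P s z.X * f (z.X, z.Ypot s) ∂P = ∫ z, f (z.X, z.Ypot s) ∂P := by
  have e := setIntegral_arm h hM.mar s (f := fun p => armWeight ε P s p.1 * f p) (by fun_prop)
  simp only at e
  rw [e]
  refine integral_congr_ae ?_
  filter_upwards [h.armProb_ae_eq hM hε s, h.le_propensity s] with z h1 h2
  have hp0 : 0 < labelProb P := hε.trans_le (h.le_labelProb hM hε)
  have hm : 0 < propensity P s z.X := hε.trans_le h2
  rw [h1, armWeight, max_eq_right h2]
  field_simp

/-- For the true weight of `P`, the arm indicator times the weight has conditional mean one given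
`X`. -/
theorem integral_balance_mul (h : Basic ε q C P) (hM : MCAR P) (hε : 0 < ε) (s : Bool)
    {f : 𝓧 → ℝ} (hf : Measurable f) (hf2 : MemLp (fun z => f z.X) 2 P) :
    ∫ o, balance (armWeight ε P s) s o * f o.X ∂(P.map Pop.obs) = 0 := by
  have e := setIntegral_arm_weight h hM hε s (f := fun p => f p.1) (by fun_prop)
  have hi : Integrable (fun z : Pop 𝓧 => armWeight ε P s z.X * f z.X) P :=
    integrable_mul_of_memLp (MemLp.of_bound (by fun_prop : Measurable _).aestronglyMeasurable _
      (ae_of_all _ fun z => abs_armWeight_le h hM hε s _)) hf2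
  have e2 : ∫ o, balance (armWeight ε P s) s o * f o.X ∂(P.map Pop.obs)
      = ∫ z, f z.X ∂P - ∫ z in arm s, armWeight ε P s z.X * f z.X ∂P := by
    rw [← integral_armInd_mul P s (F := fun x _ => armWeight ε P s x * f x) (by fun_prop),
      integral_map measurable_obs.aemeasurable (by fun_prop : Measurable _).aestronglyMeasurable,
      integral_map measurable_obs.aemeasurable (by fun_prop : Measurable _).aestronglyMeasurable,
      ← integral_sub (hf2.integrable (by norm_num))]
    · refine integral_congr_ae (ae_of_all _ fun z => ?_)
      simp only [balance, obs_X]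
      ring
    · refine (hi.indicator (measurableSet_arm s)).congr (ae_of_all _ fun z => ?_)
      exact (armInd_obs_mul s z fun _ => armWeight ε P s z.X * f z.X).symm
  rw [e2, e, sub_self]

end Arm

/-! ### Pathwise derivative of the mean potential outcomes -/

section Gradient

variable {𝓧 : Type*} [MeasurableSpace 𝓧] [StandardBorelSpace 𝓧] {ε q C : ℝ}

theorem setIntegral_abs_mul_le {Ω : Type*} [MeasurableSpace Ω] {μ : Measure Ω} {A : Set Ω}
    (hA : MeasurableSet A) {f h : Ω → ℝ} (hf : MemLp f 2 μ) (hh : MemLp h 2 μ) :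
    |∫ z in A, f z * h z ∂μ| ≤ l2norm μ f * l2norm μ h := by
  have e : ∫ z in A, f z * h z ∂μ = ∫ z, A.indicator f z * h z ∂μ := by
    rw [← integral_indicator hA]
    refine integral_congr_ae (ae_of_all _ fun z => ?_)
    by_cases hz : z ∈ A <;> simp [hz]
  rw [e]
  refine (abs_integral_mul_le (hf.indicator hA) hh).trans ?_
  refine mul_le_mul_of_nonneg_right (l2norm_mono hf (ae_of_all _ fun z => ?_)) (l2norm_nonneg _ _)
  exact norm_indicator_le_norm_self f z

theorem memLp_clip_muStar (P Q : Measure (Pop 𝓧)) [IsProbabilityMeasure P]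
    [IsProbabilityMeasure Q] (s : Bool) {L : ℝ} (hL : 0 ≤ L) :
    MemLp (fun z : Pop 𝓧 => clip L (muStar P s z.X)) 2 Q :=
  MemLp.of_bound (by fun_prop : Measurable _).aestronglyMeasurable L
    (ae_of_all _ fun _ => abs_clip_le hL _)

theorem l2norm_map_obs_X {Q : Measure (Pop 𝓧)} {h : 𝓧 → ℝ} (hh : Measurable h) :
    l2norm (Q.map Pop.obs) (fun o => h o.X) = l2norm Q fun z => h z.X :=
  l2norm_map measurable_obs (hh.comp measurable_obsX)

/-- `abs_integral_mul_comp_le` is applied to `u = armInd s * (m - Y)`, with `m` the truncated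
regression of `P`, and to `f = m - muStar Q s`. Under `P`, pairing `u` with a function of `X` sees
only the truncation error `m - muStar P s`. Under `Q`, pairing `u` with `f` gives the integral of `f
^ 2` over the arm, at least `ε ^ 2` times the squared norm of `f`; one power of the norm cancels. -/
theorem regression_dist_le {Q P : Measure (Pop 𝓧)} [IsProbabilityMeasure Q]
    [IsProbabilityMeasure P] (hQ : Basic ε q C Q) (hQ' : MAR Q) (hP : Basic ε q C P) (hP' : MAR P)
    (hε : 0 < ε) (hq : 2 < q) (hC : 0 < C) (s : Bool) {L : ℝ} (hL : 0 < L) :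
    ε ^ 2 * l2norm Q (fun z => clip L (muStar P s z.X) - muStar Q s z.X)
      ≤ 3 * √(L ^ (2 - q) * C ^ q) + 8 * L * hellinger (Q.map Pop.obs) (P.map Pop.obs)
        + 2 * l2norm P fun z => clip L (muStar P s z.X) - muStar P s z.X := by
  set m : 𝓧 → ℝ := fun x => clip L (muStar P s x) with hm
  have hmm : Measurable m := by fun_prop
  set f : 𝓧 → ℝ := fun x => m x - muStar Q s x with hf
  have hfm : Measurable f := by fun_prop
  set u : Obs 𝓧 → ℝ := fun o => armInd s o * (m o.X - o.Y) with hu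
  set v : Obs 𝓧 → ℝ := fun o => armInd s o * (m o.X - clip L o.Y) with hv
  have hvm : Measurable v := by fun_prop
  have hmQ : MemLp (fun z : Pop 𝓧 => m z.X) 2 Q := memLp_clip_muStar P Q s hL.le
  have hmP : MemLp (fun z : Pop 𝓧 => m z.X) 2 P := memLp_clip_muStar P P s hL.le
  have hfQ : MemLp (fun z : Pop 𝓧 => f z.X) 2 Q := hmQ.sub (memLp_muStar hQ hQ' hε hq s)
  have hdP : MemLp (fun z : Pop 𝓧 => m z.X - muStar P s z.X) 2 P :=
    hmP.sub (memLp_muStar hP hP' hε hq s)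
  have hvW : ∀ o, |v o| ≤ 2 * L := fun o => by
    simp only [hv]
    rw [abs_mul]
    have h1 : |m o.X - clip L o.Y| ≤ 2 * L := by
      refine (abs_sub _ _).trans ?_
      have := abs_clip_le hL.le (muStar P s o.X)
      have := abs_clip_le hL.le o.Y
      simp only [hm]
      linarith
    calc _ ≤ 1 * |m o.X - clip L o.Y| :=
          mul_le_mul_of_nonneg_right (abs_armInd_le_one s o) (abs_nonneg _)
      _ ≤ _ := by rw [one_mul]; exact h1
  have hu2 : ∀ (R : Measure (Pop 𝓧)) [IsProbabilityMeasure R], Basic ε q C R →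
      MemLp (fun z : Pop 𝓧 => m z.X) 2 R → MemLp u 2 (R.map Pop.obs) := fun R _ hR hmR =>
    (memLp_armInd_mul (Y := fun z => m z.X - z.Ypot s) (by fun_prop)
      (hmR.sub (hR.memLp_Ypot hq s)) fun z hz => by rw [obs_Y_of_arm hz, obs_X]).1
  have huv : ∀ (R : Measure (Pop 𝓧)) [IsProbabilityMeasure R], Basic ε q C R →
      l2norm (R.map Pop.obs) (fun o => u o - v o) ≤ √(L ^ (2 - q) * C ^ q) := fun R _ hR => by
    refine le_trans (le_of_eq ?_) ((memLp_armInd_mul (Q := R) (s := s)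
      (Y := fun z => z.Ypot s - clip L (z.Ypot s))
      (F := fun o => o.Y - clip L o.Y) (by fun_prop)
      ((hR.memLp_Ypot hq s).sub (memLp_clip (hR.memLp_Ypot hq s) hL.le)) fun z hz => by
        rw [obs_Y_of_arm hz]).2.trans
      (l2norm_sub_clip_le hq hC hL (measurable_Ypot s) (hR.moment s)))
    have : (fun o => u o - v o) = fun o => (-1) * (armInd s o * (o.Y - clip L o.Y)) := by
      ext o; simp only [hu, hv]; ring
    rw [this, l2norm_const_mul]
    simp
  have hκ : ∀ h : 𝓧 → ℝ, Measurable h → MemLp (fun o : Obs 𝓧 => h o.X) 2 (P.map Pop.obs) →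
      |∫ o, u o * h o.X ∂(P.map Pop.obs)|
        ≤ (l2norm P fun z => m z.X - muStar P s z.X)
          * l2norm (P.map Pop.obs) fun o => h o.X := by
    intro h hh hh2
    have hhP : MemLp (fun z : Pop 𝓧 => h z.X) 2 P := (memLp_map_iff measurable_obs
      (hh.comp measurable_obsX)).1 hh2
    have e1 : ∫ o, u o * h o.X ∂(P.map Pop.obs)
        = ∫ z in arm s, (m z.X - muStar P s z.X) * h z.X ∂P := by
      have := integral_armInd_mul P s (F := fun x y => (m x - y) * h x) (by fun_prop)
      simp only [hu, mul_assoc] at this ⊢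
      rw [this]
      have o1 := setIntegral_arm_resid_mul hP hq s hh hhP
      rw [← add_zero (∫ z in arm s, (m z.X - z.Ypot s) * h z.X ∂P), ← o1, ← integral_add]
      · exact integral_congr_ae (ae_of_all _ fun z => by simp only; ring)
      · exact (integrable_mul_of_memLp (hmP.sub (hP.memLp_Ypot hq s)) hhP).integrableOn
      · exact (integrable_mul_of_memLp ((hP.memLp_Ypot hq s).sub
          (memLp_muStar hP hP' hε hq s)) hhP).integrableOn
    rw [e1, l2norm_map_obs_X hh]
    exact setIntegral_abs_mul_le (measurableSet_arm s) hdP hhP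
  -- Truncating the outcome as well gives the surrogate `v` with `|v| ≤ 2 * L`, hence the Hellinger
  -- coefficient `4 * (2 * L)`.
  have key := abs_integral_mul_comp_le (μ₁ := Q.map Pop.obs) (μ₀ := P.map Pop.obs)
    measurable_obsX hvm hvW (hu2 Q hQ hmQ) (hu2 P hP hmP) (l2norm_nonneg _ _) hκ hfm
    ((memLp_map_iff measurable_obs (hfm.comp measurable_obsX)).2 hfQ)
  have e2 : ∫ o, u o * f o.X ∂(Q.map Pop.obs) = ∫ z in arm s, f z.X ^ 2 ∂Q := by
    have := integral_armInd_mul Q s (F := fun x y => (m x - y) * f x) (by fun_prop)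
    simp only [hu, mul_assoc] at this ⊢
    rw [this]
    have o1 := setIntegral_arm_resid_mul hQ hq s hfm hfQ
    rw [← add_zero (∫ z in arm s, (m z.X - z.Ypot s) * f z.X ∂Q), ← o1, ← integral_add]
    · refine integral_congr_ae (ae_of_all _ fun z => ?_)
      simp only [hf]
      ring
    · exact (integrable_mul_of_memLp (hmQ.sub (hQ.memLp_Ypot hq s)) hfQ).integrableOn
    · exact (integrable_mul_of_memLp ((hQ.memLp_Ypot hq s).sub
        (memLp_muStar hQ hQ' hε hq s)) hfQ).integrableOn
  have e3 : ε ^ 2 * l2norm Q (fun z => f z.X) ^ 2 ≤ ∫ z in arm s, f z.X ^ 2 ∂Q := by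
    have := setIntegral_arm hQ hQ' s (f := fun p => f p.1 ^ 2) (by fun_prop)
    simp only at this
    rw [this, sq_l2norm, ← integral_const_mul]
    refine integral_mono_ae (hfQ.integrable_sq.const_mul _) ?_ ?_
    · refine hfQ.integrable_sq.mono (by fun_prop : Measurable _).aestronglyMeasurable
        (ae_of_all _ fun z => ?_)
      rw [norm_mul, Real.norm_of_nonneg (armProb_nonneg Q s _)]
      exact mul_le_of_le_one_left (norm_nonneg _) (armProb_le_one Q s _)
    · filter_upwards [hQ.le_armProb hε s] with z hz
      exact mul_le_mul_of_nonneg_right hz (sq_nonneg _)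
  rw [l2norm_map_obs_X hfm] at key
  rw [e2] at key
  have h1 := e3.trans ((le_abs_self _).trans key)
  have hF0 : 0 ≤ l2norm Q fun z : Pop 𝓧 => f z.X := l2norm_nonneg _ _
  have hH0 : 0 ≤ hellinger (Q.map Pop.obs) (P.map Pop.obs) := l2norm_nonneg _ _
  have hd0 : 0 ≤ l2norm P fun z : Pop 𝓧 => m z.X - muStar P s z.X := l2norm_nonneg _ _
  have hs0 : 0 ≤ √(L ^ (2 - q) * C ^ q) := Real.sqrt_nonneg _
  rcases hF0.eq_or_lt with h0 | hpos
  · rw [show (fun z : Pop 𝓧 => clip L (muStar P s z.X) - muStar Q s z.X) = fun z => f z.X from rfl,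
      ← h0, mul_zero]
    positivity
  · have h2 : ε ^ 2 * l2norm Q (fun z => f z.X)
        ≤ l2norm (Q.map Pop.obs) (fun w => u w - v w)
          + 2 * l2norm (P.map Pop.obs) (fun w => u w - v w)
          + 4 * (2 * L) * hellinger (Q.map Pop.obs) (P.map Pop.obs)
          + 2 * l2norm P fun z => m z.X - muStar P s z.X := by
      refine le_of_mul_le_mul_right ?_ hpos
      rw [mul_assoc, ← sq]
      exact h1
    refine h2.trans ?_
    have := huv Q hQ
    have := huv P hP
    linarith

/-- The bound involves constants only and not the law, so it is uniform along a submodel, as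
`HasScore.tendsto_difference_quotient` requires. -/
theorem memLp_augmented {Q : Measure (Pop 𝓧)} [IsProbabilityMeasure Q]
    (h : Basic ε q C Q) (hq : 2 < q) (hC : 0 < C) (s : Bool) {a m : 𝓧 → ℝ}
    (ha : Measurable a) (hm : Measurable m) {A : ℝ} (hA : ∀ x, |a x| ≤ A)
    (hm2 : MemLp (fun z => m z.X) 2 Q) :
    MemLp (augmented a m s) 2 (Q.map Pop.obs) ∧ ∀ L, (∀ x, |m x| ≤ L) →
      l2norm (Q.map Pop.obs) (augmented a m s) ≤ L + A * (C + L) := by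
  have hd : MemLp (fun z => z.Ypot s - m z.X) 2 Q := (h.memLp_Ypot hq s).sub hm2
  have hp := memLp_mul_of_bound (v := fun z : Pop 𝓧 => a z.X) (ha.comp measurable_X)
    (fun z => hA _) hd
  have h1 := memLp_armInd_mul (Q := Q) (s := s) (F := fun o => a o.X * (o.Y - m o.X))
    (by fun_prop) hp.1 fun z hz => by rw [obs_Y_of_arm hz, obs_X]
  have h0 : MemLp (fun o : Obs 𝓧 => m o.X) 2 (Q.map Pop.obs) :=
    (memLp_map_iff measurable_obs (hm.comp measurable_obsX)).2 hm2
  refine ⟨h0.add h1.1, fun L hL => ?_⟩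
  have hx : ∀ {f : Pop 𝓧 → ℝ} {B : ℝ}, (∀ z, |f z| ≤ B) → l2norm Q f ≤ B := by
    intro f B hB
    have hB0 : 0 ≤ B := by
      obtain ⟨w⟩ : Nonempty (Pop 𝓧) := Q.nonempty_of_neZero
      exact (abs_nonneg _).trans (hB w)
    refine (l2norm_mono (memLp_const B) (ae_of_all _ fun z =>
      (hB z).trans (le_abs_self B))).trans (le_of_eq ?_)
    simp [l2norm, Real.sqrt_sq hB0]
  have hY : l2norm Q (Pop.Ypot s) ≤ C := by
    rw [l2norm_eq_toReal (h.memLp_Ypot hq s)]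
    exact ENNReal.toReal_le_of_le_ofReal hC.le (h.eLpNorm_two_le hq s)
  have hA0 : 0 ≤ A := by
    obtain ⟨w⟩ : Nonempty (Pop 𝓧) := Q.nonempty_of_neZero
    exact (abs_nonneg _).trans (hA w.X)
  refine (l2norm_add_le h0 h1.1).trans (add_le_add ?_ ((h1.2.trans hp.2).trans ?_))
  · rw [l2norm_map_obs_X hm]
    exact hx fun z => hL _
  · refine mul_le_mul_of_nonneg_left ?_ hA0
    refine (l2norm_sub_le (h.memLp_Ypot hq s) hm2).trans (add_le_add hY ?_)
    exact hx fun z => hL _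

variable {Q : ℝ → Measure (Pop 𝓧)} [∀ t, IsProbabilityMeasure (Q t)] {g : Obs 𝓧 → ℝ}

/-- `integral_augmented_sub` is used with the weight of `Q 0` and its regression truncated at `L`.
The augmented mean is differentiable. The product term is at most the Hellinger distance, which is
`O(|t|)`, times the distance of regressions, so its quotient by `t` is small for large `L` and small
`t`. Truncation is needed because the regression of `Q 0` need not be square integrable under `Q t`.
-/
theorem hasDerivAt_mean_Ypot (hε : 0 < ε) (hq : 2 < q) (hC : 0 < C)
    (hQ : ∀ᶠ t in 𝓝 (0 : ℝ), Basic ε q C (Q t) ∧ MAR (Q t)) (hM : MCAR (Q 0))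
    (hg : Measurable g) (hg2 : MemLp g 2 ((Q 0).map Pop.obs))
    (hscore : HasScore (fun t => (Q t).map Pop.obs) g) (s : Bool) :
    HasDerivAt (fun t => ∫ z, z.Ypot s ∂(Q t))
      (∫ o, augmented (armWeight ε (Q 0) s) (muStar (Q 0) s) s o * g o ∂((Q 0).map Pop.obs)) 0 := by
  have h0 := hQ.self_of_nhds
  set P := Q 0 with hP
  set a := armWeight ε P s with ha
  have hA : ∀ x, |a x| ≤ (ε ^ 2)⁻¹ := abs_armWeight_le h0.1 hM hε s
  have ham : Measurable a := by fun_prop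
  set W := 1 + (ε ^ 2)⁻¹ with hW
  have hW0 : 0 < W := by positivity
  set G := l2norm (P.map Pop.obs) g with hG
  have hG0 : 0 ≤ G := l2norm_nonneg _ _
  set K := 1 / 2 * G + 1 with hK
  have hK0 : 0 < K := by positivity
  set m : ℕ → 𝓧 → ℝ := fun L x => clip L (muStar P s x) with hm
  have hmm : ∀ L, Measurable (m L) := fun L => by fun_prop
  have hmu := memLp_muStar h0.1 h0.2 hε hq s
  set d : ℕ → ℝ := fun L => l2norm P fun z => m L z.X - muStar P s z.X with hd
  have hd0 : Tendsto d atTop (𝓝 0) := by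
    refine (tendsto_l2norm_sub_clip hmu).congr fun L => ?_
    have : (fun z : Pop 𝓧 => m L z.X - muStar P s z.X)
        = fun z => (-1) * (muStar P s z.X - clip L (muStar P s z.X)) := by
      ext z; simp only [hm]; ring
    simp only [hd]
    rw [this, l2norm_const_mul, abs_neg, abs_one, one_mul]
  have hbal : MemLp (balance a s) 2 (P.map Pop.obs) :=
    MemLp.of_bound (by fun_prop : Measurable _).aestronglyMeasurable _
      (ae_of_all _ (abs_balance_le hA s))
  have hmemaug := (memLp_augmented h0.1 hq hC s ham (measurable_muStar P s) hA hmu).1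
  rw [hasDerivAt_iff_tendsto_slope, Metric.tendsto_nhds]
  intro η hη
  -- These are the contributions that do not vanish with `t`: the effect of truncation on the
  -- candidate derivative and on the distance of regressions. They fix the choice of `L`.
  have hlim : Tendsto (fun L : ℕ => W * d L * G
      + 4 * W * K * ((ε ^ 2)⁻¹ * (3 * √((L : ℝ) ^ (2 - q) * C ^ q) + 2 * d L))) atTop (𝓝 0) := by
    have h1 := ((hd0.const_mul W).mul_const G).add ((((((tendsto_tail hq C).const_mul 3).add
      (hd0.const_mul 2)).const_mul (ε ^ 2)⁻¹)).const_mul (4 * W * K))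
    simpa using h1
  obtain ⟨L, hL1, hL2⟩ := ((hlim.eventually_lt_const (by positivity : 0 < η / 2)).and
    (eventually_ge_atTop 1)).exists
  have hLpos : (0 : ℝ) < L := by exact_mod_cast hL2
  have hmb : ∀ x, |m L x| ≤ L := fun x => abs_clip_le hLpos.le _
  have hm2 : ∀ t, MemLp (fun z : Pop 𝓧 => m L z.X) 2 (Q t) := fun t =>
    memLp_clip_muStar P (Q t) s hLpos.le
  have hmaug0 := memLp_augmented h0.1 hq hC s ham (hmm L) hA (hm2 0)
  have hder := hscore.tendsto_difference_quotient hg hg2 (f := augmented a (m L) s)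
    (by fun_prop) hmaug0.1 (B := L + (ε ^ 2)⁻¹ * (C + L)) (by
      filter_upwards [nhdsWithin_le_nhds hQ] with t ht
      have := memLp_augmented ht.1 hq hC s ham (hmm L) hA (hm2 t)
      exact ⟨this.1, this.2 L hmb⟩)
  have hT : Tendsto (fun t => |(∫ w, augmented a (m L) s w ∂((Q t).map Pop.obs)
        - ∫ w, augmented a (m L) s w ∂((Q 0).map Pop.obs)) / t
        - ∫ w, augmented a (m L) s w * g w ∂((Q 0).map Pop.obs)|
      + 4 * W * K * ((ε ^ 2)⁻¹ * (8 * L * hellinger ((Q t).map Pop.obs) ((Q 0).map Pop.obs))))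
      (𝓝[≠] 0) (𝓝 0) := by
    have h1 := (hder.sub_const (∫ w, augmented a (m L) s w * g w ∂((Q 0).map Pop.obs))).abs
    have h2 := (((hscore.tendsto_hellinger hg hg2).const_mul (8 * (L : ℝ))).const_mul
      (ε ^ 2)⁻¹).const_mul (4 * W * K)
    simpa using h1.add h2
  filter_upwards [hT.eventually_lt_const (by positivity : 0 < η / 2),
    hscore.eventually_hellinger_le hg hg2, nhdsWithin_le_nhds hQ, self_mem_nhdsWithin]
    with t h1 h2 h3 ht
  have ht' : t ≠ 0 := ht
  rw [slope_def_field, sub_zero, Real.dist_eq]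
  have r1 := integral_augmented_sub h3.1 h3.2 hε hq s ham (hmm L) hA (hm2 t)
  have r0 := integral_augmented_sub h0.1 h0.2 hε hq s ham (hmm L) hA (hm2 0)
  have hdP : MemLp (fun z : Pop 𝓧 => m L z.X - muStar P s z.X) 2 P := (hm2 0).sub hmu
  have z0 := integral_balance_mul h0.1 hM hε s (f := fun x => m L x - muStar P s x)
    (by fun_prop) hdP
  rw [z0] at r0
  set f : 𝓧 → ℝ := fun x => m L x - muStar (Q t) s x with hf
  have hfm : Measurable f := by fun_prop
  have hfQ : MemLp (fun z : Pop 𝓧 => f z.X) 2 (Q t) :=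
    (hm2 t).sub (memLp_muStar h3.1 h3.2 hε hq s)
  -- Here `u = v` is bounded and exactly orthogonal to functions of `X` under `P`, so only the
  -- Hellinger term survives.
  have rem := abs_integral_mul_comp_le (μ₁ := (Q t).map Pop.obs) (μ₀ := P.map Pop.obs)
    (u := balance a s) (v := balance a s) (κ := 0) measurable_obsX
    (by fun_prop) (abs_balance_le hA s)
    (MemLp.of_bound (by fun_prop : Measurable _).aestronglyMeasurable _
      (ae_of_all _ (abs_balance_le hA s))) hbal le_rfl
    (fun h hh hh2 => by
      rw [integral_balance_mul h0.1 hM hε s hh ((memLp_map_iff measurable_obs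
        (hh.comp measurable_obsX)).1 hh2)]
      simp) hfm
    ((memLp_map_iff measurable_obs (hfm.comp measurable_obsX)).2 hfQ)
  rw [l2norm_map_obs_X hfm] at rem
  have zz : ∀ R : Measure (Obs 𝓧), l2norm R (fun w => balance a s w - balance a s w) = 0 :=
    fun R => by simp [l2norm]
  rw [zz, zz] at rem
  simp only [mul_zero, add_zero, zero_add] at rem
  have reg := regression_dist_le h3.1 h3.2 h0.1 h0.2 hε hq hC s hLpos
  have hε2 : 0 < ε ^ 2 := by positivity
  have reg' : (l2norm (Q t) fun z => f z.X) ≤ (ε ^ 2)⁻¹ * (3 * √((L : ℝ) ^ (2 - q) * C ^ q)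
      + 8 * L * hellinger ((Q t).map Pop.obs) (P.map Pop.obs) + 2 * d L) := by
    rw [← mul_le_mul_iff_right₀ hε2, ← mul_assoc, mul_inv_cancel₀ hε2.ne', one_mul]
    exact reg
  set S := ∫ o, balance a s o * f o.X ∂((Q t).map Pop.obs) with hS
  have hrem2 : |S / t| ≤ 4 * W * K * ((ε ^ 2)⁻¹ * (3 * √((L : ℝ) ^ (2 - q) * C ^ q)
      + 8 * L * hellinger ((Q t).map Pop.obs) (P.map Pop.obs) + 2 * d L)) := by
    rw [abs_div, div_le_iff₀ (abs_pos.2 ht')]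
    have hF0 : 0 ≤ l2norm (Q t) fun z : Pop 𝓧 => f z.X := l2norm_nonneg _ _
    calc |S| ≤ 4 * W * hellinger ((Q t).map Pop.obs) (P.map Pop.obs)
            * l2norm (Q t) fun z => f z.X := rem
      _ ≤ 4 * W * (|t| * K) * l2norm (Q t) fun z => f z.X := by gcongr
      _ = 4 * W * K * (l2norm (Q t) fun z => f z.X) * |t| := by ring
      _ ≤ _ := by gcongr
  have hdiff : |∫ w, augmented a (m L) s w * g w ∂(P.map Pop.obs)
      - ∫ w, augmented a (muStar P s) s w * g w ∂(P.map Pop.obs)| ≤ W * d L * G := by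
    rw [← integral_sub (integrable_mul_of_memLp hmaug0.1 hg2)
      (integrable_mul_of_memLp hmemaug hg2)]
    have hd2 : MemLp (fun o : Obs 𝓧 => m L o.X - muStar P s o.X) 2 (P.map Pop.obs) :=
      (memLp_map_iff measurable_obs (by fun_prop)).2 hdP
    have hb := memLp_mul_of_bound (by fun_prop) (abs_balance_le hA s) hd2
    have : ∫ w, (augmented a (m L) s w * g w - augmented a (muStar P s) s w * g w)
          ∂(P.map Pop.obs)
        = ∫ w, (balance a s w * (m L w.X - muStar P s w.X)) * g w ∂(P.map Pop.obs) := by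
      refine integral_congr_ae (ae_of_all _ fun w => ?_)
      simp only
      rw [← sub_mul, augmented_sub_augmented]
    rw [this]
    refine (abs_integral_mul_le hb.1 hg2).trans ?_
    refine mul_le_mul_of_nonneg_right (hb.2.trans (le_of_eq ?_)) hG0
    rw [l2norm_map measurable_obs (by fun_prop)]
    rfl
  have e : (∫ z, z.Ypot s ∂(Q t) - ∫ z, z.Ypot s ∂P) / t
      - ∫ o, augmented a (muStar P s) s o * g o ∂(P.map Pop.obs)
      = ((∫ w, augmented a (m L) s w ∂((Q t).map Pop.obs)
        - ∫ w, augmented a (m L) s w ∂(P.map Pop.obs)) / t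
        - ∫ w, augmented a (m L) s w * g w ∂(P.map Pop.obs))
        + (∫ w, augmented a (m L) s w * g w ∂(P.map Pop.obs)
          - ∫ w, augmented a (muStar P s) s w * g w ∂(P.map Pop.obs)) - S / t := by
    have e1 : ∫ z, z.Ypot s ∂(Q t) = ∫ w, augmented a (m L) s w ∂((Q t).map Pop.obs) - S := by
      rw [hS]; simp only [hf]; linarith
    rw [e1, show ∫ z, z.Ypot s ∂P = ∫ w, augmented a (m L) s w ∂(P.map Pop.obs) by linarith]
    field_simp
    ring
  rw [e]
  refine (abs_sub _ _).trans_lt ?_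
  have := abs_add_le ((∫ w, augmented a (m L) s w ∂((Q t).map Pop.obs)
        - ∫ w, augmented a (m L) s w ∂(P.map Pop.obs)) / t
        - ∫ w, augmented a (m L) s w * g w ∂(P.map Pop.obs))
        (∫ w, augmented a (m L) s w * g w ∂(P.map Pop.obs)
          - ∫ w, augmented a (muStar P s) s w * g w ∂(P.map Pop.obs))
  nlinarith

/-- The mean of the constant `1` does not move along the path, so its derivative, the mean of the
score, is zero. -/
theorem integral_score_eq_zero (hg : Measurable g) (hg2 : MemLp g 2 ((Q 0).map Pop.obs))
    (hscore : HasScore (fun t => (Q t).map Pop.obs) g) : ∫ o, g o ∂((Q 0).map Pop.obs) = 0 := by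
  have h := hscore.tendsto_difference_quotient hg hg2 (f := fun _ => 1) measurable_const
    (memLp_const (1 : ℝ)) (B := 1) (Eventually.of_forall fun t =>
      ⟨memLp_const (1 : ℝ), by simp [l2norm]⟩)
  simp only [integral_const, probReal_univ, smul_eq_mul, mul_one, sub_self, zero_div,
    one_mul] at h
  exact (tendsto_nhds_unique h tendsto_const_nhds).symm ▸ rfl

end Gradient

/-! ### Recoupling the potential outcomes -/

section Recoupling

variable {𝓧 : Type*} [MeasurableSpace 𝓧] [StandardBorelSpace 𝓧] {ε q C : ℝ}
  (P : Measure (Pop 𝓧)) [IsProbabilityMeasure P]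

/-- covariates and potential outcomes -/
def outcomes (z : Pop 𝓧) : 𝓧 × ℝ × ℝ := (z.X, z.Ypot false, z.Ypot true)

/-- the potential outcome under treatment `s` -/
def pick (s : Bool) (y : ℝ × ℝ) : ℝ := if s then y.2 else y.1

@[fun_prop] theorem measurable_outcomes : Measurable (outcomes : Pop 𝓧 → _) := by
  unfold outcomes; fun_prop

@[fun_prop] theorem measurable_pick (s : Bool) : Measurable (pick s) := by
  unfold pick; split_ifs <;> fun_prop

/-- assemble a unit -/
def assemble (c : ((𝓧 × ℝ × ℝ) × Bool) × Bool) : Pop 𝓧 :=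
  (c.1.1.1, c.1.2, c.1.1.2.1, c.1.1.2.2, c.2)

@[fun_prop] theorem measurable_assemble :
    Measurable (assemble : ((𝓧 × ℝ × ℝ) × Bool) × Bool → Pop 𝓧) := by
  unfold assemble; fun_prop

/-- conditional law of treatment given covariates and potential outcomes, when treatment is
unconfounded jointly -/
def treatKernel : Kernel (𝓧 × ℝ × ℝ) Bool := (condDistrib Pop.T Pop.X P).comap Prod.fst measurable_fst

instance : IsMarkovKernel (treatKernel P) := by unfold treatKernel; infer_instance

instance : IsProbabilityMeasure (P.map Pop.R) :=
  Measure.isProbabilityMeasure_map measurable_popR.aemeasurable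

/-- the population law with law `J` of covariates and potential outcomes, in which treatment is
independent of the potential outcomes given the covariates, with the propensity score of `P`, and
the label is independent of everything else, with the labelling probability of `P` -/
def recouple (J : Measure (𝓧 × ℝ × ℝ)) : Measure (Pop 𝓧) :=
  ((J ⊗ₘ treatKernel P).prod (P.map Pop.R)).map assemble

variable {J : Measure (𝓧 × ℝ × ℝ)} [IsProbabilityMeasure J]

instance : IsProbabilityMeasure (recouple P J) :=
  Measure.isProbabilityMeasure_map measurable_assemble.aemeasurable

theorem recouple_map_core :
    (recouple P J).map (fun z => (outcomes z, z.T)) = J ⊗ₘ treatKernel P := by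
  rw [recouple, Measure.map_map (by fun_prop) measurable_assemble]
  exact Measure.map_fst_prod.trans (by rw [measure_univ, one_smul])

theorem recouple_map_R : (recouple P J).map Pop.R = P.map Pop.R := by
  rw [recouple, Measure.map_map (by fun_prop) measurable_assemble]
  exact Measure.map_snd_prod.trans (by rw [measure_univ, one_smul])

theorem recouple_labelProb : labelProb (recouple P J) = labelProb P := by
  have h : ∀ (R : Measure (Pop 𝓧)), labelProb R = (R.map Pop.R).real {true} := fun R => by
    rw [map_measureReal_apply measurable_popR (measurableSet_singleton _)]; rfl
  rw [h, h, recouple_map_R]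

theorem recouple_map_outcomes : (recouple P J).map outcomes = J := by
  have h : (recouple P J).map outcomes
      = ((recouple P J).map (fun z => (outcomes z, z.T))).map Prod.fst := by
    rw [Measure.map_map (by fun_prop) (by fun_prop)]; rfl
  rw [h, recouple_map_core]
  exact Measure.fst_compProd J _

theorem recouple_mcar : MCAR (recouple P J) := by
  refine IndepFun.symm ?_
  have h1 : IndepFun (fun z : Pop 𝓧 => (outcomes z, z.T)) Pop.R (recouple P J) := by
    rw [indepFun_iff_map_prod_eq_prod_map_map (by fun_prop) (by fun_prop), recouple_map_core,
      recouple_map_R, recouple, Measure.map_map (by fun_prop) measurable_assemble]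
    exact Measure.map_id
  exact h1.comp (φ := fun c : (𝓧 × ℝ × ℝ) × Bool => (c.1.1, c.2, c.1.2.1, c.1.2.2)) (ψ := id)
    (by fun_prop) measurable_id

/-- The treatment kernel depends on `X` only, so treatment is unconfounded jointly with both
potential outcomes; projecting onto one of them gives the marginal form that `Basic` asks for. -/
theorem recouple_map_arm (s : Bool) :
    (recouple P J).map (fun z => ((z.X, z.Ypot s), z.T))
      = (recouple P J).map (fun z => (z.X, z.Ypot s))
        ⊗ₘ (condDistrib Pop.T Pop.X P).prodMkRight ℝ := by
  set φ : 𝓧 × ℝ × ℝ → 𝓧 × ℝ := fun j => (j.1, pick s j.2) with hφ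
  have hφm : Measurable φ := by fun_prop
  have hY : ∀ z : Pop 𝓧, z.Ypot s = pick s (z.Ypot false, z.Ypot true) := fun z => by
    cases s <;> rfl
  have h1 : (recouple P J).map (fun z => ((z.X, z.Ypot s), z.T))
      = ((recouple P J).map (fun z => (outcomes z, z.T))).map (Prod.map φ id) := by
    rw [Measure.map_map (by fun_prop) (by fun_prop)]
    congr 1
  have h2 : (recouple P J).map (fun z => (z.X, z.Ypot s)) = J.map φ := by
    conv_rhs => rw [← recouple_map_outcomes P (J := J)]
    rw [Measure.map_map (by fun_prop) (by fun_prop)]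
    congr 1
  rw [h1, recouple_map_core, h2]
  ext S hS
  rw [Measure.map_apply (by fun_prop) hS, Measure.compProd_apply (hS.preimage (by fun_prop)),
    Measure.compProd_apply hS, lintegral_map (Kernel.measurable_kernel_prodMk_left hS) hφm]
  rfl

theorem recouple_unconfounded (s : Bool) :
    Pop.Ypot s ⟂ᵢ[Pop.X, measurable_X; recouple P J] Pop.T :=
  condIndepFun_of_map_eq_compProd measurable_X (measurable_Ypot s) measurable_popT
    (recouple_map_arm P s)

theorem recouple_condDistrib :
    condDistrib Pop.T Pop.X (recouple P J) =ᵐ[(recouple P J).map Pop.X]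
      condDistrib Pop.T Pop.X P :=
  condDistrib_ae_eq_of_measure_eq_compProd Pop.X measurable_popT.aemeasurable
    (map_prodMk_eq_compProd measurable_X (measurable_Ypot true) measurable_popT
      (recouple_map_arm P true))

theorem recouple_propensity (s : Bool) :
    ∀ᵐ z ∂(recouple P J), propensity (recouple P J) s z.X = propensity P s z.X := by
  filter_upwards [ae_of_ae_map measurable_popX.aemeasurable (recouple_condDistrib P (J := J))]
    with z hz
  rw [propensity, hz, propensity]

theorem lintegral_map_outcomes {Q : Measure (Pop 𝓧)} {φ : 𝓧 × ℝ × ℝ → ℝ≥0∞} (hφ : Measurable φ) :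
    ∫⁻ j, φ j ∂(Q.map outcomes) = ∫⁻ z, φ (outcomes z) ∂Q := lintegral_map hφ (by fun_prop)

theorem recouple_setLIntegral_treated (s : Bool) {φ : 𝓧 × ℝ → ℝ≥0∞} (hφ : Measurable φ) :
    ∫⁻ z in treated s, φ (z.X, z.Ypot s) ∂(recouple P J)
      = ∫⁻ j, ENNReal.ofReal (propensity P s j.1) * φ (j.1, pick s j.2) ∂J := by
  rw [setLIntegral_treated (fun t => recouple_unconfounded P t) s hφ]
  conv_rhs => rw [← recouple_map_outcomes P (J := J)]
  rw [lintegral_map_outcomes (by fun_prop)]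
  refine lintegral_congr_ae ?_
  filter_upwards [recouple_propensity P (J := J) s] with z hz
  rw [hz]
  cases s <;> rfl

/-- conditional law of the potential outcome -/
abbrev outcomeKernel (s : Bool) : Kernel 𝓧 ℝ := condDistrib (Pop.Ypot s) Pop.X P

/-- law of covariates and potential outcomes in which the latter are conditionally independent -/
def indepOutcomes : Measure (𝓧 × ℝ × ℝ) :=
  P.map Pop.X ⊗ₘ (outcomeKernel P false ×ₖ outcomeKernel P true)

instance : IsProbabilityMeasure (P.map Pop.X) :=
  Measure.isProbabilityMeasure_map measurable_popX.aemeasurable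

theorem lintegral_outcomeKernel (s : Bool) {φ : 𝓧 × ℝ → ℝ≥0∞} (hφ : Measurable φ) :
    ∫⁻ x, ∫⁻ y, φ (x, y) ∂(outcomeKernel P s x) ∂(P.map Pop.X)
      = ∫⁻ z, φ (z.X, z.Ypot s) ∂P := by
  rw [← Measure.lintegral_compProd hφ, compProd_map_condDistrib (measurable_Ypot s).aemeasurable,
    lintegral_map hφ (by fun_prop)]

theorem lintegral_pick (s : Bool) (x : 𝓧) {φ : ℝ → ℝ≥0∞} (hφ : Measurable φ) :
    ∫⁻ y, φ (pick s y) ∂((outcomeKernel P false ×ₖ outcomeKernel P true) x)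
      = ∫⁻ y, φ y ∂(outcomeKernel P s x) := by
  rw [Kernel.prod_apply]
  cases s
  · rw [lintegral_prod _ (by fun_prop)]
    simp [pick]
  · rw [lintegral_prod_symm _ (by fun_prop)]
    simp [pick]

/-- Each factor of the product kernel keeps the conditional law it has under `P`: only the
dependence between the two potential outcomes is changed. -/
theorem lintegral_indepOutcomes_pick (s : Bool) {φ : 𝓧 × ℝ → ℝ≥0∞} (hφ : Measurable φ) :
    ∫⁻ j, φ (j.1, pick s j.2) ∂(indepOutcomes P) = ∫⁻ z, φ (z.X, z.Ypot s) ∂P := by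
  rw [indepOutcomes, Measure.lintegral_compProd (by fun_prop), ← lintegral_outcomeKernel P s hφ]
  refine lintegral_congr fun x => ?_
  exact lintegral_pick P s x (φ := fun y => φ (x, y)) (by fun_prop)

variable {P} {f : 𝓧 × ℝ × ℝ → ℝ}

/-- `J` has density `f` with values in `[1/2, 2]` with respect to `indepOutcomes P` -/
structure IsTilt (P : Measure (Pop 𝓧)) [IsProbabilityMeasure P] (f : 𝓧 × ℝ × ℝ → ℝ)
    (J : Measure (𝓧 × ℝ × ℝ)) : Prop where
  measurable : Measurable f
  le : ∀ j, 1 / 2 ≤ f j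
  ge : ∀ j, f j ≤ 2
  eq : J = (indepOutcomes P).withDensity fun j => ENNReal.ofReal (f j)

theorem lintegral_tilt_le (h : IsTilt P f J) {φ : 𝓧 × ℝ × ℝ → ℝ≥0∞} (hφ : Measurable φ) :
    ∫⁻ j, φ j ∂J ≤ 2 * ∫⁻ j, φ j ∂(indepOutcomes P) := by
  have hf := h.measurable
  rw [h.eq, lintegral_withDensity_eq_lintegral_mul _ (by fun_prop) hφ, ← lintegral_const_mul _ hφ]
  refine lintegral_mono fun j => ?_
  refine mul_le_mul_left (le_trans (ENNReal.ofReal_le_ofReal (h.ge j)) ?_) _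
  simp

theorem le_lintegral_tilt (h : IsTilt P f J) {φ : 𝓧 × ℝ × ℝ → ℝ≥0∞} (hφ : Measurable φ) :
    ∫⁻ j, φ j ∂(indepOutcomes P) ≤ 2 * ∫⁻ j, φ j ∂J := by
  have hf := h.measurable
  rw [h.eq, lintegral_withDensity_eq_lintegral_mul _ (by fun_prop) hφ, ← lintegral_const_mul _
    (by fun_prop)]
  refine lintegral_mono fun j => ?_
  simp only [Pi.mul_apply]
  rw [← mul_assoc]
  refine le_mul_of_one_le_left bot_le ?_
  rw [show (2 : ℝ≥0∞) = ENNReal.ofReal 2 by simp, ← ENNReal.ofReal_mul (by norm_num),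
    ← ENNReal.ofReal_one]
  exact ENNReal.ofReal_le_ofReal (by linarith [h.le j])

/-- By unconfoundedness an integral over a treatment arm depends only on the law of `(X, Y(s))`,
which recoupling preserves; the density, at most 2, costs the factor. -/
theorem tilt_treated_le (hP : Basic ε q C P) (hJ : IsTilt P f J) (s : Bool) {φ : 𝓧 × ℝ → ℝ≥0∞} (hφ : Measurable φ) :
    ∫⁻ z in treated s, φ (z.X, z.Ypot s) ∂(recouple P J)
      ≤ 2 * ∫⁻ z in treated s, φ (z.X, z.Ypot s) ∂P := by
  rw [recouple_setLIntegral_treated P s hφ, setLIntegral_treated hP.unconfounded s hφ,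
    ← lintegral_indepOutcomes_pick P s
      (φ := fun p => ENNReal.ofReal (propensity P s p.1) * φ p) (by fun_prop)]
  exact lintegral_tilt_le hJ (by fun_prop)

theorem le_tilt_treated (hP : Basic ε q C P) (hJ : IsTilt P f J) (s : Bool) {φ : 𝓧 × ℝ → ℝ≥0∞} (hφ : Measurable φ) :
    ∫⁻ z in treated s, φ (z.X, z.Ypot s) ∂P
      ≤ 2 * ∫⁻ z in treated s, φ (z.X, z.Ypot s) ∂(recouple P J) := by
  rw [recouple_setLIntegral_treated P s hφ, setLIntegral_treated hP.unconfounded s hφ,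
    ← lintegral_indepOutcomes_pick P s
      (φ := fun p => ENNReal.ofReal (propensity P s p.1) * φ p) (by fun_prop)]
  exact le_lintegral_tilt hJ (by fun_prop)

theorem tilt_map_le (hJ : IsTilt P f J) (s : Bool) :
    (recouple P J).map (fun z => (z.X, z.Ypot s)) ≤ (2 : ℝ≥0∞) • P.map fun z => (z.X, z.Ypot s) := by
  refine Measure.le_iff.2 fun B hB => ?_
  have hi : Measurable (B.indicator (1 : 𝓧 × ℝ → ℝ≥0∞)) := measurable_one.indicator hB
  rw [Measure.smul_apply, smul_eq_mul, ← lintegral_indicator_one hB, ← lintegral_indicator_one hB,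
    lintegral_map hi (by fun_prop), lintegral_map hi (by fun_prop),
    ← lintegral_indepOutcomes_pick P s hi]
  have : ∫⁻ z, B.indicator (1 : 𝓧 × ℝ → ℝ≥0∞) (z.X, z.Ypot s) ∂(recouple P J)
      = ∫⁻ j, B.indicator (1 : 𝓧 × ℝ → ℝ≥0∞) (j.1, pick s j.2) ∂J := by
    conv_rhs => rw [← recouple_map_outcomes P (J := J)]
    rw [lintegral_map_outcomes (by fun_prop)]
    cases s <;> rfl
  rw [this]
  exact lintegral_tilt_le hJ (by fun_prop)

theorem tilt_ae_of_ae (hJ : IsTilt P f J) {p : 𝓧 → Prop} (h : ∀ᵐ z ∂P, p z.X) (hp : MeasurableSet {x | p x}) :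
    ∀ᵐ z ∂(recouple P J), p z.X := by
  have h1 : ∀ᵐ v ∂(P.map fun z => (z.X, z.Ypot true)), p v.1 :=
    (ae_map_iff (by fun_prop) (hp.preimage measurable_fst)).2 h
  have h2 : ∀ᵐ v ∂((recouple P J).map fun z => (z.X, z.Ypot true)), p v.1 :=
    (Measure.absolutelyContinuous_of_le_smul (tilt_map_le hJ true)) h1
  exact ae_of_ae_map (f := fun z : Pop 𝓧 => (z.X, z.Ypot true)) (p := fun v => p v.1)
    (by fun_prop) h2

theorem tilt_propensity (hP : Basic ε q C P) (hJ : IsTilt P f J) (s : Bool) : ∀ᵐ z ∂(recouple P J),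
    ε ≤ propensity (recouple P J) s z.X := by
  have := tilt_ae_of_ae hJ (hP.le_propensity s)
    (measurableSet_le measurable_const (measurable_propensity P s))
  filter_upwards [this, recouple_propensity P (J := J) s] with z h1 h2
  rw [h2]; exact h1

end Recoupling

/-! ### Upper bounds for conditional variances -/

theorem condExp_le_const_of_setIntegral_le {Ω : Type*} {m m0 : MeasurableSpace Ω} (hm : m ≤ m0)
    {μ : Measure Ω} [IsFiniteMeasure μ] {f : Ω → ℝ} (hf : Integrable f μ) {c : ℝ}
    (h : ∀ S, MeasurableSet[m] S → ∫ z in S, f z ∂μ ≤ c * μ.real S) :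
    μ[f | m] ≤ᵐ[μ] fun _ => c := by
  refine ae_le_of_ae_le_trim (hm := hm) ?_
  refine ae_le_of_forall_setIntegral_le
    (integrable_condExp.trim hm stronglyMeasurable_condExp) (integrable_const c) ?_
  intro S hS _
  rw [← setIntegral_trim hm stronglyMeasurable_condExp hS, setIntegral_condExp hm hf hS]
  refine (h S hS).trans (le_of_eq ?_)
  rw [← setIntegral_trim hm stronglyMeasurable_const hS]
  simp [mul_comm]

/-- The conditional mean is the best predictor, so any other admissible centre gives an upper bound.
The regression of the original law can therefore serve as centre under a tilted law. -/
theorem condVar_ae_le_condExp_sq_sub {Ω : Type*} {m m0 : MeasurableSpace Ω} (hm : m ≤ m0)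
    {μ : Measure Ω} [IsFiniteMeasure μ] {Y f : Ω → ℝ} (hY : MemLp Y 2 μ) (hf : MemLp f 2 μ)
    (hfm : StronglyMeasurable[m] f) :
    condVar m Y μ ≤ᵐ[μ] μ[fun z => (Y z - f z) ^ 2 | m] := by
  have h1 : condVar m Y μ =ᵐ[μ] condVar m (Y - f) μ := by
    refine condExp_congr_ae ?_
    have h2 := condExp_sub (hY.integrable (by norm_num)) (hf.integrable (by norm_num)) m
    rw [condExp_of_stronglyMeasurable hm hfm (hf.integrable (by norm_num))] at h2
    filter_upwards [h2] with z hz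
    simp [hz]
  exact h1.le.trans (condVar_ae_le_condExp_sq hm (hY.sub hf))

/-! ### Tilted laws stay in the model -/

section Recoupling

variable {𝓧 : Type*} [MeasurableSpace 𝓧] [StandardBorelSpace 𝓧] {ε q C : ℝ}
  {P : Measure (Pop 𝓧)} [IsProbabilityMeasure P] {J : Measure (𝓧 × ℝ × ℝ)}
  [IsProbabilityMeasure J] {f : 𝓧 × ℝ × ℝ → ℝ}

theorem lintegral_eq_add_treated (Q : Measure (Pop 𝓧)) (f : Pop 𝓧 → ℝ≥0∞) :
    ∫⁻ z, f z ∂Q = ∫⁻ z in treated true, f z ∂Q + ∫⁻ z in treated false, f z ∂Q := by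
  rw [← lintegral_add_compl f (measurableSet_treated true), treated_compl]
  rfl

theorem eLpNorm_tilt_le (hJ : IsTilt P f J) (s : Bool) {φ : 𝓧 × ℝ → ℝ} (hφ : Measurable φ)
    {p : ℝ≥0∞} (hp : 1 ≤ p) (hp' : p ≠ ∞) :
    eLpNorm (fun z => φ (z.X, z.Ypot s)) p (recouple P J)
      ≤ 2 * eLpNorm (fun z => φ (z.X, z.Ypot s)) p P := by
  have e : ∀ Q : Measure (Pop 𝓧), eLpNorm (fun z => φ (z.X, z.Ypot s)) p Q
      = eLpNorm φ p (Q.map fun z => (z.X, z.Ypot s)) := fun Q =>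
    (eLpNorm_map_measure hφ.aestronglyMeasurable (by fun_prop)).symm
  rw [e, e]
  refine (eLpNorm_mono_measure _ (tilt_map_le hJ s)).trans ?_
  rw [eLpNorm_smul_measure_of_ne_top hp', smul_eq_mul]
  gcongr
  calc (2 : ℝ≥0∞) ^ (1 / p).toReal ≤ 2 ^ (1 : ℝ) := by
        refine ENNReal.rpow_le_rpow_of_exponent_le (by norm_num) ?_
        rw [← ENNReal.toReal_one]
        exact ENNReal.toReal_mono (by simp) (by simpa using hp)
    _ = 2 := by simp

/-- One passes from the tilted law to `P` at the cost of a factor 2, uses the variance bound there,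
and returns at the cost of another factor 2. -/
theorem lintegral_sq_resid_tilt_le (hP : Basic ε q C P) (hM : MCAR P) (hε : 0 < ε) (hq : 2 < q)
    (hJ : IsTilt P f J) {Φ : Bool × 𝓧 → ℝ≥0∞} (hΦ : Measurable Φ) :
    ∫⁻ z, ‖z.Y - muStar P z.T z.X‖ₑ ^ 2 * Φ (z.T, z.X) ∂(recouple P J)
      ≤ ENNReal.ofReal (4 * C) * ∫⁻ z, Φ (z.T, z.X) ∂(recouple P J) := by
  have key : ∀ s : Bool,
      ∫⁻ z in treated s, ‖z.Y - muStar P z.T z.X‖ₑ ^ 2 * Φ (z.T, z.X) ∂(recouple P J)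
        ≤ ENNReal.ofReal (4 * C) * ∫⁻ z in treated s, Φ (z.T, z.X) ∂(recouple P J) := by
    intro s
    have e1 : ∫⁻ z in treated s, ‖z.Y - muStar P z.T z.X‖ₑ ^ 2 * Φ (z.T, z.X) ∂(recouple P J)
        = ∫⁻ z in treated s, ‖z.Ypot s - muStar P s z.X‖ₑ ^ 2 * Φ (s, z.X) ∂(recouple P J) :=
      setLIntegral_congr_fun (measurableSet_treated s) fun z hz => by
        have hz' : z.T = s := hz
        rw [Y_eq_of_treated hz, hz']
    have e2 : ∫⁻ z in treated s, Φ (z.T, z.X) ∂(recouple P J)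
        = ∫⁻ z in treated s, Φ (s, z.X) ∂(recouple P J) :=
      setLIntegral_congr_fun (measurableSet_treated s) fun z hz => by
        have hz' : z.T = s := hz
        rw [hz']
    rw [e1, e2]
    calc _ ≤ 2 * ∫⁻ z in treated s, ‖z.Ypot s - muStar P s z.X‖ₑ ^ 2 * Φ (s, z.X) ∂P :=
          tilt_treated_le hP hJ s
            (φ := fun v => ‖v.2 - muStar P s v.1‖ₑ ^ 2 * Φ (s, v.1)) (by fun_prop)
      _ ≤ 2 * (ENNReal.ofReal C * ∫⁻ z in treated s, Φ (s, z.X) ∂P) := by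
          gcongr
          exact lintegral_sq_resid_le hP hM.mar hε hq s (φ := fun x => Φ (s, x)) (by fun_prop)
      _ ≤ 2 * (ENNReal.ofReal C * (2 * ∫⁻ z in treated s, Φ (s, z.X) ∂(recouple P J))) := by
          gcongr
          exact le_tilt_treated hP hJ s (φ := fun v => Φ (s, v.1)) (by fun_prop)
      _ = _ := by
          rw [ENNReal.ofReal_mul (by norm_num), show ENNReal.ofReal 4 = 2 * 2 by
            rw [show (4 : ℝ) = 2 * 2 by norm_num, ENNReal.ofReal_mul (by norm_num)]; simp]
          ring
  rw [lintegral_eq_add_treated, lintegral_eq_add_treated (recouple P J) (fun z => Φ (z.T, z.X)),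
    mul_add]
  exact add_le_add (key true) (key false)

theorem memLp_muStar_tilt (hP : Basic ε q C P) (hM : MCAR P) (hε : 0 < ε) (hq : 2 < q)
    (hJ : IsTilt P f J) : MemLp (fun z => muStar P z.T z.X) 2 (recouple P J) := by
  have h : ∀ s, MemLp (fun z => muStar P s z.X) 2 (recouple P J) := fun s =>
    ⟨((measurable_muStar P s).comp measurable_popX).aestronglyMeasurable,
      (eLpNorm_tilt_le hJ s (φ := fun v => muStar P s v.1) (by fun_prop)
      (by norm_num) (by norm_num)).trans_lt
        (ENNReal.mul_lt_top (by norm_num) (memLp_muStar hP hM.mar hε hq s).2)⟩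
  refine ((h true).norm.add (h false).norm).mono
    (measurable_muStar_TX P).aestronglyMeasurable (ae_of_all _ fun z => ?_)
  have e : ‖((fun z : Pop 𝓧 => ‖muStar P true z.X‖) + fun z : Pop 𝓧 => ‖muStar P false z.X‖) z‖
      = |muStar P true z.X| + |muStar P false z.X| :=
    Real.norm_of_nonneg (add_nonneg (abs_nonneg _) (abs_nonneg _))
  rw [e, Real.norm_eq_abs]
  cases z.T
  · linarith [abs_nonneg (muStar P true z.X)]
  · linarith [abs_nonneg (muStar P false z.X)]

theorem moment_tilt (hP : Basic ε q C P) (hq : 2 < q) (hJ : IsTilt P f J) (s : Bool) :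
    eLpNorm (Pop.Ypot s) (ENNReal.ofReal q) (recouple P J) ≤ ENNReal.ofReal (4 * C) := by
  refine (eLpNorm_tilt_le hJ s (φ := Prod.snd) measurable_snd
    (by rw [← ENNReal.ofReal_one]; exact ENNReal.ofReal_le_ofReal (by linarith))
    ENNReal.ofReal_ne_top).trans ?_
  calc 2 * eLpNorm (fun z => z.Ypot s) (ENNReal.ofReal q) P
      ≤ ENNReal.ofReal 4 * ENNReal.ofReal C := by
        refine mul_le_mul' ?_ (hP.moment s)
        rw [show (2 : ℝ≥0∞) = ENNReal.ofReal 2 by simp]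
        exact ENNReal.ofReal_le_ofReal (by norm_num)
    _ = _ := (ENNReal.ofReal_mul (by norm_num)).symm

theorem memLp_Y_of_memLp {Q : Measure (Pop 𝓧)} (h : ∀ s, MemLp (Pop.Ypot s) 2 Q) :
    MemLp Pop.Y 2 Q := by
  refine ((h true).norm.add (h false).norm).mono (by fun_prop) (ae_of_all _ fun z => ?_)
  have e : ‖((fun z : Pop 𝓧 => ‖z.Ypot true‖) + fun z : Pop 𝓧 => ‖z.Ypot false‖) z‖
      = |z.Ypot true| + |z.Ypot false| :=
    Real.norm_of_nonneg (add_nonneg (abs_nonneg _) (abs_nonneg _))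
  rw [e, Real.norm_eq_abs, Pop.Y]
  cases z.T
  · linarith [abs_nonneg (z.Ypot true)]
  · linarith [abs_nonneg (z.Ypot false)]

theorem condVar_tilt (hP : Basic ε q C P) (hM : MCAR P) (hε : 0 < ε) (hq : 2 < q) (hC : 0 < C)
    (hJ : IsTilt P f J) : ∀ᵐ z ∂(recouple P J),
      condVar (MeasurableSpace.comap (fun z : Pop 𝓧 => (z.T, z.X)) inferInstance) Pop.Y
        (recouple P J) z ≤ 4 * C := by
  have hmu := memLp_muStar_tilt hP hM hε hq hJ
  have hYs : ∀ s, MemLp (Pop.Ypot s) 2 (recouple P J) := fun s =>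
    ⟨by fun_prop, (eLpNorm_tilt_le hJ s (φ := Prod.snd) (by fun_prop)
      (by norm_num) (by norm_num)).trans_lt
        (ENNReal.mul_lt_top (by norm_num) (hP.memLp_Ypot hq s).2)⟩
  have hY := memLp_Y_of_memLp hYs
  have hd : MemLp (fun z => z.Y - muStar P z.T z.X) 2 (recouple P J) := hY.sub hmu
  have h1 := condVar_ae_le_condExp_sq_sub (measurable_TX (𝓧 := 𝓧)).comap_le hY hmu
    ((measurable_muStar_uncurry P).stronglyMeasurable.comp_measurable
      (comap_measurable (fun z : Pop 𝓧 => (z.T, z.X))))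
  refine h1.trans (condExp_le_const_of_setIntegral_le measurable_TX.comap_le hd.integrable_sq ?_)
  rintro S ⟨B, hB, rfl⟩
  have hS : MeasurableSet ((fun z : Pop 𝓧 => (z.T, z.X)) ⁻¹' B) := measurable_TX hB
  have h2 := lintegral_sq_resid_tilt_le hP hM hε hq hJ (Φ := B.indicator 1)
    (measurable_one.indicator hB)
  have e1 : ∫⁻ z, B.indicator (1 : Bool × 𝓧 → ℝ≥0∞) (z.T, z.X) ∂(recouple P J)
      = recouple P J ((fun z : Pop 𝓧 => (z.T, z.X)) ⁻¹' B) := by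
    rw [← lintegral_indicator_one hS]; rfl
  have e2 : ∫⁻ z, ‖z.Y - muStar P z.T z.X‖ₑ ^ 2 * B.indicator (1 : Bool × 𝓧 → ℝ≥0∞) (z.T, z.X)
        ∂(recouple P J)
      = ENNReal.ofReal (∫ z in (fun z : Pop 𝓧 => (z.T, z.X)) ⁻¹' B,
          (z.Y - muStar P z.T z.X) ^ 2 ∂(recouple P J)) := by
    rw [ofReal_integral_eq_lintegral_ofReal hd.integrable_sq.integrableOn
      (ae_of_all _ fun z => sq_nonneg _), ← lintegral_indicator hS]
    refine lintegral_congr fun z => ?_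
    by_cases hz : (z.T, z.X) ∈ B
    · have hz' : z ∈ (fun z : Pop 𝓧 => (z.T, z.X)) ⁻¹' B := hz
      rw [Set.indicator_of_mem hz, Set.indicator_of_mem hz', Pi.one_apply, mul_one, ← sq_abs,
        ENNReal.ofReal_pow (abs_nonneg _), ← Real.norm_eq_abs, ofReal_norm]
    · have hz' : z ∉ (fun z : Pop 𝓧 => (z.T, z.X)) ⁻¹' B := hz
      rw [Set.indicator_of_notMem hz, Set.indicator_of_notMem hz', mul_zero]
  rw [e1, e2, ← ofReal_measureReal, ← ENNReal.ofReal_mul (by positivity)] at h2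
  exact (ENNReal.ofReal_le_ofReal_iff (by positivity)).1 h2

/-- The tilt changes neither the propensity as a function of `X` nor the labelling probability, so
`ε` survives unchanged; only `C` grows, by a factor that does not depend on the tilt. -/
theorem basic_tilt (hP : Basic ε q C P) (hM : MCAR P) (hε : 0 < ε) (hq : 2 < q) (hC : 0 < C)
    (hJ : IsTilt P f J) : Basic ε q (4 * C) (recouple P J) where
  unconfounded t := recouple_unconfounded P t
  overlap_treatment := by
    filter_upwards [tilt_propensity hP hJ true, tilt_propensity hP hJ false] with z h1 h2
    rw [propensity_false] at h2
    exact ⟨h1, by linarith⟩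
  overlap_label t := by
    filter_upwards [(recouple_mcar P (J := J)).rStar_ae_eq hε t (tilt_propensity hP hJ t)]
      with z hz
    rw [hz]
    refine ⟨?_, measureReal_le_one⟩
    rw [recouple_labelProb]
    exact hP.le_labelProb hM hε
  condVar_le := condVar_tilt hP hM hε hq hC hJ
  moment t := moment_tilt hP hq hJ t

end Recoupling

/-! ### Bounded directions and their observed scores -/

theorem lintegral_ofReal_add_centred {β : Type*} [MeasurableSpace β] {ν : Measure β}
    [IsProbabilityMeasure ν] {h : β → ℝ} (hh : Measurable h) {B : ℝ} (hB : ∀ y, |h y| ≤ B)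
    (h0 : ∫ y, h y ∂ν = 0) {c t : ℝ} (hc : ∀ y, 0 ≤ c + t * h y) :
    ∫⁻ y, ENNReal.ofReal (c + t * h y) ∂ν = ENNReal.ofReal c := by
  have hi : Integrable h ν := Integrable.of_bound hh.aestronglyMeasurable B (ae_of_all _ hB)
  have hi2 : Integrable (fun y => c + t * h y) ν := (integrable_const c).add (hi.const_mul t)
  rw [← ofReal_integral_eq_lintegral_ofReal hi2 (ae_of_all _ hc), integral_add (integrable_const c) (hi.const_mul t), integral_const_mul, h0]
  simp

section Direction

variable {𝓧 : Type*} [MeasurableSpace 𝓧] [StandardBorelSpace 𝓧] {ε q C : ℝ}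
  {P : Measure (Pop 𝓧)} [IsProbabilityMeasure P]

/-- average over the label of a function of the observation -/
def labelMix (ρ : Measure Bool) (F : Obs 𝓧 → ℝ≥0∞) (b : Bool) (v : 𝓧 × ℝ) : ℝ≥0∞ :=
  F (v.1, b, true, v.2) * ρ {true} + F (v.1, b, false, 0) * ρ {false}

theorem measurable_labelMix (ρ : Measure Bool) {F : Obs 𝓧 → ℝ≥0∞} (hF : Measurable F) (b : Bool) :
    Measurable (labelMix ρ F b) := by
  unfold labelMix
  exact ((hF.comp (by fun_prop)).mul_const _).add ((hF.comp (by fun_prop)).mul_const _)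

/-- The observed law involves the propensity, the labelling probability and the laws of `(X, Y(s))`
for each `s` separately. The joint law of the two potential outcomes does not enter, which is why
recoupling is invisible. -/
theorem lintegral_obs {Q : Measure (Pop 𝓧)} [IsProbabilityMeasure Q] (hM : MCAR Q)
    (hu : ∀ t : Bool, Pop.Ypot t ⟂ᵢ[Pop.X, measurable_X; Q] Pop.T) {F : Obs 𝓧 → ℝ≥0∞}
    (hF : Measurable F) :
    ∫⁻ z, F z.obs ∂Q
      = ∫⁻ z, ENNReal.ofReal (propensity Q true z.X)
          * labelMix (Q.map Pop.R) F true (z.X, z.Ypot true) ∂Q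
        + ∫⁻ z, ENNReal.ofReal (propensity Q false z.X)
          * labelMix (Q.map Pop.R) F false (z.X, z.Ypot false) ∂Q := by
  set ob : Bool × 𝓧 × Bool × ℝ × ℝ → Obs 𝓧 := fun c => Pop.obs (c.2.1, c.2.2.1, c.2.2.2.1, c.2.2.2.2, c.1)
    with hob
  have hobm : Measurable ob := measurable_obs.comp (by fun_prop)
  have hcm : Measurable fun z : Pop 𝓧 => (z.X, z.T, z.Ypot false, z.Ypot true) := by fun_prop
  have e1 : ∫⁻ z, F z.obs ∂Q = ∫⁻ z, labelMix (Q.map Pop.R) F z.T (z.X, z.Y) ∂Q := by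
    have h1 := (indepFun_iff_map_prod_eq_prod_map_map (by fun_prop) (by fun_prop)).1 hM
    have h2 : ∫⁻ z, F z.obs ∂Q
        = ∫⁻ c, F (ob c) ∂(Q.map fun z => (z.R, (z.X, z.T, z.Ypot false, z.Ypot true))) := by
      rw [lintegral_map (f := fun c => F (ob c)) (hF.comp hobm) (by fun_prop)]
      rfl
    have hFo : Measurable fun c => F (ob c) := hF.comp hobm
    rw [h2, h1, lintegral_prod_symm' _ hFo, lintegral_map hFo.lintegral_prod_left' hcm]
    refine lintegral_congr fun z => ?_
    rw [lintegral_fintype, Fintype.sum_bool]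
    rfl
  rw [e1, lintegral_eq_add_treated,
    ← setLIntegral_treated hu true (φ := labelMix (Q.map Pop.R) F true) (measurable_labelMix _ hF _),
    ← setLIntegral_treated hu false (φ := labelMix (Q.map Pop.R) F false)
      (measurable_labelMix _ hF _)]
  congr 1 <;>
  · refine setLIntegral_congr_fun (measurableSet_treated _) fun z hz => ?_
    have hz' : z.T = _ := hz
    simp only [hz', Y_eq_of_treated hz]

/-- A bounded perturbation of the law of the covariates (by `g`) and of the conditional laws of the
potential outcomes (by `h`). -/
structure Direction (P : Measure (Pop 𝓧)) [IsProbabilityMeasure P] where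
  /-- perturbation of the covariates -/
  g : 𝓧 → ℝ
  /-- perturbation of the potential outcomes -/
  h : Bool → 𝓧 × ℝ → ℝ
  /-- common bound -/
  B : ℝ
  measurable_g : Measurable g
  measurable_h : ∀ s, Measurable (h s)
  pos : 0 < B
  abs_g_le : ∀ x, |g x| ≤ B
  abs_h_le : ∀ s v, |h s v| ≤ B
  centred_g : ∫ z, g z.X ∂P = 0
  centred_h : ∀ s x, ∫ y, h s (x, y) ∂(outcomeKernel P s x) = 0

namespace Direction

variable (d : Direction P) {t : ℝ}

/-- the perturbation of the joint law of covariates and potential outcomes -/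
def total (j : 𝓧 × ℝ × ℝ) : ℝ := d.g j.1 + d.h false (j.1, j.2.1) + d.h true (j.1, j.2.2)

/-- score of the observed data -/
def score (o : Obs 𝓧) : ℝ :=
  d.g o.X + armInd false o * d.h false (o.X, o.Y) + armInd true o * d.h true (o.X, o.Y)

/-- perturbed law of covariates and potential outcomes -/
def law (t : ℝ) : Measure (𝓧 × ℝ × ℝ) :=
  (indepOutcomes P).withDensity fun j => ENNReal.ofReal (1 + t * d.total j)

theorem measurable_total : Measurable d.total := by
  have h1 := d.measurable_g
  have h2 := d.measurable_h
  unfold total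
  exact ((h1.comp measurable_fst).add ((h2 false).comp (by fun_prop))).add
    ((h2 true).comp (by fun_prop))

theorem measurable_score : Measurable d.score := by
  have h1 := d.measurable_g
  have h2 := d.measurable_h
  unfold score
  exact ((h1.comp measurable_obsX).add ((measurable_armInd _).mul ((h2 false).comp
    (measurable_obsX.prodMk measurable_obsY)))).add ((measurable_armInd _).mul ((h2 true).comp
    (measurable_obsX.prodMk measurable_obsY)))

theorem abs_mul_le (ht : |t| * (3 * d.B) ≤ 1 / 2) {a b c : ℝ} (ha : |a| ≤ d.B) (hb : |b| ≤ d.B)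
    (hc : |c| ≤ d.B) : |t * (a + b + c)| ≤ 1 / 2 := by
  rw [abs_mul]
  refine le_trans (mul_le_mul_of_nonneg_left ?_ (abs_nonneg t)) ht
  linarith [abs_add_le (a + b) c, abs_add_le a b]

theorem abs_total_mul_le (ht : |t| * (3 * d.B) ≤ 1 / 2) (j : 𝓧 × ℝ × ℝ) :
    |t * d.total j| ≤ 1 / 2 :=
  d.abs_mul_le ht (d.abs_g_le _) (d.abs_h_le _ _) (d.abs_h_le _ _)

theorem abs_score_le (o : Obs 𝓧) : |d.score o| ≤ 3 * d.B := by
  have h : ∀ s, |armInd s o * d.h s (o.X, o.Y)| ≤ d.B := fun s => by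
    rw [abs_mul]
    calc |armInd s o| * |d.h s (o.X, o.Y)| ≤ 1 * d.B :=
          mul_le_mul (abs_armInd_le_one s o) (d.abs_h_le _ _) (abs_nonneg _) zero_le_one
      _ = d.B := one_mul _
  unfold score
  refine (abs_add_le _ _).trans ?_
  have := abs_add_le (d.g o.X) (armInd false o * d.h false (o.X, o.Y))
  linarith [h true, h false, d.abs_g_le o.X]

theorem isTilt (ht : |t| * (3 * d.B) ≤ 1 / 2) :
    IsTilt P (fun j => 1 + t * d.total j) (d.law t) where
  measurable := (d.measurable_total.const_mul t).const_add 1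
  le j := by linarith [(abs_le.1 (d.abs_total_mul_le ht j)).1]
  ge j := by linarith [(abs_le.1 (d.abs_total_mul_le ht j)).2]
  eq := rfl

/-- integrating out the potential outcome that is not observed -/
theorem lintegral_pick_total (ht : |t| * (3 * d.B) ≤ 1 / 2) (b : Bool) (x : 𝓧) {φ : ℝ → ℝ≥0∞}
    (hφ : Measurable φ) :
    ∫⁻ y, ENNReal.ofReal (1 + t * d.total (x, y)) * φ (pick b y)
        ∂((outcomeKernel P false ×ₖ outcomeKernel P true) x)
      = ∫⁻ v, ENNReal.ofReal (1 + t * (d.g x + d.h b (x, v))) * φ v ∂(outcomeKernel P b x) := by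
  have hm : Measurable fun y : ℝ × ℝ => ENNReal.ofReal (1 + t * d.total (x, y)) * φ (pick b y) := by
    have := d.measurable_total.comp (measurable_prodMk_left (x := x))
    exact ((this.const_mul t).const_add 1).ennreal_ofReal.mul (hφ.comp (measurable_pick b))
  have hh : ∀ s, Measurable fun v => d.h s (x, v) := fun s =>
    (d.measurable_h s).comp measurable_prodMk_left
  have hpos : ∀ y0 y1, 0 ≤ 1 + t * (d.g x + d.h false (x, y0) + d.h true (x, y1)) := fun y0 y1 => by
    linarith [(abs_le.1 (d.abs_mul_le ht (d.abs_g_le x) (d.abs_h_le false (x, y0))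
      (d.abs_h_le true (x, y1)))).1]
  rw [Kernel.prod_apply]
  cases b
  · rw [lintegral_prod _ hm.aemeasurable]
    refine lintegral_congr fun y0 => ?_
    simp only [pick, total, Bool.false_eq_true, if_false]
    rw [lintegral_mul_const]
    · congr 1
      rw [← lintegral_ofReal_add_centred (hh true) (fun y => d.abs_h_le true (x, y))
        (d.centred_h true x) (c := 1 + t * (d.g x + d.h false (x, y0))) (t := t)
        fun y => by linarith [hpos y0 y]]
      refine lintegral_congr fun y1 => ?_
      congr 1; ring
    · exact ((((hh true).const_add _).const_mul t).const_add 1).ennreal_ofReal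
  · rw [lintegral_prod_symm _ hm.aemeasurable]
    refine lintegral_congr fun y1 => ?_
    simp only [pick, total, if_true]
    rw [lintegral_mul_const]
    · congr 1
      rw [← lintegral_ofReal_add_centred (hh false) (fun y => d.abs_h_le false (x, y))
        (d.centred_h false x) (c := 1 + t * (d.g x + d.h true (x, y1))) (t := t)
        fun y => by linarith [hpos y y1]]
      refine lintegral_congr fun y0 => ?_
      congr 1; ring
    · exact (((((hh false).const_add _).add_const _).const_mul t).const_add 1).ennreal_ofReal

theorem lintegral_outcomeKernel_tilt (ht : |t| * (3 * d.B) ≤ 1 / 2) (b : Bool) (x : 𝓧) :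
    ∫⁻ v, ENNReal.ofReal (1 + t * (d.g x + d.h b (x, v))) ∂(outcomeKernel P b x)
      = ENNReal.ofReal (1 + t * d.g x) := by
  rw [← lintegral_ofReal_add_centred ((d.measurable_h b).comp measurable_prodMk_left)
    (fun y => d.abs_h_le b (x, y)) (d.centred_h b x) (c := 1 + t * d.g x) (t := t)]
  · refine lintegral_congr fun v => ?_
    congr 1; simp only [Function.comp]; ring
  · intro y
    have := (abs_le.1 (d.abs_mul_le ht (d.abs_g_le x) (d.abs_h_le b (x, y))
      (c := 0) (by simpa using d.pos.le))).1
    simp only [Function.comp]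
    linarith

theorem lintegral_law (ht : |t| * (3 * d.B) ≤ 1 / 2) (b : Bool) {φ : 𝓧 × ℝ → ℝ≥0∞}
    (hφ : Measurable φ) :
    ∫⁻ j, φ (j.1, pick b j.2) ∂(d.law t)
      = ∫⁻ x, ∫⁻ v, ENNReal.ofReal (1 + t * (d.g x + d.h b (x, v))) * φ (x, v)
          ∂(outcomeKernel P b x) ∂(P.map Pop.X) := by
  have hd : Measurable fun j => ENNReal.ofReal (1 + t * d.total j) :=
    ((d.measurable_total.const_mul t).const_add 1).ennreal_ofReal
  rw [law, lintegral_withDensity_eq_lintegral_mul _ hd (by fun_prop), indepOutcomes,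
    Measure.lintegral_compProd (hd.mul (by fun_prop))]
  refine lintegral_congr fun x => ?_
  exact d.lintegral_pick_total ht b x (φ := fun v => φ (x, v)) (by fun_prop)

theorem isProbabilityMeasure_law (ht : |t| * (3 * d.B) ≤ 1 / 2) :
    IsProbabilityMeasure (d.law t) := by
  refine ⟨?_⟩
  have h := d.lintegral_law ht true (φ := fun _ => 1) measurable_const
  simp only [lintegral_one, mul_one] at h
  rw [h]
  simp_rw [d.lintegral_outcomeKernel_tilt ht]
  have h2 : ∫ x, d.g x ∂(P.map Pop.X) = 0 := by
    rw [integral_map measurable_popX.aemeasurable d.measurable_g.aestronglyMeasurable]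
    exact d.centred_g
  rw [lintegral_ofReal_add_centred d.measurable_g d.abs_g_le h2]
  · simp
  · intro x
    have := (abs_le.1 (d.abs_mul_le ht (d.abs_g_le x) (b := 0) (c := 0)
      (by simpa using d.pos.le) (by simpa using d.pos.le))).1
    linarith

theorem map_obs_recouple (hP : Basic ε q C P) (hM : MCAR P) (ht : |t| * (3 * d.B) ≤ 1 / 2) :
    (recouple P (d.law t)).map Pop.obs
      = (P.map Pop.obs).withDensity fun o => ENNReal.ofReal (1 + t * d.score o) := by
  have := d.isProbabilityMeasure_law ht
  have hd : Measurable fun o => ENNReal.ofReal (1 + t * d.score o) :=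
    ((d.measurable_score.const_mul t).const_add 1).ennreal_ofReal
  refine Measure.ext_of_lintegral _ fun F hF => ?_
  rw [lintegral_map hF measurable_obs, lintegral_withDensity_eq_lintegral_mul _ hd hF,
    lintegral_map (hd.mul hF) measurable_obs,
    lintegral_obs (recouple_mcar P) (fun s => recouple_unconfounded P s) hF, lintegral_obs hM hP.unconfounded (hd.mul hF)]
  have key : ∀ b : Bool, ∫⁻ z, ENNReal.ofReal (propensity (recouple P (d.law t)) b z.X)
        * labelMix ((recouple P (d.law t)).map Pop.R) F b (z.X, z.Ypot b) ∂(recouple P (d.law t))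
      = ∫⁻ z, ENNReal.ofReal (propensity P b z.X) * labelMix (P.map Pop.R)
          ((fun o => ENNReal.ofReal (1 + t * d.score o)) * F) b (z.X, z.Ypot b) ∂P := by
    intro b
    have hl := measurable_labelMix (P.map Pop.R) hF b
    have hl2 := measurable_labelMix (P.map Pop.R) (hd.mul hF) b
    rw [← setLIntegral_treated (fun s => recouple_unconfounded P s) b
        (φ := labelMix ((recouple P (d.law t)).map Pop.R) F b) (measurable_labelMix _ hF b),
      recouple_map_R, recouple_setLIntegral_treated P b hl,
      d.lintegral_law ht b (φ := fun v => ENNReal.ofReal (propensity P b v.1)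
        * labelMix (P.map Pop.R) F b v) (by fun_prop),
      ← lintegral_outcomeKernel P b (φ := fun v => ENNReal.ofReal (propensity P b v.1)
        * labelMix (P.map Pop.R) ((fun o => ENNReal.ofReal (1 + t * d.score o)) * F) b v)
        (by fun_prop)]
    refine lintegral_congr fun x => ?_
    have hp : Measurable fun v => ENNReal.ofReal (1 + t * (d.g x + d.h b (x, v))) :=
      (((((d.measurable_h b).comp measurable_prodMk_left).const_add _).const_mul t).const_add
        1).ennreal_ofReal
    have hx : ∀ {φ : 𝓧 × ℝ → ℝ≥0∞}, Measurable φ → Measurable fun v => φ (x, v) :=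
      fun hφ => hφ.comp measurable_prodMk_left
    have e1 : ∀ v, ENNReal.ofReal (1 + t * (d.g x + d.h b (x, v)))
        * (ENNReal.ofReal (propensity P b x) * labelMix (P.map Pop.R) F b (x, v))
        = ENNReal.ofReal (propensity P b x) * (ENNReal.ofReal (1 + t * (d.g x + d.h b (x, v)))
          * labelMix (P.map Pop.R) F b (x, v)) := fun v => by ring
    simp only [e1]
    have hpl : Measurable fun v => ENNReal.ofReal (1 + t * (d.g x + d.h b (x, v)))
        * labelMix (P.map Pop.R) F b (x, v) := hp.mul (hx hl)
    rw [lintegral_const_mul _ hpl, lintegral_const_mul _ (hx hl2)]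
    congr 1
    -- A labelled unit in arm `b` carries the perturbations of `X` and of `Y(b)`, an unlabelled unit
    -- only that of `X`.
    have s1 : ∀ v, d.score (x, b, true, v) = d.g x + d.h b (x, v) := fun v => by
      cases b <;> simp [score, armInd, Obs.X, Obs.T, Obs.R, Obs.Y]
    have s2 : d.score (x, b, false, 0) = d.g x := by
      simp [score, armInd, Obs.X, Obs.R]
    have hF1 : Measurable fun v : ℝ => F (x, b, true, v) * (P.map Pop.R) {true} :=
      (hF.comp (by fun_prop)).mul_const _
    have hpF : Measurable fun v => ENNReal.ofReal (1 + t * (d.g x + d.h b (x, v)))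
        * (F (x, b, true, v) * (P.map Pop.R) {true}) := hp.mul hF1
    simp only [labelMix, Pi.mul_apply, s1, s2, mul_add (ENNReal.ofReal _)]
    rw [lintegral_add_left hpF, lintegral_add_right _ measurable_const,
      lintegral_mul_const _ hp, d.lintegral_outcomeKernel_tilt ht b x, lintegral_const]
    simp only [measure_univ, mul_one]
    congr 1
    · refine lintegral_congr fun v => ?_
      ring
    · ring
  rw [key true, key false]

end Direction

end Direction

/-! ### Approximating the influence function by scores -/

section Influence

variable {𝓧 : Type*} [MeasurableSpace 𝓧] [StandardBorelSpace 𝓧] {ε q C : ℝ}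
  {P : Measure (Pop 𝓧)} [IsProbabilityMeasure P]

theorem condExp_X_eq_muStar (h : Basic ε q C P) (h' : MAR P) (hε : 0 < ε) (hq : 2 < q)
    (s : Bool) :
    P[Pop.Ypot s | MeasurableSpace.comap Pop.X inferInstance] =ᵐ[P] fun z => muStar P s z.X := by
  have hY := h.memLp_Ypot hq s
  have hmu := memLp_muStar h h' hε hq s
  symm
  refine ae_eq_condExp_of_forall_setIntegral_eq measurable_X.comap_le
    (hY.integrable (by norm_num)) (fun S _ _ => (hmu.integrable (by norm_num)).integrableOn) ?_
    ((measurable_muStar P s).stronglyMeasurable.comp_measurable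
      (comap_measurable Pop.X)).aestronglyMeasurable
  rintro S ⟨B, hB, rfl⟩ -
  have hS : MeasurableSet (Pop.X ⁻¹' B : Set (Pop 𝓧)) := measurable_X hB
  have e := integral_resid_mul h h' hε hq s (f := B.indicator 1) (measurable_one.indicator hB)
    (MemLp.of_bound ((measurable_one.indicator hB).comp measurable_X).aestronglyMeasurable 1
      (ae_of_all _ fun z => (norm_indicator_le_norm_self _ _).trans (by simp)))
  have e2 : ∫ z in Pop.X ⁻¹' B, (z.Ypot s - muStar P s z.X) ∂P = 0 := by
    rw [← e, ← integral_indicator hS]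
    refine integral_congr_ae (ae_of_all _ fun z => ?_)
    by_cases hz : z.X ∈ B
    · have hz' : z ∈ (Pop.X ⁻¹' B : Set (Pop 𝓧)) := hz
      simp [Set.indicator_of_mem hz, Set.indicator_of_mem hz']
    · have hz' : z ∉ (Pop.X ⁻¹' B : Set (Pop 𝓧)) := hz
      simp [Set.indicator_of_notMem hz, Set.indicator_of_notMem hz']
  rw [integral_sub (hY.integrable (by norm_num)).integrableOn
    (hmu.integrable (by norm_num)).integrableOn, sub_eq_zero] at e2
  exact e2.symm

/-- conditional mean of the clipped potential outcome -/
def clippedMean (P : Measure (Pop 𝓧)) [IsProbabilityMeasure P] (M : ℝ) (s : Bool) (x : 𝓧) : ℝ :=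
  ∫ y, clip M y ∂(outcomeKernel P s x)

@[fun_prop] theorem measurable_clippedMean (M : ℝ) (s : Bool) :
    Measurable (clippedMean P M s) := by
  have h : StronglyMeasurable fun x : 𝓧 => ∫ y, clip M y ∂(outcomeKernel P s x) :=
    ((measurable_clip M).comp (measurable_snd (α := 𝓧))).stronglyMeasurable.integral_kernel_prod_right'
  exact h.measurable

theorem abs_clippedMean_le {M : ℝ} (hM : 0 ≤ M) (s : Bool) (x : 𝓧) :
    |clippedMean P M s x| ≤ M := by
  have := norm_integral_le_of_norm_le_const (μ := outcomeKernel P s x) (f := clip M) (C := M)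
    (ae_of_all _ fun y => by rw [Real.norm_eq_abs]; exact abs_clip_le hM y)
  simpa [clippedMean] using this

/-- The difference is the conditional mean given `X` of the truncation error of the outcome, and
conditional expectation contracts `L²`. -/
theorem l2norm_clippedMean_sub_le (h : Basic ε q C P) (h' : MAR P) (hε : 0 < ε) (hq : 2 < q)
    (s : Bool) {M : ℝ} (hM : 0 ≤ M) :
    MemLp (fun z => clippedMean P M s z.X - muStar P s z.X) 2 P ∧
    l2norm P (fun z => clippedMean P M s z.X - muStar P s z.X)
      ≤ l2norm P fun z => z.Ypot s - clip M (z.Ypot s) := by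
  have hY := h.memLp_Ypot hq s
  have hcl := memLp_clip hY hM
  have h1 : P[fun z => clip M (z.Ypot s) | MeasurableSpace.comap Pop.X inferInstance]
      =ᵐ[P] fun z => clippedMean P M s z.X :=
    condExp_ae_eq_integral_condDistrib measurable_X (measurable_Ypot s).aemeasurable
      (measurable_clip M).stronglyMeasurable (hcl.integrable (by norm_num))
  have h2 : P[fun z => clip M (z.Ypot s) - z.Ypot s | MeasurableSpace.comap Pop.X inferInstance]
      =ᵐ[P] fun z => clippedMean P M s z.X - muStar P s z.X := by
    refine (condExp_sub (hcl.integrable (by norm_num)) (hY.integrable (by norm_num)) _).trans ?_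
    exact h1.sub (condExp_X_eq_muStar h h' hε hq s)
  have hd : MemLp (fun z => clip M (z.Ypot s) - z.Ypot s) 2 P := hcl.sub hY
  have hm := (hd.condExp (m := MeasurableSpace.comap Pop.X inferInstance) (by norm_num)).ae_eq h2
  refine ⟨hm, ?_⟩
  have h3 : l2norm P (fun z => z.Ypot s - clip M (z.Ypot s))
      = l2norm P fun z => clip M (z.Ypot s) - z.Ypot s := by
    unfold l2norm
    congr 1
    exact integral_congr_ae (ae_of_all _ fun z => by ring)
  rw [h3, l2norm_eq_toReal hm, l2norm_eq_toReal hd, ← eLpNorm_congr_ae h2]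
  exact ENNReal.toReal_mono hd.2.ne (eLpNorm_condExp_le_eLpNorm _ (by norm_num))

theorem integral_muStar (h : Basic ε q C P) (h' : MAR P) (hε : 0 < ε) (hq : 2 < q) (s : Bool) :
    ∫ z, muStar P s z.X ∂P = ∫ z, z.Ypot s ∂P := by
  have o := integral_resid_mul h h' hε hq s (f := fun _ => 1) measurable_const
    (memLp_const (1 : ℝ))
  simp only [mul_one] at o
  rw [integral_sub ((h.memLp_Ypot hq s).integrable (by norm_num))
    ((memLp_muStar h h' hε hq s).integrable (by norm_num))] at o
  linarith

theorem measurable_effectDev : Measurable (effectDev P) := by unfold effectDev; fun_prop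

theorem memLp_effectDev (h : Basic ε q C P) (h' : MAR P) (hε : 0 < ε) (hq : 2 < q) :
    MemLp (effectDev P) 2 P :=
  ((memLp_muStar h h' hε hq true).sub (memLp_muStar h h' hε hq false)).sub (memLp_const _)

theorem integral_effectDev (h : Basic ε q C P) (h' : MAR P) (hε : 0 < ε) (hq : 2 < q) :
    ∫ z, effectDev P z ∂P = 0 := by
  have h1 := (memLp_muStar h h' hε hq true).integrable (by norm_num)
  have h0 := (memLp_muStar h h' hε hq false).integrable (by norm_num)
  have hd : Integrable (fun z : Pop 𝓧 => muStar P true z.X - muStar P false z.X) P := h1.sub h0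
  unfold effectDev
  rw [integral_sub hd (integrable_const _), integral_sub h1 h0,
    integral_muStar h h' hε hq, integral_muStar h h' hε hq]
  simp [ate]

/-- sign of a treatment arm in the average treatment effect -/
def armSign (s : Bool) : ℝ := if s then 1 else -1

theorem abs_armSign (s : Bool) : |armSign s| = 1 := by cases s <;> simp [armSign]

/-- deviation of the conditional from the average treatment effect -/
def effect (P : Measure (Pop 𝓧)) [IsFiniteMeasure P] (x : 𝓧) : ℝ :=
  muStar P true x - muStar P false x - ate P

@[fun_prop] theorem measurable_effect : Measurable (effect P) := by unfold effect; fun_prop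

/-- efficient influence function of the average treatment effect -/
def influence (ε : ℝ) (P : Measure (Pop 𝓧)) [IsFiniteMeasure P] (o : Obs 𝓧) : ℝ :=
  augmented (armWeight ε P true) (muStar P true) true o
    - augmented (armWeight ε P false) (muStar P false) false o - ate P

theorem measurable_influence : Measurable (influence ε P) := by
  unfold influence
  fun_prop

theorem memLp_influence (h : Basic ε q C P) (hM : MCAR P) (hε : 0 < ε) (hq : 2 < q) (hC : 0 < C) :
    MemLp (influence ε P) 2 (P.map Pop.obs) := by
  have := fun s => (memLp_augmented h hq hC s (a := armWeight ε P s) (m := muStar P s)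
    (by fun_prop) (by fun_prop) (abs_armWeight_le h hM hε s) (memLp_muStar h hM.mar hε hq s)).1
  exact ((this true).sub (this false)).sub (memLp_const _)

/-- bounded direction that approximates the efficient influence function -/
def clippedDirection (h : Basic ε q C P) (hM : MCAR P) (hε : 0 < ε) (M : ℕ) :
    Direction P where
  g x := clip M (effect P x) - ∫ z, clip M (effect P z.X) ∂P
  h s v := armSign s * (armWeight ε P s v.1 * (clip M v.2 - clippedMean P M s v.1))
  -- The final `1` keeps the bound positive when `M = 0`.
  B := 2 * M + (ε ^ 2)⁻¹ * (2 * M) + 1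
  measurable_g := by fun_prop
  measurable_h s := by fun_prop
  pos := by positivity
  abs_g_le x := by
    have h1 := abs_clip_le (M := M) (by positivity) (effect P x)
    have h2 : |∫ z, clip M (effect P z.X) ∂P| ≤ M := by
      have := norm_integral_le_of_norm_le_const (μ := P) (f := fun z => clip M (effect P z.X))
        (C := M) (ae_of_all _ fun y => by rw [Real.norm_eq_abs]; exact abs_clip_le (by positivity) _)
      simpa using this
    have h3 : 0 ≤ (ε ^ 2)⁻¹ * (2 * (M : ℝ)) := by positivity
    refine (abs_sub _ _).trans ?_
    linarith
  abs_h_le s v := by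
    have h1 := abs_clip_le (M := M) (by positivity) v.2
    have h2 := abs_clippedMean_le (P := P) (M := M) (by positivity) s v.1
    have h3 : |clip M v.2 - clippedMean P M s v.1| ≤ 2 * M := by
      refine (abs_sub _ _).trans ?_
      linarith
    rw [abs_mul, abs_armSign, one_mul, abs_mul]
    have h4 := mul_le_mul (abs_armWeight_le h hM hε s v.1) h3 (abs_nonneg _) (by positivity)
    have h5 : (0 : ℝ) ≤ M := by positivity
    linarith
  centred_g := by
    have hi : Integrable (fun z : Pop 𝓧 => clip M (effect P z.X)) P :=
      Integrable.of_bound (by fun_prop : Measurable _).aestronglyMeasurable M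
        (ae_of_all _ fun y => by rw [Real.norm_eq_abs]; exact abs_clip_le (by positivity) _)
    rw [integral_sub hi (integrable_const _)]
    simp
  centred_h s x := by
    have hi : Integrable (clip M) (outcomeKernel P s x) :=
      Integrable.of_bound (measurable_clip _).aestronglyMeasurable M
        (ae_of_all _ fun y => by rw [Real.norm_eq_abs]; exact abs_clip_le (by positivity) _)
    have e : ∫ y, armSign s * (armWeight ε P s x * (clip M y - clippedMean P M s x))
        ∂(outcomeKernel P s x) = 0 := by
      rw [integral_const_mul, integral_const_mul, integral_sub hi (integrable_const _)]
      simp [clippedMean]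
    exact e

theorem clippedDirection_score_sub (h : Basic ε q C P) (hM : MCAR P) (hε : 0 < ε) (M : ℕ)
    (o : Obs 𝓧) :
    (clippedDirection h hM hε M).score o - influence ε P o
      = ((clip M (effect P o.X) - effect P o.X) - ∫ z, clip M (effect P z.X) ∂P)
        + (armInd false o * (-(armWeight ε P false o.X * ((clip M o.Y - o.Y)
            - (clippedMean P M false o.X - muStar P false o.X))))
          + armInd true o * (armWeight ε P true o.X * ((clip M o.Y - o.Y)
            - (clippedMean P M true o.X - muStar P true o.X)))) := by
  simp only [Direction.score, clippedDirection, influence, augmented, effect, armSign,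
    Bool.false_eq_true, if_false, if_true]
  ring

/-- Every discrepancy is a truncation error: of the conditional effect, of the outcomes, or of their
conditional means, the last being no larger than that of the outcomes. The weights contribute at
most `(ε ^ 2)⁻¹`. -/
theorem l2norm_clippedDirection_le (h : Basic ε q C P) (hM : MCAR P) (hε : 0 < ε) (hq : 2 < q)
    (M : ℕ) :
    l2norm (P.map Pop.obs) (fun o => (clippedDirection h hM hε M).score o - influence ε P o)
      ≤ 2 * l2norm P (fun z => effectDev P z - clip M (effectDev P z))
        + ((ε ^ 2)⁻¹ * (2 * l2norm P fun z => z.Ypot false - clip M (z.Ypot false))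
          + (ε ^ 2)⁻¹ * (2 * l2norm P fun z => z.Ypot true - clip M (z.Ypot true))) := by
  have hM0 : (0 : ℝ) ≤ M := by positivity
  have hneg : ∀ f g : Pop 𝓧 → ℝ, l2norm P (fun z => f z - g z) = l2norm P fun z => g z - f z :=
    fun f g => by
      unfold l2norm
      congr 1
      exact integral_congr_ae (ae_of_all _ fun z => by ring)
  have hD := memLp_effectDev h hM.mar hε hq
  have hDc : MemLp (fun z => clip M (effectDev P z) - effectDev P z) 2 P :=
    (memLp_clip hD hM0).sub hD
  have hg : MemLp (fun o : Obs 𝓧 => (clip M (effect P o.X) - effect P o.X)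
      - ∫ z, clip M (effect P z.X) ∂P) 2 (P.map Pop.obs) ∧
      l2norm (P.map Pop.obs) (fun o : Obs 𝓧 => (clip M (effect P o.X) - effect P o.X)
        - ∫ z, clip M (effect P z.X) ∂P)
      ≤ 2 * l2norm P (fun z => effectDev P z - clip M (effectDev P z)) := by
    have hm : Measurable fun x : 𝓧 => (clip M (effect P x) - effect P x)
        - ∫ z, clip M (effect P z.X) ∂P := by fun_prop
    -- The effect deviation has mean zero, so the centring constant is itself the mean of a
    -- truncation error; this accounts for the factor `2`.
    have e : ∫ z, clip M (effect P z.X) ∂P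
        = ∫ z, (clip M (effectDev P z) - effectDev P z) ∂P := by
      rw [integral_sub ((memLp_clip hD hM0).integrable (by norm_num))
        (hD.integrable (by norm_num)), integral_effectDev h hM.mar hε hq, sub_zero]
      rfl
    have hL : MemLp (fun z : Pop 𝓧 => (clip M (effect P z.X) - effect P z.X)
        - ∫ z, clip M (effect P z.X) ∂P) 2 P := hDc.sub (memLp_const _)
    refine ⟨(memLp_map_iff measurable_obs (hm.comp measurable_obsX)).2 hL, ?_⟩
    rw [l2norm_map_obs_X (h := fun x : 𝓧 => (clip M (effect P x) - effect P x)
        - ∫ z, clip M (effect P z.X) ∂P) hm]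
    refine (l2norm_sub_le hDc (memLp_const _)).trans ?_
    have h2 : l2norm P (fun _ => ∫ z, clip M (effect P z.X) ∂P)
        ≤ l2norm P fun z => clip M (effectDev P z) - effectDev P z := by
      rw [e]
      refine le_trans (le_of_eq ?_) (abs_integral_le_l2norm hDc)
      simp [l2norm, Real.sqrt_sq_eq_abs]
    rw [hneg (effectDev P)]
    linarith
  have harm : ∀ (s : Bool) (F : Obs 𝓧 → ℝ), Measurable F → (∀ o, |F o| = |armWeight ε P s o.X
        * ((clip M o.Y - o.Y) - (clippedMean P M s o.X - muStar P s o.X))|) →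
      MemLp (fun o => armInd s o * F o) 2 (P.map Pop.obs) ∧
        l2norm (P.map Pop.obs) (fun o => armInd s o * F o)
          ≤ (ε ^ 2)⁻¹ * (2 * l2norm P fun z => z.Ypot s - clip M (z.Ypot s)) := by
    intro s F hF hF2
    have hY := h.memLp_Ypot hq s
    have hYc : MemLp (fun z => clip M (z.Ypot s) - z.Ypot s) 2 P := (memLp_clip hY hM0).sub hY
    have hc := l2norm_clippedMean_sub_le h hM.mar hε hq s hM0
    have hL := (hYc.sub hc.1).const_mul (ε ^ 2)⁻¹
    have := memLp_armInd_mul (Q := P) (s := s) hF hL fun z hz => by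
      rw [hF2, obs_Y_of_arm hz, obs_X, abs_mul, abs_mul, abs_of_nonneg (a := (ε ^ 2)⁻¹)
        (by positivity)]
      exact mul_le_mul_of_nonneg_right (abs_armWeight_le h hM hε s z.X) (abs_nonneg _)
    refine ⟨this.1, this.2.trans ?_⟩
    rw [l2norm_const_mul, abs_of_nonneg (a := (ε ^ 2)⁻¹) (by positivity)]
    refine mul_le_mul_of_nonneg_left ?_ (by positivity)
    refine (l2norm_sub_le hYc hc.1).trans ?_
    rw [hneg (fun z => clip M (z.Ypot s))]
    linarith [hc.2]
  have a0 := harm false (fun o => -(armWeight ε P false o.X * ((clip M o.Y - o.Y)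
    - (clippedMean P M false o.X - muStar P false o.X)))) (by fun_prop) fun o => abs_neg _
  have a1 := harm true (fun o => armWeight ε P true o.X * ((clip M o.Y - o.Y)
    - (clippedMean P M true o.X - muStar P true o.X))) (by fun_prop) fun o => rfl
  simp_rw [clippedDirection_score_sub]
  refine (l2norm_add_le hg.1 (a0.1.add a1.1)).trans (add_le_add hg.2 ?_)
  exact (l2norm_add_le a0.1 a1.1).trans (add_le_add a0.2 a1.2)

theorem tendsto_clippedDirection (h : Basic ε q C P) (hM : MCAR P) (hε : 0 < ε) (hq : 2 < q) :
    Tendsto (fun M : ℕ => l2norm (P.map Pop.obs)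
      fun o => (clippedDirection h hM hε M).score o - influence ε P o) atTop (𝓝 0) := by
  have hY := fun s => tendsto_l2norm_sub_clip (h.memLp_Ypot hq s)
  have hD := tendsto_l2norm_sub_clip (memLp_effectDev h hM.mar hε hq)
  refine squeeze_zero (fun M => l2norm_nonneg _ _)
    (fun M => l2norm_clippedDirection_le h hM hε hq M) ?_
  have := (hD.const_mul 2).add ((((hY false).const_mul 2).const_mul (ε ^ 2)⁻¹).add
    (((hY true).const_mul 2).const_mul (ε ^ 2)⁻¹))
  simpa using this

theorem Basic.mono (h : Basic ε q C P) {C' : ℝ} (hC : C ≤ C') : Basic ε q C' P where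
  unconfounded := h.unconfounded
  overlap_treatment := h.overlap_treatment
  overlap_label := h.overlap_label
  condVar_le := by filter_upwards [h.condVar_le] with z hz using hz.trans hC
  moment t := (h.moment t).trans (ENNReal.ofReal_le_ofReal hC)

end Influence

/-! ### Gradient and tangent space -/

section Efficiency

variable {𝓧 : Type*} [MeasurableSpace 𝓧] [StandardBorelSpace 𝓧] {ε q C : ℝ}
  {P : ProbabilityMeasure (Pop 𝓧)}

/-- `recouple` as a probability measure -/
def recoupledLaw (P : ProbabilityMeasure (Pop 𝓧)) (J : Measure (𝓧 × ℝ × ℝ))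
    (hJ : IsProbabilityMeasure J) : ProbabilityMeasure (Pop 𝓧) :=
  ⟨recouple (P : Measure (Pop 𝓧)) J, inferInstance⟩

open Classical in
/-- one-dimensional submodel in a bounded direction -/
def Direction.path (d : Direction (P : Measure (Pop 𝓧))) (t : ℝ) : ProbabilityMeasure (Pop 𝓧) :=
  if h : t ≠ 0 ∧ |t| * (3 * d.B) ≤ 1 / 2 then
    recoupledLaw P (d.law t) (d.isProbabilityMeasure_law h.2)
  else P

theorem Direction.coe_path (d : Direction (P : Measure (Pop 𝓧))) {t : ℝ} (h0 : t ≠ 0)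
    (h : |t| * (3 * d.B) ≤ 1 / 2) :
    (d.path t : Measure (Pop 𝓧)) = recouple (P : Measure (Pop 𝓧)) (d.law t) := by
  rw [path, dif_pos ⟨h0, h⟩]
  rfl

theorem Direction.path_of_not (d : Direction (P : Measure (Pop 𝓧))) {t : ℝ}
    (h : ¬ (t ≠ 0 ∧ |t| * (3 * d.B) ≤ 1 / 2)) : d.path t = P := by
  rw [path, dif_neg h]

instance : IsProbabilityMeasure (obsLaw P) := by unfold obsLaw; infer_instance

theorem memLp_influence_obsLaw (hε : 0 < ε) (hq : 2 < q) (hC : 0 < C)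
    (h : Basic ε q C (P : Measure (Pop 𝓧))) (hM : MCAR (P : Measure (Pop 𝓧))) :
    MemLp (influence ε (P : Measure (Pop 𝓧))) 2 (obsLaw P) := memLp_influence h hM hε hq hC

theorem Direction.path_mem (d : Direction (P : Measure (Pop 𝓧))) (hε : 0 < ε) (hq : 2 < q)
    (hC : 0 < C) (h : Basic ε q C (P : Measure (Pop 𝓧))) (hM : MCAR (P : Measure (Pop 𝓧))) (t : ℝ) :
    d.path t ∈ modelMCAR 𝓧 ε q (4 * C) := by
  by_cases ht : t ≠ 0 ∧ |t| * (3 * d.B) ≤ 1 / 2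
  · have := d.isProbabilityMeasure_law ht.2
    have e := d.coe_path ht.1 ht.2
    have e' : d.path t = recoupledLaw P (d.law t) this :=
      Subtype.ext e
    rw [e']
    exact ⟨basic_tilt h hM hε hq hC (d.isTilt ht.2), recouple_mcar _⟩
  · rw [d.path_of_not ht]
    exact ⟨h.mono (by linarith), hM⟩

/-- At `t = 0` the path is `P` itself, not its recoupled version. The jump does no harm, since
differentiability in quadratic mean concerns only the observed laws, and these fit together. -/
theorem Direction.isSubmodel (d : Direction (P : Measure (Pop 𝓧))) (hε : 0 < ε) (hε' : ε < 1 / 2)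
    (hq : 2 < q) (hC : 0 < C) (h : Basic ε q C (P : Measure (Pop 𝓧)))
    (hM : MCAR (P : Measure (Pop 𝓧))) (g : Lp ℝ 2 (obsLaw P)) (hg : g =ᵐ[obsLaw P] d.score) :
    IsSubmodel (modelMCAR 𝓧) P d.path g where
  through := d.path_of_not (by simp)
  mem := ⟨ε, q, 4 * C, hε, hε', hq, by positivity,
    Eventually.of_forall (d.path_mem hε hq hC h hM)⟩
  score := by
    have hB := d.pos
    refine hasScore_of_tilt (P := obsLaw P) (b := (6 * d.B)⁻¹) d.measurable_score d.abs_score_le hg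
      (by rw [d.path_of_not (by simp)]) (by positivity) fun t ht htb => ?_
    have ht' : |t| * (3 * d.B) ≤ 1 / 2 :=
      calc |t| * (3 * d.B) ≤ (6 * d.B)⁻¹ * (3 * d.B) :=
            mul_le_mul_of_nonneg_right htb (by positivity)
        _ = 1 / 2 := by field_simp; norm_num
    rw [obsLaw, d.coe_path ht ht', d.map_obs_recouple h hM ht']
    rfl

theorem tangentSet_mcar_subset : tangentSet (modelMCAR 𝓧) P ⊆ tangentSet (modelMAR 𝓧) P := by
  rintro g ⟨Q, hQ⟩
  obtain ⟨ε, q, C, h1, h2, h3, h4, h5⟩ := hQ.mem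
  exact ⟨Q, hQ.through, ⟨ε, q, C, h1, h2, h3, h4, h5.mono fun t ht => ⟨ht.1, ht.2.mar⟩⟩, hQ.score⟩

/-- efficient influence function as an element of `L²` -/
def influenceLp (hε : 0 < ε) (hq : 2 < q) (hC : 0 < C) (h : Basic ε q C (P : Measure (Pop 𝓧)))
    (hM : MCAR (P : Measure (Pop 𝓧))) : Lp ℝ 2 (obsLaw P) :=
  (memLp_influence_obsLaw hε hq hC h hM).toLp (influence ε (P : Measure (Pop 𝓧)))

/-- The scores of `clippedDirection` belong to submodels with labels missing completely at random
and converge in `L²` to the influence function. -/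
theorem influenceLp_mem (hε : 0 < ε) (hε' : ε < 1 / 2) (hq : 2 < q) (hC : 0 < C)
    (h : Basic ε q C (P : Measure (Pop 𝓧))) (hM : MCAR (P : Measure (Pop 𝓧))) :
    influenceLp hε hq hC h hM
      ∈ (Submodule.span ℝ (tangentSet (modelMCAR 𝓧) P)).topologicalClosure := by
  have hs : ∀ M : ℕ, MemLp (clippedDirection h hM hε M).score 2 (obsLaw P) := fun M =>
    MemLp.of_bound (clippedDirection h hM hε M).measurable_score.aestronglyMeasurable _
      (ae_of_all _ (clippedDirection h hM hε M).abs_score_le)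
  refine mem_closure_of_tendsto (f := fun M : ℕ => (hs M).toLp _) (b := atTop) ?_
    (Eventually.of_forall fun M => Submodule.subset_span
      ⟨_, (clippedDirection h hM hε M).isSubmodel hε hε' hq hC h hM _ (MemLp.coeFn_toLp _)⟩)
  refine (Lp.tendsto_Lp_iff_tendsto_eLpNorm'' _ hs _ (memLp_influence_obsLaw hε hq hC h hM)).2 ?_
  have e : ∀ M : ℕ, eLpNorm ((clippedDirection h hM hε M).score - influence ε P) 2 (obsLaw P)
      = ENNReal.ofReal (l2norm (obsLaw P)
        fun o => (clippedDirection h hM hε M).score o - influence ε P o) := fun M =>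
    (ofReal_l2norm ((hs M).sub (memLp_influence_obsLaw hε hq hC h hM))).symm
  simp_rw [e]
  have := (ENNReal.continuous_ofReal.tendsto 0).comp (tendsto_clippedDirection h hM hε hq)
  rwa [ENNReal.ofReal_zero] at this

/-- A submodel comes with its own overlap constant; both truncations of the propensity are inactive
almost surely, so the candidate is the same for either constant. -/
theorem influence_ae_eq {ε' q' C' : ℝ} (h : Basic ε q C (P : Measure (Pop 𝓧)))
    (h' : Basic ε' q' C' (P : Measure (Pop 𝓧))) :
    ∀ᵐ o ∂(obsLaw P), influence ε (P : Measure (Pop 𝓧)) o = influence ε' (P : Measure (Pop 𝓧)) o := by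
  rw [obsLaw, ae_map_iff measurable_obs.aemeasurable
    (measurableSet_eq_fun measurable_influence measurable_influence)]
  have hw : ∀ s, ∀ᵐ z ∂(P : Measure (Pop 𝓧)),
      armWeight ε (P : Measure (Pop 𝓧)) s z.X = armWeight ε' (P : Measure (Pop 𝓧)) s z.X := fun s => by
    filter_upwards [h.le_propensity s, h'.le_propensity s] with z h1 h2
    rw [armWeight, armWeight, max_eq_right h1, max_eq_right h2]
  filter_upwards [hw true, hw false] with z h1 h0
  simp only [influence, augmented, obs_X, h1, h0]

/-- The derivatives of the two arm means are subtracted; the constant `ate` in the influence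
function is harmless because scores have mean zero. -/
theorem hasDerivAt_ate (hε : 0 < ε) (hq : 2 < q) (hC : 0 < C)
    (h : Basic ε q C (P : Measure (Pop 𝓧))) (hM : MCAR (P : Measure (Pop 𝓧)))
    {Q : ℝ → ProbabilityMeasure (Pop 𝓧)} {g : Lp ℝ 2 (obsLaw P)}
    (hQ : IsSubmodel (modelMAR 𝓧) P Q g) :
    HasDerivAt (fun t => ate (Q t : Measure (Pop 𝓧))) (inner ℝ (influenceLp hε hq hC h hM) g) 0 := by
  obtain ⟨rfl, ⟨ε', q', C', h1, -, h3, h4, h5⟩, hsc⟩ := hQ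
  have hgm : Measurable g := (Lp.stronglyMeasurable g).measurable
  have hg2 : MemLp g 2 ((Q 0 : Measure (Pop 𝓧)).map Pop.obs) := Lp.memLp g
  have hd := fun s => hasDerivAt_mean_Ypot (Q := fun t => (Q t : Measure (Pop 𝓧))) h1 h3 h4 h5 hM
    hgm hg2 hsc s
  have h0 := h5.self_of_nhds.1
  have hz := integral_score_eq_zero (Q := fun t => (Q t : Measure (Pop 𝓧))) hgm hg2 hsc
  refine ((hd true).sub (hd false)).congr_deriv ?_
  have ha := fun s => (memLp_augmented h0 h3 h4 s (a := armWeight ε' (Q 0 : Measure (Pop 𝓧)) s)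
    (m := muStar (Q 0 : Measure (Pop 𝓧)) s) (by fun_prop) (by fun_prop)
    (abs_armWeight_le h0 hM h1 s) (memLp_muStar h0 hM.mar h1 h3 s)).1
  have hi := fun s => integrable_mul_of_memLp (ha s) hg2
  rw [L2.inner_def]
  have e : ∫ o, inner ℝ (influenceLp hε hq hC h hM o) (g o) ∂(obsLaw (Q 0))
      = ∫ o, (augmented (armWeight ε' (Q 0 : Measure (Pop 𝓧)) true)
            (muStar (Q 0 : Measure (Pop 𝓧)) true) true o * g o
          - augmented (armWeight ε' (Q 0 : Measure (Pop 𝓧)) false)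
            (muStar (Q 0 : Measure (Pop 𝓧)) false) false o * g o
          - ate (Q 0 : Measure (Pop 𝓧)) * g o) ∂((Q 0 : Measure (Pop 𝓧)).map Pop.obs) := by
    refine integral_congr_ae ?_
    filter_upwards [(memLp_influence_obsLaw hε hq hC h hM).coeFn_toLp, influence_ae_eq h h0]
      with o e1 e2
    rw [influenceLp, e1, e2]
    simp only [RCLike.inner_apply, conj_trivial, influence]
    ring
  have hi2 : Integrable (fun o => augmented (armWeight ε' (Q 0 : Measure (Pop 𝓧)) true)
        (muStar (Q 0 : Measure (Pop 𝓧)) true) true o * g o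
      - augmented (armWeight ε' (Q 0 : Measure (Pop 𝓧)) false)
        (muStar (Q 0 : Measure (Pop 𝓧)) false) false o * g o)
      ((Q 0 : Measure (Pop 𝓧)).map Pop.obs) := (hi true).sub (hi false)
  rw [e, integral_sub hi2 ((hg2.integrable (by norm_num)).const_mul _),
    integral_sub (hi true) (hi false), integral_const_mul, hz, mul_zero, sub_zero]

end Efficiency

/-! ### Linear representation and its variance -/

section Correction

variable {𝓧 : Type*} [MeasurableSpace 𝓧]

/-- the observation that would be made of a unit if it were labelled -/
def full (z : Pop 𝓧) : Obs 𝓧 := (z.X, z.T, true, z.Y)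

@[fun_prop] theorem measurable_full : Measurable (full : Pop 𝓧 → Obs 𝓧) := by
  unfold full; fun_prop

/-- propensity score of arm `s` for a treatment propensity score `e` -/
def armPropensity (e : 𝓧 → ℝ) (s : Bool) (x : 𝓧) : ℝ := if s then e x else 1 - e x

theorem measurable_armPropensity {e : 𝓧 → ℝ} (he : Measurable e) (s : Bool) :
    Measurable (armPropensity e s) := by
  cases s
  · exact measurable_const.sub he
  · exact he

/-- contribution of arm `s` to the correction term -/
def armCorrection (e : 𝓧 → ℝ) (m : Bool × 𝓧 → ℝ) (s : Bool) : Pop 𝓧 → ℝ :=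
  (treated s).indicator fun z => (armPropensity e s z.X)⁻¹ * (z.Ypot s - m (s, z.X))

theorem correction_full (e : 𝓧 → ℝ) (m : Bool × 𝓧 → ℝ) (z : Pop 𝓧) :
    correction e m (full z) = armCorrection e m true z - armCorrection e m false z := by
  have hY : (full z).Y = z.Y := rfl
  have hT : (full z).T = z.T := rfl
  have hX : (full z).X = z.X := rfl
  rw [correction, hY, hT, hX, armCorrection, armCorrection]
  by_cases h : z.T = true
  · have h1 : z ∈ treated true := h
    have h0 : z ∉ treated false := fun h' => by
      have h'' : z.T = false := h'
      rw [h] at h''; exact absurd h'' (by simp)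
    rw [Set.indicator_of_mem h1, Set.indicator_of_notMem h0, Y_eq_of_treated h1, h]
    simp [ind, armPropensity]
  · have h' : z.T = false := by simpa using h
    have h1 : z ∉ treated true := h
    have h0 : z ∈ treated false := h'
    rw [Set.indicator_of_mem h0, Set.indicator_of_notMem h1, Y_eq_of_treated h0, h']
    simp [ind, armPropensity]

variable [StandardBorelSpace 𝓧] {ε q C : ℝ} {P : Measure (Pop 𝓧)} [IsProbabilityMeasure P]

theorem armPropensity_eStar (s : Bool) (x : 𝓧) :
    armPropensity (eStar P) s x = propensity P s x := by
  cases s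
  · rw [propensity_false]; rfl
  · rfl

/-- the outcome regression as a function of treatment and covariates -/
def regression (P : Measure (Pop 𝓧)) [IsFiniteMeasure P] (p : Bool × 𝓧) : ℝ := muStar P p.1 p.2

theorem weightedResid_ae_eq (h : Basic ε q C P) (hε : 0 < ε) :
    ∀ᵐ z ∂P, weightedResid P z = correction (eStar P) (regression P) (full z) := by
  filter_upwards [h.overlap_treatment] with z hz
  have h1 : eStar P z.X ≠ 0 := by linarith [hz.1]
  have h2 : 1 - eStar P z.X ≠ 0 := by linarith [hz.2]
  have hY : (full z).Y = z.Y := rfl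
  have hT : (full z).T = z.T := rfl
  have hX : (full z).X = z.X := rfl
  rw [correction, hY, hT, hX, weightedResid]
  cases z.T <;> simp only [ind, regression, Bool.false_eq_true, if_false, if_true] <;> field_simp <;>
    ring

theorem memLp_armCorrection (h : Basic ε q C P) (h' : MAR P) (hε : 0 < ε) (hq : 2 < q)
    (s : Bool) : MemLp (armCorrection (eStar P) (regression P) s) 2 P := by
  have hY := (h.memLp_Ypot hq s).sub (memLp_muStar h h' hε hq s)
  have hm : Measurable fun z : Pop 𝓧 => (armPropensity (eStar P) s z.X)⁻¹
      * (z.Ypot s - regression P (s, z.X)) := by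
    have := (measurable_armPropensity (measurable_eStar P) s).comp measurable_popX
    have h2 : Measurable fun z : Pop 𝓧 => regression P (s, z.X) :=
      (measurable_muStar P s).comp measurable_popX
    exact this.inv.mul ((measurable_Ypot s).sub h2)
  refine MemLp.indicator (measurableSet_treated s) ?_
  refine (hY.const_mul ε⁻¹).mono hm.aestronglyMeasurable ?_
  filter_upwards [h.le_propensity s] with z hz
  rw [armPropensity_eStar, norm_mul, norm_mul, Real.norm_eq_abs, Real.norm_eq_abs,
    abs_of_pos (inv_pos.2 (hε.trans_le hz)), Real.norm_of_nonneg (inv_pos.2 hε).le]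
  exact mul_le_mul_of_nonneg_right (inv_anti₀ hε hz) (abs_nonneg _)

theorem memLp_correction (h : Basic ε q C P) (h' : MAR P) (hε : 0 < ε) (hq : 2 < q) :
    MemLp (fun z => correction (eStar P) (regression P) (full z)) 2 P := by
  simp_rw [correction_full]
  exact (memLp_armCorrection h h' hε hq true).sub (memLp_armCorrection h h' hε hq false)

theorem memLp_weightedResid (h : Basic ε q C P) (h' : MAR P) (hε : 0 < ε) (hq : 2 < q) :
    MemLp (weightedResid P) 2 P :=
  (memLp_correction h h' hε hq).ae_eq
    ((weightedResid_ae_eq h hε).mono fun _ hz => hz.symm)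

theorem integral_armCorrection_mul (h : Basic ε q C P) (h' : MAR P) (hε : 0 < ε) (hq : 2 < q)
    (s : Bool) {f : 𝓧 → ℝ} (hf : Measurable f) (hf2 : MemLp (fun z => f z.X) 2 P) :
    ∫ z, armCorrection (eStar P) (regression P) s z * f z.X ∂P = 0 := by
  -- The maximum changes nothing almost everywhere and bounds the multiplier of `f` at every point.
  set v : 𝓧 → ℝ := fun x => (max ε (propensity P s x))⁻¹ * f x with hv
  have hv2 : MemLp (fun z : Pop 𝓧 => v z.X) 2 P := by
    refine (memLp_mul_of_bound (v := fun z : Pop 𝓧 => (max ε (propensity P s z.X))⁻¹)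
      (by fun_prop) (W := ε⁻¹) (fun z => ?_) hf2).1
    rw [abs_of_pos (inv_pos.2 (lt_max_of_lt_left hε))]
    exact inv_anti₀ hε (le_max_left _ _)
  rw [← setIntegral_treated_resid_mul h h' hε hq s (f := v) (by fun_prop) hv2,
    ← integral_indicator (measurableSet_treated s)]
  refine integral_congr_ae ?_
  filter_upwards [h.le_propensity s] with z hz
  by_cases hzs : z ∈ treated s
  · rw [armCorrection, Set.indicator_of_mem hzs, Set.indicator_of_mem hzs, armPropensity_eStar,
      regression]
    simp only [hv]
    rw [max_eq_right hz]
    ring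
  · rw [armCorrection, Set.indicator_of_notMem hzs, Set.indicator_of_notMem hzs, zero_mul]

theorem integral_correction_mul (h : Basic ε q C P) (h' : MAR P) (hε : 0 < ε) (hq : 2 < q)
    {f : 𝓧 → ℝ} (hf : Measurable f) (hf2 : MemLp (fun z => f z.X) 2 P) :
    ∫ z, correction (eStar P) (regression P) (full z) * f z.X ∂P = 0 := by
  simp_rw [correction_full, sub_mul]
  rw [integral_sub (integrable_mul_of_memLp (memLp_armCorrection h h' hε hq true) hf2)
    (integrable_mul_of_memLp (memLp_armCorrection h h' hε hq false) hf2),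
    integral_armCorrection_mul h h' hε hq true hf hf2,
    integral_armCorrection_mul h h' hε hq false hf hf2, sub_zero]

theorem integral_weightedResid_mul (h : Basic ε q C P) (h' : MAR P) (hε : 0 < ε) (hq : 2 < q)
    {f : 𝓧 → ℝ} (hf : Measurable f) (hf2 : MemLp (fun z => f z.X) 2 P) :
    ∫ z, weightedResid P z * f z.X ∂P = 0 := by
  rw [← integral_correction_mul h h' hε hq hf hf2]
  refine integral_congr_ae ?_
  filter_upwards [weightedResid_ae_eq h hε] with z hz
  rw [hz]

theorem measurable_weightedResid : Measurable (weightedResid P) := by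
  have h1 : Measurable fun z : Pop 𝓧 => ind z.T :=
    (measurable_of_finite ind).comp measurable_popT
  have h2 := measurable_muStar_TX P
  unfold weightedResid
  fun_prop

/-- Whatever is computed from covariates, treatment and potential outcomes is independent of the
label, so a label weight factors out of the integral. -/
theorem MCAR.integral_mul (hM : MCAR P) {f : Pop 𝓧 → ℝ} {F : 𝓧 × Bool × ℝ × ℝ → ℝ}
    (hF : Measurable F) (hf : ∀ z, f z = F (core z)) (φ : Bool → ℝ) :
    ∫ z, φ z.R * f z ∂P = (∫ z, φ z.R ∂P) * ∫ z, f z ∂P := by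
  have h1 : IndepFun (fun z : Pop 𝓧 => φ z.R) f P := by
    have := hM.comp (φ := φ) (ψ := F) (measurable_of_finite φ) hF
    have e : f = F ∘ fun z : Pop 𝓧 => (z.X, z.T, z.Ypot false, z.Ypot true) := funext hf
    rw [e]; exact this
  have hfm : Measurable f := by
    rw [show f = F ∘ core from funext hf]; exact hF.comp measurable_core
  exact h1.integral_fun_mul_eq_mul_integral
    ((measurable_of_finite φ).comp measurable_popR).aestronglyMeasurable hfm.aestronglyMeasurable

/-- the unit that has the given covariates, treatment and potential outcomes, and is labelled -/
def ofCore (c : 𝓧 × Bool × ℝ × ℝ) : Pop 𝓧 := (c.1, c.2.1, c.2.2.1, c.2.2.2, true)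

theorem measurable_ofCore : Measurable (ofCore : 𝓧 × Bool × ℝ × ℝ → Pop 𝓧) := by
  unfold ofCore; fun_prop

/-- probability that the label lies in the set with indicator `β` -/
def selectProb (P : Measure (Pop 𝓧)) (β : Bool → ℝ) : ℝ := ∫ z, β z.R ∂P

theorem integrable_label (φ : Bool → ℝ) : Integrable (fun z : Pop 𝓧 => φ z.R) P := by
  refine Integrable.of_bound ((measurable_of_finite φ).comp measurable_popR).aestronglyMeasurable
    (|φ true| + |φ false|) (ae_of_all _ fun z => ?_)
  rw [Real.norm_eq_abs]
  cases z.R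
  · linarith [abs_nonneg (φ true)]
  · linarith [abs_nonneg (φ false)]

theorem selectProb_ind : selectProb P ind = labelProb P := by
  have : ∀ z : Pop 𝓧, ind z.R = ({z : Pop 𝓧 | z.R = true}).indicator 1 z := fun z => by
    by_cases h : z.R = true
    · rw [Set.indicator_of_mem (by exact h), h]; simp [ind]
    · rw [Set.indicator_of_notMem (by exact h)]; simp [ind, h]
  rw [selectProb, integral_congr_ae (ae_of_all _ this)]
  exact integral_indicator_one (measurable_popR (measurableSet_singleton true))

/-- linear representation of the estimator that imputes the outcomes of the units with label in the
set with indicator `β` -/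
def linearized (P : Measure (Pop 𝓧)) [IsFiniteMeasure P] (β : Bool → ℝ) (z : Pop 𝓧) : ℝ :=
  (selectProb P β)⁻¹ * (β z.R * effectDev P z) + (labelProb P)⁻¹ * (ind z.R * weightedResid P z)

theorem memLp_label_mul {f : Pop 𝓧 → ℝ} (hf : MemLp f 2 P) (φ : Bool → ℝ) :
    MemLp (fun z => φ z.R * f z) 2 P := by
  refine (memLp_mul_of_bound (v := fun z : Pop 𝓧 => φ z.R)
    ((measurable_of_finite φ).comp measurable_popR) (W := |φ true| + |φ false|) (fun z => ?_) hf).1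
  cases z.R
  · linarith [abs_nonneg (φ true)]
  · linarith [abs_nonneg (φ false)]

theorem memLp_linearized (h : Basic ε q C P) (h' : MAR P) (hε : 0 < ε) (hq : 2 < q)
    (β : Bool → ℝ) : MemLp (linearized P β) 2 P :=
  ((memLp_label_mul (memLp_effectDev h h' hε hq) β).const_mul _).add
    ((memLp_label_mul (memLp_weightedResid h h' hε hq) ind).const_mul _)

theorem effectDev_eq_core (z : Pop 𝓧) : effectDev P z = (effectDev P ∘ ofCore) (core z) := rfl

theorem weightedResid_eq_core (z : Pop 𝓧) :
    weightedResid P z = (weightedResid P ∘ ofCore) (core z) := rfl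

theorem integral_label_mul_effectDev (h : Basic ε q C P) (hM : MCAR P) (hε : 0 < ε) (hq : 2 < q)
    (β : Bool → ℝ) : ∫ z, β z.R * effectDev P z ∂P = 0 := by
  rw [hM.integral_mul (measurable_effectDev.comp measurable_ofCore) effectDev_eq_core,
    integral_effectDev h hM.mar hε hq, mul_zero]

theorem integral_label_mul_weightedResid (h : Basic ε q C P) (hM : MCAR P) (hε : 0 < ε)
    (hq : 2 < q) (β : Bool → ℝ) : ∫ z, β z.R * weightedResid P z ∂P = 0 := by
  rw [hM.integral_mul (measurable_weightedResid.comp measurable_ofCore) weightedResid_eq_core]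
  have := integral_weightedResid_mul h hM.mar hε hq (f := fun _ => 1) measurable_const
    (memLp_const (1 : ℝ))
  simp only [mul_one] at this
  rw [this, mul_zero]

theorem integral_linearized (h : Basic ε q C P) (hM : MCAR P) (hε : 0 < ε) (hq : 2 < q)
    (β : Bool → ℝ) : ∫ z, linearized P β z ∂P = 0 := by
  unfold linearized
  have hD := (memLp_label_mul (memLp_effectDev h hM.mar hε hq) β).integrable (by norm_num)
  have hH := (memLp_label_mul (memLp_weightedResid h hM.mar hε hq) ind).integrable (by norm_num)
  rw [integral_add (hD.const_mul _) (hH.const_mul _), integral_const_mul, integral_const_mul,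
    integral_label_mul_effectDev h hM hε hq, integral_label_mul_weightedResid h hM hε hq]
  ring

/-- `β` is an indicator, so squaring it changes nothing; independence of the label factors its mean
out, which cancels one of the two powers of each normalization. The cross term vanishes as the
weighted residual is orthogonal to functions of `X`. -/
theorem integral_sq_linearized (h : Basic ε q C P) (hM : MCAR P) (hε : 0 < ε) (hq : 2 < q)
    {β : Bool → ℝ} (hβ : ∀ r, β r ^ 2 = β r) (hp : selectProb P β ≠ 0) :
    ∫ z, linearized P β z ^ 2 ∂P
      = 1 / selectProb P β * (∫ z, effectDev P z ^ 2 ∂P)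
        + 1 / labelProb P * ∫ z, weightedResid P z ^ 2 ∂P := by
  have hl : labelProb P ≠ 0 := (hε.trans_le (h.le_labelProb hM hε)).ne'
  have hD := memLp_effectDev h hM.mar hε hq
  have hH := memLp_weightedResid h hM.mar hε hq
  have hi : ∀ r, ind r ^ 2 = ind r := fun r => by cases r <;> simp [ind]
  have e : ∀ z, linearized P β z ^ 2 = ((selectProb P β)⁻¹ ^ 2 * (β z.R * effectDev P z ^ 2)
      + (labelProb P)⁻¹ ^ 2 * (ind z.R * weightedResid P z ^ 2))
      + 2 * (selectProb P β)⁻¹ * (labelProb P)⁻¹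
        * ((β z.R * ind z.R) * (weightedResid P z * effectDev P z)) := fun z => by
    unfold linearized
    linear_combination (selectProb P β)⁻¹ ^ 2 * effectDev P z ^ 2 * hβ z.R
      + (labelProb P)⁻¹ ^ 2 * weightedResid P z ^ 2 * hi z.R
  have hb : ∀ (φ : Bool → ℝ) {f : Pop 𝓧 → ℝ}, Integrable f P →
      Integrable (fun z => φ z.R * f z) P := fun φ f hf => by
    refine hf.bdd_mul (c := |φ true| + |φ false|)
      ((measurable_of_finite φ).comp measurable_popR).aestronglyMeasurable (ae_of_all _ fun z => ?_)
    rw [Real.norm_eq_abs]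
    cases z.R
    · linarith [abs_nonneg (φ true)]
    · linarith [abs_nonneg (φ false)]
  have i1 := (hb β hD.integrable_sq).const_mul ((selectProb P β)⁻¹ ^ 2)
  have i2 := (hb ind hH.integrable_sq).const_mul ((labelProb P)⁻¹ ^ 2)
  have i3 := (hb (fun r => β r * ind r) (integrable_mul_of_memLp hH hD)).const_mul
    (2 * (selectProb P β)⁻¹ * (labelProb P)⁻¹)
  have hDm : Measurable (effectDev P ∘ ofCore) := measurable_effectDev.comp measurable_ofCore
  have hHm : Measurable (weightedResid P ∘ ofCore) := measurable_weightedResid.comp measurable_ofCore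
  have c1 := hM.integral_mul (f := fun z => effectDev P z ^ 2) (hDm.pow_const 2) (fun z => rfl) β
  have c2 := hM.integral_mul (f := fun z => weightedResid P z ^ 2) (hHm.pow_const 2) (fun z => rfl)
    ind
  have c3 := hM.integral_mul (f := fun z => weightedResid P z * effectDev P z) (hHm.mul hDm)
    (fun z => rfl) (fun r => β r * ind r)
  have c4 : ∫ z, weightedResid P z * effectDev P z ∂P = 0 :=
    integral_weightedResid_mul h hM.mar hε hq (f := effect P) (by fun_prop) hD
  have i12 : Integrable (fun z : Pop 𝓧 => (selectProb P β)⁻¹ ^ 2 * (β z.R * effectDev P z ^ 2)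
      + (labelProb P)⁻¹ ^ 2 * (ind z.R * weightedResid P z ^ 2)) P := i1.add i2
  rw [integral_congr_ae (ae_of_all _ e), integral_add i12 i3, integral_add i1 i2,
    integral_const_mul, integral_const_mul, integral_const_mul, c1, c2, c3, c4,
    ← selectProb, ← selectProb, selectProb_ind]
  field_simp
  ring

/-- This joins the two halves of the theorem: the efficient influence function is the linear term of
the estimator that imputes on all units, so the bound equals that asymptotic variance. -/
theorem influence_obs_ae_eq (h : Basic ε q C P) (hε : 0 < ε) :
    ∀ᵐ z ∂P, influence ε P z.obs = linearized P (fun _ => 1) z := by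
  filter_upwards [weightedResid_ae_eq h hε, h.le_propensity true, h.le_propensity false]
    with z hz h1 h0
  have key : ∀ s, ε ≤ propensity P s z.X →
      augmented (armWeight ε P s) (muStar P s) s z.obs
        = muStar P s z.X
          + (labelProb P)⁻¹ * (ind z.R * armCorrection (eStar P) (regression P) s z) := by
    intro s hs
    rw [augmented, armInd_obs_mul s z (fun y => armWeight ε P s z.obs.X * (y - muStar P s z.obs.X)),
      obs_X, armWeight, max_eq_right hs, armCorrection]
    congr 1
    by_cases hT : z ∈ treated s
    · rw [Set.indicator_of_mem hT, armPropensity_eStar, regression]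
      by_cases hR : z.R = true
      · rw [Set.indicator_of_mem (show z ∈ arm s from ⟨hT, hR⟩), hR, ind, if_pos rfl, mul_inv]; ring
      · rw [Set.indicator_of_notMem (fun hc => hR hc.2), ind, if_neg hR]; ring
    · rw [Set.indicator_of_notMem (fun hc => hT hc.1), Set.indicator_of_notMem hT]; ring
  have hp : selectProb P (fun _ => 1) = 1 := by simp [selectProb]
  rw [influence, key true h1, key false h0, linearized, hz, correction_full, hp, effectDev]
  ring

end Correction

/-! ### The efficiency bound in both models -/

section Bound

variable {𝓧 : Type*} [MeasurableSpace 𝓧] [StandardBorelSpace 𝓧] {ε q C : ℝ}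
  {P : ProbabilityMeasure (Pop 𝓧)}

theorem integral_sq_influenceLp (hε : 0 < ε) (hq : 2 < q) (hC : 0 < C)
    (h : Basic ε q C (P : Measure (Pop 𝓧))) (hM : MCAR (P : Measure (Pop 𝓧))) :
    ∫ o, influenceLp hε hq hC h hM o ^ 2 ∂(obsLaw P) = varOur (P : Measure (Pop 𝓧)) := by
  have e1 : ∫ o, influenceLp hε hq hC h hM o ^ 2 ∂(obsLaw P)
      = ∫ o, influence ε (P : Measure (Pop 𝓧)) o ^ 2 ∂(obsLaw P) := by
    refine integral_congr_ae ?_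
    filter_upwards [(memLp_influence_obsLaw hε hq hC h hM).coeFn_toLp] with o ho
    rw [influenceLp, ho]
  have hp : selectProb (P : Measure (Pop 𝓧)) (fun _ => 1) = 1 := by simp [selectProb]
  have e2 := integral_sq_linearized h hM hε hq (β := fun _ => 1) (fun _ => one_pow 2)
    (by rw [hp]; exact one_ne_zero)
  rw [e1, obsLaw, integral_map measurable_obs.aemeasurable
    (measurable_influence.pow_const 2).aestronglyMeasurable, varOur, ← one_mul (∫ z, effectDev _ z ^ 2 ∂_)]
  rw [hp, div_one] at e2
  rw [← e2]
  refine integral_congr_ae ?_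
  filter_upwards [influence_obs_ae_eq h hε] with z hz
  rw [hz]

/-- A gradient in the larger model is one in the smaller, and the tangent set of the smaller lies in
that of the larger. Hence a gradient in the larger model that is tangent to the smaller is efficient
in both. -/
theorem isEfficiencyBound (hε : 0 < ε) (hε' : ε < 1 / 2) (hq : 2 < q) (hC : 0 < C)
    (h : Basic ε q C (P : Measure (Pop 𝓧))) (hM : MCAR (P : Measure (Pop 𝓧))) :
    IsEfficiencyBound (modelMCAR 𝓧) P (varOur (P : Measure (Pop 𝓧))) ∧
      IsEfficiencyBound (modelMAR 𝓧) P (varOur (P : Measure (Pop 𝓧))) := by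
  have hg := fun Q g => hasDerivAt_ate (Q := Q) (g := g) hε hq hC h hM
  have ht := influenceLp_mem hε hε' hq hC h hM
  have hV := (integral_sq_influenceLp hε hq hC h hM).symm
  refine ⟨⟨influenceLp hε hq hC h hM, ⟨fun Q g hQ => ?_, ht⟩, hV⟩,
    ⟨influenceLp hε hq hC h hM, ⟨hg, ?_⟩, hV⟩⟩
  · obtain ⟨ε', q', C', h1, h2, h3, h4, h5⟩ := hQ.mem
    exact hg Q g ⟨hQ.through,
      ⟨ε', q', C', h1, h2, h3, h4, h5.mono fun t ht => ⟨ht.1, ht.2.mar⟩⟩, hQ.score⟩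
  · exact closure_mono (Submodule.span_mono tangentSet_mcar_subset) ht

end Bound

/-! ### Errors of the nuisance estimates -/

theorem lintegral_enorm_sq {α : Type*} [MeasurableSpace α] {μ : Measure α} {f : α → ℝ}
    (hf : MemLp f 2 μ) : ∫⁻ x, ‖f x‖ₑ ^ 2 ∂μ = ENNReal.ofReal (l2norm μ f ^ 2) := by
  rw [sq_l2norm, ofReal_integral_eq_lintegral_ofReal hf.integrable_sq
    (ae_of_all _ fun _ => sq_nonneg _)]
  refine lintegral_congr fun x => ?_
  rw [← sq_abs, ENNReal.ofReal_pow (abs_nonneg _), ← Real.norm_eq_abs, ofReal_norm]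

theorem memLp_of_lintegral_le {α : Type*} [MeasurableSpace α] {μ : Measure α} {f : α → ℝ}
    (hf : AEStronglyMeasurable f μ) {c : ℝ} (hc : 0 ≤ c)
    (h : ∫⁻ x, ‖f x‖ₑ ^ 2 ∂μ ≤ ENNReal.ofReal (c ^ 2)) : MemLp f 2 μ ∧ l2norm μ f ≤ c := by
  have hm : MemLp f 2 μ := memLp_two_of_lintegral_sq_lt_top hf (h.trans_lt ENNReal.ofReal_lt_top)
  refine ⟨hm, ?_⟩
  rw [lintegral_enorm_sq hm, ENNReal.ofReal_le_ofReal_iff (sq_nonneg c)] at h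
  exact abs_le_of_sq_le_sq' h hc |>.2

section Nuisance

variable {𝓧 : Type*} [MeasurableSpace 𝓧] [StandardBorelSpace 𝓧] {ε q C : ℝ}
  {P : Measure (Pop 𝓧)} [IsProbabilityMeasure P] {e : 𝓧 → ℝ} {m : Bool × 𝓧 → ℝ}

/-- error of the outcome regression -/
def regressionError (P : Measure (Pop 𝓧)) [IsFiniteMeasure P] (m : Bool × 𝓧 → ℝ) (z : Pop 𝓧) : ℝ :=
  m (z.T, z.X) - muStar P z.T z.X

/-- error of the propensity score -/
def propensityError (P : Measure (Pop 𝓧)) [IsFiniteMeasure P] (e : 𝓧 → ℝ) (z : Pop 𝓧) : ℝ :=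
  e z.X - eStar P z.X

/-- error of the outcome regression in arm `s` -/
def armError (P : Measure (Pop 𝓧)) [IsFiniteMeasure P] (m : Bool × 𝓧 → ℝ) (s : Bool) (x : 𝓧) : ℝ :=
  m (s, x) - muStar P s x

theorem measurable_armError (hm : Measurable m) (s : Bool) : Measurable (armError P m s) :=
  (hm.comp measurable_prodMk_left).sub (measurable_muStar P s)

theorem armError_eq {s : Bool} {z : Pop 𝓧} (hz : z ∈ treated s) :
    armError P m s z.X = regressionError P m z := by
  have : z.T = s := hz
  rw [armError, regressionError, this]

/-- The assumed rate concerns the regression at the realized treatment; overlap extends it to either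
arm evaluated at all units. The factor `ε ^ (-1 / 2)` so obtained is weakened to `ε⁻¹`. -/
theorem armError_l2 (h : Basic ε q C P) (hε : 0 < ε) (hε' : ε < 1 / 2) (hm : Measurable m)
    (hm2 : MemLp (regressionError P m) 2 P) (s : Bool) :
    MemLp (fun z => armError P m s z.X) 2 P ∧
      l2norm P (fun z => armError P m s z.X) ≤ ε⁻¹ * l2norm P (regressionError P m) := by
  have hmeas : Measurable fun z : Pop 𝓧 => armError P m s z.X :=
    (measurable_armError hm s).comp measurable_popX
  have h1 := lintegral_le_treated h s (φ := fun x => ‖armError P m s x‖ₑ ^ 2)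
    ((measurable_armError hm s).enorm.pow_const 2)
  have h2 : ∫⁻ z in treated s, ‖armError P m s z.X‖ₑ ^ 2 ∂P
      ≤ ∫⁻ z, ‖regressionError P m z‖ₑ ^ 2 ∂P := by
    refine le_trans (le_of_eq ?_) (setLIntegral_le_lintegral (treated s) _)
    exact setLIntegral_congr_fun (measurableSet_treated s) fun z hz => by rw [armError_eq hz]
  refine memLp_of_lintegral_le hmeas.aestronglyMeasurable
    (mul_nonneg (inv_nonneg.2 hε.le) (l2norm_nonneg _ _)) ?_
  have h3 := h1.trans h2
  rw [lintegral_enorm_sq hm2] at h3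
  have h4 : ∫⁻ z, ‖armError P m s z.X‖ₑ ^ 2 ∂P
      = ENNReal.ofReal ε⁻¹ * (ENNReal.ofReal ε * ∫⁻ z, ‖armError P m s z.X‖ₑ ^ 2 ∂P) := by
    rw [← mul_assoc, ← ENNReal.ofReal_mul (inv_nonneg.2 hε.le), inv_mul_cancel₀ hε.ne',
      ENNReal.ofReal_one, one_mul]
  rw [h4]
  refine (mul_le_mul_right h3 _).trans ?_
  rw [← ENNReal.ofReal_mul (inv_nonneg.2 hε.le), mul_pow]
  refine ENNReal.ofReal_le_ofReal (mul_le_mul_of_nonneg_right ?_ (sq_nonneg _))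
  rw [sq]
  exact le_mul_of_one_le_left (inv_nonneg.2 hε.le) ((one_le_inv₀ hε).2 (by linarith))

theorem le_armPropensity (hr : ∀ᵐ z ∂P, e z.X ∈ Set.Icc ε (1 - ε)) (s : Bool) :
    ∀ᵐ z ∂P, ε ≤ armPropensity e s z.X := by
  filter_upwards [hr] with z hz
  cases s
  · simp only [armPropensity, Bool.false_eq_true, if_false]; linarith [hz.2]
  · exact hz.1

theorem abs_armPropensity_sub (s : Bool) (z : Pop 𝓧) :
    |armPropensity e s z.X - propensity P s z.X| = |propensityError P e z| := by
  rw [← armPropensity_eStar, propensityError]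
  cases s
  · simp only [armPropensity, Bool.false_eq_true, if_false]
    rw [abs_sub_comm]; congr 1; ring
  · rfl

theorem memLp_propensityError (h : Basic ε q C P) (he : Measurable e)
    (hr : ∀ᵐ z ∂P, e z.X ∈ Set.Icc ε (1 - ε)) : MemLp (propensityError P e) 2 P := by
  refine MemLp.of_bound ((he.comp measurable_popX).sub
    ((measurable_eStar P).comp measurable_popX)).aestronglyMeasurable (1 - 2 * ε) ?_
  filter_upwards [hr, h.overlap_treatment] with z h1 h2
  rw [Real.norm_eq_abs, propensityError, abs_le]
  exact ⟨by linarith [h1.1, h2.2], by linarith [h1.2, h2.1]⟩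

theorem inv_armPropensity_sub_le (h : Basic ε q C P) (hε : 0 < ε)
    (hr : ∀ᵐ z ∂P, e z.X ∈ Set.Icc ε (1 - ε)) (s : Bool) :
    ∀ᵐ z ∂P, |(armPropensity e s z.X)⁻¹ - (propensity P s z.X)⁻¹|
      ≤ |(ε ^ 2)⁻¹ * propensityError P e z| := by
  filter_upwards [le_armPropensity hr s, h.le_propensity s] with z h1 h2
  have p1 := hε.trans_le h1
  have p2 := hε.trans_le h2
  rw [inv_sub_inv p1.ne' p2.ne', abs_div, abs_sub_comm, abs_armPropensity_sub,
    abs_mul (ε ^ 2)⁻¹, abs_of_pos (mul_pos p1 p2), abs_of_nonneg (a := (ε ^ 2)⁻¹) (by positivity), div_eq_inv_mul]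
  refine mul_le_mul_of_nonneg_right (inv_anti₀ (by positivity) ?_) (abs_nonneg _)
  rw [sq]
  exact mul_le_mul h1 h2 hε.le p1.le

/-- the error of the correction in arm `s` that is due to the propensity score -/
def weightError (P : Measure (Pop 𝓧)) [IsFiniteMeasure P] (e : 𝓧 → ℝ) (s : Bool) : Pop 𝓧 → ℝ :=
  (treated s).indicator fun z =>
    ((armPropensity e s z.X)⁻¹ - (propensity P s z.X)⁻¹) * (z.Ypot s - muStar P s z.X)

/-- the error of the correction in arm `s` that is due to the outcome regression -/
def imputationError (P : Measure (Pop 𝓧)) [IsFiniteMeasure P] (e : 𝓧 → ℝ) (m : Bool × 𝓧 → ℝ)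
    (s : Bool) : Pop 𝓧 → ℝ :=
  (treated s).indicator fun z => (armPropensity e s z.X)⁻¹ * armError P m s z.X

/-- With hats for the estimates, `â * (Y - m̂) - a * (Y - μ) = (â - a) * (Y - μ) - â * (m̂ - μ)`. -/
theorem armCorrection_sub (s : Bool) (z : Pop 𝓧) :
    armCorrection e m s z - armCorrection (eStar P) (regression P) s z
      = weightError P e s z - imputationError P e m s z := by
  by_cases hz : z ∈ treated s
  · simp only [armCorrection, weightError, imputationError, Set.indicator_of_mem hz,
      armPropensity_eStar, armError, regression]
    ring
  · simp only [armCorrection, weightError, imputationError, Set.indicator_of_notMem hz]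

/-- Given `(T, X)`, the squared residual has mean at most `C`, so an unbounded residual still lets
the propensity error enter through its `L²` norm. -/
theorem weightError_l2 (h : Basic ε q C P) (h' : MAR P) (hε : 0 < ε) (hq : 2 < q) (hC : 0 < C)
    (he : Measurable e) (hr : ∀ᵐ z ∂P, e z.X ∈ Set.Icc ε (1 - ε)) (s : Bool) :
    MemLp (weightError P e s) 2 P ∧
      l2norm P (weightError P e s) ≤ √C * ((ε ^ 2)⁻¹ * l2norm P (propensityError P e)) := by
  have hpe := measurable_armPropensity he s
  set v : 𝓧 → ℝ := fun x => (armPropensity e s x)⁻¹ - (propensity P s x)⁻¹ with hv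
  have hvm : Measurable v := by fun_prop
  have hE := memLp_propensityError h he hr
  have hvE : l2norm P (fun z => v z.X) ≤ (ε ^ 2)⁻¹ * l2norm P (propensityError P e) := by
    have := l2norm_mono (hE.const_mul (ε ^ 2)⁻¹) (inv_armPropensity_sub_le h hε hr s)
    rwa [l2norm_const_mul, abs_of_nonneg (a := (ε ^ 2)⁻¹) (by positivity)] at this
  have hv2 : MemLp (fun z : Pop 𝓧 => v z.X) 2 P :=
    (hE.const_mul (ε ^ 2)⁻¹).mono (hvm.comp measurable_popX).aestronglyMeasurable
      (inv_armPropensity_sub_le h hε hr s)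
  have hmeas : Measurable (weightError P e s) := by
    refine Measurable.indicator ?_ (measurableSet_treated s)
    fun_prop
  refine memLp_of_lintegral_le hmeas.aestronglyMeasurable (mul_nonneg (Real.sqrt_nonneg _)
    (mul_nonneg (by positivity) (l2norm_nonneg _ _))) ?_
  have e1 : ∫⁻ z, ‖weightError P e s z‖ₑ ^ 2 ∂P
      = ∫⁻ z in treated s, ‖z.Ypot s - muStar P s z.X‖ₑ ^ 2 * ‖v z.X‖ₑ ^ 2 ∂P := by
    rw [← lintegral_indicator (measurableSet_treated s)]
    refine lintegral_congr fun z => ?_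
    by_cases hz : z ∈ treated s
    · rw [weightError, Set.indicator_of_mem hz, Set.indicator_of_mem hz, enorm_mul, mul_pow, mul_comm]
    · rw [weightError, Set.indicator_of_notMem hz, Set.indicator_of_notMem hz]; simp
  rw [e1]
  calc _ ≤ ENNReal.ofReal C * ∫⁻ z in treated s, ‖v z.X‖ₑ ^ 2 ∂P :=
        lintegral_sq_resid_le h h' hε hq s (φ := fun x => ‖v x‖ₑ ^ 2) (by fun_prop)
    _ ≤ ENNReal.ofReal C * ∫⁻ z, ‖v z.X‖ₑ ^ 2 ∂P :=
        mul_le_mul_right (setLIntegral_le_lintegral _ _) _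
    _ = ENNReal.ofReal (C * l2norm P (fun z => v z.X) ^ 2) := by
        rw [lintegral_enorm_sq hv2, ENNReal.ofReal_mul hC.le]
    _ ≤ _ := by
        refine ENNReal.ofReal_le_ofReal ?_
        rw [mul_pow, Real.sq_sqrt hC.le]
        exact mul_le_mul_of_nonneg_left (pow_le_pow_left₀ (l2norm_nonneg _ _) hvE 2) hC.le

theorem imputationError_l2 (hε : 0 < ε)
    (he : Measurable e) (hr : ∀ᵐ z ∂P, e z.X ∈ Set.Icc ε (1 - ε)) (hm : Measurable m)
    (hm2 : MemLp (regressionError P m) 2 P) (s : Bool) :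
    MemLp (imputationError P e m s) 2 P ∧
      l2norm P (imputationError P e m s) ≤ ε⁻¹ * l2norm P (regressionError P m) := by
  have hpe := measurable_armPropensity he s
  have ha := measurable_armError (P := P) hm s
  have hmeas : Measurable (imputationError P e m s) := by
    refine Measurable.indicator ?_ (measurableSet_treated s)
    fun_prop
  have hle : ∀ᵐ z ∂P, |imputationError P e m s z| ≤ |ε⁻¹ * regressionError P m z| := by
    filter_upwards [le_armPropensity hr s] with z hz
    by_cases hzs : z ∈ treated s
    · rw [imputationError, Set.indicator_of_mem hzs, armError_eq hzs, abs_mul, abs_mul,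
        abs_of_pos (inv_pos.2 hε), abs_of_pos (inv_pos.2 (hε.trans_le hz))]
      exact mul_le_mul_of_nonneg_right (inv_anti₀ hε hz) (abs_nonneg _)
    · rw [imputationError, Set.indicator_of_notMem hzs, abs_zero]; exact abs_nonneg _
  refine ⟨(hm2.const_mul ε⁻¹).mono hmeas.aestronglyMeasurable hle, ?_⟩
  have := l2norm_mono (hm2.const_mul ε⁻¹) hle
  rwa [l2norm_const_mul, abs_of_pos (inv_pos.2 hε)] at this

/-- The weight error has mean zero, its residual being orthogonal to functions of `X` on the treated
arm. In the rest the regression error is multiplied by `1 - p / p̂ = (p̂ - p) / p̂`, with `p` the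
propensity and `p̂` its estimate, and Cauchy-Schwarz yields the product of the two errors. -/
theorem abs_integral_arm_le (h : Basic ε q C P) (h' : MAR P) (hε : 0 < ε) (hε' : ε < 1 / 2)
    (hq : 2 < q) (hC : 0 < C)
    (he : Measurable e) (hr : ∀ᵐ z ∂P, e z.X ∈ Set.Icc ε (1 - ε)) (hm : Measurable m)
    (hm2 : MemLp (regressionError P m) 2 P) (s : Bool) :
    |∫ z, armError P m s z.X ∂P
        + ∫ z, (armCorrection e m s z - armCorrection (eStar P) (regression P) s z) ∂P|
      ≤ (ε ^ 2)⁻¹ * (l2norm P (propensityError P e) * l2norm P (regressionError P m)) := by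
  have hpe := measurable_armPropensity he s
  have ha := measurable_armError (P := P) hm s
  have hA := armError_l2 h hε hε' hm hm2 s
  have hW := weightError_l2 h h' hε hq hC he hr s
  have hI := imputationError_l2 hε he hr hm hm2 s
  have hE := memLp_propensityError h he hr
  have e1 : ∫ z, weightError P e s z ∂P = 0 := by
    have hv2 : MemLp (fun z : Pop 𝓧 => (armPropensity e s z.X)⁻¹ - (propensity P s z.X)⁻¹) 2 P :=
      (hE.const_mul (ε ^ 2)⁻¹).mono (by fun_prop : Measurable _).aestronglyMeasurable
        (inv_armPropensity_sub_le h hε hr s)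
    rw [← setIntegral_treated_resid_mul h h' hε hq s
      (f := fun x => (armPropensity e s x)⁻¹ - (propensity P s x)⁻¹) (by fun_prop) hv2,
      ← integral_indicator (measurableSet_treated s)]
    refine integral_congr_ae (ae_of_all _ fun z => ?_)
    simp only [weightError, mul_comm]
  have e2 : ∫ z, imputationError P e m s z ∂P
      = ∫ z, propensity P s z.X * ((armPropensity e s z.X)⁻¹ * armError P m s z.X) ∂P := by
    rw [← setIntegral_treated h s (f := fun p => (armPropensity e s p.1)⁻¹ * armError P m s p.1)
      (by fun_prop), ← integral_indicator (measurableSet_treated s)]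
    rfl
  have hpI : Integrable (fun z : Pop 𝓧 =>
      propensity P s z.X * ((armPropensity e s z.X)⁻¹ * armError P m s z.X)) P := by
    refine ((hA.1.const_mul ε⁻¹).mono (by fun_prop : Measurable _).aestronglyMeasurable
      ?_).integrable (by norm_num : (1 : ℝ≥0∞) ≤ 2)
    filter_upwards [le_armPropensity hr s] with z hz
    rw [norm_mul, norm_mul, norm_mul, Real.norm_of_nonneg (propensity_nonneg P s _),
      Real.norm_of_nonneg (inv_pos.2 hε).le, Real.norm_of_nonneg (inv_pos.2 (hε.trans_le hz)).le]
    refine (mul_le_of_le_one_left (by have := hε.trans_le hz; positivity)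
      (propensity_le_one P s _)).trans ?_
    exact mul_le_mul_of_nonneg_right (inv_anti₀ hε hz) (norm_nonneg _)
  simp_rw [armCorrection_sub]
  rw [integral_sub (hW.1.integrable (by norm_num)) (hI.1.integrable (by norm_num)), e1, e2,
    zero_sub, ← sub_eq_add_neg, ← integral_sub (hA.1.integrable (by norm_num)) hpI]
  set w : 𝓧 → ℝ := fun x => (armPropensity e s x)⁻¹ * (armPropensity e s x - propensity P s x)
    with hw
  have hwm : Measurable w := by fun_prop
  have hwle : ∀ᵐ z ∂P, |w z.X| ≤ |ε⁻¹ * propensityError P e z| := by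
    filter_upwards [le_armPropensity hr s] with z hz
    rw [hw, abs_mul, abs_armPropensity_sub, abs_mul, abs_of_pos (inv_pos.2 hε),
      abs_of_pos (inv_pos.2 (hε.trans_le hz))]
    exact mul_le_mul_of_nonneg_right (inv_anti₀ hε hz) (abs_nonneg _)
  have hw2 : MemLp (fun z : Pop 𝓧 => w z.X) 2 P :=
    (hE.const_mul ε⁻¹).mono (hwm.comp measurable_popX).aestronglyMeasurable hwle
  have hwn := l2norm_mono (hE.const_mul ε⁻¹) hwle
  rw [l2norm_const_mul, abs_of_pos (inv_pos.2 hε)] at hwn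
  have e3 : ∫ z, (armError P m s z.X
        - propensity P s z.X * ((armPropensity e s z.X)⁻¹ * armError P m s z.X)) ∂P
      = ∫ z, w z.X * armError P m s z.X ∂P := by
    refine integral_congr_ae ?_
    filter_upwards [le_armPropensity hr s] with z hz
    have := (hε.trans_le hz).ne'
    simp only [hw]
    field_simp
  rw [e3]
  refine (abs_integral_mul_le hw2 hA.1).trans ?_
  calc _ ≤ (ε⁻¹ * l2norm P (propensityError P e)) * (ε⁻¹ * l2norm P (regressionError P m)) :=
        mul_le_mul hwn hA.2 (l2norm_nonneg _ _)
          (mul_nonneg (inv_nonneg.2 hε.le) (l2norm_nonneg _ _))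
    _ = _ := by rw [sq, mul_inv]; ring

/-- error of the estimated conditional effect -/
def effectError (P : Measure (Pop 𝓧)) [IsFiniteMeasure P] (m : Bool × 𝓧 → ℝ) (o : Obs 𝓧) : ℝ :=
  armError P m true o.X - armError P m false o.X

/-- error of the estimated correction -/
def correctionError (P : Measure (Pop 𝓧)) [IsFiniteMeasure P] (e : 𝓧 → ℝ) (m : Bool × 𝓧 → ℝ)
    (o : Obs 𝓧) : ℝ := correction e m o - correction (eStar P) (regression P) o

theorem effectError_l2 (h : Basic ε q C P) (hε : 0 < ε) (hε' : ε < 1 / 2) (hm : Measurable m)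
    (hm2 : MemLp (regressionError P m) 2 P) :
    MemLp (fun z => effectError P m (full z)) 2 P ∧
      l2norm P (fun z => effectError P m (full z)) ≤ 2 * ε⁻¹ * l2norm P (regressionError P m) := by
  have h1 := armError_l2 h hε hε' hm hm2 true
  have h0 := armError_l2 h hε hε' hm hm2 false
  refine ⟨h1.1.sub h0.1, (l2norm_sub_le h1.1 h0.1).trans ?_⟩
  linarith [h1.2, h0.2]

theorem armCorrection_sub_l2 (h : Basic ε q C P) (h' : MAR P) (hε : 0 < ε) (hq : 2 < q)
    (hC : 0 < C) (he : Measurable e) (hr : ∀ᵐ z ∂P, e z.X ∈ Set.Icc ε (1 - ε)) (hm : Measurable m)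
    (hm2 : MemLp (regressionError P m) 2 P) (s : Bool) :
    MemLp (fun z => armCorrection e m s z - armCorrection (eStar P) (regression P) s z) 2 P ∧
      l2norm P (fun z => armCorrection e m s z - armCorrection (eStar P) (regression P) s z)
        ≤ √C * ((ε ^ 2)⁻¹ * l2norm P (propensityError P e))
          + ε⁻¹ * l2norm P (regressionError P m) := by
  have hW := weightError_l2 h h' hε hq hC he hr s
  have hI := imputationError_l2 hε he hr hm hm2 s
  simp_rw [armCorrection_sub]
  exact ⟨hW.1.sub hI.1, (l2norm_sub_le hW.1 hI.1).trans (add_le_add hW.2 hI.2)⟩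

theorem correctionError_full (z : Pop 𝓧) : correctionError P e m (full z)
    = (armCorrection e m true z - armCorrection (eStar P) (regression P) true z)
      - (armCorrection e m false z - armCorrection (eStar P) (regression P) false z) := by
  rw [correctionError, correction_full, correction_full]
  ring

theorem correctionError_l2 (h : Basic ε q C P) (h' : MAR P) (hε : 0 < ε) (hq : 2 < q)
    (hC : 0 < C) (he : Measurable e) (hr : ∀ᵐ z ∂P, e z.X ∈ Set.Icc ε (1 - ε)) (hm : Measurable m)
    (hm2 : MemLp (regressionError P m) 2 P) :
    MemLp (fun z => correctionError P e m (full z)) 2 P ∧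
      l2norm P (fun z => correctionError P e m (full z))
        ≤ 2 * (√C * ((ε ^ 2)⁻¹ * l2norm P (propensityError P e))
          + ε⁻¹ * l2norm P (regressionError P m)) := by
  have h1 := armCorrection_sub_l2 h h' hε hq hC he hr hm hm2 true
  have h0 := armCorrection_sub_l2 h h' hε hq hC he hr hm hm2 false
  simp_rw [correctionError_full]
  refine ⟨h1.1.sub h0.1, (l2norm_sub_le h1.1 h0.1).trans ?_⟩
  linarith [h1.2, h0.2]

theorem abs_integral_errors_le (h : Basic ε q C P) (h' : MAR P) (hε : 0 < ε) (hε' : ε < 1 / 2)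
    (hq : 2 < q) (hC : 0 < C)
    (he : Measurable e) (hr : ∀ᵐ z ∂P, e z.X ∈ Set.Icc ε (1 - ε)) (hm : Measurable m)
    (hm2 : MemLp (regressionError P m) 2 P) :
    |∫ z, effectError P m (full z) ∂P + ∫ z, correctionError P e m (full z) ∂P|
      ≤ 2 * (ε ^ 2)⁻¹ * (l2norm P (propensityError P e) * l2norm P (regressionError P m)) := by
  have a := fun s => ((armError_l2 h hε hε' hm hm2 s).1.integrable (by norm_num) : Integrable _ P)
  have b := fun s => ((armCorrection_sub_l2 h h' hε hq hC he hr hm hm2 s).1.integrable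
    (by norm_num) : Integrable _ P)
  have c := fun s => abs_integral_arm_le h h' hε hε' hq hC he hr hm hm2 s
  have e1 : ∫ z, effectError P m (full z) ∂P
      = ∫ z, armError P m true z.X ∂P - ∫ z, armError P m false z.X ∂P :=
    integral_sub (a true) (a false)
  simp_rw [correctionError_full]
  rw [e1, integral_sub (b true) (b false)]
  refine le_trans (le_of_eq ?_) ((abs_sub _ _).trans ((add_le_add (c true) (c false)).trans
    (le_of_eq ?_)))
  · congr 1; ring
  · ring

end Nuisance

/-! ### Chebyshev's inequality for cross-fitted sums -/

section Chebyshev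

variable {ι E : Type*} [Fintype ι] [MeasurableSpace E] {π : Measure E} [IsProbabilityMeasure π]

theorem measure_pi_sum_le {h : E → ℝ} (hh : MemLp h 2 π) {β : ι → ℝ} (hβ : ∀ i, |β i| ≤ 1)
    {a σ : ℝ} (ha : 0 < a) (hσ : l2norm π h ≤ σ) :
    Measure.pi (fun _ : ι => π) {x | a ≤ |∑ i, β i * (h (x i) - ∫ y, h y ∂π)|}
      ≤ ENNReal.ofReal (Fintype.card ι * σ ^ 2 / a ^ 2) := by
  set X : ι → E → ℝ := fun i y => β i * (h y - ∫ y, h y ∂π) with hX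
  have hXL : ∀ i, MemLp (X i) 2 π := fun i => (hh.sub (memLp_const _)).const_mul (β i)
  set S : (ι → E) → ℝ := ∑ i, fun x => X i (x i) with hS
  have hSL : MemLp S 2 (Measure.pi fun _ : ι => π) :=
    memLp_finsetSum' _ fun i _ => (hXL i).comp_measurePreserving (measurePreserving_eval _ i)
  have hS0 : ∫ x, S x ∂(Measure.pi fun _ : ι => π) = 0 := by
    simp only [hS, Finset.sum_apply]
    rw [integral_finsetSum _ fun i _ => integrable_comp_eval ((hXL i).integrable (by norm_num))]
    refine Finset.sum_eq_zero fun i _ => ?_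
    rw [integral_comp_eval (hXL i).1]
    simp only [hX]
    rw [integral_const_mul, integral_sub (hh.integrable (by norm_num)) (integrable_const _)]
    simp
  have hV : Var[S; Measure.pi fun _ : ι => π] ≤ Fintype.card ι * σ ^ 2 := by
    rw [hS, variance_sum_pi hXL]
    calc ∑ i, Var[X i; π] ≤ ∑ _i : ι, σ ^ 2 := by
          refine Finset.sum_le_sum fun i _ => ?_
          have h1 : Var[X i; π] = β i ^ 2 * Var[h; π] := by
            rw [hX, variance_const_mul, variance_sub_const hh.1]
          have h2 : Var[h; π] ≤ σ ^ 2 := by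
            refine (variance_le_expectation_sq hh.1).trans ?_
            have := pow_le_pow_left₀ (l2norm_nonneg π h) hσ 2
            rwa [sq_l2norm] at this
          rw [h1]
          have h3 : β i ^ 2 ≤ 1 := by
            rw [← sq_abs]; exact pow_le_one₀ (abs_nonneg _) (hβ i)
          calc β i ^ 2 * Var[h; π] ≤ 1 * Var[h; π] :=
                mul_le_mul_of_nonneg_right h3 (variance_nonneg _ _)
            _ ≤ σ ^ 2 := by rw [one_mul]; exact h2
      _ = _ := by simp
  have hc := meas_ge_le_variance_div_sq hSL ha
  rw [hS0] at hc
  simp only [sub_zero, hS, Finset.sum_apply] at hc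
  refine hc.trans (ENNReal.ofReal_le_ofReal ?_)
  exact div_le_div_of_nonneg_right hV (sq_nonneg a)

/-- Coordinates are split into those in the fold and the rest. With the rest frozen, `hoff` makes
`g` a single fixed function, so Chebyshev applies to the fold coordinates, and its bound survives
integration over the rest. -/
theorem measure_pi_crossfit_le (p : ι → Prop) [DecidablePred p] {g : (ι → E) → E → ℝ}
    (hg : Measurable fun c : (ι → E) × E => g c.1 c.2)
    (hoff : ∀ v v', (∀ i, ¬ p i → v i = v' i) → g v = g v') {β : ι → ℝ} (hβ : ∀ i, |β i| ≤ 1)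
    {a σ : ℝ} (ha : 0 < a) (hσ : 0 ≤ σ) :
    Measure.pi (fun _ : ι => π) {v | ∫⁻ x, ‖g v x‖ₑ ^ 2 ∂π ≤ ENNReal.ofReal (σ ^ 2) ∧
        a ≤ |∑ i, if p i then β i * (g v (v i) - ∫ x, g v x ∂π) else 0|}
      ≤ ENNReal.ofReal (Fintype.card ι * σ ^ 2 / a ^ 2) := by
  set S : Set (ι → E) := {v | ∫⁻ x, ‖g v x‖ₑ ^ 2 ∂π ≤ ENNReal.ofReal (σ ^ 2) ∧
        a ≤ |∑ i, if p i then β i * (g v (v i) - ∫ x, g v x ∂π) else 0|} with hS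
  have hSm : MeasurableSet S := by
    have hint : MeasurableSet {v : ι → E | ∫⁻ x, ‖g v x‖ₑ ^ 2 ∂π ≤ ENNReal.ofReal (σ ^ 2)} :=
      measurableSet_le (hg.enorm.pow_const 2).lintegral_prod_right' measurable_const
    refine hint.inter (measurableSet_le measurable_const ?_ : MeasurableSet
      {v : ι → E | a ≤ |∑ i, if p i then β i * (g v (v i) - ∫ x, g v x ∂π) else 0|})
    have h1 : Measurable fun v : ι → E => ∫ x, g v x ∂π :=
      (hg.stronglyMeasurable.integral_prod_right').measurable
    have h2 : ∀ i, Measurable fun v : ι → E => g v (v i) := fun i =>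
      hg.comp (measurable_id.prodMk (measurable_pi_apply i))
    refine (Finset.measurable_sum _ fun i _ => ?_).abs
    split_ifs
    · exact ((h2 i).sub h1).const_mul _
    · exact measurable_const
  set f := MeasurableEquiv.piEquivPiSubtypeProd (fun _ : ι => E) p with hf
  have hmp := measurePreserving_piEquivPiSubtypeProd (fun _ : ι => π) p
  have e1 : Measure.pi (fun _ : ι => π) S
      = ((Measure.pi fun _ : Subtype p => π).prod (Measure.pi fun _ : {i // ¬ p i} => π))
        (f.symm ⁻¹' S) := by
    rw [← hmp.measure_preimage (hSm.preimage f.symm.measurable).nullMeasurableSet,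
      ← Set.preimage_comp]
    congr 1
    ext v
    simp [hf]
  rw [e1, Measure.prod_apply_symm (hSm.preimage f.symm.measurable)]
  refine (lintegral_mono (g := fun _ => ENNReal.ofReal (Fintype.card ι * σ ^ 2 / a ^ 2))
    fun w => ?_).trans (by simp)
  -- One point `x0` of the slice suffices to obtain the moment condition for the frozen function,
  -- which is the same at all points of the slice.
  rcases Set.eq_empty_or_nonempty ((fun x => (x, w)) ⁻¹' (f.symm ⁻¹' S)) with h0 | ⟨x0, hx0⟩
  · rw [h0]; simp
  have hp : ∀ x (i : ι) (h : p i), f.symm (x, w) i = x ⟨i, h⟩ := fun x i h => dif_pos h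
  have hn : ∀ x (i : ι) (h : ¬ p i), f.symm (x, w) i = w ⟨i, h⟩ := fun x i h => dif_neg h
  set h : E → ℝ := g (f.symm (x0, w)) with hh
  have hgx : ∀ x, g (f.symm (x, w)) = h := fun x => hoff _ _ fun i hi => by rw [hn x i hi, hn x0 i hi]
  have hL := memLp_of_lintegral_le (f := h) (hg.comp measurable_prodMk_left).aestronglyMeasurable hσ
    hx0.1
  calc Measure.pi (fun _ : Subtype p => π) ((fun x => (x, w)) ⁻¹' (f.symm ⁻¹' S))
      ≤ Measure.pi (fun _ : Subtype p => π)
          {x | a ≤ |∑ i : Subtype p, β i * (h (x i) - ∫ y, h y ∂π)|} := by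
        refine measure_mono fun x hx => ?_
        have hx2 := hx.2
        simp only [Set.mem_ofPred_eq]
        refine hx2.trans (le_of_eq ?_)
        congr 1
        rw [hgx, ← Finset.sum_filter, ← Finset.sum_subtype_eq_sum_filter]
        refine (Finset.sum_congr (by ext; simp) fun i _ => ?_)
        rw [hp x i.1 i.2]
    _ ≤ ENNReal.ofReal (Fintype.card (Subtype p) * σ ^ 2 / a ^ 2) :=
        measure_pi_sum_le (ι := Subtype p) (β := fun i => β i) hL.1 (fun i => hβ i) ha hL.2
    _ ≤ _ := by
        refine ENNReal.ofReal_le_ofReal (div_le_div_of_nonneg_right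
          (mul_le_mul_of_nonneg_right ?_ (sq_nonneg σ)) (sq_nonneg a))
        exact_mod_cast Fintype.card_subtype_le p

end Chebyshev

/-! ### Conditioning on seed and labels -/

section Conditioning

variable {Ω ι E 𝓒 : Type*} {K : ℕ} [Fintype ι] [MeasurableSpace E] [MeasurableSpace Ω]
  [MeasurableSpace 𝓒] {π : Measure E} [IsProbabilityMeasure π] {Pr : Measure Ω}
  [IsProbabilityMeasure Pr]

/-- Folds and weights are functions of `c`, which is independent of `V`, so by Tonelli the bound for
fixed folds holds for random ones. -/
theorem measure_crossfit_le {c : Ω → 𝓒} {V : Ω → ι → E} (hc : Measurable c) (hV : Measurable V)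
    (hlaw : Pr.map (fun ω => (c ω, V ω)) = (Pr.map c).prod (Measure.pi fun _ : ι => π))
    {g : 𝓒 → (ι → E) → E → ℝ} (hg : Measurable fun r : 𝓒 × (ι → E) × E => g r.1 r.2.1 r.2.2)
    {κ : 𝓒 → ι → Fin K} (hκ : Measurable κ) (k : Fin K)
    (hoff : ∀ c v v', (∀ i, κ c i ≠ k → v i = v' i) → g c v = g c v')
    {β : 𝓒 → ι → ℝ} (hβm : Measurable β) (hβ : ∀ c i, |β c i| ≤ 1)
    {a σ : ℝ} (ha : 0 < a) (hσ : 0 ≤ σ) :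
    Pr {ω | ∫⁻ x, ‖g (c ω) (V ω) x‖ₑ ^ 2 ∂π ≤ ENNReal.ofReal (σ ^ 2) ∧
        a ≤ |∑ i, if κ (c ω) i = k then
          β (c ω) i * (g (c ω) (V ω) (V ω i) - ∫ x, g (c ω) (V ω) x ∂π) else 0|}
      ≤ ENNReal.ofReal (Fintype.card ι * σ ^ 2 / a ^ 2) := by
  set S : Set (𝓒 × (ι → E)) := {r | ∫⁻ x, ‖g r.1 r.2 x‖ₑ ^ 2 ∂π ≤ ENNReal.ofReal (σ ^ 2) ∧
        a ≤ |∑ i, if κ r.1 i = k then β r.1 i * (g r.1 r.2 (r.2 i) - ∫ x, g r.1 r.2 x ∂π) else 0|}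
    with hS
  have hg' : Measurable fun r : (𝓒 × (ι → E)) × E => g r.1.1 r.1.2 r.2 :=
    hg.comp (f := fun r : (𝓒 × (ι → E)) × E => (r.1.1, r.1.2, r.2)) (by fun_prop)
  have hSm : MeasurableSet S := by
    have hint : MeasurableSet {r : 𝓒 × (ι → E) |
        ∫⁻ x, ‖g r.1 r.2 x‖ₑ ^ 2 ∂π ≤ ENNReal.ofReal (σ ^ 2)} :=
      measurableSet_le (hg'.enorm.pow_const 2).lintegral_prod_right' measurable_const
    refine hint.inter (measurableSet_le measurable_const ?_ : MeasurableSet {r : 𝓒 × (ι → E) |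
      a ≤ |∑ i, if κ r.1 i = k then β r.1 i * (g r.1 r.2 (r.2 i) - ∫ x, g r.1 r.2 x ∂π) else 0|})
    have h1 : Measurable fun r : 𝓒 × (ι → E) => ∫ x, g r.1 r.2 x ∂π :=
      (hg'.stronglyMeasurable.integral_prod_right').measurable
    have h2 : ∀ i, Measurable fun r : 𝓒 × (ι → E) => g r.1 r.2 (r.2 i) := fun i =>
      hg.comp (f := fun r : 𝓒 × (ι → E) => (r.1, r.2, r.2 i)) (by fun_prop)
    refine (Finset.measurable_sum _ fun i _ => ?_).abs
    refine Measurable.ite ?_ ((((measurable_pi_apply i).comp hβm).comp measurable_fst).mul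
      ((h2 i).sub h1)) measurable_const
    exact (((measurable_pi_apply i).comp hκ).comp measurable_fst) (measurableSet_singleton k)
  have e : Pr ((fun ω => (c ω, V ω)) ⁻¹' S) = (Pr.map c).prod (Measure.pi fun _ : ι => π) S := by
    rw [← hlaw, Measure.map_apply (hc.prodMk hV) hSm]
  have : IsProbabilityMeasure (Pr.map c) := Measure.isProbabilityMeasure_map hc.aemeasurable
  change Pr ((fun ω => (c ω, V ω)) ⁻¹' S) ≤ _
  rw [e, Measure.prod_apply hSm]
  refine (lintegral_mono (g := fun _ => ENNReal.ofReal (Fintype.card ι * σ ^ 2 / a ^ 2))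
    fun c => ?_).trans (by simp)
  exact measure_pi_crossfit_le (fun i => κ c i = k) (g := g c) (hg.comp measurable_prodMk_left)
    (hoff c) (hβ c) ha hσ

end Conditioning

/-! ### Independence of labels and completed data -/

section Design

variable {𝓧 Ω 𝓤 : Type*} [MeasurableSpace 𝓧] [StandardBorelSpace 𝓧] [MeasurableSpace Ω]
  [MeasurableSpace 𝓤] {P : Measure (Pop 𝓧)} [IsProbabilityMeasure P] {Pr : Measure Ω}
  [IsProbabilityMeasure Pr] {Z : ℕ → Ω → Pop 𝓧} {U : Ω → 𝓤}

theorem map_units (hZ : ∀ i, Measurable (Z i)) (hZind : iIndepFun Z Pr)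
    (hZlaw : ∀ i, Pr.map (Z i) = P) (N : ℕ) :
    Pr.map (fun ω (i : Fin N) => Z i ω) = Measure.pi fun _ => P := by
  have := (iIndepFun_iff_map_fun_eq_pi_map (μ := Pr) (f := fun i : Fin N => Z i)
    fun i => (hZ i).aemeasurable).1 (hZind.precomp Fin.val_injective)
  rw [this]; simp only [hZlaw]

theorem map_label_full (hM : MCAR P) :
    P.map (fun z => (z.R, full z)) = (P.map Pop.R).prod (P.map full) := by
  have h : IndepFun Pop.R (full : Pop 𝓧 → Obs 𝓧) P := by
    have e : (full : Pop 𝓧 → Obs 𝓧) = (full ∘ ofCore) ∘ core := funext fun z => by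
      rcases z with ⟨x, t, y0, y1, r⟩; cases t <;> rfl
    rw [e]
    exact hM.comp (φ := id) measurable_id (measurable_full.comp measurable_ofCore)
  exact (indepFun_iff_map_prod_eq_prod_map_map measurable_popR.aemeasurable
    measurable_full.aemeasurable).1 h

/-- fold seed and labelling indicators -/
def seedLabels (Z : ℕ → Ω → Pop 𝓧) (U : Ω → 𝓤) (N : ℕ) (ω : Ω) : 𝓤 × (Fin N → Bool) :=
  (U ω, fun i => (Z i ω).R)

/-- the sample, with the outcomes of all units -/
def completed (Z : ℕ → Ω → Pop 𝓧) (N : ℕ) (ω : Ω) (i : Fin N) : Obs 𝓧 := full (Z i ω)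

theorem measurable_seedLabels (hZ : ∀ i, Measurable (Z i)) (hU : Measurable U) (N : ℕ) :
    Measurable (seedLabels Z U N) :=
  hU.prodMk (measurable_pi_lambda _ fun i => measurable_popR.comp (hZ i))

theorem measurable_completed (hZ : ∀ i, Measurable (Z i)) (N : ℕ) : Measurable (completed Z N) :=
  measurable_pi_lambda _ fun i => measurable_full.comp (hZ i)

theorem map_seed_prod (hZ : ∀ i, Measurable (Z i)) (hU : Measurable U)
    (hUind : IndepFun U (fun ω i => Z i ω) Pr) {G : Type*} [MeasurableSpace G]
    {f : (ℕ → Pop 𝓧) → G} (hf : Measurable f) :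
    Pr.map (fun ω => (U ω, f fun i => Z i ω))
      = (Pr.map U).prod (Pr.map fun ω => f fun i => Z i ω) :=
  (indepFun_iff_map_prod_eq_prod_map_map hU.aemeasurable
    (hf.comp (measurable_pi_lambda _ hZ)).aemeasurable).1 (hUind.comp measurable_id hf)

/-- Observed outcomes depend on the labels, but completed ones do not: unit by unit by
`map_label_full`, across units by i.i.d. sampling, and the seed is independent of both. -/
theorem map_seedLabels_completed (hM : MCAR P) (hZ : ∀ i, Measurable (Z i)) (hZind : iIndepFun Z Pr)
    (hZlaw : ∀ i, Pr.map (Z i) = P) (hU : Measurable U) (hUind : IndepFun U (fun ω i => Z i ω) Pr)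
    (N : ℕ) :
    Pr.map (fun ω => (seedLabels Z U N ω, completed Z N ω))
      = (Pr.map (seedLabels Z U N)).prod (Measure.pi fun _ => P.map full) := by
  set lab : Ω → Fin N → Bool := fun ω i => (Z i ω).R
  have hlab : Measurable lab := measurable_pi_lambda _ fun i => measurable_popR.comp (hZ i)
  have hcomp := measurable_completed (Ω := Ω) hZ N
  have : IsProbabilityMeasure (P.map full) :=
    Measure.isProbabilityMeasure_map measurable_full.aemeasurable
  have : IsProbabilityMeasure (P.map Pop.R) :=
    Measure.isProbabilityMeasure_map measurable_popR.aemeasurable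
  have : IsProbabilityMeasure (Pr.map U) := Measure.isProbabilityMeasure_map hU.aemeasurable
  have : IsProbabilityMeasure (Pr.map lab) := Measure.isProbabilityMeasure_map hlab.aemeasurable
  have h1 : Pr.map (fun ω => (lab ω, completed Z N ω))
      = (Measure.pi fun _ : Fin N => P.map Pop.R).prod (Measure.pi fun _ => P.map full) := by
    rw [← (measurePreserving_arrowProdEquivProdArrow Bool (Obs 𝓧) (Fin N)
      (fun _ => P.map Pop.R) fun _ => P.map full).map_eq]
    have e : (fun _ : Fin N => (P.map Pop.R).prod (P.map full))
        = fun _ : Fin N => P.map fun z => (z.R, full z) := by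
      rw [map_label_full hM]
    have hm : Measurable fun z : Pop 𝓧 => (z.R, full z) := by fun_prop
    rw [e, ← Measure.pi_map_pi (fun _ => hm.aemeasurable), ← map_units hZ hZind hZlaw N,
      Measure.map_map (by fun_prop) (measurable_pi_lambda _ fun i => hZ _),
      Measure.map_map (MeasurableEquiv.measurable _)
        (Measurable.comp (by fun_prop) (measurable_pi_lambda _ fun i => hZ _))]
    rfl
  have h2 : Pr.map lab = Measure.pi fun _ : Fin N => P.map Pop.R := by
    have := congrArg (Measure.map Prod.fst) h1
    rw [Measure.map_map measurable_fst (hlab.prodMk hcomp), Measure.map_fst_prod] at this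
    simpa [Function.comp_def] using this
  have h3 := map_seed_prod hZ hU hUind
    (f := fun z : ℕ → Pop 𝓧 => ((fun i : Fin N => (z i).R), fun i : Fin N => full (z i)))
    (by fun_prop)
  have h4 := map_seed_prod hZ hU hUind (f := fun z : ℕ → Pop 𝓧 => (fun i : Fin N => (z i).R))
    (by fun_prop)
  change _ = (Pr.map fun ω => (U ω, lab ω)).prod _
  change Pr.map (fun ω => (U ω, lab ω)) = (Pr.map U).prod (Pr.map lab) at h4
  change Pr.map (fun ω => (U ω, lab ω, completed Z N ω))
    = (Pr.map U).prod (Pr.map fun ω => (lab ω, completed Z N ω)) at h3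
  rw [h4]
  refine (MeasurableEquiv.prodAssoc.map_measurableEquiv_injective).eq_iff.1 ?_
  rw [Measure.prodAssoc_prod, h2, ← h1, ← h3,
    Measure.map_map (MeasurableEquiv.measurable _) ((measurable_seedLabels hZ hU N).prodMk hcomp)]
  rfl

end Design

/-! ### Calculus of `o_p` and `O_p` -/

section StochasticOrder

variable {Ω : Type*} [MeasurableSpace Ω] {Pr : Measure Ω} {ξ ζ : ℕ → Ω → ℝ}

/-- `ξ N = o_p(1)` -/
def NegligibleP (Pr : Measure Ω) (ξ : ℕ → Ω → ℝ) : Prop :=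
  ∀ η : ℝ, 0 < η → ∀ δ : ℝ, 0 < δ → ∀ᶠ N in atTop, Pr {ω | η ≤ |ξ N ω|} ≤ ENNReal.ofReal δ

/-- `ξ N = O_p(1)` -/
def BoundedP (Pr : Measure Ω) (ξ : ℕ → Ω → ℝ) : Prop :=
  ∀ δ : ℝ, 0 < δ → ∃ M : ℝ, ∀ᶠ N in atTop, Pr {ω | M < |ξ N ω|} ≤ ENNReal.ofReal δ

theorem measure_le_of_subset_union {A B C : Set Ω} {δ : ℝ} (hδ : 0 < δ) (h : A ⊆ B ∪ C)
    (hB : Pr B ≤ ENNReal.ofReal (δ / 2)) (hC : Pr C ≤ ENNReal.ofReal (δ / 2)) :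
    Pr A ≤ ENNReal.ofReal δ := by
  refine (measure_mono h).trans ((measure_union_le _ _).trans ((add_le_add hB hC).trans ?_))
  rw [← ENNReal.ofReal_add (by positivity) (by positivity), add_halves]

theorem BoundedP.exists_pos (h : BoundedP Pr ξ) {δ : ℝ} (hδ : 0 < δ) :
    ∃ M : ℝ, 0 < M ∧ ∀ᶠ N in atTop, Pr {ω | M < |ξ N ω|} ≤ ENNReal.ofReal δ := by
  obtain ⟨M, hM⟩ := h δ hδ
  refine ⟨max M 1, by positivity, hM.mono fun N hN => (measure_mono fun ω (hω : max M 1 < |ξ N ω|) => ?_).trans hN⟩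
  exact lt_of_le_of_lt (le_max_left M 1) hω

theorem NegligibleP.congr_prob (h : NegligibleP Pr ζ)
    (h' : ∀ δ : ℝ, 0 < δ → ∀ᶠ N in atTop, Pr {ω | ξ N ω ≠ ζ N ω} ≤ ENNReal.ofReal δ) :
    NegligibleP Pr ξ := by
  intro η hη δ hδ
  filter_upwards [h η hη (δ / 2) (by positivity), h' (δ / 2) (by positivity)] with N h1 h2
  refine measure_le_of_subset_union hδ (fun ω hω => ?_) h1 h2
  by_cases e : ξ N ω = ζ N ω
  · left; rw [Set.mem_ofPred_eq, ← e]; exact hω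
  · right; exact e

/-- An `O_p` rate gives an event of high probability with a constant `M` fixed before `N` grows; on
that event a deterministic bound suffices. -/
theorem NegligibleP.of_good {G : ℝ → ℕ → Ω → Prop}
    (hG : ∀ δ : ℝ, 0 < δ → ∃ M : ℝ, 0 < M ∧ ∀ᶠ N in atTop, Pr {ω | ¬ G M N ω} ≤ ENNReal.ofReal δ)
    (hb : ∀ M : ℝ, 0 < M → ∃ b : ℕ → ℝ, Tendsto b atTop (𝓝 0) ∧
      ∀ N ω, G M N ω → |ξ N ω| ≤ b N) : NegligibleP Pr ξ := by
  intro η hη δ hδ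
  obtain ⟨M, hM, hGM⟩ := hG δ hδ
  obtain ⟨b, hb0, hbM⟩ := hb M hM
  filter_upwards [hGM, hb0.eventually_lt_const hη] with N h1 h2
  refine (measure_mono fun ω (hω : η ≤ |ξ N ω|) => ?_).trans h1
  by_contra hg
  linarith [hbM N ω (not_not.1 hg)]

theorem BoundedP.mono (h : BoundedP Pr ζ) (h' : ∀ N ω, |ξ N ω| ≤ |ζ N ω|) : BoundedP Pr ξ :=
  fun δ hδ => (h δ hδ).imp fun _ hM => hM.mono fun N hN =>
    (measure_mono fun ω (hω : _ < |ξ N ω|) => hω.trans_le (h' N ω)).trans hN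

theorem NegligibleP.boundedP (h : NegligibleP Pr ξ) : BoundedP Pr ξ := fun δ hδ =>
  ⟨1, (h 1 one_pos δ hδ).mono fun N hN =>
    (measure_mono fun ω (hω : 1 < |ξ N ω|) => hω.le).trans hN⟩

theorem NegligibleP.add (h : NegligibleP Pr ξ) (h' : NegligibleP Pr ζ) :
    NegligibleP Pr fun N ω => ξ N ω + ζ N ω := by
  intro η hη δ hδ
  filter_upwards [h (η / 2) (by positivity) (δ / 2) (by positivity),
    h' (η / 2) (by positivity) (δ / 2) (by positivity)] with N h1 h2
  refine measure_le_of_subset_union hδ (fun ω hω => ?_) h1 h2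
  by_contra hc
  simp only [Set.mem_union, Set.mem_ofPred_eq, not_or, not_le] at hc hω
  linarith [abs_add_le (ξ N ω) (ζ N ω)]

theorem BoundedP.add (h : BoundedP Pr ξ) (h' : BoundedP Pr ζ) :
    BoundedP Pr fun N ω => ξ N ω + ζ N ω := by
  intro δ hδ
  obtain ⟨M, hM⟩ := h (δ / 2) (by positivity)
  obtain ⟨M', hM'⟩ := h' (δ / 2) (by positivity)
  refine ⟨M + M', ?_⟩
  filter_upwards [hM, hM'] with N h1 h2
  refine measure_le_of_subset_union hδ (fun ω hω => ?_) h1 h2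
  by_contra hc
  simp only [Set.mem_union, Set.mem_ofPred_eq, not_or, not_lt] at hc hω
  linarith [abs_add_le (ξ N ω) (ζ N ω)]

theorem BoundedP.mul (h : BoundedP Pr ξ) (h' : BoundedP Pr ζ) :
    BoundedP Pr fun N ω => ξ N ω * ζ N ω := by
  intro δ hδ
  obtain ⟨M, hM0, hM⟩ := h.exists_pos (δ := δ / 2) (by positivity)
  obtain ⟨M', hM0', hM'⟩ := h'.exists_pos (δ := δ / 2) (by positivity)
  refine ⟨M * M', ?_⟩
  filter_upwards [hM, hM'] with N h1 h2
  refine measure_le_of_subset_union hδ (fun ω hω => ?_) h1 h2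
  by_contra hc
  simp only [Set.mem_union, Set.mem_ofPred_eq, not_or, not_lt, abs_mul] at hc hω
  have := mul_le_mul hc.1 hc.2 (abs_nonneg _) hM0.le
  linarith

theorem BoundedP.mul_negligibleP (h : BoundedP Pr ξ) (h' : NegligibleP Pr ζ) :
    NegligibleP Pr fun N ω => ξ N ω * ζ N ω := by
  intro η hη δ hδ
  obtain ⟨M, hM0, hM⟩ := h.exists_pos (δ := δ / 2) (by positivity)
  filter_upwards [hM, h' (η / (2 * M)) (by positivity) (δ / 2) (by positivity)] with N h1 h2
  refine measure_le_of_subset_union hδ (fun ω hω => ?_) h1 h2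
  by_contra hc
  simp only [Set.mem_union, Set.mem_ofPred_eq, not_or, not_lt, not_le, abs_mul] at hc hω
  have := mul_le_mul hc.1 hc.2.le (abs_nonneg _) hM0.le
  have e : M * (η / (2 * M)) = η / 2 := by field_simp
  linarith

theorem NegligibleP.mul_boundedP (h : NegligibleP Pr ξ) (h' : BoundedP Pr ζ) :
    NegligibleP Pr fun N ω => ξ N ω * ζ N ω := by
  simpa only [mul_comm] using h'.mul_negligibleP h

theorem negligibleP_of_tendsto {a : ℕ → ℝ} (h : Tendsto a atTop (𝓝 0)) :
    NegligibleP Pr fun N (_ : Ω) => a N := by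
  intro η hη δ hδ
  have h1 := h.abs
  rw [abs_zero] at h1
  filter_upwards [h1.eventually_lt_const hη] with N hN
  rw [show {ω : Ω | η ≤ |a N|} = ∅ from Set.eq_empty_of_forall_notMem fun ω hω =>
    absurd hN (not_lt.2 hω)]
  simp

theorem boundedP_const (c : ℝ) : BoundedP Pr fun _ (_ : Ω) => c := fun δ _ =>
  ⟨|c|, Eventually.of_forall fun N => by simp⟩

theorem NegligibleP.sum {ι : Type*} (s : Finset ι) {ξ : ι → ℕ → Ω → ℝ}
    (h : ∀ i ∈ s, NegligibleP Pr (ξ i)) : NegligibleP Pr fun N ω => ∑ i ∈ s, ξ i N ω := by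
  classical
  induction s using Finset.induction_on with
  | empty => simpa using negligibleP_of_tendsto (Pr := Pr) (a := fun _ => 0) tendsto_const_nhds
  | insert i s hi ih =>
    simp only [Finset.sum_insert hi]
    exact (h i (Finset.mem_insert_self i s)).add (ih fun j hj => h j (Finset.mem_insert_of_mem hj))

theorem NegligibleP.inv_sub {p : ℝ} (hp : 0 < p) (h : NegligibleP Pr fun N ω => ξ N ω - p) :
    NegligibleP Pr fun N ω => (ξ N ω)⁻¹ - p⁻¹ := by
  intro η hη δ hδ
  -- The first bound keeps `ξ` above `p / 2`, so that inversion enlarges the error at most by `2 / p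
  -- ^ 2`; the second then yields `η / 2`.
  have hm : 0 < min (p / 2) (η * p ^ 2 / 4) := by positivity
  refine (h _ hm δ hδ).mono fun N hN => (measure_mono fun ω hω => ?_).trans hN
  by_contra hc
  simp only [Set.mem_ofPred_eq, not_le, lt_min_iff] at hc hω
  have h1 : p / 2 < ξ N ω := by linarith [abs_lt.1 hc.1]
  have h2 : 0 < ξ N ω := by linarith
  have e : (ξ N ω)⁻¹ - p⁻¹ = -(ξ N ω - p) * ((ξ N ω)⁻¹ * p⁻¹) := by field_simp; ring
  rw [e, abs_mul, abs_neg, abs_of_pos (by positivity : 0 < (ξ N ω)⁻¹ * p⁻¹)] at hω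
  have h3 : (ξ N ω)⁻¹ * p⁻¹ ≤ 2 / p * p⁻¹ := by
    refine mul_le_mul_of_nonneg_right ?_ (by positivity)
    rw [show 2 / p = (p / 2)⁻¹ by field_simp]
    exact inv_anti₀ (by positivity) h1.le
  have h4 := mul_le_mul hc.2.le h3 (by positivity) (by positivity)
  have e2 : η * p ^ 2 / 4 * (2 / p * p⁻¹) = η / 2 := by field_simp; ring
  linarith

theorem NegligibleP.boundedP_of_sub {p : ℝ} (h : NegligibleP Pr fun N ω => ξ N ω - p) :
    BoundedP Pr ξ := by
  simpa using h.boundedP.add (boundedP_const p)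

theorem NegligibleP.tendstoInMeasure (h : NegligibleP Pr ξ) : TendstoInMeasure Pr ξ atTop 0 := by
  rw [tendstoInMeasure_iff_norm]
  intro η hη
  rw [ENNReal.tendsto_nhds_zero]
  intro δ hδ
  rcases eq_or_ne δ ⊤ with rfl | hδ'
  · exact Eventually.of_forall fun _ => le_top
  filter_upwards [h η hη δ.toReal (ENNReal.toReal_pos hδ.ne' hδ')] with N hN
  rw [ENNReal.ofReal_toReal hδ'] at hN
  simpa [Real.norm_eq_abs] using hN

end StochasticOrder

/-! ### Label counts and fold weights -/

section Counts

variable {𝓧 Ω 𝓤 : Type*} {K : ℕ} [MeasurableSpace 𝓧] [StandardBorelSpace 𝓧] [MeasurableSpace Ω]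
  [MeasurableSpace 𝓤] {P : Measure (Pop 𝓧)} [IsProbabilityMeasure P] {Pr : Measure Ω}
  [IsProbabilityMeasure Pr] {Z : ℕ → Ω → Pop 𝓧} {U : Ω → 𝓤} {F : FoldRule 𝓤 K}

theorem boundedP_sum_units (hZ : ∀ i, Measurable (Z i)) (hZind : iIndepFun Z Pr)
    (hZlaw : ∀ i, Pr.map (Z i) = P) {h : Pop 𝓧 → ℝ} (hh : MemLp h 2 P) (h0 : ∫ z, h z ∂P = 0) :
    BoundedP Pr fun N ω => (√(N : ℝ))⁻¹ * ∑ i : Fin N, h (Z i ω) := by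
  intro δ hδ
  set σ := l2norm P h
  -- Chebyshev asks for `M ^ 2 ≥ σ ^ 2 / δ`; the added `1` keeps `M` positive when `σ = 0`.
  set M := √((σ ^ 2 + 1) / δ) with hM
  have hM2 : M ^ 2 = (σ ^ 2 + 1) / δ := Real.sq_sqrt (by positivity)
  have hM0 : 0 < M := Real.sqrt_pos.2 (by positivity)
  refine ⟨M, (eventually_gt_atTop 0).mono fun N hN => ?_⟩
  have hN' : (0 : ℝ) < N := by exact_mod_cast hN
  have hs : 0 < √(N : ℝ) := Real.sqrt_pos.2 hN'
  have hc := measure_pi_sum_le (ι := Fin N) (π := P) hh (β := fun _ => 1) (by simp)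
    (a := M * √(N : ℝ)) (by positivity) le_rfl
  rw [← map_units hZ hZind hZlaw N] at hc
  have hm : Measurable fun ω (i : Fin N) => Z i ω := measurable_pi_lambda _ fun i => hZ _
  refine (measure_mono fun ω (hω : M < _) => ?_).trans
    ((Measure.le_map_apply hm.aemeasurable _).trans (hc.trans (ENNReal.ofReal_le_ofReal ?_)))
  · rw [abs_mul, abs_of_pos (inv_pos.2 hs), inv_mul_eq_div, lt_div_iff₀ hs] at hω
    simpa [h0] using hω.le
  · rw [Fintype.card_fin, mul_pow, Real.sq_sqrt hN'.le, hM2]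
    have : (N : ℝ) * σ ^ 2 / ((σ ^ 2 + 1) / δ * N) = δ * (σ ^ 2 / (σ ^ 2 + 1)) := by field_simp
    rw [this]
    refine mul_le_of_le_one_right hδ.le (div_le_one_of_le₀ (by linarith) (by positivity))

/-- total weight of the first `N` units, a unit having a weight determined by its label -/
def weightSum (Z : ℕ → Ω → Pop 𝓧) (β : Bool → ℝ) (N : ℕ) (ω : Ω) : ℝ := ∑ i : Fin N, β (Z i ω).R

/-- total weight of the units of a fold -/
def foldWeight (F : FoldRule 𝓤 K) (Z : ℕ → Ω → Pop 𝓧) (U : Ω → 𝓤) (β : Bool → ℝ) (k : Fin K)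
    (N : ℕ) (ω : Ω) : ℝ := ∑ i : Fin N, if folds F Z U N ω i = k then β (Z i ω).R else 0

theorem memLp_label (β : Bool → ℝ) : MemLp (fun z : Pop 𝓧 => β z.R) 2 P := by
  simpa using memLp_label_mul (P := P) (memLp_const (1 : ℝ)) β

theorem negligibleP_weightSum (hZ : ∀ i, Measurable (Z i)) (hZind : iIndepFun Z Pr)
    (hZlaw : ∀ i, Pr.map (Z i) = P) (β : Bool → ℝ) :
    NegligibleP Pr fun N ω => weightSum Z β N ω / N - selectProb P β := by
  have h0 : ∫ z, (β z.R - selectProb P β) ∂P = 0 := by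
    rw [integral_sub (integrable_label β) (integrable_const _)]
    simp [selectProb]
  have h1 := boundedP_sum_units hZ hZind hZlaw
    (h := fun z => β z.R - selectProb P β) ((memLp_label β).sub (memLp_const _)) h0
  have h2 : Tendsto (fun N : ℕ => (√(N : ℝ))⁻¹) atTop (𝓝 0) :=
    (Real.tendsto_sqrt_atTop.comp tendsto_natCast_atTop_atTop).inv_tendsto_atTop
  refine ((negligibleP_of_tendsto (Pr := Pr) h2).mul_boundedP h1).congr_prob fun δ _ => ?_
  filter_upwards [eventually_gt_atTop 0] with N hN
  have hN' : (0 : ℝ) < N := by exact_mod_cast hN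
  rw [show {ω | weightSum Z β N ω / N - selectProb P β ≠ _} = (∅ : Set Ω) from
    Set.eq_empty_of_forall_notMem fun ω hω => hω ?_]
  · simp
  rw [← mul_assoc, ← mul_inv, Real.mul_self_sqrt hN'.le, Finset.sum_sub_distrib]
  simp only [weightSum, Finset.sum_const, Finset.card_univ, Fintype.card_fin, nsmul_eq_mul]
  field_simp

theorem negligibleP_inv_weightSum (hZ : ∀ i, Measurable (Z i)) (hZind : iIndepFun Z Pr)
    (hZlaw : ∀ i, Pr.map (Z i) = P) {β : Bool → ℝ} (hp : 0 < selectProb P β) :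
    NegligibleP Pr fun N ω => N / weightSum Z β N ω - (selectProb P β)⁻¹ := by
  simpa only [inv_div] using (negligibleP_weightSum hZ hZind hZlaw β).inv_sub hp

theorem weightSum_ne_zero (hZ : ∀ i, Measurable (Z i)) (hZind : iIndepFun Z Pr)
    (hZlaw : ∀ i, Pr.map (Z i) = P) {β : Bool → ℝ} (hp : 0 < selectProb P β) {δ : ℝ}
    (hδ : 0 < δ) : ∀ᶠ N in atTop, Pr {ω | weightSum Z β N ω = 0} ≤ ENNReal.ofReal δ := by
  filter_upwards [negligibleP_weightSum hZ hZind hZlaw β _ hp δ hδ] with N hN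
  refine (measure_mono fun ω (hω : _ = _) => ?_).trans hN
  simp [hω, le_abs_self]

theorem weightSum_eq (β : Bool → ℝ) (N : ℕ) (ω : Ω) : weightSum Z β N ω
    = β true * labelCount Z true N ω + β false * labelCount Z false N ω := by
  simp only [weightSum, labelCount, Finset.natCast_card_filter, Finset.mul_sum,
    ← Finset.sum_add_distrib]
  refine Finset.sum_congr rfl fun i _ => ?_
  cases (Z i ω).R <;> simp

theorem foldWeight_eq (β : Bool → ℝ) (k : Fin K) (N : ℕ) (ω : Ω) : foldWeight F Z U β k N ω
    = β true * foldCount F Z U true k N ω + β false * foldCount F Z U false k N ω := by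
  simp only [foldWeight, foldCount, Finset.natCast_card_filter, Finset.mul_sum,
    ← Finset.sum_add_distrib]
  refine Finset.sum_congr rfl fun i _ => ?_
  by_cases h : folds F Z U N ω i = k <;> cases (Z i ω).R <;> simp [h]

/-- A weight determined by the label is a combination of the counts of the two label classes, each
of which is balanced by assumption. -/
theorem IsBalanced.boundedP (hbal : IsBalanced Pr F Z U) (β : Bool → ℝ) (k : Fin K) :
    BoundedP Pr fun N ω => (√(N : ℝ))⁻¹ * (foldWeight F Z U β k N ω - weightSum Z β N ω / K) := by
  have h1 : ∀ r : Bool, BoundedP Pr fun N ω =>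
      (√(N : ℝ))⁻¹ * ((foldCount F Z U r k N ω : ℝ) - (labelCount Z r N ω : ℝ) / K) := by
    intro r δ hδ
    obtain ⟨M, hM⟩ := hbal r k δ hδ
    refine ⟨max M 0, ?_⟩
    filter_upwards [hM, eventually_gt_atTop 0] with N h1 hN
    have hs : 0 < √(N : ℝ) := Real.sqrt_pos.2 (by exact_mod_cast hN)
    refine (measure_mono fun ω (hω : max M 0 < |(√(N : ℝ))⁻¹ *
      ((foldCount F Z U r k N ω : ℝ) - (labelCount Z r N ω : ℝ) / K)|) => ?_).trans h1
    rw [abs_mul, abs_of_pos (inv_pos.2 hs), inv_mul_eq_div, lt_div_iff₀ hs] at hω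
    have h2 : 0 ≤ max M 0 * √(N : ℝ) := by positivity
    refine (ENNReal.ofReal_lt_ofReal_iff (h2.trans_lt hω)).2 (lt_of_le_of_lt ?_ hω)
    exact mul_le_mul_of_nonneg_right (le_max_left _ _) hs.le
  refine (((boundedP_const (β true)).mul (h1 true)).add
    ((boundedP_const (β false)).mul (h1 false))).mono fun N ω => le_of_eq ?_
  rw [weightSum_eq, foldWeight_eq]
  congr 1
  ring

theorem abs_foldWeight_div_le {β : Bool → ℝ} (hβ : ∀ r, 0 ≤ β r) (k : Fin K) (N : ℕ) (ω : Ω) :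
    |foldWeight F Z U β k N ω / weightSum Z β N ω| ≤ 1 := by
  have h0 : 0 ≤ foldWeight F Z U β k N ω := Finset.sum_nonneg fun i _ => by
    split_ifs
    exacts [hβ _, le_rfl]
  have h1 : foldWeight F Z U β k N ω ≤ weightSum Z β N ω := Finset.sum_le_sum fun i _ => by
    split_ifs
    exacts [le_rfl, hβ _]
  rw [abs_of_nonneg (div_nonneg h0 (h0.trans h1))]
  exact div_le_one_of_le₀ h1 (h0.trans h1)

end Counts

/-! ### Learned functions in terms of seed, labels and completed data -/

section Learners

variable {𝓧 Ω 𝓤 B : Type*} {K N : ℕ} [MeasurableSpace 𝓧] [StandardBorelSpace 𝓧]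
  [MeasurableSpace 𝓤] [MeasurableSpace B] {P : Measure (Pop 𝓧)} [IsProbabilityMeasure P]
  {F : FoldRule 𝓤 K} {A : Learner 𝓤 𝓧 B K}

/-- the data observed when the units with completed data `v` have labels `r` -/
def observe (r : Fin N → Bool) (v : Fin N → Obs 𝓧) (i : Fin N) : Obs 𝓧 :=
  ((v i).X, (v i).T, r i, if r i then (v i).Y else 0)

theorem measurable_observe :
    Measurable fun p : (Fin N → Bool) × (Fin N → Obs 𝓧) => observe p.1 p.2 := by
  refine measurable_pi_lambda _ fun i => ?_
  have h1 : Measurable fun p : (Fin N → Bool) × (Fin N → Obs 𝓧) => p.2 i :=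
    (measurable_pi_apply i).comp measurable_snd
  have h2 : Measurable fun p : (Fin N → Bool) × (Fin N → Obs 𝓧) => p.1 i :=
    (measurable_pi_apply i).comp measurable_fst
  refine h1.fst.prodMk (h1.snd.fst.prodMk (h2.prodMk ?_))
  exact Measurable.ite (h2 (measurableSet_singleton true)) h1.snd.snd.snd measurable_const

/-- the function learned for fold `k`, in terms of seed, labels and completed data -/
def learned (A : Learner 𝓤 𝓧 B K) (F : FoldRule 𝓤 K) (N : ℕ) (k : Fin K)
    (c : 𝓤 × (Fin N → Bool)) (v : Fin N → Obs 𝓧) : B → ℝ :=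
  A N k c.1 (F N c.1 c.2) (observe c.2 v)

theorem measurable_foldRule (hF : ∀ (N : ℕ) (r : Fin N → Bool), Measurable fun u => F N u r)
    (N : ℕ) : Measurable fun c : 𝓤 × (Fin N → Bool) => F N c.1 c.2 :=
  measurable_from_prod_countable_left fun r => hF N r

/-- Fold assignments range over a finite set, so joint measurability reduces to that for each fixed
assignment. -/
theorem IsCrossFit.measurable_learned (hA : IsCrossFit A)
    (hF : ∀ (N : ℕ) (r : Fin N → Bool), Measurable fun u => F N u r) (N : ℕ) (k : Fin K) :
    Measurable fun q : ((𝓤 × (Fin N → Bool)) × (Fin N → Obs 𝓧)) × B =>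
      learned A F N k q.1.1 q.1.2 q.2 := by
  have h1 : Measurable fun p : (Fin N → Fin K) ×
      (((𝓤 × (Fin N → Bool)) × (Fin N → Obs 𝓧)) × B) =>
        A N k p.2.1.1.1 p.1 (observe p.2.1.1.2 p.2.1.2) p.2.2 := by
    refine measurable_from_prod_countable_right fun κ => ?_
    have h2 : Measurable fun q : ((𝓤 × (Fin N → Bool)) × (Fin N → Obs 𝓧)) × B =>
        observe q.1.1.2 q.1.2 :=
      measurable_observe.comp (f := fun q : ((𝓤 × (Fin N → Bool)) × (Fin N → Obs 𝓧)) × B =>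
        (q.1.1.2, q.1.2)) (by fun_prop)
    exact (hA.measurable N k κ).comp (f := fun q : ((𝓤 × (Fin N → Bool)) × (Fin N → Obs 𝓧)) × B =>
      (q.1.1.1, observe q.1.1.2 q.1.2, q.2))
      ((measurable_fst.comp (measurable_fst.comp measurable_fst)).prodMk (h2.prodMk measurable_snd))
  exact h1.comp (f := fun q : ((𝓤 × (Fin N → Bool)) × (Fin N → Obs 𝓧)) × B =>
    (F N q.1.1.1 q.1.1.2, q)) (((measurable_foldRule hF N).comp
      (measurable_fst.comp measurable_fst)).prodMk measurable_id)

theorem IsCrossFit.learned_congr (hA : IsCrossFit A) (k : Fin K) (c : 𝓤 × (Fin N → Bool))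
    (v v' : Fin N → Obs 𝓧) (h : ∀ i, F N c.1 c.2 i ≠ k → v i = v' i) :
    learned A F N k c v = learned A F N k c v' :=
  hA.out_of_fold N k c.1 _ _ _ fun i hi => by simp only [observe, h i hi]

theorem measurable_effectError_param {γ : Type*} [MeasurableSpace γ] {m : γ → Bool × 𝓧 → ℝ}
    (hm : Measurable fun r : γ × (Bool × 𝓧) => m r.1 r.2) :
    Measurable fun r : γ × Obs 𝓧 => effectError P (m r.1) r.2 := by
  have h (s : Bool) : Measurable fun r : γ × Obs 𝓧 => armError P (m r.1) s r.2.X := by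
    refine (hm.comp (f := fun r : γ × Obs 𝓧 => (r.1, s, r.2.1)) (by fun_prop)).sub ?_
    exact (measurable_muStar P s).comp (measurable_fst.comp measurable_snd)
  exact (h true).sub (h false)

theorem measurable_correction_param {γ : Type*} [MeasurableSpace γ] {e : γ → 𝓧 → ℝ}
    {m : γ → Bool × 𝓧 → ℝ} (he : Measurable fun r : γ × 𝓧 => e r.1 r.2)
    (hm : Measurable fun r : γ × (Bool × 𝓧) => m r.1 r.2) :
    Measurable fun r : γ × Obs 𝓧 => correction (e r.1) (m r.1) r.2 := by
  have h (s : Bool) : Measurable fun r : γ × Obs 𝓧 => m r.1 (s, r.2.X) :=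
    hm.comp (f := fun r : γ × Obs 𝓧 => (r.1, s, r.2.1)) (by fun_prop)
  have h1 : Measurable fun r : γ × Obs 𝓧 => e r.1 r.2.X :=
    he.comp (f := fun r : γ × Obs 𝓧 => (r.1, r.2.1)) (by fun_prop)
  have h2 : Measurable fun r : γ × Obs 𝓧 => ind r.2.T :=
    (measurable_of_finite ind).comp (measurable_fst.comp (measurable_snd.comp measurable_snd))
  have h3 : Measurable fun r : γ × Obs 𝓧 => r.2.Y :=
    measurable_snd.comp (measurable_snd.comp (measurable_snd.comp measurable_snd))
  exact ((h2.div h1).mul (h3.sub (h true))).sub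
    (((measurable_const.sub h2).div (measurable_const.sub h1)).mul (h3.sub (h false)))

theorem measurable_correctionError_param {γ : Type*} [MeasurableSpace γ] {e : γ → 𝓧 → ℝ}
    {m : γ → Bool × 𝓧 → ℝ} (he : Measurable fun r : γ × 𝓧 => e r.1 r.2)
    (hm : Measurable fun r : γ × (Bool × 𝓧) => m r.1 r.2) :
    Measurable fun r : γ × Obs 𝓧 => correctionError P (e r.1) (m r.1) r.2 := by
  have h1 : Measurable fun r : γ × 𝓧 => eStar P r.2 := (measurable_eStar P).comp measurable_snd
  have h2 : Measurable fun r : γ × (Bool × 𝓧) => regression P r.2 :=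
    (measurable_muStar_uncurry P).comp measurable_snd
  exact (measurable_correction_param he hm).sub (measurable_correction_param (e := fun _ : γ => eStar P)
    (m := fun _ : γ => regression P) h1 h2)

end Learners

/-! ### Cross-fitted fluctuations -/

section CrossFit

variable {𝓧 Ω 𝓤 : Type*} {K : ℕ} [MeasurableSpace 𝓧] [StandardBorelSpace 𝓧]
  [MeasurableSpace Ω] [MeasurableSpace 𝓤] {P : Measure (Pop 𝓧)} [IsProbabilityMeasure P]
  {Pr : Measure Ω} [IsProbabilityMeasure Pr] {Z : ℕ → Ω → Pop 𝓧} {U : Ω → 𝓤} {F : FoldRule 𝓤 K}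

/-- sum, over the units of a fold, of weighted centred values of a function, the weights being
determined by the labels and the values being computed from the completed data -/
def foldSum (P : Measure (Pop 𝓧)) (F : FoldRule 𝓤 K) (Z : ℕ → Ω → Pop 𝓧) (U : Ω → 𝓤)
    (β : Bool → ℝ) (k : Fin K) (g : ℕ → Ω → Obs 𝓧 → ℝ) (N : ℕ) (ω : Ω) : ℝ :=
  ∑ i : Fin N, if folds F Z U N ω i = k then
    β (Z i ω).R * (g N ω (full (Z i ω)) - ∫ z, g N ω (full z) ∂P) else 0

/-- Given seed, labels and the data outside the fold, the sum has variance at most `N * b N ^ 2`, so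
after division by `√N` Chebyshev gives `b N ^ 2 / η ^ 2`. The bound `b` is available only on the
event `G M`, which is why `measure_crossfit_le` carries the moment condition inside its event. -/
theorem negligibleP_foldSum (hM : MCAR P) (hZ : ∀ i, Measurable (Z i)) (hZind : iIndepFun Z Pr)
    (hZlaw : ∀ i, Pr.map (Z i) = P) (hU : Measurable U) (hUind : IndepFun U (fun ω i => Z i ω) Pr)
    (hF : ∀ (N : ℕ) (r : Fin N → Bool), Measurable fun u => F N u r)
    {β : Bool → ℝ} (hβ : ∀ r, |β r| ≤ 1) (k : Fin K)
    {g : ∀ N : ℕ, 𝓤 × (Fin N → Bool) → (Fin N → Obs 𝓧) → Obs 𝓧 → ℝ}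
    (hg : ∀ N, Measurable fun r : ((𝓤 × (Fin N → Bool)) × (Fin N → Obs 𝓧)) × Obs 𝓧 =>
      g N r.1.1 r.1.2 r.2)
    (hoff : ∀ N c v v', (∀ i, F N c.1 c.2 i ≠ k → v i = v' i) → g N c v = g N c v')
    {G : ℝ → ℕ → Ω → Prop}
    (hG : ∀ δ : ℝ, 0 < δ → ∃ M : ℝ, 0 < M ∧ ∀ᶠ N in atTop, Pr {ω | ¬ G M N ω} ≤ ENNReal.ofReal δ)
    (hb : ∀ M : ℝ, 0 < M → ∃ b : ℕ → ℝ, Tendsto b atTop (𝓝 0) ∧ ∀ N ω, G M N ω →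
      MemLp (fun z => g N (seedLabels Z U N ω) (completed Z N ω) (full z)) 2 P ∧
        l2norm P (fun z => g N (seedLabels Z U N ω) (completed Z N ω) (full z)) ≤ b N) :
    NegligibleP Pr fun N ω => (√(N : ℝ))⁻¹ *
      foldSum P F Z U β k (fun N ω => g N (seedLabels Z U N ω) (completed Z N ω)) N ω := by
  intro η hη δ hδ
  obtain ⟨M, hM0, hGM⟩ := hG (δ / 2) (by positivity)
  obtain ⟨b, hb0, hbM⟩ := hb M hM0
  have : IsProbabilityMeasure (P.map full) :=
    Measure.isProbabilityMeasure_map measurable_full.aemeasurable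
  have hlim : Tendsto (fun N => |b N| ^ 2 / η ^ 2) atTop (𝓝 0) := by
    have := (hb0.abs.pow 2).div_const (η ^ 2)
    simpa using this
  filter_upwards [hGM, hlim.eventually_le_const (by positivity : 0 < δ / 2),
    eventually_gt_atTop 0] with N h1 h2 hN
  have hN' : (0 : ℝ) < N := by exact_mod_cast hN
  have hs : 0 < √(N : ℝ) := Real.sqrt_pos.2 hN'
  have hgN : ∀ c v, Measurable (g N c v) := fun c v =>
    (hg N).comp (measurable_prodMk_left (x := (c, v)))
  have hc := measure_crossfit_le (Pr := Pr) (π := P.map full) (K := K)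
    (measurable_seedLabels hZ hU N)
    (measurable_completed hZ N) (map_seedLabels_completed hM hZ hZind hZlaw hU hUind N)
    (g := g N) ((hg N).comp (f := fun r : (𝓤 × (Fin N → Bool)) × (Fin N → Obs 𝓧) × Obs 𝓧 =>
      ((r.1, r.2.1), r.2.2)) (by fun_prop))
    (κ := fun c => F N c.1 c.2) (measurable_foldRule hF N) k (hoff N)
    (β := fun c i => β (c.2 i)) (measurable_pi_lambda _ fun i =>
      (measurable_of_finite β).comp ((measurable_pi_apply i).comp measurable_snd))
    (fun c i => hβ _) (a := η * √(N : ℝ)) (by positivity) (abs_nonneg (b N))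
  have hc' := hc.trans (b := _) (c := ENNReal.ofReal (δ / 2)) (ENNReal.ofReal_le_ofReal (by
    rw [Fintype.card_fin, mul_pow, Real.sq_sqrt hN'.le]
    refine le_trans (le_of_eq ?_) h2
    field_simp))
  refine measure_le_of_subset_union hδ (fun ω hω => ?_) h1 hc'
  by_cases hgood : G M N ω
  swap
  · exact Or.inl hgood
  right
  obtain ⟨hL, hle⟩ := hbM N ω hgood
  refine ⟨?_, ?_⟩
  · rw [lintegral_map ((hgN _ _).enorm.pow_const 2) measurable_full, lintegral_enorm_sq hL]
    exact ENNReal.ofReal_le_ofReal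
      (pow_le_pow_left₀ (l2norm_nonneg _ _) (hle.trans (le_abs_self _)) 2)
  · have e : ∫ x, g N (seedLabels Z U N ω) (completed Z N ω) x ∂(P.map full)
        = ∫ z, g N (seedLabels Z U N ω) (completed Z N ω) (full z) ∂P :=
      integral_map measurable_full.aemeasurable (hgN _ _).aestronglyMeasurable
    rw [e]
    have hω' : η ≤ |(√(N : ℝ))⁻¹ * foldSum P F Z U β k
      (fun N ω => g N (seedLabels Z U N ω) (completed Z N ω)) N ω| := hω
    rw [abs_mul, abs_of_pos (inv_pos.2 hs), inv_mul_eq_div, le_div_iff₀ hs] at hω'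
    exact hω'

end CrossFit

/-! ### Negligibility of fitting errors and biases -/

section Fits

variable {𝓧 Ω 𝓤 : Type*} {K : ℕ} [MeasurableSpace 𝓧] [StandardBorelSpace 𝓧]
  [MeasurableSpace Ω] [MeasurableSpace 𝓤] {P : Measure (Pop 𝓧)} [IsProbabilityMeasure P]
  {Pr : Measure Ω} [IsProbabilityMeasure Pr] {Z : ℕ → Ω → Pop 𝓧} {U : Ω → 𝓤} {F : FoldRule 𝓤 K}
  {eLearn : Learner 𝓤 𝓧 𝓧 K} {muLearn : Learner 𝓤 𝓧 (Bool × 𝓧) K} {ρe ρmu : ℕ → ℝ} {ε q C : ℝ}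

/-- The nuisance estimates `e`, `m` respect overlap and have errors at most `re`, `rm`. -/
structure GoodFit (ε : ℝ) (P : Measure (Pop 𝓧)) [IsFiniteMeasure P] (e : 𝓧 → ℝ)
    (m : Bool × 𝓧 → ℝ) (re rm : ℝ) : Prop where
  overlap : ∀ᵐ z ∂P, e z.X ∈ Set.Icc ε (1 - ε)
  memLp : MemLp (regressionError P m) 2 P
  propensity_le : l2norm P (propensityError P e) ≤ re
  regression_le : l2norm P (regressionError P m) ≤ rm

theorem measurable_fitted {B : Type*} [MeasurableSpace B] {A : Learner 𝓤 𝓧 B K}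
    (hA : IsCrossFit A) (N : ℕ) (ω : Ω) (k : Fin K) : Measurable (fitted A F Z U N ω k) :=
  (hA.measurable N k (folds F Z U N ω)).comp
    (f := fun b : B => (U ω, sample Z N ω, b)) (by fun_prop)

/-- One constant `M` serves both rates. Square integrability of the regression error is not assumed:
it is read off from the finite bound on its norm. -/
theorem exists_goodFit (h : Basic ε q C P) (he : IsCrossFit eLearn) (hmu : IsCrossFit muLearn)
    (k : Fin K)
    (heBdd : ∀ N : ℕ, ∀ᵐ ω ∂Pr, ∀ᵐ z ∂P, fitted eLearn F Z U N ω k z.X ∈ Set.Icc ε (1 - ε))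
    (hρe0 : ∀ N, 0 ≤ ρe N) (hρmu0 : ∀ N, 0 ≤ ρmu N)
    (heRate : IsBigOp Pr (fun N ω =>
      eLpNorm (fun z : Pop 𝓧 => fitted eLearn F Z U N ω k z.X - eStar P z.X) 2 P) ρe)
    (hmuRate : IsBigOp Pr (fun N ω =>
      eLpNorm (fun z : Pop 𝓧 => fitted muLearn F Z U N ω k (z.T, z.X) - muStar P z.T z.X) 2 P) ρmu)
    {δ : ℝ} (hδ : 0 < δ) : ∃ M : ℝ, 0 < M ∧ ∀ᶠ N in atTop,
      Pr {ω | ¬ GoodFit ε P (fitted eLearn F Z U N ω k) (fitted muLearn F Z U N ω k)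
        (M * ρe N) (M * ρmu N)} ≤ ENNReal.ofReal δ := by
  obtain ⟨M1, hM1⟩ := heRate (δ / 2) (by positivity)
  obtain ⟨M2, hM2⟩ := hmuRate (δ / 2) (by positivity)
  set M := max 1 (max M1 M2)
  have hMe : ∀ N, M1 * ρe N ≤ M * ρe N := fun N =>
    mul_le_mul_of_nonneg_right ((le_max_left _ _).trans (le_max_right _ _)) (hρe0 N)
  have hMmu : ∀ N, M2 * ρmu N ≤ M * ρmu N := fun N =>
    mul_le_mul_of_nonneg_right ((le_max_right _ _).trans (le_max_right _ _)) (hρmu0 N)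
  have hM : 0 < M := lt_max_of_lt_left one_pos
  refine ⟨M, hM, ?_⟩
  filter_upwards [hM1, hM2] with N h1 h2
  set S := {ω | ¬ ∀ᵐ z ∂P, fitted eLearn F Z U N ω k z.X ∈ Set.Icc ε (1 - ε)}
  have hS : Pr S = 0 := heBdd N
  refine le_trans (measure_mono (t := S ∪ ({ω | ENNReal.ofReal (M1 * ρe N) < eLpNorm
      (fun z : Pop 𝓧 => fitted eLearn F Z U N ω k z.X - eStar P z.X) 2 P} ∪
      {ω | ENNReal.ofReal (M2 * ρmu N) < eLpNorm
      (fun z : Pop 𝓧 => fitted muLearn F Z U N ω k (z.T, z.X) - muStar P z.T z.X) 2 P}))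
      fun ω hω => ?_) ((measure_union_le _ _).trans ?_)
  · by_contra hc
    simp only [Set.mem_union, Set.mem_ofPred_eq, not_or, not_lt, S, not_not] at hc
    obtain ⟨hr, hce, hcm⟩ := hc
    have hLe := memLp_propensityError h (measurable_fitted he N ω k) hr
    have hLm : MemLp (regressionError P (fitted muLearn F Z U N ω k)) 2 P :=
      ⟨(((measurable_fitted hmu N ω k).comp measurable_TX).sub
        (measurable_muStar_TX P)).aestronglyMeasurable, hcm.trans_lt ENNReal.ofReal_lt_top⟩
    refine hω ⟨hr, hLm, ?_, ?_⟩
    · rw [l2norm_eq_toReal hLe]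
      exact ENNReal.toReal_le_of_le_ofReal (mul_nonneg hM.le (hρe0 N))
        (hce.trans (ENNReal.ofReal_le_ofReal (hMe N)))
    · rw [l2norm_eq_toReal hLm]
      exact ENNReal.toReal_le_of_le_ofReal (mul_nonneg hM.le (hρmu0 N))
        (hcm.trans (ENNReal.ofReal_le_ofReal (hMmu N)))
  · rw [hS, zero_add]
    exact measure_le_of_subset_union hδ subset_rfl h1 h2

/-- expected error of the conditional effect fitted for fold `k` -/
def effectBias (P : Measure (Pop 𝓧)) [IsFiniteMeasure P] (m : Bool × 𝓧 → ℝ) : ℝ :=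
  ∫ z, effectError P m (full z) ∂P

/-- expected error of the correction -/
def correctionBias (P : Measure (Pop 𝓧)) [IsFiniteMeasure P] (e : 𝓧 → ℝ) (m : Bool × 𝓧 → ℝ) : ℝ :=
  ∫ z, correctionError P e m (full z) ∂P

theorem negligibleP_effectError (h : Basic ε q C P) (hM : MCAR P) (hε : 0 < ε) (hε' : ε < 1 / 2)
    (hZ : ∀ i, Measurable (Z i)) (hZind : iIndepFun Z Pr)
    (hZlaw : ∀ i, Pr.map (Z i) = P) (hU : Measurable U) (hUind : IndepFun U (fun ω i => Z i ω) Pr)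
    (hF : ∀ (N : ℕ) (r : Fin N → Bool), Measurable fun u => F N u r)
    (hmu : IsCrossFit muLearn) (hρmu : Tendsto ρmu atTop (𝓝 0)) (k : Fin K)
    (hgood : ∀ δ : ℝ, 0 < δ → ∃ M : ℝ, 0 < M ∧ ∀ᶠ N in atTop,
      Pr {ω | ¬ GoodFit ε P (fitted eLearn F Z U N ω k) (fitted muLearn F Z U N ω k)
        (M * ρe N) (M * ρmu N)} ≤ ENNReal.ofReal δ) {β : Bool → ℝ} (hβ : ∀ r, |β r| ≤ 1) :
    NegligibleP Pr fun N ω => (√(N : ℝ))⁻¹ * foldSum P F Z U β k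
      (fun N ω => effectError P (fitted muLearn F Z U N ω k)) N ω := by
  refine negligibleP_foldSum hM hZ hZind hZlaw hU hUind hF hβ k
    (g := fun N c v => effectError P (learned muLearn F N k c v))
    (fun N => measurable_effectError_param
      (m := fun r : (𝓤 × (Fin N → Bool)) × (Fin N → Obs 𝓧) => learned muLearn F N k r.1 r.2)
      (hmu.measurable_learned hF N k))
    (fun N c v v' hv => by rw [hmu.learned_congr k c v v' hv]) hgood fun M _ => ?_
  refine ⟨fun N => 2 * ε⁻¹ * (M * ρmu N), ?_, fun N ω hg => ?_⟩
  · simpa using (hρmu.const_mul M).const_mul (2 * ε⁻¹)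
  · have := effectError_l2 h hε hε' (measurable_fitted hmu N ω k) hg.memLp
    exact ⟨this.1, this.2.trans (mul_le_mul_of_nonneg_left hg.regression_le (by positivity))⟩

theorem correctionError_l2_of_goodFit (h : Basic ε q C P) (hM : MCAR P) (hε : 0 < ε)
    (hq : 2 < q) (hC : 0 < C) {e : 𝓧 → ℝ} {m : Bool × 𝓧 → ℝ} (he : Measurable e)
    (hm : Measurable m) {re rm : ℝ} (hg : GoodFit ε P e m re rm) :
    MemLp (fun z => correctionError P e m (full z)) 2 P ∧
      l2norm P (fun z => correctionError P e m (full z))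
        ≤ 2 * (√C * ((ε ^ 2)⁻¹ * re) + ε⁻¹ * rm) := by
  have := correctionError_l2 h hM.mar hε hq hC he hg.overlap hm hg.memLp
  refine ⟨this.1, this.2.trans (mul_le_mul_of_nonneg_left (add_le_add ?_ ?_) two_pos.le)⟩
  · exact mul_le_mul_of_nonneg_left (mul_le_mul_of_nonneg_left hg.propensity_le (by positivity))
      (Real.sqrt_nonneg _)
  · exact mul_le_mul_of_nonneg_left hg.regression_le (by positivity)

theorem tendsto_correction_bound (hρe : Tendsto ρe atTop (𝓝 0)) (hρmu : Tendsto ρmu atTop (𝓝 0))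
    (M : ℝ) : Tendsto (fun N => 2 * (√C * ((ε ^ 2)⁻¹ * (M * ρe N)) + ε⁻¹ * (M * ρmu N)))
      atTop (𝓝 0) := by
  have h1 := ((hρe.const_mul M).const_mul ((ε ^ 2)⁻¹)).const_mul √C
  have h2 := (hρmu.const_mul M).const_mul ε⁻¹
  simpa using (h1.add h2).const_mul 2

theorem negligibleP_correctionError (h : Basic ε q C P) (hM : MCAR P) (hε : 0 < ε)
    (hq : 2 < q) (hC : 0 < C)
    (hZ : ∀ i, Measurable (Z i)) (hZind : iIndepFun Z Pr)
    (hZlaw : ∀ i, Pr.map (Z i) = P) (hU : Measurable U) (hUind : IndepFun U (fun ω i => Z i ω) Pr)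
    (hF : ∀ (N : ℕ) (r : Fin N → Bool), Measurable fun u => F N u r)
    (he : IsCrossFit eLearn) (hmu : IsCrossFit muLearn)
    (hρe : Tendsto ρe atTop (𝓝 0)) (hρmu : Tendsto ρmu atTop (𝓝 0)) (k : Fin K)
    (hgood : ∀ δ : ℝ, 0 < δ → ∃ M : ℝ, 0 < M ∧ ∀ᶠ N in atTop,
      Pr {ω | ¬ GoodFit ε P (fitted eLearn F Z U N ω k) (fitted muLearn F Z U N ω k)
        (M * ρe N) (M * ρmu N)} ≤ ENNReal.ofReal δ) {β : Bool → ℝ} (hβ : ∀ r, |β r| ≤ 1) :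
    NegligibleP Pr fun N ω => (√(N : ℝ))⁻¹ * foldSum P F Z U β k
      (fun N ω => correctionError P (fitted eLearn F Z U N ω k) (fitted muLearn F Z U N ω k)) N ω := by
  refine negligibleP_foldSum hM hZ hZind hZlaw hU hUind hF hβ k
    (g := fun N c v => correctionError P (learned eLearn F N k c v) (learned muLearn F N k c v))
    (fun N => measurable_correctionError_param
      (e := fun r : (𝓤 × (Fin N → Bool)) × (Fin N → Obs 𝓧) => learned eLearn F N k r.1 r.2)
      (m := fun r : (𝓤 × (Fin N → Bool)) × (Fin N → Obs 𝓧) => learned muLearn F N k r.1 r.2)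
      (he.measurable_learned hF N k) (hmu.measurable_learned hF N k))
    (fun N c v v' hv => by rw [hmu.learned_congr k c v v' hv, he.learned_congr k c v v' hv])
    hgood fun M _ => ?_
  exact ⟨_, tendsto_correction_bound (C := C) (ε := ε) hρe hρmu M, fun N ω hg =>
    correctionError_l2_of_goodFit h hM hε hq hC (measurable_fitted he N ω k)
      (measurable_fitted hmu N ω k) hg⟩

/-- Consistency without a rate is enough here, because in `remainder` this bias is multiplied by a
scaled fold imbalance, which is `O_p(1)`. -/
theorem negligibleP_correctionBias (h : Basic ε q C P) (hM : MCAR P) (hε : 0 < ε)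
    (hq : 2 < q) (hC : 0 < C) (he : IsCrossFit eLearn) (hmu : IsCrossFit muLearn)
    (hρe : Tendsto ρe atTop (𝓝 0)) (hρmu : Tendsto ρmu atTop (𝓝 0)) (k : Fin K)
    (hgood : ∀ δ : ℝ, 0 < δ → ∃ M : ℝ, 0 < M ∧ ∀ᶠ N in atTop,
      Pr {ω | ¬ GoodFit ε P (fitted eLearn F Z U N ω k) (fitted muLearn F Z U N ω k)
        (M * ρe N) (M * ρmu N)} ≤ ENNReal.ofReal δ) :
    NegligibleP Pr fun N ω =>
      correctionBias P (fitted eLearn F Z U N ω k) (fitted muLearn F Z U N ω k) := by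
  refine NegligibleP.of_good hgood fun M _ =>
    ⟨_, tendsto_correction_bound (C := C) (ε := ε) hρe hρmu M, fun N ω hg => ?_⟩
  have := correctionError_l2_of_goodFit h hM hε hq hC (measurable_fitted he N ω k)
      (measurable_fitted hmu N ω k) hg
  exact (abs_integral_le_l2norm this.1).trans this.2

/-- Either bias alone may be larger than `N ^ (-1 / 2)`; their sum is bounded by the product of the
nuisance errors. -/
theorem negligibleP_bias (h : Basic ε q C P) (hM : MCAR P) (hε : 0 < ε) (hε' : ε < 1 / 2)
    (hq : 2 < q) (hC : 0 < C) (he : IsCrossFit eLearn) (hmu : IsCrossFit muLearn)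
    (hρ : (fun N => ρmu N * ρe N) =o[atTop] fun N : ℕ => (N : ℝ) ^ (-(1 / 2) : ℝ)) (k : Fin K)
    (hgood : ∀ δ : ℝ, 0 < δ → ∃ M : ℝ, 0 < M ∧ ∀ᶠ N in atTop,
      Pr {ω | ¬ GoodFit ε P (fitted eLearn F Z U N ω k) (fitted muLearn F Z U N ω k)
        (M * ρe N) (M * ρmu N)} ≤ ENNReal.ofReal δ) :
    NegligibleP Pr fun N ω => √(N : ℝ) * (effectBias P (fitted muLearn F Z U N ω k) +
      correctionBias P (fitted eLearn F Z U N ω k) (fitted muLearn F Z U N ω k)) := by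
  refine NegligibleP.of_good hgood fun M hM0 => ⟨fun N => 2 * (ε ^ 2)⁻¹ * M ^ 2 *
    (√(N : ℝ) * (ρmu N * ρe N)), ?_, fun N ω hg => ?_⟩
  · have h1 : Tendsto (fun N : ℕ => √(N : ℝ) * (ρmu N * ρe N)) atTop (𝓝 0) := by
      refine hρ.tendsto_div_nhds_zero.congr fun N => ?_
      rw [show (-(1 / 2) : ℝ) = -(1 / 2 : ℝ) by norm_num, Real.rpow_neg (Nat.cast_nonneg N),
        ← Real.sqrt_eq_rpow, div_inv_eq_mul, mul_comm]
    simpa using h1.const_mul (2 * (ε ^ 2)⁻¹ * M ^ 2)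
  · have h1 := abs_integral_errors_le h hM.mar hε hε' hq hC (measurable_fitted he N ω k) hg.overlap
      (measurable_fitted hmu N ω k) hg.memLp
    have h2 := mul_le_mul hg.propensity_le hg.regression_le (l2norm_nonneg _ _)
      ((l2norm_nonneg _ _).trans hg.propensity_le)
    have h3 := h1.trans (mul_le_mul_of_nonneg_left h2 (by positivity))
    rw [abs_mul, abs_of_nonneg (Real.sqrt_nonneg _)]
    refine (mul_le_mul_of_nonneg_left h3 (Real.sqrt_nonneg _)).trans (le_of_eq ?_)
    ring

end Fits

/-! ### Exact decomposition of the estimation error -/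

section Decomposition

variable {𝓧 Ω 𝓤 : Type*} {K : ℕ} [MeasurableSpace 𝓧] [StandardBorelSpace 𝓧]
  [MeasurableSpace Ω] [MeasurableSpace 𝓤] {P : Measure (Pop 𝓧)} [IsProbabilityMeasure P]
  {Z : ℕ → Ω → Pop 𝓧} {U : Ω → 𝓤} {F : FoldRule 𝓤 K}
  {eLearn : Learner 𝓤 𝓧 𝓧 K} {muLearn : Learner 𝓤 𝓧 (Bool × 𝓧) K}

/-- the estimator that averages the imputed effects with weights determined by the labels -/
def weightedEstimator {N : ℕ} (β : Bool → ℝ) (κ : Fin N → Fin K) (e : Fin K → 𝓧 → ℝ)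
    (m : Fin K → Bool × 𝓧 → ℝ) (w : Fin N → Obs 𝓧) : ℝ :=
  (∑ i, β (w i).R)⁻¹ * ∑ i, β (w i).R * (m (κ i) (true, (w i).X) - m (κ i) (false, (w i).X))
    + avgCorrection κ e m w

theorem deltaOur_eq {N : ℕ} (κ : Fin N → Fin K) (e : Fin K → 𝓧 → ℝ) (m : Fin K → Bool × 𝓧 → ℝ)
    (w : Fin N → Obs 𝓧) : deltaOur κ e m w = weightedEstimator (fun _ => 1) κ e m w := by
  simp [deltaOur, weightedEstimator]

theorem deltaZB_eq {N : ℕ} (κ : Fin N → Fin K) (e : Fin K → 𝓧 → ℝ) (m : Fin K → Bool × 𝓧 → ℝ)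
    (w : Fin N → Obs 𝓧) : deltaZB κ e m w = weightedEstimator (fun r => ind (!r)) κ e m w := by
  have h : ∀ r : Bool, ind (!r) = if r = false then 1 else 0 := fun r => by cases r <;> simp [ind]
  simp only [deltaZB, weightedEstimator, numUnlabelled, h, Finset.natCast_card_filter, one_div,
    Finset.sum_filter, ite_mul, one_mul, zero_mul]

/-- Only labelled units contribute, and for them the observation coincides with the completed one.
-/
theorem avgCorrection_sample (κ : Fin N → Fin K) (e : Fin K → 𝓧 → ℝ) (m : Fin K → Bool × 𝓧 → ℝ)
    (ω : Ω) : avgCorrection κ e m (sample Z N ω) = (weightSum Z ind N ω)⁻¹ *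
      ∑ i : Fin N, ind (Z i ω).R * correction (e (κ i)) (m (κ i)) (full (Z i ω)) := by
  rw [avgCorrection, numLabelled, Finset.natCast_card_filter, Finset.sum_filter, one_div]
  refine congrArg₂ _ (congrArg _ (Finset.sum_congr rfl fun i _ => rfl))
    (Finset.sum_congr rfl fun i _ => ?_)
  have hR : (sample Z N ω i).R = (Z i ω).R := rfl
  by_cases h : (Z i ω).R = true
  · have : sample Z N ω i = full (Z i ω) := by
      change ((Z i ω).X, (Z i ω).T, (Z i ω).R, if (Z i ω).R then (Z i ω).Y else 0) = _
      rw [h]; rfl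
    rw [hR, if_pos h, h, this]; simp [ind]
  · rw [hR, if_neg h]; simp [ind, h]

theorem sum_folds_eq (β : Bool → ℝ) (g : Fin K → ℕ → Ω → Obs 𝓧 → ℝ) (N : ℕ) (ω : Ω) :
    ∑ i : Fin N, β (Z i ω).R * g (folds F Z U N ω i) N ω (full (Z i ω))
      = ∑ k, (foldSum P F Z U β k (g k) N ω
        + foldWeight F Z U β k N ω * ∫ z, g k N ω (full z) ∂P) := by
  have h : ∀ k, foldSum P F Z U β k (g k) N ω + foldWeight F Z U β k N ω * ∫ z, g k N ω (full z) ∂P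
      = ∑ i : Fin N, if folds F Z U N ω i = k then β (Z i ω).R * g k N ω (full (Z i ω)) else 0 := by
    intro k
    rw [foldSum, foldWeight, Finset.sum_mul, ← Finset.sum_add_distrib]
    refine Finset.sum_congr rfl fun i _ => ?_
    split_ifs <;> ring
  simp only [h]
  rw [Finset.sum_comm]
  simp

/-- the part of the estimation error that is not linear in the units -/
def remainder (P : Measure (Pop 𝓧)) [IsFiniteMeasure P] (F : FoldRule 𝓤 K) (Z : ℕ → Ω → Pop 𝓧)
    (U : Ω → 𝓤) (eLearn : Learner 𝓤 𝓧 𝓧 K) (muLearn : Learner 𝓤 𝓧 (Bool × 𝓧) K) (β : Bool → ℝ)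
    (N : ℕ) (ω : Ω) : ℝ :=
  (N / weightSum Z β N ω - (selectProb P β)⁻¹) *
      ((√(N : ℝ))⁻¹ * ∑ i : Fin N, β (Z i ω).R * effectDev P (Z i ω))
    + (N / weightSum Z ind N ω - (labelProb P)⁻¹) *
      ((√(N : ℝ))⁻¹ * ∑ i : Fin N, ind (Z i ω).R * weightedResid P (Z i ω))
    + (N / weightSum Z β N ω * ∑ k, (√(N : ℝ))⁻¹ *
        foldSum P F Z U β k (fun N ω => effectError P (fitted muLearn F Z U N ω k)) N ω
      + N / weightSum Z ind N ω * ∑ k, (√(N : ℝ))⁻¹ * foldSum P F Z U ind k (fun N ω =>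
        correctionError P (fitted eLearn F Z U N ω k) (fitted muLearn F Z U N ω k)) N ω)
    + ∑ k, (foldWeight F Z U β k N ω / weightSum Z β N ω *
        (√(N : ℝ) * (effectBias P (fitted muLearn F Z U N ω k) +
          correctionBias P (fitted eLearn F Z U N ω k) (fitted muLearn F Z U N ω k)))
      + (N / weightSum Z ind N ω *
          ((√(N : ℝ))⁻¹ * (foldWeight F Z U ind k N ω - weightSum Z ind N ω / K))
        + (-1) * (N / weightSum Z β N ω *
          ((√(N : ℝ))⁻¹ * (foldWeight F Z U β k N ω - weightSum Z β N ω / K))))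
        * correctionBias P (fitted eLearn F Z U N ω k) (fitted muLearn F Z U N ω k))

/-- Each of the two weighted sums splits into its population version, centred fold sums and fold
biases; replacing the random normalizations by their limits leaves the linear part. -/
theorem estimation_error_eq (β : Bool → ℝ) {N : ℕ} {ω : Ω} (hN : 0 < N)
    (hβ : weightSum Z β N ω ≠ 0) (hl : weightSum Z ind N ω ≠ 0)
    (hH : ∀ i : Fin N, weightedResid P (Z i ω)
      = correction (eStar P) (regression P) (full (Z i ω))) :
    √(N : ℝ) * (weightedEstimator β (folds F Z U N ω) (fitted eLearn F Z U N ω)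
        (fitted muLearn F Z U N ω) (sample Z N ω) - ate P)
      - (√(N : ℝ))⁻¹ * ∑ i : Fin N, linearized P β (Z i ω)
      = remainder P F Z U eLearn muLearn β N ω := by
  have hs : √(N : ℝ) ≠ 0 := (Real.sqrt_pos.2 (by exact_mod_cast hN)).ne'
  have hs2 : (N : ℝ) = √(N : ℝ) ^ 2 := (Real.sq_sqrt (Nat.cast_nonneg N)).symm
  have ha : ∑ i : Fin N, β (sample Z N ω i).R *
      (fitted muLearn F Z U N ω (folds F Z U N ω i) (true, (sample Z N ω i).X)
        - fitted muLearn F Z U N ω (folds F Z U N ω i) (false, (sample Z N ω i).X))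
      = ∑ i : Fin N, β (Z i ω).R * effectDev P (Z i ω) + weightSum Z β N ω * ate P
        + ∑ k, (foldSum P F Z U β k (fun N ω => effectError P (fitted muLearn F Z U N ω k)) N ω
          + foldWeight F Z U β k N ω * effectBias P (fitted muLearn F Z U N ω k)) := by
    have := sum_folds_eq (P := P) (F := F) (Z := Z) (U := U) β
      (fun k N ω => effectError P (fitted muLearn F Z U N ω k)) N ω
    simp only [effectBias]
    rw [← this, weightSum, Finset.sum_mul, ← Finset.sum_add_distrib, ← Finset.sum_add_distrib]
    refine Finset.sum_congr rfl fun i _ => ?_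
    have hR : (sample Z N ω i).R = (Z i ω).R := rfl
    have hX : (sample Z N ω i).X = (Z i ω).X := rfl
    have hX' : (full (Z i ω)).X = (Z i ω).X := rfl
    rw [hR, hX, effectDev, effectError, armError, armError, hX']
    ring
  have hb : ∑ i : Fin N, ind (Z i ω).R * correction (fitted eLearn F Z U N ω (folds F Z U N ω i))
        (fitted muLearn F Z U N ω (folds F Z U N ω i)) (full (Z i ω))
      = ∑ i : Fin N, ind (Z i ω).R * weightedResid P (Z i ω)
        + ∑ k, (foldSum P F Z U ind k (fun N ω =>
            correctionError P (fitted eLearn F Z U N ω k) (fitted muLearn F Z U N ω k)) N ω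
          + foldWeight F Z U ind k N ω *
            correctionBias P (fitted eLearn F Z U N ω k) (fitted muLearn F Z U N ω k)) := by
    have := sum_folds_eq (P := P) (F := F) (Z := Z) (U := U) ind
      (fun k N ω => correctionError P (fitted eLearn F Z U N ω k) (fitted muLearn F Z U N ω k)) N ω
    simp only [correctionBias]
    rw [← this, ← Finset.sum_add_distrib]
    refine Finset.sum_congr rfl fun i _ => ?_
    rw [hH i, correctionError]
    ring
  have hW : ∑ i, β (sample Z N ω i).R = weightSum Z β N ω := rfl
  rw [weightedEstimator, hW, avgCorrection_sample, ha, hb, remainder]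
  simp only [linearized]
  -- The two biases of a fold come with different relative weights. Giving both the weight of the
  -- first isolates their sum; the correction bias is left with the difference of the weights,
  -- written as a difference of imbalances, in which the two terms `1 / K` cancel.
  have hlast : ∀ k : Fin K, foldWeight F Z U β k N ω / weightSum Z β N ω *
        (√(N : ℝ) * (effectBias P (fitted muLearn F Z U N ω k) +
          correctionBias P (fitted eLearn F Z U N ω k) (fitted muLearn F Z U N ω k)))
      + (N / weightSum Z ind N ω *
          ((√(N : ℝ))⁻¹ * (foldWeight F Z U ind k N ω - weightSum Z ind N ω / K))
        + (-1) * (N / weightSum Z β N ω *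
          ((√(N : ℝ))⁻¹ * (foldWeight F Z U β k N ω - weightSum Z β N ω / K))))
        * correctionBias P (fitted eLearn F Z U N ω k) (fitted muLearn F Z U N ω k)
      = √(N : ℝ) * (weightSum Z β N ω)⁻¹ *
          (foldWeight F Z U β k N ω * effectBias P (fitted muLearn F Z U N ω k))
        + √(N : ℝ) * (weightSum Z ind N ω)⁻¹ * (foldWeight F Z U ind k N ω *
            correctionBias P (fitted eLearn F Z U N ω k) (fitted muLearn F Z U N ω k)) := by
    intro k
    have hK : (K : ℝ) ≠ 0 := by exact_mod_cast (Nat.pos_of_ne_zero (by rintro rfl; exact k.elim0)).ne'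
    generalize √(N : ℝ) = s at *
    rw [hs2]
    field_simp
    ring
  rw [Finset.sum_congr rfl fun k _ => hlast k]
  simp only [Finset.sum_add_distrib, ← Finset.mul_sum]
  generalize √(N : ℝ) = s at *
  rw [hs2]
  field_simp
  ring

end Decomposition

/-! ### Asymptotic normality and comparison of variances -/

section Normality

variable {𝓧 Ω 𝓤 : Type*} {K : ℕ} [MeasurableSpace 𝓧] [StandardBorelSpace 𝓧]
  [MeasurableSpace Ω] [MeasurableSpace 𝓤] {P : Measure (Pop 𝓧)} [IsProbabilityMeasure P]
  {Pr : Measure Ω} [IsProbabilityMeasure Pr] {Z : ℕ → Ω → Pop 𝓧} {U : Ω → 𝓤} {F : FoldRule 𝓤 K}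
  {eLearn : Learner 𝓤 𝓧 𝓧 K} {muLearn : Learner 𝓤 𝓧 (Bool × 𝓧) K} {ρe ρmu : ℕ → ℝ} {ε q C : ℝ}

theorem measurable_fitted_fold {B : Type*} [MeasurableSpace B] {A : Learner 𝓤 𝓧 B K}
    (hA : IsCrossFit A) (hF : ∀ (N : ℕ) (r : Fin N → Bool), Measurable fun u => F N u r)
    (hZ : ∀ i, Measurable (Z i)) (hU : Measurable U) (N : ℕ) (i : Fin N) :
    Measurable fun r : Ω × B => fitted A F Z U N r.1 (folds F Z U N r.1 i) r.2 := by
  have hd := measurable_seedLabels (Ω := Ω) hZ hU N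
  have h1 : ∀ k, Measurable fun r : Ω × B => fitted A F Z U N r.1 k r.2 := fun k =>
    (hA.measurable_learned hF N k).comp (f := fun r : Ω × B =>
      ((seedLabels Z U N r.1, completed Z N r.1), r.2))
      (((hd.comp measurable_fst).prodMk ((measurable_completed hZ N).comp measurable_fst)).prodMk
        measurable_snd)
  have h2 : Measurable fun p : Fin K × (Ω × B) => fitted A F Z U N p.2.1 p.1 p.2.2 :=
    measurable_from_prod_countable_right h1
  have h3 : Measurable fun ω => folds F Z U N ω i :=
    (measurable_pi_apply i).comp ((measurable_foldRule hF N).comp hd)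
  exact h2.comp (f := fun r : Ω × B => (folds F Z U N r.1 i, r))
    ((h3.comp measurable_fst).prodMk measurable_id)

theorem measurable_weightedEstimator (he : IsCrossFit eLearn) (hmu : IsCrossFit muLearn)
    (hF : ∀ (N : ℕ) (r : Fin N → Bool), Measurable fun u => F N u r)
    (hZ : ∀ i, Measurable (Z i)) (hU : Measurable U) (β : Bool → ℝ) (N : ℕ) :
    Measurable fun ω => weightedEstimator β (folds F Z U N ω) (fitted eLearn F Z U N ω)
      (fitted muLearn F Z U N ω) (sample Z N ω) := by
  have hR : ∀ (φ : Bool → ℝ) (i : Fin N), Measurable fun ω => φ (Z i ω).R := fun φ i =>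
    (measurable_of_finite φ).comp (measurable_popR.comp (hZ i))
  have hm : ∀ (s : Bool) (i : Fin N), Measurable fun ω =>
      fitted muLearn F Z U N ω (folds F Z U N ω i) (s, (sample Z N ω i).X) := fun s i =>
    (measurable_fitted_fold hmu hF hZ hU N i).comp (f := fun ω => (ω, s, (Z i ω).X))
      (measurable_id.prodMk (measurable_const.prodMk (measurable_popX.comp (hZ i))))
  have hc : ∀ i : Fin N, Measurable fun ω =>
      correction (fitted eLearn F Z U N ω (folds F Z U N ω i))
        (fitted muLearn F Z U N ω (folds F Z U N ω i)) (full (Z i ω)) := fun i =>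
    (measurable_correction_param (e := fun ω => fitted eLearn F Z U N ω (folds F Z U N ω i))
      (m := fun ω => fitted muLearn F Z U N ω (folds F Z U N ω i))
      (measurable_fitted_fold he hF hZ hU N i) (measurable_fitted_fold hmu hF hZ hU N i)).comp
      (f := fun ω => (ω, full (Z i ω))) (measurable_id.prodMk (measurable_full.comp (hZ i)))
  simp only [weightedEstimator, avgCorrection_sample]
  refine ((Finset.measurable_sum _ fun i _ => hR β i).inv.mul (Finset.measurable_sum _ fun i _ =>
    (hR β i).mul ((hm true i).sub (hm false i)))).add
    ((Finset.measurable_sum _ fun i _ => hR ind i).inv.mul (Finset.measurable_sum _ fun i _ =>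
    (hR ind i).mul (hc i)))

theorem tendstoInDistribution_sum_units (hZ : ∀ i, Measurable (Z i)) (hZind : iIndepFun Z Pr)
    (hZlaw : ∀ i, Pr.map (Z i) = P) {h : Pop 𝓧 → ℝ} (hm : Measurable h) (hh : MemLp h 2 P)
    (h0 : ∫ z, h z ∂P = 0) : TendstoInDistribution
      (fun (N : ℕ) ω => (√(N : ℝ))⁻¹ * ∑ i : Fin N, h (Z i ω)) atTop id (fun _ => Pr)
      (gaussianReal 0 (∫ z, h z ^ 2 ∂P).toNNReal) := by
  have hmean : ∫ ω, h (Z 0 ω) ∂Pr = 0 := by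
    rw [← integral_map (hZ 0).aemeasurable hm.aestronglyMeasurable, hZlaw, h0]
  have hL : MemLp (fun ω => h (Z 0 ω)) 2 Pr := by
    rw [← hZlaw 0] at hh
    exact hh.comp_of_map (hZ 0).aemeasurable
  have hvar : Var[fun ω => h (Z 0 ω); Pr] = ∫ z, h z ^ 2 ∂P := by
    rw [variance_of_integral_eq_zero hL.1.aemeasurable hmean,
      ← integral_map (f := fun z => h z ^ 2) (hZ 0).aemeasurable
        (hm.pow_const 2).aestronglyMeasurable, hZlaw]
  have := tendstoInDistribution_inv_sqrt_mul_sum_sub (P := Pr) (X := fun i ω => h (Z i ω))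
    (Y := id) (P' := gaussianReal 0 Var[fun ω => h (Z 0 ω); Pr].toNNReal) HasLaw.id hL
    (hZind.comp (fun _ => h) fun _ => hm) fun i =>
      ⟨(hm.comp (hZ i)).aemeasurable, (hm.comp (hZ 0)).aemeasurable, by
        rw [← Function.comp_def h, ← Function.comp_def h, ← Measure.map_map hm (hZ i),
          ← Measure.map_map hm (hZ 0), hZlaw, hZlaw]⟩
  simpa only [hvar, hmean, mul_zero, sub_zero, Finset.sum_range] using this

/-- The four groups of terms are normalization errors times `O_p(1)` sums, cross-fitted
fluctuations, paired biases of product order, and `O_p(1)` imbalances times a vanishing bias. -/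
theorem negligibleP_remainder (h : Basic ε q C P) (hM : MCAR P) (hε : 0 < ε) (hε' : ε < 1 / 2)
    (hq : 2 < q) (hC : 0 < C) (hZ : ∀ i, Measurable (Z i)) (hZind : iIndepFun Z Pr)
    (hZlaw : ∀ i, Pr.map (Z i) = P) (hU : Measurable U) (hUind : IndepFun U (fun ω i => Z i ω) Pr)
    (hF : ∀ (N : ℕ) (r : Fin N → Bool), Measurable fun u => F N u r) (hbal : IsBalanced Pr F Z U)
    (he : IsCrossFit eLearn) (hmu : IsCrossFit muLearn)
    (hρe : Tendsto ρe atTop (𝓝 0)) (hρmu : Tendsto ρmu atTop (𝓝 0))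
    (hρ : (fun N => ρmu N * ρe N) =o[atTop] fun N : ℕ => (N : ℝ) ^ (-(1 / 2) : ℝ))
    (hgood : ∀ (k : Fin K) (δ : ℝ), 0 < δ → ∃ M : ℝ, 0 < M ∧ ∀ᶠ N in atTop,
      Pr {ω | ¬ GoodFit ε P (fitted eLearn F Z U N ω k) (fitted muLearn F Z U N ω k)
        (M * ρe N) (M * ρmu N)} ≤ ENNReal.ofReal δ)
    {β : Bool → ℝ} (hβ0 : ∀ r, 0 ≤ β r) (hβ1 : ∀ r, β r ≤ 1) (hp : 0 < selectProb P β) :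
    NegligibleP Pr (remainder P F Z U eLearn muLearn β) := by
  have hl : 0 < labelProb P := hε.trans_le (h.le_labelProb hM hε)
  have hi : ∀ r, |ind r| ≤ 1 := fun r => by cases r <;> simp [ind]
  have hβ : ∀ r, |β r| ≤ 1 := fun r => by rw [abs_of_nonneg (hβ0 r)]; exact hβ1 r
  have hWβ := negligibleP_inv_weightSum hZ hZind hZlaw hp
  have hWl := negligibleP_inv_weightSum hZ hZind hZlaw (selectProb_ind (P := P) ▸ hl)
  have hD := boundedP_sum_units hZ hZind hZlaw
    (memLp_label_mul (memLp_effectDev h hM.mar hε hq) β)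
    (integral_label_mul_effectDev h hM hε hq β)
  have hH := boundedP_sum_units hZ hZind hZlaw
    (memLp_label_mul (memLp_weightedResid h hM.mar hε hq) ind)
    (integral_label_mul_weightedResid h hM hε hq ind)
  have hu := NegligibleP.sum Finset.univ fun k _ => negligibleP_effectError h hM hε hε' hZ hZind
    hZlaw hU hUind hF hmu hρmu k (hgood k) hβ
  have hw := NegligibleP.sum Finset.univ fun k _ => negligibleP_correctionError h hM hε hq hC hZ
    hZind hZlaw hU hUind hF he hmu hρe hρmu k (hgood k) hi
  have hb : ∀ k : Fin K, BoundedP Pr fun N ω =>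
      foldWeight F Z U β k N ω / weightSum Z β N ω := fun k =>
    (boundedP_const 1).mono fun N ω => by
      rw [abs_one]; exact abs_foldWeight_div_le hβ0 k N ω
  have hlast := NegligibleP.sum Finset.univ fun k _ =>
    ((hb k).mul_negligibleP (negligibleP_bias h hM hε hε' hq hC he hmu hρ k (hgood k))).add
      (((hWl.boundedP_of_sub.mul (hbal.boundedP ind k)).add ((boundedP_const (-1)).mul
        (hWβ.boundedP_of_sub.mul (hbal.boundedP β k)))).mul_negligibleP
        (negligibleP_correctionBias h hM hε hq hC he hmu hρe hρmu k (hgood k)))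
  rw [selectProb_ind] at hWl
  exact (((hWβ.mul_boundedP hD).add (hWl.mul_boundedP hH)).add
    ((hWβ.boundedP_of_sub.mul_negligibleP hu).add
      (hWl.boundedP_of_sub.mul_negligibleP hw))).add hlast

/-- The central limit theorem for the linear part is combined with Slutsky. `estimation_error_eq`
can fail only where a total weight vanishes, an event of vanishing probability, or on a null set. -/
theorem tendstoInDistribution_weightedEstimator (h : Basic ε q C P) (hM : MCAR P) (hε : 0 < ε)
    (hε' : ε < 1 / 2)
    (hq : 2 < q) (hC : 0 < C) (hZ : ∀ i, Measurable (Z i)) (hZind : iIndepFun Z Pr)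
    (hZlaw : ∀ i, Pr.map (Z i) = P) (hU : Measurable U) (hUind : IndepFun U (fun ω i => Z i ω) Pr)
    (hF : ∀ (N : ℕ) (r : Fin N → Bool), Measurable fun u => F N u r) (hbal : IsBalanced Pr F Z U)
    (he : IsCrossFit eLearn) (hmu : IsCrossFit muLearn)
    (hρe : Tendsto ρe atTop (𝓝 0)) (hρmu : Tendsto ρmu atTop (𝓝 0))
    (hρ : (fun N => ρmu N * ρe N) =o[atTop] fun N : ℕ => (N : ℝ) ^ (-(1 / 2) : ℝ))
    (hgood : ∀ (k : Fin K) (δ : ℝ), 0 < δ → ∃ M : ℝ, 0 < M ∧ ∀ᶠ N in atTop,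
      Pr {ω | ¬ GoodFit ε P (fitted eLearn F Z U N ω k) (fitted muLearn F Z U N ω k)
        (M * ρe N) (M * ρmu N)} ≤ ENNReal.ofReal δ)
    {β : Bool → ℝ} (hβ : ∀ r, β r ^ 2 = β r) (hp : 0 < selectProb P β) :
    TendstoInDistribution
      (fun (N : ℕ) ω => √(N : ℝ) * (weightedEstimator β (folds F Z U N ω)
        (fitted eLearn F Z U N ω) (fitted muLearn F Z U N ω) (sample Z N ω) - ate P))
      atTop id (fun _ => Pr) (gaussianReal 0 (1 / selectProb P β * (∫ z, effectDev P z ^ 2 ∂P)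
        + 1 / labelProb P * ∫ z, weightedResid P z ^ 2 ∂P).toNNReal) := by
  -- An idempotent weight is an indicator, so it lies in `[0, 1]`.
  have hβ0 : ∀ r, 0 ≤ β r := fun r => hβ r ▸ sq_nonneg _
  have hβ1 : ∀ r, β r ≤ 1 := fun r => by nlinarith [hβ r, sq_nonneg (β r - 1)]
  have hl : 0 < labelProb P := hε.trans_le (h.le_labelProb hM hε)
  have hlin : Measurable (linearized P β) := by
    have h1 : ∀ φ : Bool → ℝ, Measurable fun z : Pop 𝓧 => φ z.R := fun φ =>
      (measurable_of_finite φ).comp measurable_popR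
    exact (((h1 β).mul measurable_effectDev).const_mul _).add
      (((h1 ind).mul measurable_weightedResid).const_mul _)
  have hclt := tendstoInDistribution_sum_units hZ hZind hZlaw hlin
    (memLp_linearized h hM.mar hε hq β) (integral_linearized h hM hε hq β)
  rw [integral_sq_linearized h hM hε hq hβ hp.ne'] at hclt
  refine tendstoInDistribution_of_tendstoInMeasure_sub _ _ hclt ?_ fun N =>
    (((measurable_weightedEstimator he hmu hF hZ hU β N).sub_const _).const_mul _).aemeasurable
  refine NegligibleP.tendstoInMeasure ((negligibleP_remainder h hM hε hε' hq hC hZ hZind hZlaw hU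
    hUind hF hbal he hmu hρe hρmu hρ hgood hβ0 hβ1 hp).congr_prob fun δ hδ => ?_)
  filter_upwards [weightSum_ne_zero hZ hZind hZlaw hp (half_pos hδ),
    weightSum_ne_zero hZ hZind hZlaw (selectProb_ind (P := P) ▸ hl) (half_pos hδ),
    eventually_gt_atTop 0] with N h1 h2 hN
  have h3 : Pr {ω | ¬ ∀ i : Fin N, weightedResid P (Z i ω)
      = correction (eStar P) (regression P) (full (Z i ω))} = 0 := by
    refine ae_all_iff.2 fun i => ae_of_ae_map (μ := Pr)
      (p := fun z => weightedResid P z = correction (eStar P) (regression P) (full z))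
      (hZ i).aemeasurable ?_
    rw [hZlaw]
    exact weightedResid_ae_eq h hε
  refine (measure_mono fun ω hω => ?_).trans ((measure_union_le _ _).trans
    (add_le_add h3.le (measure_le_of_subset_union hδ subset_rfl h1 h2) |>.trans
      (zero_add _).le))
  by_contra hc
  simp only [Set.mem_union, Set.mem_ofPred_eq, not_or, not_not] at hc
  exact hω (estimation_error_eq β hN hc.2.1 hc.2.2 hc.1)

theorem selectProb_one : selectProb P (fun _ => 1) = 1 := by simp [selectProb]

theorem selectProb_ind_not : selectProb P (fun r => ind (!r)) = 1 - labelProb P := by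
  have h : ∀ r : Bool, ind (!r) = 1 - ind r := fun r => by cases r <;> simp [ind]
  rw [← selectProb_ind, selectProb, selectProb]
  simp only [h]
  rw [integral_sub (integrable_const _) (integrable_label ind)]
  simp

theorem varZB_sub_varOur (h1 : labelProb P < 1) : varZB P - varOur P
    = labelProb P / (1 - labelProb P) * ∫ z, effectDev P z ^ 2 ∂P := by
  have : 1 - labelProb P ≠ 0 := (sub_pos.2 h1).ne'
  rw [varZB, varOur]
  field_simp
  ring

/-- The factor in front is positive, and the integral of a square vanishes only if the function is
almost surely zero. -/
theorem varZB_sub_varOur_pos_iff (hD : Integrable (fun z => effectDev P z ^ 2) P)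
    (h0 : 0 < labelProb P) (h1 : labelProb P < 1) : 0 < varZB P - varOur P ↔
      ¬ ∀ᵐ z ∂P, muStar P true z.X - muStar P false z.X = ate P := by
  rw [varZB_sub_varOur h1, mul_pos_iff_of_pos_left (div_pos h0 (sub_pos.2 h1)),
    (integral_nonneg fun z => sq_nonneg (effectDev P z)).lt_iff_ne, ne_comm, ne_eq,
    integral_eq_zero_iff_of_nonneg (fun z => sq_nonneg _) hD]
  refine not_congr ⟨fun h => h.mono fun z hz => ?_, fun h => h.mono fun z hz => ?_⟩
  · exact sub_eq_zero.1 (pow_eq_zero_iff two_ne_zero |>.1 hz)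
  · simp [effectDev, hz]

end Normality

end

end SemiSupervisedATE

theorem proposition1 {𝓧 Ω 𝓤 : Type*} [MeasurableSpace 𝓧] [StandardBorelSpace 𝓧]
    [MeasurableSpace Ω] [MeasurableSpace 𝓤]
    -- population law: unconfoundedness, overlap, moments, labels missing completely at random
    (P : ProbabilityMeasure (Pop 𝓧)) (ε q C : ℝ)
    (hε : 0 < ε) (hε' : ε < 1 / 2) (hq : 2 < q) (hC : 0 < C)
    (hP : Basic ε q C (P : Measure (Pop 𝓧))) (hMCAR : MCAR (P : Measure (Pop 𝓧)))
    -- i.i.d. sample and an independent random seed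
    (Pr : Measure Ω) [IsProbabilityMeasure Pr]
    (Z : ℕ → Ω → Pop 𝓧) (hZ : ∀ i, Measurable (Z i)) (hZind : iIndepFun Z Pr)
    (hZlaw : ∀ i, Pr.map (Z i) = (P : Measure (Pop 𝓧)))
    (U : Ω → 𝓤) (hU : Measurable U) (hUind : IndepFun U (fun ω i => Z i ω) Pr)
    -- random partition into `K` folds
    (K : ℕ) (F : FoldRule 𝓤 K)
    (hF : ∀ (N : ℕ) (r : Fin N → Bool), Measurable fun u => F N u r)
    (hbal : IsBalanced Pr F Z U)
    -- cross-fitted nuisance estimators and their convergence rates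
    (eLearn : Learner 𝓤 𝓧 𝓧 K) (muLearn : Learner 𝓤 𝓧 (Bool × 𝓧) K)
    (he : IsCrossFit eLearn) (hmu : IsCrossFit muLearn)
    (heBdd : ∀ (N : ℕ) (k : Fin K), ∀ᵐ ω ∂Pr, ∀ᵐ z ∂(P : Measure (Pop 𝓧)),
      fitted eLearn F Z U N ω k z.X ∈ Set.Icc ε (1 - ε))
    (ρe ρmu : ℕ → ℝ) (hρe0 : ∀ N, 0 ≤ ρe N) (hρmu0 : ∀ N, 0 ≤ ρmu N)
    (hρe : Tendsto ρe atTop (𝓝 0)) (hρmu : Tendsto ρmu atTop (𝓝 0))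
    (hρ : (fun N => ρmu N * ρe N) =o[atTop] fun N : ℕ => (N : ℝ) ^ (-(1 / 2) : ℝ))
    (heRate : ∀ k : Fin K, IsBigOp Pr (fun N ω =>
      eLpNorm (fun z : Pop 𝓧 => fitted eLearn F Z U N ω k z.X - eStar (P : Measure (Pop 𝓧)) z.X)
        2 (P : Measure (Pop 𝓧))) ρe)
    (hmuRate : ∀ k : Fin K, IsBigOp Pr (fun N ω =>
      eLpNorm (fun z : Pop 𝓧 =>
          fitted muLearn F Z U N ω k (z.T, z.X) - muStar (P : Measure (Pop 𝓧)) z.T z.X)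
        2 (P : Measure (Pop 𝓧))) ρmu) :
    -- the expectations in the variances are finite
    (Integrable (fun z => effectDev (P : Measure (Pop 𝓧)) z ^ 2) (P : Measure (Pop 𝓧)) ∧
      Integrable (fun z => weightedResid (P : Measure (Pop 𝓧)) z ^ 2) (P : Measure (Pop 𝓧))) ∧
    -- asymptotic normality of the surrogate-free estimator
    TendstoInDistribution
      (fun (N : ℕ) ω => √(N : ℝ) *
        (deltaOur (folds F Z U N ω) (fitted eLearn F Z U N ω) (fitted muLearn F Z U N ω)
          (sample Z N ω) - ate (P : Measure (Pop 𝓧))))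
      atTop id (fun _ => Pr) (gaussianReal 0 (varOur (P : Measure (Pop 𝓧))).toNNReal) ∧
    -- its variance is the efficiency bound, with labels missing (completely) at random
    IsEfficiencyBound (modelMCAR 𝓧) P (varOur (P : Measure (Pop 𝓧))) ∧
    IsEfficiencyBound (modelMAR 𝓧) P (varOur (P : Measure (Pop 𝓧))) ∧
    -- the Zhang-Bradic estimator, and the comparison
    0 < labelProb (P : Measure (Pop 𝓧)) ∧
    (labelProb (P : Measure (Pop 𝓧)) < 1 →
      TendstoInDistribution
        (fun (N : ℕ) ω => √(N : ℝ) *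
          (deltaZB (folds F Z U N ω) (fitted eLearn F Z U N ω) (fitted muLearn F Z U N ω)
            (sample Z N ω) - ate (P : Measure (Pop 𝓧))))
        atTop id (fun _ => Pr) (gaussianReal 0 (varZB (P : Measure (Pop 𝓧))).toNNReal) ∧
      varZB (P : Measure (Pop 𝓧)) - varOur (P : Measure (Pop 𝓧)) =
        labelProb (P : Measure (Pop 𝓧)) / (1 - labelProb (P : Measure (Pop 𝓧))) *
          ∫ z, effectDev (P : Measure (Pop 𝓧)) z ^ 2 ∂(P : Measure (Pop 𝓧)) ∧
      (0 < varZB (P : Measure (Pop 𝓧)) - varOur (P : Measure (Pop 𝓧)) ↔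
        ¬ (∀ᵐ z ∂(P : Measure (Pop 𝓧)),
          muStar (P : Measure (Pop 𝓧)) true z.X - muStar (P : Measure (Pop 𝓧)) false z.X
            = ate (P : Measure (Pop 𝓧))))) := by
  have hD := (memLp_effectDev hP hMCAR.mar hε hq).integrable_sq
  have hl : 0 < labelProb (P : Measure (Pop 𝓧)) := hε.trans_le (hP.le_labelProb hMCAR hε)
  have hbound := isEfficiencyBound hε hε' hq hC hP hMCAR
  -- One normality statement serves both estimators: `β = 1` imputes on all units, `β r = ind (!r)`
  -- on the unlabelled ones, and `selectProb` becomes `1` or `1 - labelProb`.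
  have hnormal : ∀ {β : Bool → ℝ}, (∀ r, β r ^ 2 = β r) →
      0 < selectProb (P : Measure (Pop 𝓧)) β → _ := fun hβ hp =>
    tendstoInDistribution_weightedEstimator hP hMCAR hε hε' hq hC hZ hZind hZlaw hU hUind hF hbal
      he hmu hρe hρmu hρ (fun k _ hδ => exists_goodFit hP he hmu k (fun N => heBdd N k) hρe0 hρmu0
        (heRate k) (hmuRate k) hδ) hβ hp
  have hp1 : selectProb (P : Measure (Pop 𝓧)) (fun _ => 1) = 1 := selectProb_one
  have hp2 : selectProb (P : Measure (Pop 𝓧)) (fun r => ind (!r))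
      = 1 - labelProb (P : Measure (Pop 𝓧)) := selectProb_ind_not
  refine ⟨⟨hD, (memLp_weightedResid hP hMCAR.mar hε hq).integrable_sq⟩, ?_, hbound.1, hbound.2, hl,
    fun h1 => ⟨?_, varZB_sub_varOur h1, varZB_sub_varOur_pos_iff hD hl h1⟩⟩
  · have := hnormal (β := fun _ => 1) (fun _ => one_pow 2) (by rw [hp1]; exact one_pos)
    simp only [hp1, div_one, one_mul] at this
    simp only [deltaOur_eq, varOur]
    exact this
  · have := hnormal (β := fun r => ind (!r)) (fun r => by cases r <;> simp [ind])
      (by rw [hp2]; exact sub_pos.2 h1)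
    simp only [hp2] at this
    simp only [deltaZB_eq, varZB]
    exact this
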